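/- **Setting.** Let $N\ge 2$, let $\Omega\subset\mathbb R^N$ be a bounded domain (nonempty, open, connected), and let $R,\widetilde R$ be $\mathbb R^N$-valued vector fields that are $C^1$ on an open neighbourhood of $\overline\Omega$. Put $\Phi_t(x)=x+tR(x)+\tfrac12t^2\widetilde R(x)$ and $\Omega_t=\Phi_t(\Omega)$. Let $p,q\ge 2$, $q\ne p$, $q<p^*$, where $p^*=\frac{Np}{N-p}$ if $p<N$ and $p^*=+\infty$ if $p\ge N$. Put $L(s,z)=\frac1p|z|^p-\frac1q|s|^q$, and let $$E_t[w]=\int_{\Omega_t}L(w,Dw)\,dy,\qquad w\in W_0^{1,p}(\Omega_t),$$ where $W_0^{1,p}$ is the closure of $C_c^\infty$ in the Sobolev space $W^{1,p}$. The Nehari manifold is $\mathcal N(\Omega_t)=\{w\in W_0^{1,p}(\Omega_t)\setminus\{0\}: E_t'[w]w=0\}$ (with $E_0,\ \mathcal N(\Omega)$ for $t=0$). A least energy critical point of $E_t$ is a nonzero critical point whose energy is least among all nonzero critical points. $DF=(\partial_jF_i)_{ij}$ denotes the Jacobi matrix of a vector field, gradients $Du$ are row vectors, $(\cdot,\cdot)$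 is the Euclidean inner product, and $\chi_2(M)=\sum_{i<j}(M_{ii}M_{jj}-M_{ij}M_{ji})$. For a least energy critical point $u$ of $E_0$ let $\langle g,h\rangle_0=E_0''[u](g,h)$ and $$\begin{aligned}Q[h]=&-\int_\Omega (D^2_{zz}L(u,Du),Dh\otimes Du\cdot DR)\,dx-\int_\Omega (D_zL_u(u,Du),Du\cdot DR)\,h\,dx-\int_\Omega (D_zL(u,Du),Dh\cdot DR)\,dx\\&+\int_\Omega (D_zL(u,Du),Dh)\,\mathrm{div}R\,dx+\int_\Omega L_u(u,Du)\,h\,\mathrm{div}R\,dx .\end{aligned}$$ **(A) The abstract hypotheses hold.** There is $\delta>0$ such that for $|t|<\delta$ the map $\Phi_t$ is an orientation preserving $C^1$-diffeomorphism of $\Omega$ onto the open set $\Omega_t$, and: (i) $E_t\in C^2(W_0^{1,p}(\Omega_t),\mathbb R)$ for $|t|<\delta$, and for every $w\in W_0^{1,p}(\Omega)$ the functions $w\circ\Phi_t^{-1}$ belong to $W_0^{1,p}(\Omega_t)$ and $t\mapsto E_t[w\circ\Phi_t^{-1}]$ is $C^2$ on $(-\delta,\delta)$; (ii) for $|t|<\delta$,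 $E_t$ has a least energy critical point, and every such point belongs to $\mathcal N(\Omega_t)$ and minimizes $E_t$ over $\mathcal N(\Omega_t)$; (iii) for every $w\in W_0^{1,p}(\Omega)\setminus\{0\}$ there is $\alpha>0$ with $\alpha w\in\mathcal N(\Omega)$; and for $w\in\mathcal N(\Omega)$, $v\in W_0^{1,p}(\Omega)$ there are $\varepsilon\in(0,\delta]$ and $\alpha,\beta\in C^1((-\varepsilon,\varepsilon),(0,\infty))$ with $\alpha_0=\beta_0=1$, $\alpha_t(w+tv)\circ\Phi_t^{-1}\in\mathcal N(\Omega_t)$ and $\beta_s(w+sv)\in\mathcal N(\Omega)$ for $|t|,|s|<\varepsilon$; (iv) $E_0$ has a least energy critical point $u$ with $E_0''[u](u,u)\ne0$. **(B) The formulas.** Let $u$ be any least energy critical point of $E_0$. Then $\langle u,u\rangle_0=(p-q)\int_\Omega|u|^q\,dx\neq0$, and for all $h\in W_0^{1,p}(\Omega)$ $$\langle h,h\rangle_0=\int_\Omega|Du|^{p-2}|Dh|^2dx+(p-2)\int_\Omega|Du|^{p-4}(Du,Dh)^2dx-(q-1)\int_\Omega|u|^{q-2}h^2dx,$$ $$\begin{aligned}Q[h]=&-\int_\Omega|Du|^{p-2}(Dh,Du\cdot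 DR)\,dx-(p-2)\int_\Omega|Du|^{p-4}(Du,Dh)(Du,Du\cdot DR)\,dx\\&-\int_\Omega|Du|^{p-2}(Du,Dh\cdot DR)\,dx+\int_\Omega|Du|^{p-2}(Du,Dh)\,\mathrm{div}R\,dx-\int_\Omega|u|^{q-2}uh\,\mathrm{div}R\,dx\end{aligned}$$ (integrands with factor $(p-2)|Du|^{p-4}$ are read as $0$ where $Du=0$; $0^0=1$ otherwise). Moreover, let $v\in W_0^{1,p}(\Omega)$ satisfy $\int_\Omega|u|^{q-2}uv\,dx=0$ and $\langle v,v\rangle_0=-Q[v]>0$. For all small $|t|$ let $\alpha_t>0$ be such that $U_t:=\alpha_t(u+tv)\circ\Phi_t^{-1}\in\mathcal N(\Omega_t)$, and put $m(t)=E_t[U_t]$. If $\dot m(0)=0$, then $m$ is $C^2$ near $0$ and $$\begin{aligned}\ddot m(0)=&\frac1p\int_\Omega|Du|^p\,\mathrm{div}\widetilde R\,dx-\frac1q\int_\Omega|u|^q\,\mathrm{div}\widetilde R\,dx-\int_\Omega|Du|^{p-2}(Du,Du\cdot D\widetilde R)\,dx\\&+\frac2p\int_\Omega|Du|^p\chi_2(DR)\,dx-\frac2q\int_\Omega|u|^q\chi_2(DR)\,dx-2\int_\Omega|Du|^{p-2}(Du,Du\cdot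 DR)\,\mathrm{div}R\,dx\\&+2\int_\Omega|Du|^{p-2}(Du,Du\cdot DR\cdot DR)\,dx+\int_\Omega|Du|^{p-2}(Du\cdot DR,Du\cdot DR)\,dx\\&+(p-2)\int_\Omega|Du|^{p-4}(Du,Du\cdot DR)^2dx+\frac{q-p}{q^2}\frac{\left(\int_\Omega|u|^q\,\mathrm{div}R\,dx\right)^2}{\int_\Omega|u|^q\,dx}-\frac{Q[v]^2}{\langle v,v\rangle_0}.\end{aligned}$$ -/

import Mathlib

open MeasureTheory Filter Topology
open scoped ContDiff

noncomputable section

namespace NehariShape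

/-- Euclidean space of dimension `N`. -/
abbrev Eucl (N : ℕ) : Type := EuclideanSpace ℝ (Fin N)

/-! ### Matrix notation: `D` is the Jacobi matrix, gradients are row vectors -/

/-- The Jacobi matrix `(DF)_{ij} = ∂_j F_i`. -/
def jac {N : ℕ} (F : Eucl N → Eucl N) (x : Eucl N) : Matrix (Fin N) (Fin N) ℝ :=
  Matrix.of fun i j => fderiv ℝ F x (EuclideanSpace.single j 1) i

/-- The row vector `z` times the matrix `M`. -/
def rowMul {N : ℕ} (z : Eucl N) (M : Matrix (Fin N) (Fin N) ℝ) : Eucl N :=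
  WithLp.toLp 2 (Matrix.vecMul z.ofLp M)

/-- The divergence of a vector field. -/
def divg {N : ℕ} (F : Eucl N → Eucl N) (x : Eucl N) : ℝ := (jac F x).trace

/-- `χ₂(M) = ∑_{i<j} (M_{ii} M_{jj} - M_{ij} M_{ji})`. -/
def chi2 {N : ℕ} (M : Matrix (Fin N) (Fin N) ℝ) : ℝ :=
  ∑ i : Fin N, ∑ j ∈ Finset.Ioi i, (M i i * M j j - M i j * M j i)

/-- The deformation `Φ_t(x) = x + t R(x) + (t²/2) R'(x)`. -/
def flow {N : ℕ} (R R' : Eucl N → Eucl N) (t : ℝ) (x : Eucl N) : Eucl N :=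
  x + t • R x + (t ^ 2 / 2) • R' x

/-- `F` is a `C^1` vector field over `closure Ω`, i.e. on some open neighbourhood of it. -/
def IsC1Over {N : ℕ} (F : Eucl N → Eucl N) (Ω : Set (Eucl N)) : Prop :=
  ∃ U : Set (Eucl N), IsOpen U ∧ closure Ω ⊆ U ∧ ContDiffOn ℝ 1 F U

/-! ### The space `W_0^{1,p}(Ω)` -/

/-- The pairs `(φ, Dφ)`, `φ ∈ C_c^∞(Ω)`, as a subspace of `L^p(Ω) × L^p(Ω; ℝ^N)`. -/
def testPairs {N : ℕ} (Ω : Set (Eucl N)) (p : ℝ) [Fact (1 ≤ ENNReal.ofReal p)] :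
    Submodule ℝ (Lp ℝ (ENNReal.ofReal p) (volume.restrict Ω) ×
      Lp (Eucl N) (ENNReal.ofReal p) (volume.restrict Ω)) where
  carrier := {f | ∃ φ : Eucl N → ℝ, ContDiff ℝ ∞ φ ∧ HasCompactSupport φ ∧ tsupport φ ⊆ Ω ∧
    f.1 =ᵐ[volume.restrict Ω] φ ∧ f.2 =ᵐ[volume.restrict Ω] gradient φ}
  zero_mem' := by
    refine ⟨0, contDiff_const, HasCompactSupport.zero, ?_, ?_, ?_⟩
    · simp [tsupport]
    · exact Lp.coeFn_zero _ _ _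
    · have h : gradient (0 : Eucl N → ℝ) = 0 := by
        funext x
        simp [gradient]
      rw [h]
      exact Lp.coeFn_zero _ _ _
  add_mem' := by
    rintro f g ⟨φ, h1, h2, h3, h4, h5⟩ ⟨ψ, k1, k2, k3, k4, k5⟩
    refine ⟨φ + ψ, h1.add k1, h2.add k2, ?_, ?_, ?_⟩
    · exact (tsupport_add φ ψ).trans (Set.union_subset h3 k3)
    · exact (Lp.coeFn_add f.1 g.1).trans (h4.add k4)
    · have h : gradient (φ + ψ) = gradient φ + gradient ψ := by
        funext x
        simp only [gradient, Pi.add_apply, ← map_add]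
        rw [fderiv_add (h1.differentiable (by simp) x) (k1.differentiable (by simp) x)]
      rw [h]
      exact (Lp.coeFn_add f.2 g.2).trans (h5.add k5)
  smul_mem' := by
    rintro c f ⟨φ, h1, h2, h3, h4, h5⟩
    refine ⟨c • φ, contDiff_const.smul h1, h2.smul_left (f := fun _ => c), ?_, ?_, ?_⟩
    · exact (tsupport_smul_subset_right (fun _ => c) φ).trans h3
    · exact (Lp.coeFn_smul c f.1).trans (h4.const_smul c)
    · have h : gradient (c • φ) = c • gradient φ := by
        funext x
        simp only [gradient, Pi.smul_apply]
        rw [fderiv_const_smul (h1.differentiable (by simp) x)]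
        simp
      rw [h]
      exact (Lp.coeFn_smul c f.2).trans (h5.const_smul c)

/-- `W_0^{1,p}(Ω)`, the closure of `C_c^∞(Ω)` in the Sobolev norm. An element is a function
together with its weak gradient. -/
def W0 {N : ℕ} (Ω : Set (Eucl N)) (p : ℝ) [Fact (1 ≤ ENNReal.ofReal p)] :
    Submodule ℝ (Lp ℝ (ENNReal.ofReal p) (volume.restrict Ω) ×
      Lp (Eucl N) (ENNReal.ofReal p) (volume.restrict Ω)) :=
  (testPairs Ω p).topologicalClosure

section

variable {N : ℕ} {Ω : Set (Eucl N)} {p : ℝ} [Fact (1 ≤ ENNReal.ofReal p)]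

/-- The function underlying an element of `W_0^{1,p}(Ω)`. -/
def val (w : W0 Ω p) : Eucl N → ℝ := w.1.1

/-- The weak gradient of an element of `W_0^{1,p}(Ω)`. -/
def grad (w : W0 Ω p) : Eucl N → Eucl N := w.1.2

/-- `W = w ∘ Φ⁻¹` almost everywhere on `Φ(Ω)`. -/
def IsTransport (Φ : Eucl N → Eucl N) (w : W0 Ω p) (W : W0 (Φ '' Ω) p) : Prop :=
  ∀ᵐ x ∂(volume.restrict Ω), val W (Φ x) = val w x

/-! ### Energy, Nehari manifold, critical points -/

/-- `E[w] = ∫_Ω L(w, Dw) dx`. -/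
def energy (L : ℝ → Eucl N → ℝ) (w : W0 Ω p) : ℝ :=
  ∫ x in Ω, L (val w x) (grad w x)

/-- The Nehari manifold of a functional: nonzero `w` with `E'[w]w = 0`. -/
def nehari (E : W0 Ω p → ℝ) : Set (W0 Ω p) :=
  {w | w ≠ 0 ∧ fderiv ℝ E w w = 0}

/-- A nonzero critical point whose energy is least among all nonzero critical points. -/
def IsLeastEnergyCritical (E : W0 Ω p → ℝ) (u : W0 Ω p) : Prop :=
  u ≠ 0 ∧ HasFDerivAt E (0 : W0 Ω p →L[ℝ] ℝ) u ∧ ∀ w : W0 Ω p, w ≠ 0 → HasFDerivAt E (0 : W0 Ω p →L[ℝ] ℝ) w → E u ≤ E w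

/-- The second variation `⟨g, h⟩₀ = E''[u](g, h)`. -/
def bracket (L : ℝ → Eucl N → ℝ) (u g h : W0 Ω p) : ℝ :=
  fderiv ℝ (fderiv ℝ (energy L : W0 Ω p → ℝ)) u g h

/-- `D_z L(s, z)`. -/
def DzL (L : ℝ → Eucl N → ℝ) (s : ℝ) (z : Eucl N) : Eucl N := gradient (L s) z

/-- `(D²_{zz} L(s, z), a ⊗ b)`. -/
def DzzL (L : ℝ → Eucl N → ℝ) (s : ℝ) (z a b : Eucl N) : ℝ :=
  (fderiv ℝ (fun y : Eucl N => fderiv ℝ (L s) y) z a) b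

/-- `L_u(s, z)`, the derivative in the scalar variable. -/
def Lu (L : ℝ → Eucl N → ℝ) (s : ℝ) (z : Eucl N) : ℝ := deriv (fun r => L r z) s

/-- `D_z L_u(s, z)`. -/
def DzLu (L : ℝ → Eucl N → ℝ) (s : ℝ) (z : Eucl N) : Eucl N := gradient (Lu L s) z

/-- The functional `Q[h]`, collecting the mixed second derivatives (once in the deformation, once
in direction `h`). -/
def Q (L : ℝ → Eucl N → ℝ) (R : Eucl N → Eucl N) (u h : W0 Ω p) : ℝ :=
  - (∫ x in Ω, DzzL L (val u x) (grad u x) (grad h x) (rowMul (grad u x) (jac R x)))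
  - (∫ x in Ω, inner ℝ (DzLu L (val u x) (grad u x)) (rowMul (grad u x) (jac R x)) * val h x)
  - (∫ x in Ω, inner ℝ (DzL L (val u x) (grad u x)) (rowMul (grad h x) (jac R x)))
  + (∫ x in Ω, inner ℝ (DzL L (val u x) (grad u x)) (grad h x) * divg R x)
  + (∫ x in Ω, Lu L (val u x) (grad u x) * val h x * divg R x)

end

/-- The abstract assumptions on the family `E_t[w] = ∫_{Ω_t} L(w, Dw) dy`, `Ω_t = Φ_t(Ω)`,
`|t| < δ`. -/
structure Assumptions {N : ℕ} (L : ℝ → Eucl N → ℝ) (p : ℝ) [Fact (1 ≤ ENNReal.ofReal p)]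
    (Ω : Set (Eucl N)) (R R' : Eucl N → Eucl N) (δ : ℝ) : Prop where
  /-- `Φ_t` is an orientation preserving `C^1` diffeomorphism of `Ω` onto the open set `Ω_t`. -/
  diffeo : ∀ t ∈ Set.Ioo (-δ) δ, ContDiffOn ℝ 1 (flow R R' t) Ω ∧ Set.InjOn (flow R R' t) Ω ∧
    IsOpen (flow R R' t '' Ω) ∧ ∀ x ∈ Ω, 0 < (jac (flow R R' t) x).det
  /-- `E_t` is of class `C²` on `W_0^{1,p}(Ω_t)`. -/
  i_energy : ∀ t ∈ Set.Ioo (-δ) δ,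
    ContDiff ℝ 2 (energy L : W0 (flow R R' t '' Ω) p → ℝ)
  /-- `t ↦ E_t[w ∘ Φ_t⁻¹]` is of class `C²` for each `w ∈ W_0^{1,p}(Ω)`. -/
  i_path : ∀ w : W0 Ω p, ∃ W : (t : ℝ) → W0 (flow R R' t '' Ω) p,
    (∀ t ∈ Set.Ioo (-δ) δ, IsTransport (flow R R' t) w (W t)) ∧
    ContDiffOn ℝ 2 (fun t => energy L (W t)) (Set.Ioo (-δ) δ)
  /-- Existence of a least energy critical point of each `E_t`. -/
  ii_exists : ∀ t ∈ Set.Ioo (-δ) δ, ∃ w : W0 (flow R R' t '' Ω) p,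
    IsLeastEnergyCritical (energy L) w
  /-- Each least energy critical point minimizes `E_t` over the Nehari manifold. -/
  ii_min : ∀ t ∈ Set.Ioo (-δ) δ, ∀ w : W0 (flow R R' t '' Ω) p,
    IsLeastEnergyCritical (energy L) w →
      w ∈ nehari (energy L) ∧ IsMinOn (energy L) (nehari (energy L)) w
  /-- Each ray meets the Nehari manifold. -/
  iii_ray : ∀ w : W0 Ω p, w ≠ 0 → ∃ a : ℝ, 0 < a ∧ a • w ∈ nehari (energy L)
  /-- `C^1` Nehari normalization along `(w + t v) ∘ Φ_t⁻¹` and along `w + s v`, for small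
  parameters. -/
  iii_path : ∀ w v : W0 Ω p, w ∈ nehari (energy L) → ∃ ε : ℝ, 0 < ε ∧ ε ≤ δ ∧
    (∃ (α : ℝ → ℝ) (U : (t : ℝ) → W0 (flow R R' t '' Ω) p),
      ContDiffOn ℝ 1 α (Set.Ioo (-ε) ε) ∧ α 0 = 1 ∧ ∀ t ∈ Set.Ioo (-ε) ε, 0 < α t ∧
        IsTransport (flow R R' t) (α t • (w + t • v)) (U t) ∧ U t ∈ nehari (energy L)) ∧
    (∃ β : ℝ → ℝ, ContDiffOn ℝ 1 β (Set.Ioo (-ε) ε) ∧ β 0 = 1 ∧ ∀ s ∈ Set.Ioo (-ε) ε, 0 < β s ∧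
      β s • (w + s • v) ∈ nehari (energy L))
  /-- There is a least energy critical point `u` of `E_0` with `E_0''[u](u,u) ≠ 0`. -/
  iv : ∃ u : W0 Ω p, IsLeastEnergyCritical (energy L) u ∧ bracket L u u u ≠ 0

/-! ### The Lane–Emden functional -/

/-- `L(s, z) = |z|^p / p - |s|^q / q`. -/
def laneEmden {N : ℕ} (p q : ℝ) (s : ℝ) (z : Eucl N) : ℝ :=
  1 / p * ‖z‖ ^ p - 1 / q * |s| ^ q

/-- The critical Sobolev exponent `p^*`. -/
def sobolevConj (N : ℕ) (p : ℝ) : EReal :=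
  if p < N then ((N * p / (N - p) : ℝ) : EReal) else ⊤

end NehariShape

end

open NehariShape

/-!
The statement combines an existence theory for the Lane–Emden functional on every `Ω_t` with a
second order expansion of its value along one explicit curve of the Nehari manifolds.

*Smoothness.* For `p ≥ 2` the function `‖z‖ ^ p` has two continuous derivatives, and the second one
is homogeneous of degree `p - 2`. Homogeneity turns its continuity on the unit ball into a modulus
of continuity on the whole space (`normPowD2_modulus`), and Hölder's inequality with exponents
`p / (p - 2)`, `p`, `p` carries this over to `g ↦ ∫ ‖g‖ ^ p` on `L^p`, which is therefore of class
`C²` (`contDiff_lpPow`). With the embedding `W_0^{1,p} → L^q` (`sobolev_inequality`) the energy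
is of class `C²`.

*Ground states.* The embedding is compact (`exists_subseq_cauchySeq`): averaging against a
mollifier centred at the values of a simple function approximates it in `L¹` by operators of finite
rank, and interpolation with a higher subcritical exponent gives `L^q`. A minimizing sequence for
`‖∇v‖_p / ‖v‖_q` that is Cauchy in `L^q` is Cauchy in `W_0^{1,p}` by Clarkson's inequality
(`exists_minimizer_norm`), so the quotient attains its minimum without any appeal to weak
compactness. Scaled to the Nehari manifold, the minimizer is a critical point of least energy
(`exists_ground_state`).

*Transport.* For small `|t|` the map `Φ_t` is at Lipschitz distance at most `1/2` from the identity.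
Hence composition with `Φ_t⁻¹` maps `W_0^{1,p}(Ω)` to `W_0^{1,p}(Ω_t)`, with the chain rule for weak
gradients (`exists_isPushforward`). For `W = (u + t v) ∘ Φ_t⁻¹` the change of variables gives
`A(t) = ∫ |DW|^p = ∫_Ω det DΦ_t |(DΦ_t)^{-T} (∇u + t ∇v)|^p` and
`B(t) = ∫ |W|^q = ∫_Ω det DΦ_t |u + t v|^q`, and both are differentiated twice under the integral
sign (`IsFlowData.hasC2Path_grad`, `IsFlowData.hasC2Path_val`).

*The value along the Nehari manifold.* Since the functional is a difference of two powers, the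
factor that puts `W` on the Nehari manifold is `(A / B) ^ (1 / (q - p))`, so no implicit function
theorem is needed, and the energy there is
`m = (1/p - 1/q) A ^ (q / (q - p)) B ^ (-p / (q - p))`. If `A(0) = B(0)` and `m'(0) = 0`, then
`m''(0) = A''(0) / p - B''(0) / q + (q - p) / q² · B'(0)² / B(0)` (`deriv_deriv_nehari_value`).
The condition `∫ |u|^{q-2} u v = 0` removes `v` from `B'(0)`. In `A''(0) / p - B''(0) / q` the terms
that contain `v` add up to `⟨v, v⟩ + 2 Q[v]`, which equals `-Q[v]² / ⟨v, v⟩` when `⟨v, v⟩ = -Q[v]`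
(`IsFlowData.second_variation`).
-/

noncomputable section

namespace NehariShape

/-! ### Second order calculus of powers of the norm -/

section NormPow

variable {F : Type*} [NormedAddCommGroup F] [InnerProductSpace ℝ F]

/-- The inner product as a bilinear form over `ℝ` (`innerSL` is conjugate linear by type). -/
def realInner : F →L[ℝ] F →L[ℝ] ℝ := innerSL ℝ

lemma realInner_apply (a b : F) : realInner a b = inner ℝ a b := rfl

/-- The first derivative of `z ↦ ‖z‖ ^ p`, as a linear form. -/
def normPowD1 (p : ℝ) (z : F) : F →L[ℝ] ℝ := (p * ‖z‖ ^ (p - 2)) • realInner z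

/-- The second derivative of `z ↦ ‖z‖ ^ p`, as a bilinear form. -/
def normPowD2 (p : ℝ) (z : F) : F →L[ℝ] F →L[ℝ] ℝ :=
  (p * ‖z‖ ^ (p - 2)) • realInner +
    (p * (p - 2) * ‖z‖ ^ (p - 4)) • (realInner z).smulRight (realInner z)

lemma normPowD1_apply (p : ℝ) (z a : F) :
    normPowD1 p z a = p * ‖z‖ ^ (p - 2) * inner ℝ z a := by
  simp [normPowD1, realInner_apply]

lemma normPowD2_apply (p : ℝ) (z a b : F) :
    normPowD2 p z a b = p * ‖z‖ ^ (p - 2) * inner ℝ a b +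
      p * (p - 2) * ‖z‖ ^ (p - 4) * (inner ℝ z a * inner ℝ z b) := by
  simp [normPowD2, realInner_apply]

/-- `0 ^ (r - 2) * 0 ^ 2 ≤ 0 ^ r` also holds for the junk value `0 ^ (-2)`. -/
lemma rpow_sub_two_mul_sq_le {x r : ℝ} (hx : 0 ≤ x) : x ^ (r - 2) * x ^ 2 ≤ x ^ r := by
  rcases hx.eq_or_lt with rfl | h
  · simpa using Real.rpow_nonneg le_rfl r
  · rw [← Real.rpow_natCast x 2, ← Real.rpow_add h]
    norm_num

lemma abs_normPowD1_le {p : ℝ} (hp : 2 ≤ p) (z a : F) :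
    |normPowD1 p z a| ≤ p * (‖z‖ ^ (p - 1) * ‖a‖) := by
  have h1 : ‖z‖ ^ (p - 1) = ‖z‖ ^ (p - 2) * ‖z‖ := by
    rw [← Real.rpow_add_one' (norm_nonneg _) (by linarith)]
    ring_nf
  rw [normPowD1_apply, abs_mul, abs_of_nonneg (by positivity), h1]
  calc p * ‖z‖ ^ (p - 2) * |inner ℝ z a| ≤ p * ‖z‖ ^ (p - 2) * (‖z‖ * ‖a‖) := by
        gcongr
        exact abs_real_inner_le_norm z a
    _ = _ := by ring

lemma abs_normPowD2_le {p : ℝ} (hp : 2 ≤ p) (z a b : F) :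
    |normPowD2 p z a b| ≤ p * (p - 1) * ‖z‖ ^ (p - 2) * ‖a‖ * ‖b‖ := by
  have hp2 : 0 ≤ p - 2 := by linarith
  have h0 : ‖z‖ ^ (p - 4) * ‖z‖ ^ 2 ≤ ‖z‖ ^ (p - 2) := by
    have := rpow_sub_two_mul_sq_le (r := p - 2) (norm_nonneg z)
    rwa [show p - 2 - 2 = p - 4 by ring] at this
  rw [normPowD2_apply]
  calc |p * ‖z‖ ^ (p - 2) * inner ℝ a b +
      p * (p - 2) * ‖z‖ ^ (p - 4) * (inner ℝ z a * inner ℝ z b)|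
      ≤ |p * ‖z‖ ^ (p - 2) * inner ℝ a b| +
        |p * (p - 2) * ‖z‖ ^ (p - 4) * (inner ℝ z a * inner ℝ z b)| := abs_add_le _ _
    _ ≤ p * ‖z‖ ^ (p - 2) * (‖a‖ * ‖b‖) +
        p * (p - 2) * ‖z‖ ^ (p - 4) * ((‖z‖ * ‖a‖) * (‖z‖ * ‖b‖)) := by
        rw [abs_mul (p * ‖z‖ ^ (p - 2)), abs_mul (p * (p - 2) * ‖z‖ ^ (p - 4)),
          abs_of_nonneg (by positivity : 0 ≤ p * ‖z‖ ^ (p - 2)),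
          abs_of_nonneg (by positivity : 0 ≤ p * (p - 2) * ‖z‖ ^ (p - 4)), abs_mul]
        gcongr <;> exact abs_real_inner_le_norm _ _
    _ = p * ‖z‖ ^ (p - 2) * (‖a‖ * ‖b‖) +
        p * (p - 2) * (‖z‖ ^ (p - 4) * ‖z‖ ^ 2) * (‖a‖ * ‖b‖) := by ring
    _ ≤ p * ‖z‖ ^ (p - 2) * (‖a‖ * ‖b‖) + p * (p - 2) * ‖z‖ ^ (p - 2) * (‖a‖ * ‖b‖) := by
        gcongr
    _ = _ := by ring

lemma norm_normPowD2_le {p : ℝ} (hp : 2 ≤ p) (z : F) :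
    ‖normPowD2 p z‖ ≤ p * (p - 1) * ‖z‖ ^ (p - 2) := by
  have h0 : 0 ≤ p * (p - 1) * ‖z‖ ^ (p - 2) :=
    mul_nonneg (mul_nonneg (by linarith) (by linarith)) (by positivity)
  refine ContinuousLinearMap.opNorm_le_bound₂ _ h0 fun a b => ?_
  exact abs_normPowD2_le hp z a b

lemma hasFDerivAt_norm_rpow_normPowD1 {p : ℝ} (hp : 2 ≤ p) (z : F) :
    HasFDerivAt (fun y : F => ‖y‖ ^ p) (normPowD1 p z) z :=
  hasFDerivAt_norm_rpow z (by linarith)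

/-- The origin is treated apart for `p > 2`: there the factor `‖z‖ ^ (p - 2)` need not be
differentiable, but it tends to `0`, which suffices because `realInner z` is linear in `z`. -/
lemma hasFDerivAt_normPowD1 {p : ℝ} (hp : 2 ≤ p) (z : F) :
    HasFDerivAt (normPowD1 p : F → F →L[ℝ] ℝ) (normPowD2 p z) z := by
  by_cases hp2 : p = 2
  · subst hp2
    have h1 : (normPowD1 2 : F → F →L[ℝ] ℝ) = ⇑((2 : ℝ) • (realInner : F →L[ℝ] F →L[ℝ] ℝ)) := by
      funext y
      ext a
      simp [normPowD1_apply, realInner_apply]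
    have h2 : normPowD2 2 z = ((2 : ℝ) • realInner) := by
      ext a b
      simp [normPowD2_apply, realInner_apply]
    rw [h1, h2]
    exact ContinuousLinearMap.hasFDerivAt _
  have hp' : 2 < p := lt_of_le_of_ne hp (Ne.symm hp2)
  by_cases hz : z = 0
  · subst hz
    have h0 : normPowD2 p (0 : F) = 0 := by
      ext a b
      simp [normPowD2_apply, Real.zero_rpow (by linarith : p - 2 ≠ 0)]
    have h0' : normPowD1 p (0 : F) = 0 := by
      ext a
      simp [normPowD1_apply]
    rw [h0]
    refine .of_isLittleO ?_
    have h1 : (fun x : F => normPowD1 p x - normPowD1 p 0 - (0 : F →L[ℝ] F →L[ℝ] ℝ) (x - 0))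
        =O[𝓝 0] fun x : F => ‖x‖ ^ (p - 2) * ‖x‖ := by
      refine Asymptotics.IsBigO.of_bound p (Eventually.of_forall fun x => ?_)
      rw [h0']
      simp only [sub_zero, zero_apply]
      rw [normPowD1, norm_smul, show ‖realInner x‖ = ‖x‖ from innerSL_apply_norm ℝ x,
        Real.norm_of_nonneg (by positivity), Real.norm_of_nonneg (by positivity), mul_assoc]
    refine h1.trans_isLittleO ?_
    have h2 : (fun x : F => ‖x‖ ^ (p - 2)) =o[𝓝 0] fun _ : F => (1 : ℝ) := by
      rw [Asymptotics.isLittleO_const_iff one_ne_zero]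
      have : Continuous fun x : F => ‖x‖ ^ (p - 2) :=
        continuous_norm.rpow_const fun _ => Or.inr (by linarith)
      have h3 := this.tendsto 0
      simpa [Real.zero_rpow (by linarith : p - 2 ≠ 0)] using h3
    have h4 := h2.mul_isBigO (Asymptotics.isBigO_refl (fun x : F => ‖x‖) (𝓝 0))
    rw [← Asymptotics.isLittleO_norm_right]
    simpa using h4
  · have h1 : HasFDerivAt (fun y : F => p * ‖y‖ ^ (p - 2))
        ((p * (p - 2) * ‖z‖ ^ (p - 4)) • realInner z) z := by
      have h := ((hasStrictFDerivAt_norm_sq z).hasFDerivAt.rpow_const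
        (p := (p - 2) / 2) (Or.inl (by simpa using hz))).const_mul p
      convert! h using 1
      · funext y
        rw [← Real.rpow_natCast_mul (norm_nonneg _)]
        congr 2
        push_cast
        ring
      · ext a
        rw [← Real.rpow_natCast_mul (norm_nonneg _)]
        simp only [smul_apply, smul_eq_mul, realInner_apply]
        push_cast
        rw [show 2 * ((p - 2) / 2 - 1) = p - 4 by ring]
        simp
        ring
    have h2 := h1.smul ((realInner : F →L[ℝ] F →L[ℝ] ℝ).hasFDerivAt (x := z))
    have h3 : normPowD2 p z = (p * ‖z‖ ^ (p - 2)) • realInner +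
        ((p * (p - 2) * ‖z‖ ^ (p - 4)) • realInner z).smulRight (realInner z) := by
      ext a b
      simp [normPowD2_apply, realInner_apply]
      ring
    rw [h3]
    exact h2

lemma continuous_normPowD2 {p : ℝ} (hp : 2 ≤ p) :
    Continuous (normPowD2 p : F → F →L[ℝ] F →L[ℝ] ℝ) := by
  by_cases hp2 : p = 2
  · subst hp2
    have h2 : (normPowD2 2 : F → F →L[ℝ] F →L[ℝ] ℝ) = fun _ => (2 : ℝ) • realInner := by
      funext z
      ext a b
      simp [normPowD2_apply, realInner_apply]
    rw [h2]
    exact continuous_const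
  have hp' : 0 < p - 2 := sub_pos.2 (lt_of_le_of_ne hp (Ne.symm hp2))
  rw [continuous_iff_continuousAt]
  intro z
  by_cases hz : z = 0
  · subst hz
    have h0 : normPowD2 p (0 : F) = 0 := by
      ext a b
      simp [normPowD2_apply, Real.zero_rpow hp'.ne']
    rw [ContinuousAt, h0]
    refine squeeze_zero_norm (E := F →L[ℝ] F →L[ℝ] ℝ) (norm_normPowD2_le hp) ?_
    have : Continuous fun x : F => p * (p - 1) * ‖x‖ ^ (p - 2) :=
      continuous_const.mul (continuous_norm.rpow_const fun _ => Or.inr hp'.le)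
    simpa [Real.zero_rpow hp'.ne'] using this.tendsto 0
  · have hn : ‖z‖ ≠ 0 := by simpa using hz
    have h1 : ContDiffAt ℝ 1 (normPowD1 p : F → F →L[ℝ] ℝ) z := by
      have h3 : ContDiffAt ℝ 1 (fun y : F => p * ‖y‖ ^ (p - 2)) z :=
        contDiffAt_const.mul ((contDiffAt_norm ℝ hz).rpow_const_of_ne hn)
      exact h3.smul (realInner : F →L[ℝ] F →L[ℝ] ℝ).contDiff.contDiffAt
    rw [← funext fun z : F => (hasFDerivAt_normPowD1 hp z).fderiv]
    exact (h1.fderiv_right (m := 0) (by norm_num)).continuousAt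

lemma normPowD2_smul {p : ℝ} {c : ℝ} (hc : 0 < c) (z : F) :
    normPowD2 p (c • z) = c ^ (p - 2) • normPowD2 p z := by
  ext a b
  have h : c ^ (p - 2) = c ^ (p - 4) * c ^ 2 := by
    rw [← Real.rpow_natCast c 2, ← Real.rpow_add hc]
    norm_num
    ring_nf
  simp only [normPowD2_apply, smul_apply, smul_eq_mul, norm_smul,
    Real.norm_of_nonneg hc.le, Real.mul_rpow hc.le (norm_nonneg z), real_inner_smul_left]
  rw [h]
  ring

lemma norm_smul_sub_smul {X : Type*} [NormedAddCommGroup X] [NormedSpace ℝ X] {c : ℝ}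
    (hc : 0 ≤ c) (a b : X) : ‖c • a - c • b‖ = c * ‖a - b‖ := by
  rw [← smul_sub, norm_smul, Real.norm_of_nonneg hc]

/-- The modulus of continuity of the second derivative, uniform on the whole space because the
second derivative is homogeneous of degree `p - 2`. -/
lemma normPowD2_modulus [FiniteDimensional ℝ F] {p : ℝ} (hp : 2 ≤ p) {ε : ℝ} (hε : 0 < ε) :
    ∃ c : ℝ, 0 < c ∧ ∀ z w : F,
      ‖normPowD2 p z - normPowD2 p w‖ ≤ ε * (‖z‖ + ‖w‖ + c * ‖z - w‖) ^ (p - 2) := by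
  by_cases hp2 : p = 2
  · subst hp2
    refine ⟨1, one_pos, fun z w => ?_⟩
    have : normPowD2 2 z - normPowD2 2 w = 0 := by
      ext a b
      simp [normPowD2_apply]
    rw [this]
    refine (norm_zero (E := F →L[ℝ] F →L[ℝ] ℝ)).le.trans ?_
    positivity
  have hp' : 0 < p - 2 := sub_pos.2 (lt_of_le_of_ne hp (Ne.symm hp2))
  have hpp : 0 < p * (p - 1) := mul_pos (by linarith) (by linarith)
  have huc : UniformContinuousOn (normPowD2 p : F → F →L[ℝ] F →L[ℝ] ℝ) (Metric.closedBall 0 1) :=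
    (isCompact_closedBall _ _).uniformContinuousOn_of_continuous
      (continuous_normPowD2 hp).continuousOn
  obtain ⟨d, hd, hdc⟩ :=
    (Metric.uniformContinuousOn_iff (α := F) (β := F →L[ℝ] F →L[ℝ] ℝ)).1 huc ε hε
  -- `K` is chosen so that `2 p (p - 1) s ^ (p - 2) ≤ ε (K s) ^ (p - 2)`
  obtain ⟨K, hK, hKε⟩ : ∃ K : ℝ, 0 < K ∧ 2 * (p * (p - 1)) = ε * K ^ (p - 2) := by
    refine ⟨(2 * (p * (p - 1)) / ε) ^ (1 / (p - 2)), by positivity, ?_⟩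
    rw [← Real.rpow_mul (by positivity), one_div_mul_cancel hp'.ne', Real.rpow_one]
    field_simp
  refine ⟨K / d, by positivity, fun z w => ?_⟩
  set m := ‖z‖ + ‖w‖ with hm
  have hm0 : 0 ≤ m := by positivity
  -- If `z` and `w` are far apart relative to their size, the growth bound on each term suffices.
  -- Otherwise both are rescaled by `1 / m` into the unit ball, where uniform continuity applies.
  by_cases hcase : d * m ≤ ‖z - w‖
  · have h1 : ‖normPowD2 p z - normPowD2 p w‖ ≤ 2 * (p * (p - 1)) * m ^ (p - 2) := by
      calc ‖normPowD2 p z - normPowD2 p w‖ ≤ ‖normPowD2 p z‖ + ‖normPowD2 p w‖ :=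
            norm_sub_le (normPowD2 p z) (normPowD2 p w)
        _ ≤ p * (p - 1) * ‖z‖ ^ (p - 2) + p * (p - 1) * ‖w‖ ^ (p - 2) :=
            add_le_add (norm_normPowD2_le hp z) (norm_normPowD2_le hp w)
        _ ≤ p * (p - 1) * m ^ (p - 2) + p * (p - 1) * m ^ (p - 2) := by
            gcongr <;> simp [hm]
        _ = _ := by ring
    refine h1.trans ?_
    rw [hKε, mul_assoc, ← Real.mul_rpow hK.le hm0]
    gcongr
    calc K * m = K / d * (d * m) := by field_simp
      _ ≤ K / d * ‖z - w‖ := by gcongr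
      _ ≤ m + K / d * ‖z - w‖ := by linarith
  · push Not at hcase
    have hmpos : 0 < m := by
      by_contra h
      have : m = 0 := le_antisymm (not_lt.1 h) hm0
      rw [this, mul_zero] at hcase
      exact absurd hcase (not_lt.2 (norm_nonneg _))
    have hz : z = m • (m⁻¹ • z) := by rw [smul_smul, mul_inv_cancel₀ hmpos.ne', one_smul]
    have hw : w = m • (m⁻¹ • w) := by rw [smul_smul, mul_inv_cancel₀ hmpos.ne', one_smul]
    have h2 := hdc (m⁻¹ • z) (by
        rw [mem_closedBall_zero_iff, norm_smul, norm_inv, Real.norm_of_nonneg hm0,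
          inv_mul_le_iff₀ hmpos]
        simp [hm]) (m⁻¹ • w) (by
        rw [mem_closedBall_zero_iff, norm_smul, norm_inv, Real.norm_of_nonneg hm0,
          inv_mul_le_iff₀ hmpos]
        simp [hm]) (by
        rw [dist_eq_norm, ← smul_sub, norm_smul, norm_inv, Real.norm_of_nonneg hm0,
          inv_mul_lt_iff₀ hmpos]
        linarith)
    replace h2 := (dist_eq_norm (E := F →L[ℝ] F →L[ℝ] ℝ) _ _).symm.trans_lt h2
    calc ‖normPowD2 p z - normPowD2 p w‖
        = m ^ (p - 2) * ‖normPowD2 p (m⁻¹ • z) - normPowD2 p (m⁻¹ • w)‖ := by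
          conv_lhs => rw [hz, hw]
          rw [normPowD2_smul hmpos, normPowD2_smul hmpos]
          exact norm_smul_sub_smul (X := F →L[ℝ] F →L[ℝ] ℝ) (by positivity) _ _
      _ ≤ m ^ (p - 2) * ε := by gcongr
      _ ≤ ε * (m + K / d * ‖z - w‖) ^ (p - 2) := by
          rw [mul_comm]
          gcongr
          have : 0 ≤ K / d * ‖z - w‖ := by positivity
          linarith

/-- First order Taylor estimate for the derivative of `‖z‖ ^ p`, with a remainder that is
homogeneous of degree `p - 1`. -/
lemma normPowD1_taylor [FiniteDimensional ℝ F] {p : ℝ} (hp : 2 ≤ p) {ε : ℝ} (hε : 0 < ε) :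
    ∃ c : ℝ, 0 < c ∧ ∀ z w : F,
      ‖normPowD1 p (z + w) - normPowD1 p z - normPowD2 p z w‖
        ≤ ε * (2 * ‖z‖ + c * ‖w‖) ^ (p - 2) * ‖w‖ := by
  obtain ⟨c, hc, h⟩ := normPowD2_modulus (F := F) hp hε
  refine ⟨1 + c, by linarith, fun z w => ?_⟩
  have key := (convex_segment z (z + w)).norm_image_sub_le_of_norm_hasFDerivWithin_le'
    (f := (normPowD1 p : F → F →L[ℝ] ℝ)) (f' := normPowD2 p) (φ := normPowD2 p z)
    (C := ε * (2 * ‖z‖ + (1 + c) * ‖w‖) ^ (p - 2)) (x := z) (y := z + w)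
    (fun x _ => (hasFDerivAt_normPowD1 hp x).hasFDerivWithinAt) (fun x hx => ?_)
    (left_mem_segment _ _ _) (right_mem_segment _ _ _)
  · simpa using key
  · obtain ⟨s, ⟨hs0, hs1⟩, rfl⟩ := (segment_eq_image' ℝ z (z + w)) ▸ hx
    refine (h _ _).trans ?_
    have e1 : z + s • (z + w - z) - z = s • w := by simp
    rw [e1, add_sub_cancel_left, norm_smul, Real.norm_of_nonneg hs0]
    have h1 : s * ‖w‖ ≤ ‖w‖ := mul_le_of_le_one_left (norm_nonneg _) hs1
    have h2 : ‖z + s • w‖ ≤ ‖z‖ + ‖w‖ := by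
      refine (norm_add_le _ _).trans ?_
      rw [norm_smul, Real.norm_of_nonneg hs0]
      linarith
    gcongr ε * ?_ ^ (p - 2)
    · nlinarith

/-- First order Taylor estimate for `‖z‖ ^ p`. -/
lemma norm_rpow_taylor {p : ℝ} (hp : 2 ≤ p) (z w : F) :
    |‖z + w‖ ^ p - ‖z‖ ^ p - normPowD1 p z w|
      ≤ p * (p - 1) * (‖z‖ + ‖w‖) ^ (p - 2) * ‖w‖ * ‖w‖ := by
  have hp1 : 0 ≤ p * (p - 1) := mul_nonneg (by linarith) (by linarith)
  have hseg : ∀ x ∈ segment ℝ z (z + w), ‖x‖ ≤ ‖z‖ + ‖w‖ ∧ ‖x - z‖ ≤ ‖w‖ := by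
    intro x hx
    obtain ⟨s, ⟨hs0, hs1⟩, rfl⟩ := (segment_eq_image' ℝ z (z + w)) ▸ hx
    have h1 : ‖s • w‖ ≤ ‖w‖ := by
      rw [norm_smul, Real.norm_of_nonneg hs0]
      exact mul_le_of_le_one_left (norm_nonneg _) hs1
    rw [add_sub_cancel_left]
    refine ⟨(norm_add_le _ _).trans (by linarith), ?_⟩
    simpa using h1
  have hD1 : ∀ x ∈ segment ℝ z (z + w), ‖normPowD1 p x - normPowD1 p z‖
      ≤ p * (p - 1) * (‖z‖ + ‖w‖) ^ (p - 2) * ‖w‖ := by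
    intro x hx
    have key := (convex_segment z (z + w)).norm_image_sub_le_of_norm_hasFDerivWithin_le
      (f := (normPowD1 p : F → F →L[ℝ] ℝ)) (f' := normPowD2 p)
      (C := p * (p - 1) * (‖z‖ + ‖w‖) ^ (p - 2)) (x := z) (y := x)
      (fun x _ => (hasFDerivAt_normPowD1 hp x).hasFDerivWithinAt)
      (fun y hy => (norm_normPowD2_le hp y).trans (by gcongr; exact (hseg y hy).1))
      (left_mem_segment _ _ _) hx
    refine key.trans ?_
    gcongr
    exact (hseg x hx).2
  have key := (convex_segment z (z + w)).norm_image_sub_le_of_norm_hasFDerivWithin_le'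
    (f := fun y : F => ‖y‖ ^ p) (f' := normPowD1 p) (φ := normPowD1 p z)
    (x := z) (y := z + w)
    (fun x _ => (hasFDerivAt_norm_rpow_normPowD1 hp x).hasFDerivWithinAt) hD1
    (left_mem_segment _ _ _) (right_mem_segment _ _ _)
  simpa [Real.norm_eq_abs] using key

end NormPow

/-! ### The functional `g ↦ ∫ ‖g‖ ^ p` is of class `C²` on `L^p` -/

section LpPow

variable {X : Type*} [MeasurableSpace X] {μ : Measure X}

/-- The `L^p` seminorm as a real number. -/
def lpN (p : ℝ) (μ : Measure X) (a : X → ℝ) : ℝ := (eLpNorm a (ENNReal.ofReal p) μ).toReal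

lemma lpN_nonneg (p : ℝ) (a : X → ℝ) : 0 ≤ lpN p μ a := ENNReal.toReal_nonneg

lemma lpN_add_le {p : ℝ} (hp : 1 ≤ p) {a b : X → ℝ} (ha : MemLp a (ENNReal.ofReal p) μ)
    (hb : MemLp b (ENNReal.ofReal p) μ) :
    lpN p μ (fun x => a x + b x) ≤ lpN p μ a + lpN p μ b := by
  rw [lpN, lpN, lpN, ← ENNReal.toReal_add ha.2.ne hb.2.ne]
  refine ENNReal.toReal_mono (ENNReal.add_ne_top.2 ⟨ha.2.ne, hb.2.ne⟩) ?_
  exact eLpNorm_add_le ha.1 hb.1 (by simpa using ENNReal.ofReal_le_ofReal hp)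

lemma lpN_const_mul {p : ℝ} {c : ℝ} (hc : 0 ≤ c) (a : X → ℝ) :
    lpN p μ (fun x => c * a x) = c * lpN p μ a := by
  have := eLpNorm_const_smul c a (ENNReal.ofReal p) μ
  rw [lpN, lpN]
  have h2 : (fun x => c * a x) = c • a := rfl
  rw [h2, this, ENNReal.toReal_mul]
  simp [abs_of_nonneg hc]

lemma lpN_norm {F : Type*} [NormedAddCommGroup F] {p : ℝ} (g : Lp F (ENNReal.ofReal p) μ) :
    lpN p μ (fun x => ‖g x‖) = ‖g‖ := by
  rw [lpN, eLpNorm_norm, Lp.norm_def]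

lemma lpN_eq_lintegral {p : ℝ} (hp : 1 ≤ p) (a : X → ℝ) :
    eLpNorm a (ENNReal.ofReal p) μ = (∫⁻ x, ‖a x‖ₑ ^ p ∂μ) ^ (1 / p) := by
  rw [eLpNorm_eq_lintegral_rpow_enorm_toReal (by simp; linarith) ENNReal.ofReal_ne_top,
    ENNReal.toReal_ofReal (by linarith)]

/-- Hölder's inequality with the three exponents `p / (p - 2)`, `p`, `p`. -/
lemma lintegral_holder_three {p : ℝ} (hp : 2 ≤ p) {a b c : X → ℝ}
    (ha : MemLp a (ENNReal.ofReal p) μ) (hb : MemLp b (ENNReal.ofReal p) μ)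
    (hc : MemLp c (ENNReal.ofReal p) μ) :
    ∫⁻ x, ‖a x‖ₑ ^ (p - 2) * ‖b x‖ₑ * ‖c x‖ₑ ∂μ ≤
      ENNReal.ofReal (lpN p μ a ^ (p - 2) * lpN p μ b * lpN p μ c) := by
  have hp0 : p ≠ 0 := by linarith
  have h := ENNReal.lintegral_prod_norm_pow_le (μ := μ) (Finset.univ : Finset (Fin 3))
    (f := ![fun x => ‖a x‖ₑ ^ p, fun x => ‖b x‖ₑ ^ p, fun x => ‖c x‖ₑ ^ p])
    (p := ![(p - 2) / p, 1 / p, 1 / p]) (by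
      intro i _
      fin_cases i
      · exact ha.1.enorm.pow_const p
      · exact hb.1.enorm.pow_const p
      · exact hc.1.enorm.pow_const p)
    (by
      simp [Fin.sum_univ_three]
      field_simp
      ring)
    (by
      have h1 : 0 ≤ (p - 2) / p := div_nonneg (by linarith) (by linarith)
      have h2 : 0 ≤ 1 / p := div_nonneg (by linarith) (by linarith)
      intro i _
      fin_cases i
      · exact h1
      · exact h2
      · exact h2)
  simp only [Fin.prod_univ_three, Matrix.cons_val_zero, Matrix.cons_val_one, Matrix.cons_val] at h
  simp only [← ENNReal.rpow_mul, mul_div_cancel₀ _ hp0,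
    ENNReal.rpow_one] at h
  refine h.trans (le_of_eq ?_)
  have e1 : (∫⁻ x, ‖a x‖ₑ ^ p ∂μ) ^ ((p - 2) / p) =
      (eLpNorm a (ENNReal.ofReal p) μ) ^ (p - 2) := by
    rw [lpN_eq_lintegral (by linarith), ← ENNReal.rpow_mul]
    congr 1
    ring
  rw [e1, ← lpN_eq_lintegral (by linarith), ← lpN_eq_lintegral (by linarith),
    ENNReal.ofReal_mul (mul_nonneg (Real.rpow_nonneg (lpN_nonneg _ _) _) (lpN_nonneg _ _)),
    ENNReal.ofReal_mul (Real.rpow_nonneg (lpN_nonneg _ _) _),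
    ← ENNReal.ofReal_rpow_of_nonneg (lpN_nonneg _ _) (by linarith), lpN, lpN, lpN,
    ENNReal.ofReal_toReal ha.2.ne, ENNReal.ofReal_toReal hb.2.ne, ENNReal.ofReal_toReal hc.2.ne]

/-- Integral form of `lintegral_holder_three` for a function dominated by `a ^ (p - 2) b c`. -/
lemma integrable_and_abs_integral_le {p : ℝ} (hp : 2 ≤ p) {a b c φ : X → ℝ} {C : ℝ} (hC : 0 ≤ C)
    (ha0 : ∀ x, 0 ≤ a x) (hb0 : ∀ x, 0 ≤ b x) (hc0 : ∀ x, 0 ≤ c x)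
    (ha : MemLp a (ENNReal.ofReal p) μ) (hb : MemLp b (ENNReal.ofReal p) μ)
    (hc : MemLp c (ENNReal.ofReal p) μ) (hφ : AEStronglyMeasurable φ μ)
    (h : ∀ᵐ x ∂μ, |φ x| ≤ C * (a x ^ (p - 2) * b x * c x)) :
    Integrable φ μ ∧ |∫ x, φ x ∂μ| ≤ C * (lpN p μ a ^ (p - 2) * lpN p μ b * lpN p μ c) := by
  have hN : 0 ≤ lpN p μ a ^ (p - 2) * lpN p μ b * lpN p μ c :=
    mul_nonneg (mul_nonneg (Real.rpow_nonneg (lpN_nonneg _ _) _) (lpN_nonneg _ _))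
      (lpN_nonneg _ _)
  have h1 : ∫⁻ x, ‖φ x‖ₑ ∂μ ≤
      ENNReal.ofReal (C * (lpN p μ a ^ (p - 2) * lpN p μ b * lpN p μ c)) := by
    calc ∫⁻ x, ‖φ x‖ₑ ∂μ
        ≤ ∫⁻ x, ENNReal.ofReal C * (‖a x‖ₑ ^ (p - 2) * ‖b x‖ₑ * ‖c x‖ₑ) ∂μ := by
          refine lintegral_mono_ae (h.mono fun x hx => ?_)
          rw [Real.enorm_eq_ofReal_abs, Real.enorm_eq_ofReal (ha0 x), Real.enorm_eq_ofReal (hb0 x),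
            Real.enorm_eq_ofReal (hc0 x), ENNReal.ofReal_rpow_of_nonneg (ha0 x) (by linarith),
            ← ENNReal.ofReal_mul (Real.rpow_nonneg (ha0 x) _),
            ← ENNReal.ofReal_mul (mul_nonneg (Real.rpow_nonneg (ha0 x) _) (hb0 x)),
            ← ENNReal.ofReal_mul hC]
          exact ENNReal.ofReal_le_ofReal hx
      _ = ENNReal.ofReal C * ∫⁻ x, ‖a x‖ₑ ^ (p - 2) * ‖b x‖ₑ * ‖c x‖ₑ ∂μ :=
          lintegral_const_mul' _ _ ENNReal.ofReal_ne_top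
      _ ≤ _ := by
          rw [ENNReal.ofReal_mul hC]
          gcongr
          exact lintegral_holder_three hp ha hb hc
  have hint : Integrable φ μ := ⟨hφ, lt_of_le_of_lt h1 ENNReal.ofReal_lt_top⟩
  refine ⟨hint, ?_⟩
  have h2 := enorm_integral_le_lintegral_enorm (μ := μ) φ
  rw [Real.enorm_eq_ofReal_abs] at h2
  exact (ENNReal.ofReal_le_ofReal_iff (mul_nonneg hC hN)).1 (h2.trans h1)

lemma hasFDerivAt_of_eventually_le {V W : Type*} [NormedAddCommGroup V] [NormedSpace ℝ V]
    [NormedAddCommGroup W] [NormedSpace ℝ W] {f : V → W} {f' : V →L[ℝ] W} {g : V}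
    (h : ∀ ε > 0, ∀ᶠ v in 𝓝 (0 : V), ‖f (g + v) - f g - f' v‖ ≤ ε * ‖v‖) :
    HasFDerivAt f f' g :=
  hasFDerivAt_iff_isLittleO_nhds_zero.2 (Asymptotics.isLittleO_iff.2 fun ε hε => h ε hε)

lemma hasFDerivAt_form_of_eventually_le {V : Type*} [NormedAddCommGroup V] [NormedSpace ℝ V]
    {f : V → V →L[ℝ] ℝ} {f' : V →L[ℝ] V →L[ℝ] ℝ} {g : V}
    (h : ∀ ε > 0, ∀ᶠ v in 𝓝 (0 : V), ∀ k, |f (g + v) k - f g k - f' v k| ≤ ε * ‖v‖ * ‖k‖) :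
    HasFDerivAt f f' g :=
  hasFDerivAt_of_eventually_le fun ε hε => (h ε hε).mono fun v hv =>
    ContinuousLinearMap.opNorm_le_bound _ (by positivity) hv

lemma continuous_of_eventually_le {V W : Type*} [NormedAddCommGroup V]
    [NormedAddCommGroup W] {f : V → W}
    (h : ∀ g, ∀ ε > 0, ∀ᶠ v in 𝓝 g, ‖f v - f g‖ ≤ ε) : Continuous f := by
  refine continuous_iff_continuousAt.2 fun g => Metric.continuousAt_iff'.2 fun ε hε => ?_
  filter_upwards [h g _ (half_pos hε)] with v hv
  rw [dist_eq_norm]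
  exact hv.trans_lt (half_lt_self hε)

lemma continuous_form_of_eventually_le {V : Type*} [NormedAddCommGroup V] [NormedSpace ℝ V]
    {f : V → V →L[ℝ] V →L[ℝ] ℝ}
    (h : ∀ g, ∀ ε > 0, ∀ᶠ v in 𝓝 g, ∀ a b, |f v a b - f g a b| ≤ ε * ‖a‖ * ‖b‖) :
    Continuous f :=
  continuous_of_eventually_le (W := V →L[ℝ] V →L[ℝ] ℝ) fun g ε hε => (h g ε hε).mono fun _ hv =>
    ContinuousLinearMap.opNorm_le_bound₂ _ hε.le hv

lemma contDiff_two_of_hasFDerivAt {V : Type*} [NormedAddCommGroup V] [NormedSpace ℝ V]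
    {f : V → ℝ} {f₁ : V → V →L[ℝ] ℝ} {f₂ : V → V →L[ℝ] V →L[ℝ] ℝ}
    (h₁ : ∀ g, HasFDerivAt f (f₁ g) g) (h₂ : ∀ g, HasFDerivAt f₁ (f₂ g) g)
    (hc : Continuous f₂) : ContDiff ℝ 2 f := by
  have h3 : ContDiff ℝ 1 f₁ := by
    rw [contDiff_one_iff_fderiv]
    refine ⟨fun z => (h₂ z).differentiableAt, ?_⟩
    rw [funext fun z => (h₂ z).fderiv]
    exact hc
  rw [show (2 : WithTop ℕ∞) = 1 + 1 by norm_num, contDiff_succ_iff_fderiv]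
  refine ⟨fun z => (h₁ z).differentiableAt, by simp, ?_⟩
  rw [funext fun z => (h₁ z).fderiv]
  exact h3

variable {F : Type*} [NormedAddCommGroup F] [InnerProductSpace ℝ F]
variable {p : ℝ} [Fact (1 ≤ ENNReal.ofReal p)]

omit [InnerProductSpace ℝ F] [Fact (1 ≤ ENNReal.ofReal p)] in
lemma memLp_norm (g : Lp F (ENNReal.ofReal p) μ) :
    MemLp (fun x => ‖g x‖) (ENNReal.ofReal p) μ := (Lp.memLp g).norm

omit [InnerProductSpace ℝ F] in
lemma aestronglyMeasurable_norm_rpow {g : X → F} (hg : AEStronglyMeasurable g μ) (r : ℝ) :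
    AEStronglyMeasurable (fun x => ‖g x‖ ^ r) μ :=
  (hg.norm.aemeasurable.pow_const r).aestronglyMeasurable

omit [Fact (1 ≤ ENNReal.ofReal p)] in
lemma aestronglyMeasurable_normPowD1 {g h : X → F}
    (hg : AEStronglyMeasurable g μ) (hh : AEStronglyMeasurable h μ) :
    AEStronglyMeasurable (fun x => normPowD1 p (g x) (h x)) μ := by
  simp only [normPowD1_apply]
  exact ((aestronglyMeasurable_norm_rpow hg _).const_mul p).mul (hg.inner hh)

omit [Fact (1 ≤ ENNReal.ofReal p)] in
lemma aestronglyMeasurable_normPowD2 {g h k : X → F}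
    (hg : AEStronglyMeasurable g μ) (hh : AEStronglyMeasurable h μ)
    (hk : AEStronglyMeasurable k μ) :
    AEStronglyMeasurable (fun x => normPowD2 p (g x) (h x) (k x)) μ := by
  simp only [normPowD2_apply]
  exact (((aestronglyMeasurable_norm_rpow hg _).const_mul p).mul (hh.inner hk)).add
    (((aestronglyMeasurable_norm_rpow hg _).const_mul _).mul ((hg.inner hh).mul (hg.inner hk)))

omit [Fact (1 ≤ ENNReal.ofReal p)] in
lemma integrable_normPowD1 (hp : 2 ≤ p) (g h : Lp F (ENNReal.ofReal p) μ) :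
    Integrable (fun x => normPowD1 p (g x) (h x)) μ ∧
      |∫ x, normPowD1 p (g x) (h x) ∂μ| ≤ p * (‖g‖ ^ (p - 2) * ‖g‖ * ‖h‖) := by
  have := integrable_and_abs_integral_le hp (by linarith : 0 ≤ p) (fun x => norm_nonneg _)
    (fun x => norm_nonneg _) (fun x => norm_nonneg _) (memLp_norm g) (memLp_norm g) (memLp_norm h)
    (aestronglyMeasurable_normPowD1 (Lp.memLp g).1 (Lp.memLp h).1)
    (Eventually.of_forall fun x => by
      rw [← Real.rpow_add_one' (norm_nonneg _) (by linarith), show p - 2 + 1 = p - 1 by ring]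
      exact abs_normPowD1_le hp _ _)
  simpa only [lpN_norm] using this

omit [Fact (1 ≤ ENNReal.ofReal p)] in
lemma integrable_normPowD2 (hp : 2 ≤ p) (g h k : Lp F (ENNReal.ofReal p) μ) :
    Integrable (fun x => normPowD2 p (g x) (h x) (k x)) μ ∧
      |∫ x, normPowD2 p (g x) (h x) (k x) ∂μ| ≤
        p * (p - 1) * (‖g‖ ^ (p - 2) * ‖h‖ * ‖k‖) := by
  have := integrable_and_abs_integral_le hp
    (mul_nonneg (by linarith) (by linarith) : 0 ≤ p * (p - 1)) (fun x => norm_nonneg _)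
    (fun x => norm_nonneg _) (fun x => norm_nonneg _) (memLp_norm g) (memLp_norm h) (memLp_norm k)
    (aestronglyMeasurable_normPowD2 (Lp.memLp g).1 (Lp.memLp h).1 (Lp.memLp k).1)
    (Eventually.of_forall fun x => by
      have := abs_normPowD2_le hp (g x) (h x) (k x)
      linarith)
  simpa only [lpN_norm] using this

omit [InnerProductSpace ℝ F] [Fact (1 ≤ ENNReal.ofReal p)] in
lemma integrable_norm_rpow (hp : 2 ≤ p) (g : Lp F (ENNReal.ofReal p) μ) :
    Integrable (fun x => ‖g x‖ ^ p) μ := by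
  have := (Lp.memLp g).integrable_norm_rpow (by simp; linarith) ENNReal.ofReal_ne_top
  rwa [ENNReal.toReal_ofReal (by linarith)] at this

/-- `g ↦ ∫ ‖g‖ ^ p` on `L^p`. -/
def lpPow (g : Lp F (ENNReal.ofReal p) μ) : ℝ := ∫ x, ‖g x‖ ^ p ∂μ

/-- The first derivative of `lpPow`. -/
def lpPowD1 (hp : 2 ≤ p) (g : Lp F (ENNReal.ofReal p) μ) : Lp F (ENNReal.ofReal p) μ →L[ℝ] ℝ :=
  LinearMap.mkContinuous
    { toFun := fun h => ∫ x, normPowD1 p (g x) (h x) ∂μ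
      map_add' := fun h k => by
        rw [← integral_add (integrable_normPowD1 hp g h).1 (integrable_normPowD1 hp g k).1]
        refine integral_congr_ae ((Lp.coeFn_add h k).mono fun x hx => ?_)
        simp only [hx, Pi.add_apply, map_add]
      map_smul' := fun c h => by
        rw [RingHom.id_apply, smul_eq_mul, ← integral_const_mul]
        refine integral_congr_ae ((Lp.coeFn_smul c h).mono fun x hx => ?_)
        simp only [hx, Pi.smul_apply, map_smul, smul_eq_mul] }
    (p * (‖g‖ ^ (p - 2) * ‖g‖)) fun h => by
      rw [mul_assoc]
      exact (integrable_normPowD1 hp g h).2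

/-- The second derivative of `lpPow`. -/
def lpPowD2 (hp : 2 ≤ p) (g : Lp F (ENNReal.ofReal p) μ) :
    Lp F (ENNReal.ofReal p) μ →L[ℝ] Lp F (ENNReal.ofReal p) μ →L[ℝ] ℝ :=
  LinearMap.mkContinuous₂
    (LinearMap.mk₂ ℝ (fun h k => ∫ x, normPowD2 p (g x) (h x) (k x) ∂μ)
      (fun h h' k => by
        rw [← integral_add (integrable_normPowD2 hp g h k).1 (integrable_normPowD2 hp g h' k).1]
        refine integral_congr_ae ((Lp.coeFn_add h h').mono fun x hx => ?_)
        simp only [hx, Pi.add_apply, map_add, add_apply])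
      (fun c h k => by
        rw [smul_eq_mul, ← integral_const_mul]
        refine integral_congr_ae ((Lp.coeFn_smul c h).mono fun x hx => ?_)
        simp only [hx, Pi.smul_apply, map_smul, smul_apply, smul_eq_mul])
      (fun h k k' => by
        rw [← integral_add (integrable_normPowD2 hp g h k).1 (integrable_normPowD2 hp g h k').1]
        refine integral_congr_ae ((Lp.coeFn_add k k').mono fun x hx => ?_)
        simp only [hx, Pi.add_apply, map_add])
      (fun c h k => by
        rw [smul_eq_mul, ← integral_const_mul]
        refine integral_congr_ae ((Lp.coeFn_smul c k).mono fun x hx => ?_)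
        simp only [hx, Pi.smul_apply, map_smul, smul_eq_mul]))
    (p * (p - 1) * ‖g‖ ^ (p - 2)) fun h k => by
      have := (integrable_normPowD2 hp g h k).2
      rw [LinearMap.mk₂_apply, Real.norm_eq_abs]
      linarith

lemma lpPowD1_apply (hp : 2 ≤ p) (g h : Lp F (ENNReal.ofReal p) μ) :
    lpPowD1 hp g h = ∫ x, normPowD1 p (g x) (h x) ∂μ := rfl

lemma lpPowD2_apply (hp : 2 ≤ p) (g h k : Lp F (ENNReal.ofReal p) μ) :
    lpPowD2 hp g h k = ∫ x, normPowD2 p (g x) (h x) (k x) ∂μ := rfl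

omit [InnerProductSpace ℝ F] [Fact (1 ≤ ENNReal.ofReal p)] in
lemma lpN_norm_add_norm_le (hp : 2 ≤ p) {s t : ℝ} (hs : 0 ≤ s) (ht : 0 ≤ t)
    (g h : Lp F (ENNReal.ofReal p) μ) :
    lpN p μ (fun x => s * ‖g x‖ + t * ‖h x‖) ≤ s * ‖g‖ + t * ‖h‖ := by
  refine (lpN_add_le (by linarith) ((memLp_norm g).const_mul s)
    ((memLp_norm h).const_mul t)).trans ?_
  rw [lpN_const_mul hs, lpN_const_mul ht, lpN_norm, lpN_norm]

lemma hasFDerivAt_lpPow (hp : 2 ≤ p) (g : Lp F (ENNReal.ofReal p) μ) :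
    HasFDerivAt (lpPow : Lp F (ENNReal.ofReal p) μ → ℝ) (lpPowD1 hp g) g := by
  have hC : 0 ≤ p * (p - 1) := mul_nonneg (by linarith) (by linarith)
  have key : ∀ h : Lp F (ENNReal.ofReal p) μ, |lpPow (g + h) - lpPow g - lpPowD1 hp g h| ≤
      p * (p - 1) * ((1 * ‖g‖ + 1 * ‖h‖) ^ (p - 2) * ‖h‖ * ‖h‖) := by
    intro h
    have hval : lpPow (g + h) - lpPow g - lpPowD1 hp g h =
        ∫ x, (‖(g + h : Lp F (ENNReal.ofReal p) μ) x‖ ^ p - ‖g x‖ ^ p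
          - normPowD1 p (g x) (h x)) ∂μ := by
      have h1 := integrable_norm_rpow hp (g + h)
      have h2 := integrable_norm_rpow hp g
      have h3 := (integrable_normPowD1 hp g h).1
      rw [lpPow, lpPow, lpPowD1_apply, ← integral_sub h1 h2]
      exact (integral_sub (h1.sub h2) h3).symm
    rw [hval]
    have := (integrable_and_abs_integral_le (μ := μ) hp hC
      (a := fun x => 1 * ‖g x‖ + 1 * ‖h x‖) (b := fun x => ‖h x‖) (c := fun x => ‖h x‖)
      (fun x => by positivity) (fun x => by positivity) (fun x => by positivity)
      (((memLp_norm g).const_mul 1).add ((memLp_norm h).const_mul 1))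
      (memLp_norm h) (memLp_norm h)
      (((integrable_norm_rpow hp (g + h)).sub (integrable_norm_rpow hp g)).sub
        (integrable_normPowD1 hp g h).1).1
      ((Lp.coeFn_add g h).mono fun x hx => by
        have := norm_rpow_taylor hp (g x) (h x)
        simp only [Pi.sub_apply, hx, Pi.add_apply, one_mul]
        linarith)).2
    refine this.trans ?_
    rw [lpN_norm]
    gcongr
    · exact lpN_nonneg _ _
    · exact lpN_norm_add_norm_le hp zero_le_one zero_le_one g h
  refine hasFDerivAt_of_eventually_le fun ε hε => ?_
  have hlim : Tendsto (fun h : Lp F (ENNReal.ofReal p) μ =>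
      p * (p - 1) * ((1 * ‖g‖ + 1 * ‖h‖) ^ (p - 2) * ‖h‖)) (𝓝 0) (𝓝 0) := by
    have : Continuous (fun h : Lp F (ENNReal.ofReal p) μ =>
        p * (p - 1) * ((1 * ‖g‖ + 1 * ‖h‖) ^ (p - 2) * ‖h‖)) := by
      refine continuous_const.mul (Continuous.mul (Continuous.rpow_const (by fun_prop) ?_)
        continuous_norm)
      exact fun _ => Or.inr (by linarith)
    simpa using this.tendsto 0
  filter_upwards [hlim.eventually (gt_mem_nhds hε)] with h hh
  rw [Real.norm_eq_abs]
  refine (key h).trans ?_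
  rw [← mul_assoc]
  rw [← mul_assoc] at hh
  have := mul_le_mul_of_nonneg_right hh.le (norm_nonneg h)
  linarith

variable [FiniteDimensional ℝ F]

lemma hasFDerivAt_lpPowD1 (hp : 2 ≤ p) (g : Lp F (ENNReal.ofReal p) μ) :
    HasFDerivAt (lpPowD1 hp : Lp F (ENNReal.ofReal p) μ → Lp F (ENNReal.ofReal p) μ →L[ℝ] ℝ)
      (lpPowD2 hp g) g := by
  refine hasFDerivAt_form_of_eventually_le fun ε hε => ?_
  set M := (2 * ‖g‖ + 1) ^ (p - 2) with hM
  have hMpos : 0 < M := by positivity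
  obtain ⟨c, hc, htay⟩ := normPowD1_taylor (F := F) hp (div_pos hε hMpos)
  have hlim : ∀ᶠ h : Lp F (ENNReal.ofReal p) μ in 𝓝 0, c * ‖h‖ < 1 := by
    have : Tendsto (fun h : Lp F (ENNReal.ofReal p) μ => c * ‖h‖) (𝓝 0) (𝓝 0) := by
      have : Continuous (fun h : Lp F (ENNReal.ofReal p) μ => c * ‖h‖) := by fun_prop
      simpa using this.tendsto 0
    exact this.eventually (gt_mem_nhds one_pos)
  filter_upwards [hlim] with h hh k
  have hval : lpPowD1 hp (g + h) k - lpPowD1 hp g k - lpPowD2 hp g h k =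
      ∫ x, (normPowD1 p ((g + h : Lp F (ENNReal.ofReal p) μ) x) (k x) - normPowD1 p (g x) (k x)
        - normPowD2 p (g x) (h x) (k x)) ∂μ := by
    have h1 := (integrable_normPowD1 hp (g + h) k).1
    have h2 := (integrable_normPowD1 hp g k).1
    have h3 := (integrable_normPowD2 hp g h k).1
    rw [lpPowD1_apply, lpPowD1_apply, lpPowD2_apply, ← integral_sub h1 h2]
    exact (integral_sub (h1.sub h2) h3).symm
  rw [hval]
  have := (integrable_and_abs_integral_le (μ := μ) hp (div_pos hε hMpos).le
      (a := fun x => 2 * ‖g x‖ + c * ‖h x‖) (b := fun x => ‖h x‖) (c := fun x => ‖k x‖)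
      (fun x => by positivity) (fun x => by positivity) (fun x => by positivity)
      (((memLp_norm g).const_mul 2).add ((memLp_norm h).const_mul c))
      (memLp_norm h) (memLp_norm k)
      (((integrable_normPowD1 hp (g + h) k).1.sub (integrable_normPowD1 hp g k).1).sub
        (integrable_normPowD2 hp g h k).1).1
      ((Lp.coeFn_add g h).mono fun x hx => by
        have h1 := (ContinuousLinearMap.le_of_opNorm_le _ (htay (g x) (h x)) (k x))
        rw [Real.norm_eq_abs] at h1
        simp only [Pi.sub_apply, hx, Pi.add_apply]
        refine h1.trans (le_of_eq ?_)
        ring)).2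
  refine this.trans ?_
  rw [lpN_norm, lpN_norm]
  have h2 : lpN p μ (fun x => 2 * ‖g x‖ + c * ‖h x‖) ^ (p - 2) ≤ M := by
    refine Real.rpow_le_rpow (lpN_nonneg _ _) ?_ (by linarith)
    exact (lpN_norm_add_norm_le hp zero_le_two hc.le g h).trans (by linarith)
  calc ε / M * (lpN p μ (fun x => 2 * ‖g x‖ + c * ‖h x‖) ^ (p - 2) * ‖h‖ * ‖k‖)
      ≤ ε / M * (M * ‖h‖ * ‖k‖) := by gcongr
    _ = ε * ‖h‖ * ‖k‖ := by field_simp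

/-- The derivative `lpPowD2` inherits the modulus of continuity `normPowD2_modulus` through Hölder's
inequality. -/
lemma continuous_lpPowD2 (hp : 2 ≤ p) :
    Continuous (lpPowD2 hp : Lp F (ENNReal.ofReal p) μ →
      Lp F (ENNReal.ofReal p) μ →L[ℝ] Lp F (ENNReal.ofReal p) μ →L[ℝ] ℝ) := by
  refine continuous_form_of_eventually_le fun g ε hε => ?_
  set M := (2 * ‖g‖ + 2) ^ (p - 2) with hM
  have hMpos : 0 < M := by positivity
  obtain ⟨c, hc, hmod⟩ := normPowD2_modulus (F := F) hp (div_pos hε hMpos)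
  have hlim : ∀ᶠ h : Lp F (ENNReal.ofReal p) μ in 𝓝 g, c * ‖h - g‖ < 1 ∧ ‖h - g‖ < 1 := by
    have h1 : Tendsto (fun h : Lp F (ENNReal.ofReal p) μ => c * ‖h - g‖) (𝓝 g) (𝓝 0) := by
      have : Continuous (fun h : Lp F (ENNReal.ofReal p) μ => c * ‖h - g‖) := by fun_prop
      simpa using this.tendsto g
    have h2 : Tendsto (fun h : Lp F (ENNReal.ofReal p) μ => ‖h - g‖) (𝓝 g) (𝓝 0) := by
      have : Continuous (fun h : Lp F (ENNReal.ofReal p) μ => ‖h - g‖) := by fun_prop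
      simpa using this.tendsto g
    exact (h1.eventually (gt_mem_nhds one_pos)).and (h2.eventually (gt_mem_nhds one_pos))
  filter_upwards [hlim] with h hh a b
  have hval : lpPowD2 hp h a b - lpPowD2 hp g a b =
      ∫ x, (normPowD2 p (h x) (a x) (b x) - normPowD2 p (g x) (a x) (b x)) ∂μ := by
    rw [integral_sub (integrable_normPowD2 hp _ _ _).1 (integrable_normPowD2 hp _ _ _).1]
    rfl
  rw [hval]
  have := (integrable_and_abs_integral_le (μ := μ) hp (div_pos hε hMpos).le
      (a := fun x => (1 * ‖h x‖ + 1 * ‖g x‖) + c * ‖(h - g : Lp F (ENNReal.ofReal p) μ) x‖)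
      (b := fun x => ‖a x‖) (c := fun x => ‖b x‖)
      (fun x => by positivity) (fun x => by positivity) (fun x => by positivity)
      ((((memLp_norm h).const_mul 1).add ((memLp_norm g).const_mul 1)).add
        ((memLp_norm (h - g)).const_mul c))
      (memLp_norm a) (memLp_norm b)
      ((integrable_normPowD2 hp h a b).1.sub (integrable_normPowD2 hp g a b).1).1
      ((Lp.coeFn_sub h g).mono fun x hx => by
        have h1 := ContinuousLinearMap.le_of_opNorm_le _
          (ContinuousLinearMap.le_of_opNorm_le _ (hmod (h x) (g x)) (a x)) (b x)
        rw [Real.norm_eq_abs] at h1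
        simp only [Pi.sub_apply, hx, one_mul]
        refine h1.trans (le_of_eq ?_)
        ring)).2
  refine this.trans ?_
  rw [lpN_norm, lpN_norm]
  have h2 : lpN p μ (fun x => (1 * ‖h x‖ + 1 * ‖g x‖) +
      c * ‖(h - g : Lp F (ENNReal.ofReal p) μ) x‖) ^ (p - 2) ≤ M := by
    refine Real.rpow_le_rpow (lpN_nonneg _ _) ?_ (by linarith)
    refine (lpN_add_le (by linarith)
      (((memLp_norm h).const_mul 1).add ((memLp_norm g).const_mul 1))
      ((memLp_norm (h - g)).const_mul c)).trans ?_
    rw [lpN_const_mul hc.le, lpN_norm]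
    have h3 : lpN p μ ((fun x => 1 * ‖h x‖) + fun x => 1 * ‖g x‖) ≤ 1 * ‖h‖ + 1 * ‖g‖ :=
      lpN_norm_add_norm_le hp zero_le_one zero_le_one h g
    have h4 : ‖h‖ ≤ ‖g‖ + ‖h - g‖ := by
      have := norm_add_le g (h - g)
      rwa [add_sub_cancel] at this
    linarith
  calc ε / M * (_ * ‖a‖ * ‖b‖)
      ≤ ε / M * (M * ‖a‖ * ‖b‖) := by gcongr
    _ = ε * ‖a‖ * ‖b‖ := by field_simp

lemma contDiff_lpPow (hp : 2 ≤ p) :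
    ContDiff ℝ 2 (lpPow : Lp F (ENNReal.ofReal p) μ → ℝ) :=
  contDiff_two_of_hasFDerivAt (hasFDerivAt_lpPow hp) (hasFDerivAt_lpPowD1 hp)
    (continuous_lpPowD2 hp)

end LpPow

/-! ### The space `W_0^{1,p}` and weak gradients -/

/-- The normed group structure of `W_0^{1,p}(Ω)`, named so that instance search finds it at once. -/
@[reducible] def normedAddCommGroupW0 {N : ℕ} (Ω : Set (Eucl N)) (p : ℝ)
    [Fact (1 ≤ ENNReal.ofReal p)] : NormedAddCommGroup (W0 Ω p) :=
  Submodule.normedAddCommGroup (W0 Ω p)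

/-- The normed space structure of `W_0^{1,p}(Ω)`. -/
@[reducible] def normedSpaceW0 {N : ℕ} (Ω : Set (Eucl N)) (p : ℝ)
    [Fact (1 ≤ ENNReal.ofReal p)] :
    @NormedSpace ℝ (W0 Ω p) _ (normedAddCommGroupW0 Ω p).toSeminormedAddCommGroup :=
  Submodule.normedSpace (W0 Ω p)

attribute [local instance] normedAddCommGroupW0 normedSpaceW0

section Sobolev

variable {N : ℕ} {Ω : Set (Eucl N)} {p : ℝ} [Fact (1 ≤ ENNReal.ofReal p)]

/-- Smooth functions with compact support in `Ω`. -/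
def IsTestFun (Ω : Set (Eucl N)) (φ : Eucl N → ℝ) : Prop :=
  ContDiff ℝ ∞ φ ∧ HasCompactSupport φ ∧ tsupport φ ⊆ Ω

/-- The underlying function, as an element of `L^p`. -/
def valL (w : W0 Ω p) : Lp ℝ (ENNReal.ofReal p) (volume.restrict Ω) := w.1.1

/-- The weak gradient, as an element of `L^p`. -/
def gradL (w : W0 Ω p) : Lp (Eucl N) (ENNReal.ofReal p) (volume.restrict Ω) := w.1.2

/-- `valL` as a continuous linear map. -/
def valCLM : W0 Ω p →L[ℝ] Lp ℝ (ENNReal.ofReal p) (volume.restrict Ω) :=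
  (ContinuousLinearMap.fst ℝ _ _).comp (W0 Ω p).subtypeL

/-- `gradL` as a continuous linear map. -/
def gradCLM : W0 Ω p →L[ℝ] Lp (Eucl N) (ENNReal.ofReal p) (volume.restrict Ω) :=
  (ContinuousLinearMap.snd ℝ _ _).comp (W0 Ω p).subtypeL

lemma continuous_valL : Continuous (valL : W0 Ω p → _) := valCLM.continuous

lemma continuous_gradL : Continuous (gradL : W0 Ω p → _) := gradCLM.continuous

lemma coe_valL (w : W0 Ω p) : (valL w : Eucl N → ℝ) = val w := rfl

lemma coe_gradL (w : W0 Ω p) : (gradL w : Eucl N → Eucl N) = grad w := rfl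

lemma norm_eq_max (w : W0 Ω p) : ‖w‖ = max ‖valL w‖ ‖gradL w‖ := rfl

lemma memLp_val (w : W0 Ω p) : MemLp (val w) (ENNReal.ofReal p) (volume.restrict Ω) :=
  Lp.memLp (valL w)

lemma memLp_grad (w : W0 Ω p) : MemLp (grad w) (ENNReal.ofReal p) (volume.restrict Ω) :=
  Lp.memLp (gradL w)

lemma val_add (w v : W0 Ω p) :
    val (w + v) =ᵐ[volume.restrict Ω] fun x => val w x + val v x :=
  Lp.coeFn_add (valL w) (valL v)

lemma val_sub (w v : W0 Ω p) :
    val (w - v) =ᵐ[volume.restrict Ω] fun x => val w x - val v x :=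
  Lp.coeFn_sub (valL w) (valL v)

lemma val_smul (c : ℝ) (w : W0 Ω p) :
    val (c • w) =ᵐ[volume.restrict Ω] fun x => c * val w x :=
  Lp.coeFn_smul c (valL w)

lemma grad_add (w v : W0 Ω p) :
    grad (w + v) =ᵐ[volume.restrict Ω] fun x => grad w x + grad v x :=
  Lp.coeFn_add (gradL w) (gradL v)

lemma grad_sub (w v : W0 Ω p) :
    grad (w - v) =ᵐ[volume.restrict Ω] fun x => grad w x - grad v x :=
  Lp.coeFn_sub (gradL w) (gradL v)

lemma grad_smul (c : ℝ) (w : W0 Ω p) :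
    grad (c • w) =ᵐ[volume.restrict Ω] fun x => c • grad w x :=
  Lp.coeFn_smul c (gradL w)

instance : CompleteSpace (W0 Ω p) :=
  (Submodule.isClosed_topologicalClosure _).completeSpace_coe

lemma exists_seq_testFun (w : W0 Ω p) :
    ∃ (φ : ℕ → Eucl N → ℝ) (v : ℕ → W0 Ω p), (∀ n, IsTestFun Ω (φ n)) ∧
      (∀ n, val (v n) =ᵐ[volume.restrict Ω] φ n) ∧
      (∀ n, grad (v n) =ᵐ[volume.restrict Ω] gradient (φ n)) ∧ Tendsto v atTop (𝓝 w) := by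
  have hw : (w : Lp ℝ (ENNReal.ofReal p) (volume.restrict Ω) ×
      Lp (Eucl N) (ENNReal.ofReal p) (volume.restrict Ω)) ∈ closure (testPairs Ω p : Set _) := by
    have h := Submodule.topologicalClosure_coe (testPairs Ω p)
    exact h ▸ w.2
  obtain ⟨f, hf, hlim⟩ := mem_closure_iff_seq_limit.1 hw
  choose φ h1 h2 h3 h4 h5 using hf
  exact ⟨φ, fun n => ⟨f n, Submodule.le_topologicalClosure _ (by exact ⟨φ n, h1 n, h2 n, h3 n,
    h4 n, h5 n⟩)⟩, fun n => ⟨h1 n, h2 n, h3 n⟩, h4, h5, tendsto_subtype_rng.2 hlim⟩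

lemma norm_gradient (φ : Eucl N → ℝ) (x : Eucl N) : ‖gradient φ x‖ = ‖fderiv ℝ φ x‖ := by
  simp [gradient]

lemma inner_gradient (φ : Eucl N → ℝ) (x e : Eucl N) :
    inner ℝ (gradient φ x) e = fderiv ℝ φ x e := by
  simp [gradient]

/-- A continuous compactly supported vector field has `L^p` class on `Ω`. -/
lemma memLp_restrict_of_hasCompactSupport {F : Type*} [NormedAddCommGroup F] {f : Eucl N → F}
    (hf : Continuous f) (hc : HasCompactSupport f) (r : ENNReal) :
    MemLp f r (volume.restrict Ω) :=
  (hf.memLp_of_hasCompactSupport hc).mono_measure Measure.restrict_le_self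

lemma continuous_gradient {φ : Eucl N → ℝ} (h : ContDiff ℝ 1 φ) : Continuous (gradient φ) :=
  (InnerProductSpace.toDual ℝ (Eucl N)).symm.continuous.comp (h.continuous_fderiv (by simp))

lemma hasCompactSupport_gradient {φ : Eucl N → ℝ} (h : HasCompactSupport φ) :
    HasCompactSupport (gradient φ) :=
  (h.fderiv ℝ).comp_left (g := (InnerProductSpace.toDual ℝ (Eucl N)).symm) (by simp)

/-- The element of `W_0^{1,p}(Ω)` given by a test function. -/
lemma exists_of_testFun {φ : Eucl N → ℝ} (h : IsTestFun Ω φ) :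
    ∃ w : W0 Ω p, val w =ᵐ[volume.restrict Ω] φ ∧
      grad w =ᵐ[volume.restrict Ω] gradient φ := by
  have h1 : MemLp φ (ENNReal.ofReal p) (volume.restrict Ω) :=
    memLp_restrict_of_hasCompactSupport h.1.continuous h.2.1 _
  have h2 : MemLp (gradient φ) (ENNReal.ofReal p) (volume.restrict Ω) :=
    memLp_restrict_of_hasCompactSupport (continuous_gradient (h.1.of_le (by simp)))
      (hasCompactSupport_gradient h.2.1) _
  exact ⟨⟨(h1.toLp φ, h2.toLp _), Submodule.le_topologicalClosure _
    (by exact ⟨φ, h.1, h.2.1, h.2.2, h1.coeFn_toLp, h2.coeFn_toLp⟩)⟩, h1.coeFn_toLp, h2.coeFn_toLp⟩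

omit [Fact (1 ≤ ENNReal.ofReal p)] in
/-- On a set of finite measure, pairing with a bounded function is controlled by the `L^p` norm. -/
lemma exists_integral_inner_bound {X : Type*} [MeasurableSpace X] {μ : Measure X}
    [IsFiniteMeasure μ] {F : Type*} [NormedAddCommGroup F]
    [InnerProductSpace ℝ F] (hp : 2 ≤ p) {a : X → F} (ha : AEStronglyMeasurable a μ)
    {M : ℝ} (hM : ∀ x, ‖a x‖ ≤ M) :
    ∃ C : ℝ, ∀ f : Lp F (ENNReal.ofReal p) μ, Integrable (fun x => inner ℝ (a x) (f x)) μ ∧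
      |∫ x, inner ℝ (a x) (f x) ∂μ| ≤ C * ‖f‖ := by
  refine ⟨lpN p μ (fun _ => 1) ^ (p - 2) * lpN p μ (fun _ => |M|), fun f => ?_⟩
  have := integrable_and_abs_integral_le (μ := μ) hp zero_le_one
    (a := fun _ => 1) (b := fun _ => |M|) (c := fun x => ‖f x‖) (fun _ => zero_le_one)
    (fun _ => abs_nonneg _) (fun _ => norm_nonneg _) (memLp_const _) (memLp_const _) (memLp_norm f)
    (ha.inner (Lp.memLp f).1) (Eventually.of_forall fun x => by
      simp only [Real.one_rpow, one_mul]
      refine (abs_real_inner_le_norm _ _).trans ?_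
      gcongr
      exact (hM x).trans (le_abs_self M))
  rwa [lpN_norm, one_mul] at this

/-- Pairing with a bounded function, as a continuous linear form on `L^p`. -/
lemma exists_pairing {X : Type*} [MeasurableSpace X] {μ : Measure X}
    [IsFiniteMeasure μ] {F : Type*} [NormedAddCommGroup F]
    [InnerProductSpace ℝ F] (hp : 2 ≤ p) {a : X → F} (ha : AEStronglyMeasurable a μ)
    {M : ℝ} (hM : ∀ x, ‖a x‖ ≤ M) :
    ∃ T : Lp F (ENNReal.ofReal p) μ →L[ℝ] ℝ, ∀ f, T f = ∫ x, inner ℝ (a x) (f x) ∂μ := by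
  obtain ⟨C, hC⟩ := exists_integral_inner_bound hp ha hM
  refine ⟨LinearMap.mkContinuous
    { toFun := fun f => ∫ x, inner ℝ (a x) (f x) ∂μ
      map_add' := fun f g => by
        rw [← integral_add (hC f).1 (hC g).1]
        refine integral_congr_ae ((Lp.coeFn_add f g).mono fun x hx => ?_)
        simp only [hx, Pi.add_apply, inner_add_right]
      map_smul' := fun c f => by
        rw [RingHom.id_apply, smul_eq_mul, ← integral_const_mul]
        refine integral_congr_ae ((Lp.coeFn_smul c f).mono fun x hx => ?_)
        simp only [hx, Pi.smul_apply, inner_smul_right] } C fun f => (hC f).2, fun f => rfl⟩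

lemma exists_norm_le_of_hasCompactSupport {F : Type*} [NormedAddCommGroup F] {f : Eucl N → F}
    (hf : Continuous f) (hc : HasCompactSupport f) : ∃ M : ℝ, ∀ x, ‖f x‖ ≤ M :=
  hf.bounded_above_of_compact_support hc

lemma integral_mul_fderiv_of_hasCompactSupport {φ ψ : Eucl N → ℝ} (hφ : ContDiff ℝ 1 φ)
    (hψ : ContDiff ℝ 1 ψ) (hc : HasCompactSupport ψ) (e : Eucl N) :
    ∫ x, φ x * fderiv ℝ ψ x e = - ∫ x, fderiv ℝ φ x e * ψ x := by
  have hd : Continuous fun x => fderiv ℝ ψ x e :=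
    (hψ.continuous_fderiv (by simp)).clm_apply continuous_const
  have hdc : HasCompactSupport fun x => fderiv ℝ ψ x e := hc.fderiv_apply ℝ e
  have hd' : Continuous fun x => fderiv ℝ φ x e :=
    (hφ.continuous_fderiv (by simp)).clm_apply continuous_const
  have s1 : HasCompactSupport fun x => fderiv ℝ φ x e * ψ x :=
    HasCompactSupport.mul_left (f := fun x => fderiv ℝ φ x e) hc
  have s2 : HasCompactSupport fun x => φ x * fderiv ℝ ψ x e :=
    HasCompactSupport.mul_left (f := φ) hdc
  have s3 : HasCompactSupport fun x => φ x * ψ x := HasCompactSupport.mul_left (f := φ) hc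
  exact integral_mul_fderiv_eq_neg_fderiv_mul_of_integrable
    ((hd'.mul hψ.continuous).integrable_of_hasCompactSupport s1)
    ((hφ.continuous.mul hd).integrable_of_hasCompactSupport s2)
    ((hφ.continuous.mul hψ.continuous).integrable_of_hasCompactSupport s3)
    (fun x _ => (hφ.differentiable (by simp)) x) (fun x _ => (hψ.differentiable (by simp)) x)

/-- Integration by parts against a test function: `grad w` is the weak gradient of `val w`. -/
lemma integral_val_mul_fderiv (hp : 2 ≤ p) (hΩ : Bornology.IsBounded Ω) {ψ : Eucl N → ℝ}
    (hψ : IsTestFun Ω ψ) (e : Eucl N) (w : W0 Ω p) :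
    ∫ x in Ω, val w x * fderiv ℝ ψ x e = - ∫ x in Ω, inner ℝ (ψ x • e) (grad w x) := by
  have : IsFiniteMeasure (volume.restrict Ω) := ⟨by simpa using hΩ.measure_lt_top⟩
  have hψ1 : ContDiff ℝ 1 ψ := hψ.1.of_le (by simp)
  have hd : Continuous fun x => fderiv ℝ ψ x e :=
    (hψ1.continuous_fderiv (by simp)).clm_apply continuous_const
  have hdc : HasCompactSupport fun x => fderiv ℝ ψ x e := hψ.2.1.fderiv_apply ℝ e
  have hs : Continuous fun x => ψ x • e := hψ1.continuous.smul continuous_const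
  have hsc : HasCompactSupport fun x => ψ x • e := hψ.2.1.smul_right
  obtain ⟨M₁, hM₁⟩ := exists_norm_le_of_hasCompactSupport hd hdc
  obtain ⟨M₂, hM₂⟩ := exists_norm_le_of_hasCompactSupport hs hsc
  obtain ⟨T₁, hT₁⟩ := exists_pairing (p := p) (μ := volume.restrict Ω) hp
    hd.aestronglyMeasurable hM₁
  obtain ⟨T₂, hT₂⟩ := exists_pairing (p := p) (μ := volume.restrict Ω) hp
    hs.aestronglyMeasurable hM₂
  have key : T₁ (valL w) = - T₂ (gradL w) := by
    obtain ⟨φ, v, h1, h2, h3, h4⟩ := exists_seq_testFun w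
    have hT : ∀ n, T₁ (valL (v n)) = - T₂ (gradL (v n)) := by
      intro n
      have hφ1 : ContDiff ℝ 1 (φ n) := (h1 n).1.of_le (by simp)
      have e1 : T₁ (valL (v n)) = ∫ x, φ n x * fderiv ℝ ψ x e := by
        rw [hT₁]
        refine Eq.trans (integral_congr_ae (g := fun x => φ n x * fderiv ℝ ψ x e)
          ((h2 n).mono fun x hx => ?_))
          (setIntegral_eq_integral_of_forall_compl_eq_zero fun x hx => ?_)
        · simp only [coe_valL, hx]
          simp
        · have : φ n x = 0 := image_eq_zero_of_notMem_tsupport fun h => hx ((h1 n).2.2 h)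
          rw [this, zero_mul]
      have e2 : T₂ (gradL (v n)) = ∫ x, fderiv ℝ (φ n) x e * ψ x := by
        rw [hT₂]
        refine Eq.trans (integral_congr_ae (g := fun x => fderiv ℝ (φ n) x e * ψ x)
          ((h3 n).mono fun x hx => ?_))
          (setIntegral_eq_integral_of_forall_compl_eq_zero fun x hx => ?_)
        · simp only [coe_gradL, hx, real_inner_smul_left]
          rw [real_inner_comm, inner_gradient]
          ring
        · have : ψ x = 0 := image_eq_zero_of_notMem_tsupport fun h => hx (hψ.2.2 h)
          rw [this, mul_zero]
      rw [e1, e2]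
      exact integral_mul_fderiv_of_hasCompactSupport hφ1 hψ1 hψ.2.1 e
    have l1 : Tendsto (fun n => T₁ (valL (v n))) atTop (𝓝 (T₁ (valL w))) :=
      ((T₁.continuous.comp continuous_valL).tendsto w).comp h4
    have l2 : Tendsto (fun n => - T₂ (gradL (v n))) atTop (𝓝 (- T₂ (gradL w))) :=
      ((T₂.continuous.comp continuous_gradL).neg.tendsto w).comp h4
    simp_rw [hT] at l1
    exact tendsto_nhds_unique l1 l2
  rw [hT₁, hT₂] at key
  rw [coe_gradL] at key
  rw [← key]
  refine integral_congr_ae (Eventually.of_forall fun x => ?_)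
  simp only [coe_valL]
  simp

/-- The weak gradient is determined by the function. -/
lemma eq_of_val_ae_eq (hp : 2 ≤ p) (hΩo : IsOpen Ω) (hΩ : Bornology.IsBounded Ω) {w v : W0 Ω p}
    (h : val w =ᵐ[volume.restrict Ω] val v) : w = v := by
  have : IsFiniteMeasure (volume.restrict Ω) := ⟨by simpa using hΩ.measure_lt_top⟩
  rw [← sub_eq_zero]
  set u := w - v with hu
  -- The weak gradient of the zero function is orthogonal to all test functions, hence zero.
  have hval : valL u = 0 := by
    rw [Lp.eq_zero_iff_ae_eq_zero]
    filter_upwards [val_sub w v, h] with x h1 h2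
    rw [coe_valL, h1, h2, sub_self]
    rfl
  have hgrad : gradL u = 0 := by
    rw [Lp.eq_zero_iff_ae_eq_zero]
    have hint : Integrable (grad u) (volume.restrict Ω) :=
      (memLp_grad u).integrable (by simpa using ENNReal.ofReal_le_ofReal (by linarith : 1 ≤ p))
    have hae : ∀ᵐ x, x ∈ Ω → grad u x = 0 := by
      refine hΩo.ae_eq_zero_of_integral_contDiff_smul_eq_zero
        (IntegrableOn.locallyIntegrableOn hint) fun ψ h1 h2 h3 => ?_
      obtain ⟨M, hM⟩ := exists_norm_le_of_hasCompactSupport h1.continuous h2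
      have hi : IntegrableOn (fun x => ψ x • grad u x) Ω :=
        hint.bdd_smul M h1.continuous.aestronglyMeasurable (Eventually.of_forall hM)
      rw [← setIntegral_eq_integral_of_forall_compl_eq_zero (s := Ω) (by
        intro x hx
        have : ψ x = 0 := image_eq_zero_of_notMem_tsupport fun h => hx (h3 h)
        rw [this, zero_smul])]
      refine ext_inner_left ℝ fun e => ?_
      rw [inner_zero_right, ← integral_inner hi]
      have h4 := integral_val_mul_fderiv hp hΩ ⟨h1, h2, h3⟩ e u
      have h5 : ∫ x in Ω, val u x * fderiv ℝ ψ x e = 0 := by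
        have : (fun x => val u x * fderiv ℝ ψ x e) =ᵐ[volume.restrict Ω] fun _ => 0 := by
          have h6 := (Lp.eq_zero_iff_ae_eq_zero).1 hval
          filter_upwards [h6] with x hx
          rw [coe_valL] at hx
          simp [hx]
        rw [integral_congr_ae this, integral_zero]
      rw [h5, zero_eq_neg] at h4
      rw [← h4]
      refine integral_congr_ae (Eventually.of_forall fun x => ?_)
      simp only [real_inner_smul_left, inner_smul_right]
    rw [Filter.EventuallyEq, ae_restrict_iff' hΩo.measurableSet]
    exact hae
  exact Subtype.ext (Prod.ext hval hgrad)

end Sobolev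

/-! ### The Sobolev embedding -/

section SobolevEmbedding

variable {N : ℕ} {Ω : Set (Eucl N)} {p : ℝ}

/-- Above the dimension a subcritical exponent `s < N` with `s^* = r` is used instead of `p`. -/
lemma exists_sobolev_exponent (hN : 2 ≤ N) (hp : 2 ≤ p) {r : ℝ} (hr : 2 ≤ r)
    (hcrit : (r : EReal) < sobolevConj N p) :
    ∃ s : ℝ, 1 ≤ s ∧ s < N ∧ s ≤ p ∧ s⁻¹ - (N : ℝ)⁻¹ ≤ r⁻¹ := by
  have hN' : (2 : ℝ) ≤ N := by exact_mod_cast hN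
  by_cases hpN : p < N
  · refine ⟨p, by linarith, hpN, le_rfl, ?_⟩
    rw [sobolevConj, if_pos hpN, EReal.coe_lt_coe_iff] at hcrit
    have h1 : p⁻¹ - (N : ℝ)⁻¹ = (N * p / (N - p))⁻¹ := by
      have : (N : ℝ) - p ≠ 0 := by linarith
      field_simp
    rw [h1]
    exact inv_anti₀ (by linarith) hcrit.le
  · -- `s = N r / (N + r)` is the solution of `1 / s - 1 / N = 1 / r`
    push Not at hpN
    have h0 : (0 : ℝ) < N + r := by linarith
    have h1 : (N : ℝ) * r / (N + r) < N := by
      rw [div_lt_iff₀ h0]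
      nlinarith
    refine ⟨N * r / (N + r), ?_, h1, h1.le.trans hpN, ?_⟩
    · rw [le_div_iff₀ h0]
      nlinarith
    · have : (N : ℝ) ≠ 0 := by linarith
      have : r ≠ 0 := by linarith
      rw [inv_div]
      apply le_of_eq
      field_simp
      ring

/-- The Gagliardo–Nirenberg–Sobolev inequality, in terms of the gradient. -/
lemma exists_gns_constant {s r : ℝ} (hs : 1 ≤ s) (hsN : s < N) (hr : 0 ≤ r)
    (hsr : s⁻¹ - (N : ℝ)⁻¹ ≤ r⁻¹) (hΩ : Bornology.IsBounded Ω) :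
    ∃ C : NNReal, ∀ φ : Eucl N → ℝ, ContDiff ℝ 1 φ → tsupport φ ⊆ Ω →
      eLpNorm φ (ENNReal.ofReal r) volume ≤
        C * eLpNorm (gradient φ) (ENNReal.ofReal s) volume := by
  refine ⟨eLpNormLESNormFDerivOfLeConst ℝ (volume : Measure (Eucl N)) Ω s.toNNReal r.toNNReal,
    fun φ hφ hsupp => ?_⟩
  have h1 := eLpNorm_le_eLpNorm_fderiv_of_le (F := ℝ) (volume : Measure (Eucl N)) (s := Ω) hφ
    ((subset_tsupport φ).trans hsupp) (p := s.toNNReal) (q := r.toNNReal)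
    (by rwa [Real.one_le_toNNReal])
    (by
      rw [finrank_euclideanSpace_fin, Real.toNNReal_lt_iff_lt_coe (by linarith)]
      simpa using hsN)
    (by
      rw [finrank_euclideanSpace_fin, Real.coe_toNNReal _ hr]
      rw [NNReal.coe_inv, Real.coe_toNNReal _ (by linarith)]
      exact hsr) hΩ
  refine h1.trans (le_of_eq ?_)
  congr 1
  exact eLpNorm_congr_norm_ae (Eventually.of_forall fun x => (norm_gradient φ x).symm)

lemma support_gradient_subset {φ : Eucl N → ℝ} (h : tsupport φ ⊆ Ω) :
    Function.support (gradient φ) ⊆ Ω := by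
  intro x hx
  refine h (tsupport_fderiv_subset ℝ (subset_tsupport _ (Function.mem_support.2 fun h0 => ?_)))
  rw [Function.mem_support, ← norm_ne_zero_iff, norm_gradient, h0] at hx
  exact hx norm_zero

lemma sobolev_testFun (hN : 2 ≤ N) (hp : 2 ≤ p) {r : ℝ} (hr : 2 ≤ r)
    (hcrit : (r : EReal) < sobolevConj N p) (hΩ : Bornology.IsBounded Ω) :
    ∃ C : NNReal, ∀ φ : Eucl N → ℝ, ContDiff ℝ 1 φ → tsupport φ ⊆ Ω →
      eLpNorm φ (ENNReal.ofReal r) volume ≤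
        C * eLpNorm (gradient φ) (ENNReal.ofReal p) (volume.restrict Ω) := by
  obtain ⟨s, hs1, hsN, hsp, hsr⟩ := exists_sobolev_exponent hN hp hr hcrit
  have hfin : volume Ω ≠ ⊤ := hΩ.measure_lt_top.ne
  have hpow : volume Ω ^ (1 / s - 1 / p) ≠ ⊤ := by
    refine ENNReal.rpow_ne_top_of_nonneg ?_ hfin
    have := one_div_le_one_div_of_le (by linarith : 0 < s) hsp
    linarith
  obtain ⟨C, hC⟩ := exists_gns_constant hs1 hsN (by linarith) hsr hΩ
  refine ⟨C * (volume Ω ^ (1 / s - 1 / p)).toNNReal, fun φ hφ hsupp => ?_⟩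
  refine (hC φ hφ hsupp).trans ?_
  rw [ENNReal.coe_mul, ENNReal.coe_toNNReal hpow, mul_assoc]
  gcongr
  rw [← eLpNorm_restrict_eq_of_support_subset (support_gradient_subset hsupp)]
  have h2 := eLpNorm_le_eLpNorm_mul_rpow_measure_univ (μ := volume.restrict Ω)
    (p := ENNReal.ofReal s) (q := ENNReal.ofReal p) (ENNReal.ofReal_le_ofReal hsp)
    (continuous_gradient hφ).aestronglyMeasurable
  rw [ENNReal.toReal_ofReal (by linarith), ENNReal.toReal_ofReal (by linarith),
    Measure.restrict_apply_univ] at h2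
  rw [mul_comm]
  exact h2

variable [Fact (1 ≤ ENNReal.ofReal p)]

/-- A bound by the gradient norm passes from test functions to their closure. -/
lemma eLpNorm_val_le_of_testFun {r : ENNReal} {C : ENNReal} (hC : C ≠ ⊤)
    (h : ∀ φ : Eucl N → ℝ, IsTestFun Ω φ → eLpNorm φ r (volume.restrict Ω) ≤
        C * eLpNorm (gradient φ) (ENNReal.ofReal p) (volume.restrict Ω)) (w : W0 Ω p) :
    eLpNorm (val w) r (volume.restrict Ω) ≤
        C * eLpNorm (grad w) (ENNReal.ofReal p) (volume.restrict Ω) := by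
  obtain ⟨φ, v, h1, h2, h3, h4⟩ := exists_seq_testFun w
  have hv : Tendsto (fun n => valL (v n)) atTop (𝓝 (valL w)) :=
    (continuous_valL.tendsto w).comp h4
  have hg : Tendsto (fun n => gradL (v n)) atTop (𝓝 (gradL w)) :=
    (continuous_gradL.tendsto w).comp h4
  -- Along an almost everywhere convergent subsequence, the left side is lower semicontinuous
  -- (Fatou), although convergence in `L^r` is not yet known.
  obtain ⟨k, hk, hae⟩ := (tendstoInMeasure_of_tendsto_Lp hv).exists_seq_tendsto_ae
  have hlim : Tendsto (fun n => eLpNorm (gradL (v (k n))) (ENNReal.ofReal p) (volume.restrict Ω))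
      atTop (𝓝 (eLpNorm (gradL w) (ENNReal.ofReal p) (volume.restrict Ω))) := by
    have := (continuous_enorm.tendsto _).comp (hg.comp hk.tendsto_atTop)
    simp only [Function.comp_def, Lp.enorm_def] at this
    exact this
  refine (Lp.eLpNorm_lim_le_liminf_eLpNorm (fun n => (Lp.memLp (valL (v (k n)))).1) _ hae).trans ?_
  have hlim2 := ENNReal.Tendsto.const_mul (a := C) hlim (Or.inr hC)
  rw [coe_gradL] at hlim2
  rw [← hlim2.liminf_eq]
  refine liminf_le_liminf (Eventually.of_forall fun n => ?_)
  have e1 : eLpNorm (valL (v (k n))) r (volume.restrict Ω) =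
      eLpNorm (φ (k n)) r (volume.restrict Ω) := eLpNorm_congr_ae (h2 _)
  have e2 : eLpNorm (gradL (v (k n))) (ENNReal.ofReal p) (volume.restrict Ω) =
      eLpNorm (gradient (φ (k n))) (ENNReal.ofReal p) (volume.restrict Ω) :=
    eLpNorm_congr_ae (h3 _)
  rw [e1, e2]
  exact h _ (h1 _)

/-- The Sobolev inequality on `W_0^{1,p}(Ω)` for subcritical exponents. -/
lemma sobolev_inequality (hN : 2 ≤ N) (hp : 2 ≤ p) {r : ℝ} (hr : 2 ≤ r)
    (hcrit : (r : EReal) < sobolevConj N p) (hΩ : Bornology.IsBounded Ω) :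
    ∃ C : NNReal, ∀ w : W0 Ω p, eLpNorm (val w) (ENNReal.ofReal r) (volume.restrict Ω) ≤
        C * eLpNorm (grad w) (ENNReal.ofReal p) (volume.restrict Ω) := by
  obtain ⟨C, hC⟩ := sobolev_testFun hN hp hr hcrit hΩ
  refine ⟨C, eLpNorm_val_le_of_testFun ENNReal.coe_ne_top fun φ hφ => ?_⟩
  have h1 := hC φ (hφ.1.of_le (by simp)) hφ.2.2
  exact (eLpNorm_mono_measure _ Measure.restrict_le_self).trans h1

omit [Fact (1 ≤ ENNReal.ofReal p)] in
lemma lt_sobolevConj_self (hN : 2 ≤ N) (hp : 2 ≤ p) : (p : EReal) < sobolevConj N p := by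
  have hN' : (2 : ℝ) ≤ N := by exact_mod_cast hN
  rw [sobolevConj]
  split_ifs with h
  · rw [EReal.coe_lt_coe_iff, lt_div_iff₀ (by linarith)]
    nlinarith
  · exact EReal.coe_lt_top p

/-- The Poincaré inequality. -/
lemma exists_norm_valL_le (hN : 2 ≤ N) (hp : 2 ≤ p) (hΩ : Bornology.IsBounded Ω) :
    ∃ C : NNReal, ∀ w : W0 Ω p, ‖valL w‖ ≤ C * ‖gradL w‖ := by
  obtain ⟨C, hC⟩ := sobolev_inequality (Ω := Ω) hN hp hp (lt_sobolevConj_self hN hp) hΩ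
  refine ⟨C, fun w => ?_⟩
  rw [Lp.norm_def, Lp.norm_def, ← ENNReal.coe_toReal, ← ENNReal.toReal_mul]
  exact ENNReal.toReal_mono (ENNReal.mul_ne_top ENNReal.coe_ne_top (Lp.eLpNorm_ne_top _)) (hC w)

lemma exists_continuousLinearMap_toLp {X V : Type*} [MeasurableSpace X] {μ : Measure X}
    [NormedAddCommGroup V] [NormedSpace ℝ V] {r : ENNReal} [Fact (1 ≤ r)] (f : V → X → ℝ)
    (hadd : ∀ w v, f (w + v) =ᵐ[μ] fun x => f w x + f v x)
    (hsmul : ∀ (c : ℝ) w, f (c • w) =ᵐ[μ] fun x => c * f w x)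
    (hmem : ∀ w, MemLp (f w) r μ) {C : ℝ} (hC : ∀ w, ‖(hmem w).toLp (f w)‖ ≤ C * ‖w‖) :
    ∃ J : V →L[ℝ] Lp ℝ r μ, ∀ w, J w = (hmem w).toLp (f w) :=
  ⟨LinearMap.mkContinuous
    { toFun := fun w => (hmem w).toLp (f w)
      map_add' := fun w v => by
        rw [← MemLp.toLp_add, MemLp.toLp_eq_toLp_iff]
        exact hadd w v
      map_smul' := fun c w => by
        rw [RingHom.id_apply, ← MemLp.toLp_const_smul, MemLp.toLp_eq_toLp_iff]
        exact hsmul c w } C hC, fun _ => rfl⟩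

/-- The embedding `W_0^{1,p}(Ω) → L^r(Ω)`. -/
lemma exists_embedding {r : ℝ} [Fact (1 ≤ ENNReal.ofReal r)] {C : NNReal}
    (hC : ∀ w : W0 Ω p, eLpNorm (val w) (ENNReal.ofReal r) (volume.restrict Ω) ≤
        C * eLpNorm (grad w) (ENNReal.ofReal p) (volume.restrict Ω)) :
    ∃ J : W0 Ω p →L[ℝ] Lp ℝ (ENNReal.ofReal r) (volume.restrict Ω),
      (∀ w, J w =ᵐ[volume.restrict Ω] val w) ∧ ∀ w, ‖J w‖ ≤ C * ‖gradL w‖ := by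
  have hmem : ∀ w : W0 Ω p, MemLp (val w) (ENNReal.ofReal r) (volume.restrict Ω) := fun w =>
    ⟨(memLp_val w).1, (hC w).trans_lt (ENNReal.mul_lt_top ENNReal.coe_lt_top (memLp_grad w).2)⟩
  have hbound : ∀ w : W0 Ω p, ‖(hmem w).toLp (val w)‖ ≤ C * ‖gradL w‖ := by
    intro w
    rw [Lp.norm_toLp, Lp.norm_def, ← ENNReal.coe_toReal, ← ENNReal.toReal_mul]
    exact ENNReal.toReal_mono (ENNReal.mul_ne_top ENNReal.coe_ne_top (Lp.eLpNorm_ne_top _)) (hC w)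
  obtain ⟨J, hJ⟩ := exists_continuousLinearMap_toLp (val : W0 Ω p → Eucl N → ℝ) val_add val_smul
    hmem (C := C) fun w => (hbound w).trans (by
      gcongr
      rw [norm_eq_max]
      exact le_max_right _ _)
  refine ⟨J, fun w => ?_, fun w => ?_⟩
  · rw [hJ w]
    exact (hmem w).coeFn_toLp
  · rw [hJ w]
    exact hbound w

end SobolevEmbedding

/-! ### Compactness of the embedding -/

section Compactness

/-- A norm limit of operators of finite rank is compact. -/
lemma isCompactOperator_of_finite_rank_approx {V W : Type*} [NormedAddCommGroup V]
    [NormedSpace ℝ V] [NormedAddCommGroup W] [NormedSpace ℝ W] [CompleteSpace W] {K : V →L[ℝ] W}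
    (h : ∀ ε : ℝ, 0 < ε → ∃ (ι : Type) (s : Finset ι) (f : ι → V →L[ℝ] ℝ) (b : ι → W),
      ∀ v, ‖K v - ∑ i ∈ s, f i v • b i‖ ≤ ε * ‖v‖) : IsCompactOperator K := by
  have hmem : K ∈ closure {T : V →L[ℝ] W | IsCompactOperator T} := by
    refine Metric.mem_closure_iff.2 fun ε hε => ?_
    obtain ⟨ι, s, f, b, hb⟩ := h (ε / 2) (half_pos hε)
    refine ⟨∑ i ∈ s, (f i).smulRight (b i), ?_, ?_⟩
    · have : ∑ i ∈ s, (f i).smulRight (b i) ∈ compactOperator (RingHom.id ℝ) V W := by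
        refine Submodule.sum_mem _ fun i _ => ?_
        have h1 : IsCompactOperator (f i) :=
          (isCompactOperator_id (E := ℝ)).comp_clm (f i)
        exact h1.clm_comp (ContinuousLinearMap.toSpanSingleton ℝ (b i))
      exact this
    · rw [dist_eq_norm]
      refine lt_of_le_of_lt (ContinuousLinearMap.opNorm_le_bound _ (half_pos hε).le fun v => ?_)
        (half_lt_self hε)
      have := hb v
      simpa [sum_apply] using this
  have hcl : IsClosed {T : V →L[ℝ] W | IsCompactOperator T} :=
    isClosed_setOfPred_isCompactOperator
  exact hcl.closure_subset hmem

lemma exists_subseq_of_isCompactOperator {V W : Type*} [NormedAddCommGroup V]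
    [NormedSpace ℝ V] [NormedAddCommGroup W] [NormedSpace ℝ W] {K : V →L[ℝ] W}
    (hK : IsCompactOperator K) {v : ℕ → V} {M : ℝ} (hv : ∀ n, ‖v n‖ ≤ M) :
    ∃ (k : ℕ → ℕ) (f : W), StrictMono k ∧ Tendsto (fun n => K (v (k n))) atTop (𝓝 f) := by
  obtain ⟨S, hS, hS'⟩ := hK.image_closedBall_subset_compact (f := K.toLinearMap) M
  obtain ⟨f, -, k, hk, hlim⟩ := hS.tendsto_subseq (x := fun n => K (v n)) fun n =>
    hS' ⟨v n, by simpa using hv n, rfl⟩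
  exact ⟨k, f, hk, hlim⟩

variable {N : ℕ} {Ω : Set (Eucl N)} {p : ℝ}

/-- Translations are controlled in `L¹` by the gradient. -/
lemma lintegral_sub_translate_le {φ : Eucl N → ℝ} (hφ : ContDiff ℝ 1 φ) (z : Eucl N) :
    ∫⁻ x, ‖φ x - φ (x - z)‖ₑ ≤ ‖z‖ₑ * ∫⁻ x, ‖gradient φ x‖ₑ := by
  have hg := continuous_gradient hφ
  have hpt : ∀ x, ‖φ x - φ (x - z)‖ₑ ≤
      ∫⁻ s in Set.Ioc (0 : ℝ) 1, ‖z‖ₑ * ‖gradient φ (x - s • z)‖ₑ := by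
    intro x
    have hd : ∀ s : ℝ, HasDerivAt (fun s : ℝ => - φ (x - s • z))
        (inner ℝ (gradient φ (x - s • z)) z) s := by
      intro s
      have h1 : HasDerivAt (fun s : ℝ => x - s • z) (-z) s := by
        simpa using ((hasDerivAt_id s).smul_const z).const_sub x
      have h2 := ((hφ.differentiable (by simp) (x - s • z)).hasFDerivAt.comp_hasDerivAt s h1).neg
      rw [inner_gradient]
      convert! h2 using 1
      simp
    have hc : Continuous fun s : ℝ => (inner ℝ (gradient φ (x - s • z)) z : ℝ) := by fun_prop
    have h3 := intervalIntegral.integral_eq_sub_of_hasDerivAt (a := 0) (b := 1)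
      (fun s _ => hd s) (hc.intervalIntegrable _ _)
    have h4 : φ x - φ (x - z) = ∫ s in (0:ℝ)..1, inner ℝ (gradient φ (x - s • z)) z := by
      rw [h3]
      simp
      ring
    rw [h4, intervalIntegral.integral_of_le zero_le_one]
    refine (enorm_integral_le_lintegral_enorm _).trans (lintegral_mono fun s => ?_)
    rw [mul_comm, ← ofReal_norm, ← ofReal_norm, ← ofReal_norm, ← ENNReal.ofReal_mul (norm_nonneg _)]
    exact ENNReal.ofReal_le_ofReal (norm_inner_le_norm _ _)
  calc ∫⁻ x, ‖φ x - φ (x - z)‖ₑ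
      ≤ ∫⁻ x, ∫⁻ s in Set.Ioc (0 : ℝ) 1, ‖z‖ₑ * ‖gradient φ (x - s • z)‖ₑ := lintegral_mono hpt
    _ = ∫⁻ s in Set.Ioc (0 : ℝ) 1, ∫⁻ x, ‖z‖ₑ * ‖gradient φ (x - s • z)‖ₑ := by
        refine lintegral_lintegral_swap ?_
        have : Continuous fun y : Eucl N × ℝ => gradient φ (y.1 - y.2 • z) := by fun_prop
        exact (this.enorm.measurable.const_mul _).aemeasurable
    _ = ∫⁻ s in Set.Ioc (0 : ℝ) 1, ‖z‖ₑ * ∫⁻ x, ‖gradient φ x‖ₑ := by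
        refine lintegral_congr fun s => ?_
        have hm : Continuous fun x : Eucl N => gradient φ (x - s • z) := by fun_prop
        rw [lintegral_const_mul _ hm.enorm.measurable]
        congr 1
        exact lintegral_sub_right_eq_self (fun x => ‖gradient φ x‖ₑ) (s • z)
    _ = ‖z‖ₑ * ∫⁻ x, ‖gradient φ x‖ₑ := by simp

/-- The error of averaging a function against a kernel `η (s x - y)`, where `s` is close to the
identity. If `s` has finite range this compares `φ` with a function of finite rank. -/
lemma lintegral_sub_average_le {φ η : Eucl N → ℝ} (hφ : ContDiff ℝ 1 φ) (hφc : HasCompactSupport φ)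
    (hη : Continuous η) (hηc : HasCompactSupport η) (hη0 : ∀ z, 0 ≤ η z) (hη1 : ∫ z, η z = 1)
    {h τ : ℝ} (hsupp : ∀ z, η z ≠ 0 → ‖z‖ ≤ h) {s : Eucl N → Eucl N}
    (hτ : ∀ x ∈ Ω, ∀ y, |η (x - y) - η (s x - y)| ≤ τ) (hΩ : MeasurableSet Ω) :
    ∫⁻ x in Ω, ‖φ x - ∫ y, η (s x - y) * φ y‖ₑ ≤
      ENNReal.ofReal h * (∫⁻ x, ‖gradient φ x‖ₑ) +
        ENNReal.ofReal τ * volume Ω * ∫⁻ x, ‖φ x‖ₑ := by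
  have hηi : Integrable η volume := hη.integrable_of_hasCompactSupport hηc
  have hη1' : ∫⁻ z, ‖η z‖ₑ = 1 := by
    have := ofReal_integral_eq_lintegral_ofReal hηi (Eventually.of_forall hη0)
    rw [hη1, ENNReal.ofReal_one] at this
    rw [this]
    exact lintegral_congr fun z => Real.enorm_eq_ofReal (hη0 z)
  have hint : ∀ c : Eucl N, Integrable (fun y => η (c - y) * φ y) volume := fun c =>
    (((hη.comp (continuous_const.sub continuous_id)).mul
      hφ.continuous).integrable_of_hasCompactSupport hφc.mul_left)
  have hpt : ∀ x ∈ Ω, ‖φ x - ∫ y, η (s x - y) * φ y‖ₑ ≤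
      (∫⁻ z, ‖η z‖ₑ * ‖φ x - φ (x - z)‖ₑ) + ENNReal.ofReal τ * ∫⁻ y, ‖φ y‖ₑ := by
    intro x hx
    -- The error splits into the mollification error and the error of replacing the centre `x` by
    -- `s x`.
    have e1 : φ x - ∫ y, η (s x - y) * φ y =
        (∫ z, η z * (φ x - φ (x - z))) + ∫ y, (η (x - y) - η (s x - y)) * φ y := by
      have h1 : ∫ z, η z * (φ x - φ (x - z)) = φ x - ∫ y, η (x - y) * φ y := by
        have h2 : ∫ y, η (x - y) * φ y = ∫ z, η z * φ (x - z) := by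
          rw [← integral_sub_left_eq_self (fun z => η z * φ (x - z)) volume x]
          simp
        have h3 : Integrable (fun z => η z * φ (x - z)) volume :=
          (hη.mul (hφ.continuous.comp (continuous_const.sub
            continuous_id))).integrable_of_hasCompactSupport hηc.mul_right
        rw [h2]
        simp_rw [mul_sub]
        rw [integral_sub (hηi.mul_const _) h3,
          integral_mul_const, hη1, one_mul]
      have h2 : ∫ y, (η (x - y) - η (s x - y)) * φ y =
          (∫ y, η (x - y) * φ y) - ∫ y, η (s x - y) * φ y := by
        simp_rw [sub_mul]
        exact integral_sub (hint x) (hint (s x))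
      rw [h1, h2]
      ring
    rw [e1]
    refine (enorm_add_le _ _).trans (add_le_add ?_ ?_)
    · refine (enorm_integral_le_lintegral_enorm _).trans (le_of_eq ?_)
      exact lintegral_congr fun z => enorm_mul _ _
    · refine (enorm_integral_le_lintegral_enorm _).trans ?_
      rw [← lintegral_const_mul' _ _ ENNReal.ofReal_ne_top]
      refine lintegral_mono fun y => ?_
      rw [enorm_mul]
      gcongr
      rw [Real.enorm_eq_ofReal_abs]
      exact ENNReal.ofReal_le_ofReal (hτ x hx y)
  have hcont : Continuous fun y : Eucl N × Eucl N => φ y.1 - φ (y.1 - y.2) := by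
    have := hφ.continuous
    fun_prop
  calc ∫⁻ x in Ω, ‖φ x - ∫ y, η (s x - y) * φ y‖ₑ
      ≤ ∫⁻ x in Ω, ((∫⁻ z, ‖η z‖ₑ * ‖φ x - φ (x - z)‖ₑ) + ENNReal.ofReal τ * ∫⁻ y, ‖φ y‖ₑ) :=
        setLIntegral_mono' hΩ hpt
    _ = (∫⁻ x in Ω, ∫⁻ z, ‖η z‖ₑ * ‖φ x - φ (x - z)‖ₑ) +
          ENNReal.ofReal τ * volume Ω * ∫⁻ y, ‖φ y‖ₑ := by
        rw [lintegral_add_right _ measurable_const, setLIntegral_const]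
        ring
    _ ≤ _ := by
        gcongr
        calc ∫⁻ x in Ω, ∫⁻ z, ‖η z‖ₑ * ‖φ x - φ (x - z)‖ₑ
            ≤ ∫⁻ x, ∫⁻ z, ‖η z‖ₑ * ‖φ x - φ (x - z)‖ₑ := setLIntegral_le_lintegral _ _
          _ = ∫⁻ z, ∫⁻ x, ‖η z‖ₑ * ‖φ x - φ (x - z)‖ₑ := by
              refine lintegral_lintegral_swap ?_
              exact (((hη.comp continuous_snd).enorm.measurable).mul
                hcont.enorm.measurable).aemeasurable
          _ ≤ ∫⁻ z, ‖η z‖ₑ * (ENNReal.ofReal h * ∫⁻ x, ‖gradient φ x‖ₑ) := by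
              refine lintegral_mono fun z => ?_
              have hm : Measurable fun x => ‖φ x - φ (x - z)‖ₑ := by
                have := hφ.continuous
                have h5 : Continuous fun x => φ x - φ (x - z) := by fun_prop
                exact h5.enorm.measurable
              rw [lintegral_const_mul _ hm]
              by_cases hz : η z = 0
              · simp [hz]
              · gcongr
                refine (lintegral_sub_translate_le hφ z).trans ?_
                gcongr
                rw [← ofReal_norm]
                exact ENNReal.ofReal_le_ofReal (hsupp z hz)
          _ = ENNReal.ofReal h * ∫⁻ x, ‖gradient φ x‖ₑ := by
              rw [lintegral_mul_const _ hη.enorm.measurable, hη1', one_mul]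

/-- A bounded set is uniformly approximated by a simple function with values near the identity. -/
lemma exists_simpleFunc_near_id (hΩ : Bornology.IsBounded Ω) {ρ : ℝ} (hρ : 0 < ρ) :
    ∃ s : SimpleFunc (Eucl N) (Eucl N), ∀ x ∈ Ω, dist (s x) x < ρ := by
  have hc : IsCompact (closure Ω) := hΩ.isCompact_closure
  obtain ⟨t, ht⟩ := hc.elim_finite_subcover
    (fun k : ℕ => Metric.ball (TopologicalSpace.denseSeq (Eucl N) k) ρ)
    (fun _ => Metric.isOpen_ball) fun x _ => by
      obtain ⟨k, hk⟩ := (TopologicalSpace.denseRange_denseSeq (Eucl N)).exists_dist_lt x hρ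
      exact Set.mem_iUnion.2 ⟨k, hk⟩
  refine ⟨SimpleFunc.nearestPt (TopologicalSpace.denseSeq (Eucl N)) (t.sup id), fun x hx => ?_⟩
  obtain ⟨k, hk, hxk⟩ := Set.mem_iUnion₂.1 (ht (subset_closure hx))
  have h1 := SimpleFunc.edist_nearestPt_le (TopologicalSpace.denseSeq (Eucl N)) x
    (Finset.le_sup (f := id) hk)
  rw [edist_dist, edist_dist, ENNReal.ofReal_le_ofReal_iff dist_nonneg] at h1
  refine h1.trans_lt ?_
  rw [dist_comm]
  exact hxk

end Compactness

/-! ### The Rellich–Kondrachov theorem -/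

section Rellich

lemma lpPow_eq_norm_rpow {X : Type*} [MeasurableSpace X] {μ : Measure X} {F : Type*}
    [NormedAddCommGroup F] [InnerProductSpace ℝ F] {p : ℝ} (hp : 2 ≤ p)
    (g : Lp F (ENNReal.ofReal p) μ) : lpPow g = ‖g‖ ^ p := by
  rw [lpPow, Lp.norm_def, (Lp.memLp g).eLpNorm_eq_integral_rpow_norm (by simp; linarith)
    ENNReal.ofReal_ne_top, ENNReal.toReal_ofReal (by linarith : 0 ≤ p)]
  have h0 : 0 ≤ ∫ x, ‖g x‖ ^ p ∂μ := integral_nonneg fun x => by positivity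
  rw [ENNReal.toReal_ofReal (by positivity), ← Real.rpow_mul h0, inv_mul_cancel₀ (by linarith),
    Real.rpow_one]

variable {N : ℕ} {Ω : Set (Eucl N)} {p : ℝ} [Fact (1 ≤ ENNReal.ofReal p)]

/-- On a set of finite measure, `L^p` embeds into `L¹`. -/
lemma exists_eLpNorm_one_le (hp : 2 ≤ p) (hΩ : Bornology.IsBounded Ω) :
    ∃ C : ℝ, 0 < C ∧ ∀ {F : Type} [NormedAddCommGroup F]
      (f : Lp F (ENNReal.ofReal p) (volume.restrict Ω)),
        eLpNorm f 1 (volume.restrict Ω) ≤ ENNReal.ofReal (C * ‖f‖) := by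
  have hfin : volume Ω ≠ ⊤ := hΩ.measure_lt_top.ne
  have hpow : volume Ω ^ (1 - 1 / p) ≠ ⊤ := by
    refine ENNReal.rpow_ne_top_of_nonneg ?_ hfin
    have : 1 / p ≤ 1 := (div_le_one (by linarith)).2 (by linarith)
    linarith
  refine ⟨(volume Ω ^ (1 - 1 / p)).toReal + 1, by positivity, fun {F} _ f => ?_⟩
  have h2 := eLpNorm_le_eLpNorm_mul_rpow_measure_univ (μ := volume.restrict Ω)
    (p := 1) (q := ENNReal.ofReal p) (ENNReal.one_le_ofReal.2 (by linarith)) (Lp.memLp f).1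
  rw [ENNReal.toReal_ofReal (by linarith), Measure.restrict_apply_univ] at h2
  refine h2.trans ?_
  rw [ENNReal.toReal_one, div_one, ENNReal.ofReal_mul (by positivity), mul_comm, ofReal_norm,
    Lp.enorm_def]
  gcongr
  rw [← ENNReal.ofReal_toReal hpow]
  exact ENNReal.ofReal_le_ofReal (by simp)

/-- A kernel and a simple function that average all `C¹` functions up to a small error. -/
lemma exists_average_kernel (hΩo : IsOpen Ω) (hΩ : Bornology.IsBounded Ω) {ε : ℝ} (hε : 0 < ε) :
    ∃ (s : SimpleFunc (Eucl N) (Eucl N)) (η : Eucl N → ℝ), Continuous η ∧ HasCompactSupport η ∧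
      ∀ φ : Eucl N → ℝ, ContDiff ℝ 1 φ → HasCompactSupport φ →
        ∫⁻ x in Ω, ‖φ x - ∫ y, η (s x - y) * φ y‖ₑ ≤
          ENNReal.ofReal ε * ((∫⁻ x, ‖gradient φ x‖ₑ) + ∫⁻ x, ‖φ x‖ₑ) := by
  set m := (volume Ω).toReal with hm
  have hm0 : 0 ≤ m := ENNReal.toReal_nonneg
  -- The tolerance `ε / (m + 1)` for the kernel absorbs the factor `volume Ω` in the error.
  have hτ0 : 0 < ε / (m + 1) := by positivity
  let b : ContDiffBump (0 : Eucl N) := ⟨ε / 2, ε, half_pos hε, half_lt_self hε⟩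
  have hηc : Continuous (b.normed volume) := b.continuous_normed
  have hηs : HasCompactSupport (b.normed volume) := b.hasCompactSupport_normed
  have hsupp : ∀ z, b.normed volume z ≠ 0 → ‖z‖ ≤ ε := by
    intro z hz
    have : z ∈ Function.support (b.normed (volume : Measure (Eucl N))) := hz
    rw [b.support_normed_eq] at this
    exact (mem_ball_zero_iff.1 this).le
  obtain ⟨ρ, hρ, huc⟩ := Metric.uniformContinuous_iff.1
    (hηs.uniformContinuous_of_continuous hηc) _ hτ0
  obtain ⟨s, hs⟩ := exists_simpleFunc_near_id hΩ hρ
  refine ⟨s, b.normed volume, hηc, hηs, fun φ hφ hφc => ?_⟩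
  refine (lintegral_sub_average_le hφ hφc hηc hηs b.nonneg_normed
    b.integral_normed hsupp (τ := ε / (m + 1)) (fun x hx y => ?_) hΩo.measurableSet).trans ?_
  · have h1 := huc (a := x - y) (b := s x - y) (by
      rw [dist_sub_right, dist_comm]
      exact hs x hx)
    rw [Real.dist_eq] at h1
    exact h1.le
  · have e3 : volume Ω = ENNReal.ofReal m := (ENNReal.ofReal_toReal hΩ.measure_lt_top.ne).symm
    rw [mul_add]
    gcongr
    rw [e3, ← ENNReal.ofReal_mul hτ0.le]
    refine ENNReal.ofReal_le_ofReal ?_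
    rw [div_mul_eq_mul_div, div_le_iff₀ (by positivity)]
    nlinarith

/-- On test functions, the embedding into `L¹` is uniformly close to an operator of finite rank. -/
lemma exists_finite_rank_approx (hp : 2 ≤ p) (hΩo : IsOpen Ω) (hΩ : Bornology.IsBounded Ω)
    {ε : ℝ} (hε : 0 < ε) :
    ∃ (s : SimpleFunc (Eucl N) (Eucl N)) (f : Eucl N → W0 Ω p →L[ℝ] ℝ),
      ∀ (w : W0 Ω p) (φ : Eucl N → ℝ), IsTestFun Ω φ → val w =ᵐ[volume.restrict Ω] φ →
        grad w =ᵐ[volume.restrict Ω] gradient φ →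
        ∫⁻ x in Ω, ‖φ x - f (s x) w‖ₑ ≤ ENNReal.ofReal (ε * ‖w‖) := by
  have : IsFiniteMeasure (volume.restrict Ω) := ⟨by simpa using hΩ.measure_lt_top⟩
  obtain ⟨C, hC0, hC⟩ := exists_eLpNorm_one_le (N := N) (Ω := Ω) hp hΩ
  have hδ : 0 < ε / (2 * C) := by positivity
  obtain ⟨s, η, hηc, hηs, hη⟩ := exists_average_kernel (N := N) hΩo hΩ hδ
  obtain ⟨M, hM⟩ := exists_norm_le_of_hasCompactSupport hηc hηs
  have hpair : ∀ c : Eucl N, ∃ T : W0 Ω p →L[ℝ] ℝ,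
      ∀ w, T w = ∫ y in Ω, inner ℝ (η (c - y)) (val w y) := by
    intro c
    obtain ⟨T, hT⟩ := exists_pairing (p := p) (μ := volume.restrict Ω) hp
      (a := fun y => η (c - y))
      (hηc.comp (continuous_const.sub continuous_id)).aestronglyMeasurable (fun y => hM _)
    exact ⟨T.comp valCLM, fun w => hT (valL w)⟩
  choose f hf using hpair
  refine ⟨s, f, fun w φ hφ hv hg => ?_⟩
  have hfw : ∀ c, f c w = ∫ y, η (c - y) * φ y := by
    intro c
    rw [hf]
    refine Eq.trans (integral_congr_ae (g := fun y => η (c - y) * φ y)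
      (hv.mono fun y hy => ?_))
      (setIntegral_eq_integral_of_forall_compl_eq_zero fun x hx => ?_)
    · simp only [hy]
      simp [mul_comm]
    · have : φ x = 0 := image_eq_zero_of_notMem_tsupport fun h => hx (hφ.2.2 h)
      rw [this, mul_zero]
  simp_rw [hfw]
  have e1 : ∫⁻ x, ‖gradient φ x‖ₑ ≤ ENNReal.ofReal (C * ‖gradL w‖) := by
    have h1 : ∫⁻ x, ‖gradient φ x‖ₑ = eLpNorm (gradL w) 1 (volume.restrict Ω) := by
      rw [← eLpNorm_one_eq_lintegral_enorm,
        ← eLpNorm_restrict_eq_of_support_subset (support_gradient_subset hφ.2.2)]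
      exact eLpNorm_congr_ae hg.symm
    rw [h1]
    exact hC (gradL w)
  have e2 : ∫⁻ x, ‖φ x‖ₑ ≤ ENNReal.ofReal (C * ‖valL w‖) := by
    have h1 : ∫⁻ x, ‖φ x‖ₑ = eLpNorm (valL w) 1 (volume.restrict Ω) := by
      rw [← eLpNorm_one_eq_lintegral_enorm,
        ← eLpNorm_restrict_eq_of_support_subset ((subset_tsupport φ).trans hφ.2.2)]
      exact eLpNorm_congr_ae hv.symm
    rw [h1]
    exact hC (valL w)
  refine (hη φ (hφ.1.of_le (by simp)) hφ.2.1).trans ?_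
  have h1 : ‖gradL w‖ ≤ ‖w‖ := by rw [norm_eq_max]; exact le_max_right _ _
  have h2 : ‖valL w‖ ≤ ‖w‖ := by rw [norm_eq_max]; exact le_max_left _ _
  calc _ ≤ ENNReal.ofReal (ε / (2 * C)) *
        (ENNReal.ofReal (C * ‖gradL w‖) + ENNReal.ofReal (C * ‖valL w‖)) := by gcongr
    _ = ENNReal.ofReal (ε / (2 * C) * (C * ‖gradL w‖ + C * ‖valL w‖)) := by
        rw [ENNReal.ofReal_mul hδ.le, ENNReal.ofReal_add (by positivity) (by positivity)]
    _ ≤ _ := by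
        refine ENNReal.ofReal_le_ofReal ?_
        have h3 : ε / (2 * C) * (C * ‖gradL w‖ + C * ‖valL w‖) =
            ε / 2 * (‖gradL w‖ + ‖valL w‖) := by field_simp
        rw [h3]
        calc ε / 2 * (‖gradL w‖ + ‖valL w‖) ≤ ε / 2 * (‖w‖ + ‖w‖) := by gcongr
          _ = ε * ‖w‖ := by ring

/-- `∑_c g(c) 1_{s = c}` represents `g ∘ s`. -/
lemma sum_smul_indicatorConstLp {X Y : Type*} [MeasurableSpace X] {μ : Measure X}
    [IsFiniteMeasure μ] (s : SimpleFunc X Y) (g : Y → ℝ) :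
    (∑ c ∈ s.range, g c • indicatorConstLp 1 (s.measurableSet_fiber c)
      (measure_ne_top μ _) (1 : ℝ) : Lp ℝ 1 μ) =ᵐ[μ] fun x => g (s x) := by
  have h1 : ∀ᵐ x ∂μ, ∀ c ∈ s.range,
      (g c • indicatorConstLp 1 (s.measurableSet_fiber c) (measure_ne_top μ _) (1 : ℝ) :
        Lp ℝ 1 μ) x = g c * (s ⁻¹' {c}).indicator (fun _ => (1 : ℝ)) x := by
    refine (ae_ball_iff s.range.countable_toSet).2 fun c _ => ?_
    filter_upwards [Lp.coeFn_smul (g c) (indicatorConstLp 1 (s.measurableSet_fiber c)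
      (measure_ne_top μ _) (1 : ℝ)), indicatorConstLp_coeFn (p := 1)
      (hs := s.measurableSet_fiber c) (hμs := measure_ne_top μ _)
      (c := (1 : ℝ))] with x h1 h2
    rw [h1, Pi.smul_apply, h2, smul_eq_mul]
  filter_upwards [h1, Lp.coeFn_finsetSum s.range fun c => g c •
    (indicatorConstLp 1 (s.measurableSet_fiber c) (measure_ne_top μ _) (1 : ℝ) : Lp ℝ 1 μ)]
    with x h1 h2
  rw [h2, Finset.sum_apply, Finset.sum_congr rfl h1, Finset.sum_eq_single (s x)]
  · simp
  · intro c _ hc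
    simp [Set.indicator, hc.symm]
  · intro h
    exact absurd (s.mem_range_self x) h

lemma norm_sub_finset_sum_le {X Y : Type*} [MeasurableSpace X] {μ : Measure X}
    [IsFiniteMeasure μ] (s : SimpleFunc X Y) (g : Y → ℝ) (k : Lp ℝ 1 μ) {φ : X → ℝ}
    (hk : k =ᵐ[μ] φ) {ε : ℝ} (hε : 0 ≤ ε) (h : ∫⁻ x, ‖φ x - g (s x)‖ₑ ∂μ ≤ ENNReal.ofReal ε) :
    ‖k - ∑ c ∈ s.range, g c • (indicatorConstLp 1 (s.measurableSet_fiber c)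
      (measure_ne_top μ _) (1 : ℝ) : Lp ℝ 1 μ)‖ ≤ ε := by
  rw [Lp.norm_def, eLpNorm_one_eq_lintegral_enorm]
  refine ENNReal.toReal_le_of_le_ofReal hε ?_
  refine le_trans (le_of_eq ?_) h
  refine lintegral_congr_ae ?_
  filter_upwards [Lp.coeFn_sub k (∑ c ∈ s.range, g c •
    (indicatorConstLp 1 (s.measurableSet_fiber c) (measure_ne_top μ _) (1 : ℝ) : Lp ℝ 1 μ)), hk,
    sum_smul_indicatorConstLp s g] with x e1 e2 e4
  rw [e1, Pi.sub_apply, e2, e4]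

/-- If a continuous linear map agrees on a dense sequence of approximations up to `ε` with a
finite-rank one, it does so everywhere. -/
lemma norm_sub_sum_le_of_seq {V G Y : Type*} [NormedAddCommGroup V] [NormedSpace ℝ V]
    [NormedAddCommGroup G] [NormedSpace ℝ G] (K : V →L[ℝ] G) (S : Finset Y) (f : Y → V →L[ℝ] ℝ)
    (b : Y → G) {ε : ℝ} {v : ℕ → V} {w : V} (h4 : Tendsto v atTop (𝓝 w))
    (hb : ∀ n, ‖K (v n) - ∑ c ∈ S, f c (v n) • b c‖ ≤ ε * ‖v n‖) :
    ‖K w - ∑ c ∈ S, f c w • b c‖ ≤ ε * ‖w‖ := by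
  have hc : Continuous fun w => ‖K w - ∑ c ∈ S, f c w • b c‖ :=
    (K.continuous.sub (continuous_finsetSum _ fun c _ =>
      (f c).continuous.smul continuous_const)).norm
  exact le_of_tendsto_of_tendsto' ((hc.tendsto w).comp h4)
    (((continuous_const.mul continuous_norm).tendsto w).comp h4) hb

/-- An operator into `L¹` that is close, on a dense set, to averaging over the fibres of a simple
function is compact. -/
lemma isCompactOperator_of_simpleFunc_approx {V X Y : Type} [NormedAddCommGroup V]
    [NormedSpace ℝ V] [MeasurableSpace X] {μ : Measure X} [IsFiniteMeasure μ] (K : V →L[ℝ] Lp ℝ 1 μ)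
    (h : ∀ ε : ℝ, 0 < ε → ∃ (s : SimpleFunc X Y) (f : Y → V →L[ℝ] ℝ), ∀ w, ∃ v : ℕ → V,
      Tendsto v atTop (𝓝 w) ∧ ∀ n, ∃ φ : X → ℝ, K (v n) =ᵐ[μ] φ ∧
        ∫⁻ x, ‖φ x - f (s x) (v n)‖ₑ ∂μ ≤ ENNReal.ofReal (ε * ‖v n‖)) : IsCompactOperator K := by
  refine isCompactOperator_of_finite_rank_approx fun ε hε => ?_
  obtain ⟨s, f, hf⟩ := h ε hε
  refine ⟨Y, s.range, f, fun c => indicatorConstLp 1 (s.measurableSet_fiber c)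
    (measure_ne_top _ _) (1 : ℝ), fun w => ?_⟩
  obtain ⟨v, hv, hφ⟩ := hf w
  refine norm_sub_sum_le_of_seq K s.range f _ hv fun n => ?_
  obtain ⟨φ, h1, h2⟩ := hφ n
  exact norm_sub_finset_sum_le s (fun c => f c (v n)) (K (v n)) h1 (by positivity) h2

/-- Interpolation between `1` and `r`: a small multiple of `|s|^r` plus a multiple of `|s|`. -/
lemma rpow_le_interpolate {q r A s : ℝ} (hq : 1 ≤ q) (hr : q ≤ r) (hA : 0 < A) (hs : 0 ≤ s) :
    s ^ q ≤ A ^ (q - r) * s ^ r + A ^ (q - 1) * s := by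
  rcases hs.eq_or_lt with rfl | hs
  · rw [Real.zero_rpow (by linarith), Real.zero_rpow (by linarith)]
    simp
  rcases le_total A s with h | h
  · have h1 : s ^ (q - r) ≤ A ^ (q - r) := Real.rpow_le_rpow_of_nonpos hA h (by linarith)
    have h2 : s ^ q = s ^ (q - r) * s ^ r := by rw [← Real.rpow_add hs]; ring_nf
    rw [h2]
    nlinarith [Real.rpow_pos_of_pos hs r, Real.rpow_pos_of_pos hA (q - 1)]
  · have h1 : s ^ (q - 1) ≤ A ^ (q - 1) := Real.rpow_le_rpow hs.le h (by linarith)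
    have h2 : s ^ q = s ^ (q - 1) * s := by rw [← Real.rpow_add_one hs.ne']; ring_nf
    rw [h2]
    nlinarith [Real.rpow_pos_of_pos hs r, Real.rpow_pos_of_pos hA (q - r)]

lemma lpPow_le_interpolate {X : Type*} [MeasurableSpace X] {μ : Measure X} [IsFiniteMeasure μ]
    {q r A : ℝ} (hq : 2 ≤ q) (hr : q ≤ r) (hA : 0 < A) (f : Lp ℝ (ENNReal.ofReal q) μ)
    (g : Lp ℝ (ENNReal.ofReal r) μ) (k : Lp ℝ 1 μ) (hg : g =ᵐ[μ] f) (hk : k =ᵐ[μ] f) :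
    lpPow f ≤ A ^ (q - r) * lpPow g + A ^ (q - 1) * ‖k‖ := by
  have i1 : Integrable (fun x => ‖f x‖ ^ q) μ := integrable_norm_rpow hq f
  have i2 : Integrable (fun x => ‖g x‖ ^ r) μ := integrable_norm_rpow (hq.trans hr) g
  have i3 : Integrable (fun x => ‖k x‖) μ := (L1.integrable_coeFn k).norm
  have h3 : ‖k‖ = ∫ x, ‖k x‖ ∂μ := L1.norm_eq_integral_norm k
  rw [h3, lpPow, lpPow, ← integral_const_mul, ← integral_const_mul,
    ← integral_add (i2.const_mul _) (i3.const_mul _)]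
  refine integral_mono_ae i1 ((i2.const_mul _).add (i3.const_mul _)) ?_
  filter_upwards [hg, hk] with x h1 h2
  rw [h1, h2]
  exact rpow_le_interpolate (by linarith) hr hA (norm_nonneg _)

/-- Compactness in `L^q` from finite-rank approximation in `L¹` and boundedness in `L^r`,
`q < r`. -/
lemma exists_subseq_cauchySeq_of_approx {V X Y : Type} [NormedAddCommGroup V]
    [NormedSpace ℝ V] [MeasurableSpace X] {μ : Measure X} [IsFiniteMeasure μ] {q r C : ℝ}
    [Fact (1 ≤ ENNReal.ofReal q)] [Fact (1 ≤ ENNReal.ofReal r)] (hq : 2 ≤ q) (hqr : q < r)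
    (hC0 : 0 ≤ C) {f : V → X → ℝ}
    (hadd : ∀ w v, f (w + v) =ᵐ[μ] fun x => f w x + f v x)
    (hsmul : ∀ (c : ℝ) w, f (c • w) =ᵐ[μ] fun x => c * f w x)
    (hmeas : ∀ w, AEStronglyMeasurable (f w) μ)
    (hC : ∀ w, eLpNorm (f w) 1 μ ≤ ENNReal.ofReal (C * ‖w‖))
    (happrox : ∀ ε : ℝ, 0 < ε → ∃ (s : SimpleFunc X Y) (g : Y → V →L[ℝ] ℝ), ∀ w, ∃ v : ℕ → V,
      Tendsto v atTop (𝓝 w) ∧ ∀ n, ∃ φ : X → ℝ, f (v n) =ᵐ[μ] φ ∧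
        ∫⁻ x, ‖φ x - g (s x) (v n)‖ₑ ∂μ ≤ ENNReal.ofReal (ε * ‖v n‖))
    {I : V → Lp ℝ (ENNReal.ofReal r) μ} (hI : ∀ w, I w =ᵐ[μ] f w) (hIC : ∀ w, ‖I w‖ ≤ C * ‖w‖)
    {J : V → Lp ℝ (ENNReal.ofReal q) μ} (hJ : ∀ w, J w =ᵐ[μ] f w)
    {v : ℕ → V} {M : ℝ} (hv : ∀ n, ‖v n‖ ≤ M) :
    ∃ k : ℕ → ℕ, StrictMono k ∧ CauchySeq fun n => J (v (k n)) := by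
  have hmem : ∀ w : V, MemLp (f w) 1 μ := fun w =>
    ⟨hmeas w, (hC w).trans_lt ENNReal.ofReal_lt_top⟩
  obtain ⟨K, hK⟩ := exists_continuousLinearMap_toLp f hadd hsmul hmem (C := C) fun w => by
    rw [Lp.norm_toLp]
    exact ENNReal.toReal_le_of_le_ofReal (by positivity) (hC w)
  have hK' : ∀ w, K w =ᵐ[μ] f w := fun w => by rw [hK]; exact (hmem w).coeFn_toLp
  have hKc : IsCompactOperator K := isCompactOperator_of_simpleFunc_approx (Y := Y) K
    fun ε hε => by
      obtain ⟨s, g, h⟩ := happrox ε hε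
      refine ⟨s, g, fun w => ?_⟩
      obtain ⟨v, h1, h2⟩ := h w
      refine ⟨v, h1, fun n => ?_⟩
      obtain ⟨φ, h3, h4⟩ := h2 n
      exact ⟨φ, (hK' _).trans h3, h4⟩
  obtain ⟨k, g, hk, hlim⟩ := exists_subseq_of_isCompactOperator hKc hv
  refine ⟨k, hk, Metric.cauchySeq_iff.2 fun ε hε => ?_⟩
  have hM : 0 ≤ M := (norm_nonneg _).trans (hv 0)
  have hsub : ∀ w z, f (w - z) =ᵐ[μ] fun x => f w x - f z x := fun w z => by
    have h1 := hadd w ((-1 : ℝ) • z)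
    rw [neg_one_smul, ← sub_eq_add_neg] at h1
    filter_upwards [h1, hsmul (-1) z] with x h2 h3
    rw [neg_one_smul] at h3
    rw [h2, h3]
    ring
  -- the factor `A` makes the `L^r` contribution less than half of `ε ^ q`
  obtain ⟨A, hA, hA'⟩ : ∃ A : ℝ, 0 < A ∧ A ^ (q - r) * (C * (M + M)) ^ r ≤ ε ^ q / 2 := by
    have h1 : Tendsto (fun A : ℝ => A ^ (-(r - q)) * (C * (M + M)) ^ r) atTop
        (𝓝 (0 * (C * (M + M)) ^ r)) :=
      (tendsto_rpow_neg_atTop (by linarith)).mul_const _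
    rw [zero_mul] at h1
    have h2 := (h1.eventually (ge_mem_nhds (show (0 : ℝ) < ε ^ q / 2 by positivity))).and
      (eventually_gt_atTop 0)
    obtain ⟨A, h3, h4⟩ := h2.exists
    exact ⟨A, h4, by rwa [neg_sub] at h3⟩
  have hAq : 0 < A ^ (q - 1) := Real.rpow_pos_of_pos hA _
  obtain ⟨n₀, hn₀⟩ := Metric.cauchySeq_iff.1 hlim.cauchySeq (ε ^ q / 2 / A ^ (q - 1))
    (by positivity)
  refine ⟨n₀, fun m hm n hn => ?_⟩
  have h1 := hn₀ m hm n hn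
  rw [dist_eq_norm, ← map_sub] at h1
  rw [dist_eq_norm]
  have e1 : I (v (k m) - v (k n)) =ᵐ[μ] (J (v (k m)) - J (v (k n)) : Lp ℝ _ μ) := by
    filter_upwards [hI (v (k m) - v (k n)), hsub (v (k m)) (v (k n)), hJ (v (k m)), hJ (v (k n)),
      Lp.coeFn_sub (J (v (k m))) (J (v (k n)))] with x a1 a2 a3 a4 a5
    rw [a1, a2, a5, Pi.sub_apply, a3, a4]
  have e2 : K (v (k m) - v (k n)) =ᵐ[μ] (J (v (k m)) - J (v (k n)) : Lp ℝ _ μ) :=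
    (hK' _).trans ((hI _).symm.trans e1)
  have h2 := lpPow_le_interpolate hq hqr.le hA (J (v (k m)) - J (v (k n))) _ _ e1 e2
  rw [lpPow_eq_norm_rpow hq, lpPow_eq_norm_rpow (hq.trans hqr.le)] at h2
  have h3 : ‖I (v (k m) - v (k n))‖ ≤ C * (M + M) := by
    refine (hIC _).trans (mul_le_mul_of_nonneg_left ?_ hC0)
    exact (norm_sub_le _ _).trans (add_le_add (hv _) (hv _))
  have h4 : ‖I (v (k m) - v (k n))‖ ^ r ≤ (C * (M + M)) ^ r :=
    Real.rpow_le_rpow (norm_nonneg _) h3 (by linarith)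
  have h5 : A ^ (q - r) * ‖I (v (k m) - v (k n))‖ ^ r ≤ ε ^ q / 2 :=
    (mul_le_mul_of_nonneg_left h4 (by positivity)).trans hA'
  rw [lt_div_iff₀ hAq] at h1
  have h6 : ‖J (v (k m)) - J (v (k n))‖ ^ q < ε ^ q := by linarith
  exact (Real.rpow_lt_rpow_iff (norm_nonneg _) hε.le (by linarith)).1 h6

set_option maxHeartbeats 400000 in
/-- The Rellich–Kondrachov theorem: a bounded sequence of `W_0^{1,p}(Ω)` has a subsequence that
is Cauchy in `L^q(Ω)`, for a subcritical exponent `q`. -/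
lemma exists_subseq_cauchySeq (hN : 2 ≤ N) (hp : 2 ≤ p) {q : ℝ} [Fact (1 ≤ ENNReal.ofReal q)]
    (hq : 2 ≤ q) (hcrit : (q : EReal) < sobolevConj N p) (hΩo : IsOpen Ω)
    (hΩ : Bornology.IsBounded Ω) {J : W0 Ω p → Lp ℝ (ENNReal.ofReal q) (volume.restrict Ω)}
    (hJ : ∀ w, J w =ᵐ[volume.restrict Ω] val w) {v : ℕ → W0 Ω p} {M : ℝ} (hv : ∀ n, ‖v n‖ ≤ M) :
    ∃ k : ℕ → ℕ, StrictMono k ∧ CauchySeq fun n => J (v (k n)) := by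
  have : IsFiniteMeasure (volume.restrict Ω) := ⟨by simpa using hΩ.measure_lt_top⟩
  obtain ⟨r, hqr, hr⟩ := EReal.lt_iff_exists_real_btwn.1 hcrit
  rw [EReal.coe_lt_coe_iff] at hqr
  have : Fact (1 ≤ ENNReal.ofReal r) := ⟨ENNReal.one_le_ofReal.2 (by linarith)⟩
  obtain ⟨C, hC⟩ := sobolev_inequality (Ω := Ω) hN hp (hq.trans hqr.le) hr hΩ
  obtain ⟨I, hI, hIC⟩ := exists_embedding (r := r) hC
  obtain ⟨D, hD0, hD⟩ := exists_eLpNorm_one_le (N := N) (Ω := Ω) hp hΩ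
  have n1 : ∀ w : W0 Ω p, ‖valL w‖ ≤ ‖w‖ := fun w => by
    rw [norm_eq_max]; exact le_max_left _ _
  have n2 : ∀ w : W0 Ω p, ‖gradL w‖ ≤ ‖w‖ := fun w => by
    rw [norm_eq_max]; exact le_max_right _ _
  refine exists_subseq_cauchySeq_of_approx (Y := Eucl N) (C := C + D) (I := fun w => I w) hq hqr
    (by positivity) val_add val_smul (fun w => (memLp_val w).1) (fun w => ?_) (fun ε hε => ?_)
    hI (fun w => ?_) hJ hv
  · refine (hD (valL w)).trans (ENNReal.ofReal_le_ofReal ?_)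
    exact mul_le_mul (by simp) (n1 w) (norm_nonneg _) (by positivity)
  · obtain ⟨s, f, hf⟩ := exists_finite_rank_approx (N := N) hp hΩo hΩ hε
    refine ⟨s, f, fun w => ?_⟩
    obtain ⟨φ, v, h1, h2, h3, h4⟩ := exists_seq_testFun w
    exact ⟨v, h4, fun n => ⟨φ n, h2 n, hf (v n) (φ n) (h1 n) (h2 n) (h3 n)⟩⟩
  · exact (hIC w).trans (mul_le_mul (by linarith) (n2 w) (norm_nonneg _) (by positivity))

end Rellich

/-! ### Clarkson's inequality -/

section Clarkson

variable {F : Type*} [NormedAddCommGroup F] [InnerProductSpace ℝ F]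

/-- Clarkson's inequality for vectors, `p ≥ 2`. -/
lemma norm_half_add_rpow_add_norm_half_sub_rpow_le {p : ℝ} (hp : 2 ≤ p) (a b : F) :
    ‖(1 / 2 : ℝ) • (a + b)‖ ^ p + ‖(1 / 2 : ℝ) • (a - b)‖ ^ p ≤
      1 / 2 * ‖a‖ ^ p + 1 / 2 * ‖b‖ ^ p := by
  have hp1 : 1 ≤ p / 2 := by linarith
  have hsq : ∀ c : F, ‖c‖ ^ p = (‖c‖ ^ 2) ^ (p / 2) := fun c => by
    rw [← Real.rpow_natCast, ← Real.rpow_mul (norm_nonneg _)]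
    congr 1
    push_cast
    ring
  simp only [hsq]
  have h1 : (‖(1 / 2 : ℝ) • (a + b)‖ ^ 2) ^ (p / 2) + (‖(1 / 2 : ℝ) • (a - b)‖ ^ 2) ^ (p / 2) ≤
      (‖(1 / 2 : ℝ) • (a + b)‖ ^ 2 + ‖(1 / 2 : ℝ) • (a - b)‖ ^ 2) ^ (p / 2) := by
    have := NNReal.add_rpow_le_rpow_add (p := p / 2) (‖(1 / 2 : ℝ) • (a + b)‖₊ ^ 2)
      (‖(1 / 2 : ℝ) • (a - b)‖₊ ^ 2) hp1
    exact_mod_cast this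
  have h2 : ‖(1 / 2 : ℝ) • (a + b)‖ ^ 2 + ‖(1 / 2 : ℝ) • (a - b)‖ ^ 2 =
      (1 / 2) * ‖a‖ ^ 2 + (1 / 2) * ‖b‖ ^ 2 := by
    have := parallelogram_law_with_norm ℝ a b
    rw [norm_smul, norm_smul, Real.norm_of_nonneg (by norm_num)]
    nlinarith
  refine h1.trans ?_
  rw [h2]
  exact (convexOn_rpow hp1).2 (Set.mem_Ici.2 (sq_nonneg _)) (Set.mem_Ici.2 (sq_nonneg _))
    (by norm_num) (by norm_num) (by norm_num)

variable {X : Type*} [MeasurableSpace X] {μ : Measure X}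

/-- Clarkson's inequality in `L^p`, `p ≥ 2`. -/
lemma lpPow_half_add_add_lpPow_half_sub_le {p : ℝ} (hp : 2 ≤ p) (f g : Lp F (ENNReal.ofReal p) μ) :
    lpPow ((1 / 2 : ℝ) • (f + g)) + lpPow ((1 / 2 : ℝ) • (f - g)) ≤
      1 / 2 * lpPow f + 1 / 2 * lpPow g := by
  have i1 := integrable_norm_rpow hp ((1 / 2 : ℝ) • (f + g))
  have i2 := integrable_norm_rpow hp ((1 / 2 : ℝ) • (f - g))
  have i3 := (integrable_norm_rpow hp f).const_mul (1 / 2)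
  have i4 := (integrable_norm_rpow hp g).const_mul (1 / 2)
  rw [lpPow, lpPow, lpPow, lpPow, ← integral_const_mul, ← integral_const_mul,
    ← integral_add i1 i2, ← integral_add i3 i4]
  refine integral_mono_ae (i1.add i2) (i3.add i4) ?_
  filter_upwards [Lp.coeFn_smul (1 / 2 : ℝ) (f + g), Lp.coeFn_smul (1 / 2 : ℝ) (f - g),
    Lp.coeFn_add f g, Lp.coeFn_sub f g] with x h1 h2 h3 h4
  rw [h1, h2, Pi.smul_apply, Pi.smul_apply, h3, h4]
  exact norm_half_add_rpow_add_norm_half_sub_rpow_le hp (f x) (g x)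

variable {p : ℝ} [Fact (1 ≤ ENNReal.ofReal p)]

omit [Fact (1 ≤ ENNReal.ofReal p)] in
lemma norm_half_add_rpow_add_norm_half_sub_rpow_le_lp (hp : 2 ≤ p)
    (f g : Lp F (ENNReal.ofReal p) μ) :
    ‖(1 / 2 : ℝ) • (f + g)‖ ^ p + ‖(1 / 2 : ℝ) • (f - g)‖ ^ p ≤
      1 / 2 * ‖f‖ ^ p + 1 / 2 * ‖g‖ ^ p := by
  simpa only [lpPow_eq_norm_rpow hp] using lpPow_half_add_add_lpPow_half_sub_le hp f g

lemma lpPow_smul (hp : 2 ≤ p) (c : ℝ) (g : Lp F (ENNReal.ofReal p) μ) :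
    lpPow (c • g) = |c| ^ p * lpPow g := by
  rw [lpPow_eq_norm_rpow hp, lpPow_eq_norm_rpow hp, norm_smul, Real.norm_eq_abs,
    Real.mul_rpow (abs_nonneg _) (norm_nonneg _)]

lemma rpow_sub_two_mul_self {p : ℝ} (hp : 2 ≤ p) {x : ℝ} (hx : 0 ≤ x) :
    x ^ (p - 2) * x ^ 2 = x ^ p := by
  rcases hx.eq_or_lt with rfl | h
  · simp [Real.zero_rpow (show p ≠ 0 by linarith)]
  · rw [← Real.rpow_natCast, ← Real.rpow_add h]
    norm_num

lemma rpow_sub_four_mul_self {p : ℝ} {x : ℝ} (hx : 0 ≤ x) (hp : 0 < p) :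
    x ^ (p - 4) * x ^ 4 = x ^ p := by
  rcases hx.eq_or_lt with rfl | h
  · simp [Real.zero_rpow hp.ne']
  · rw [← Real.rpow_natCast, ← Real.rpow_add h]
    norm_num

lemma lpPowD1_self (hp : 2 ≤ p) (g : Lp F (ENNReal.ofReal p) μ) :
    lpPowD1 hp g g = p * lpPow g := by
  rw [lpPowD1_apply, lpPow, ← integral_const_mul]
  refine integral_congr_ae (Eventually.of_forall fun x => ?_)
  simp only [normPowD1_apply, real_inner_self_eq_norm_sq]
  rw [mul_assoc, rpow_sub_two_mul_self hp (norm_nonneg _)]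

lemma lpPowD2_self (hp : 2 ≤ p) (g : Lp F (ENNReal.ofReal p) μ) :
    lpPowD2 hp g g g = p * (p - 1) * lpPow g := by
  rw [lpPowD2_apply, lpPow, ← integral_const_mul]
  refine integral_congr_ae (Eventually.of_forall fun x => ?_)
  simp only [normPowD2_apply, real_inner_self_eq_norm_sq]
  have h1 := rpow_sub_two_mul_self hp (norm_nonneg (g x))
  have h2 := rpow_sub_four_mul_self (p := p) (norm_nonneg (g x)) (by linarith)
  linear_combination p * h1 + p * (p - 2) * h2

end Clarkson

/-! ### Differences of powers of norms -/

section PowEnergy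

variable {V X F : Type*} [NormedAddCommGroup V] [NormedSpace ℝ V] [MeasurableSpace X]
  {μ : Measure X} [NormedAddCommGroup F] [InnerProductSpace ℝ F]
  {p q : ℝ} [Fact (1 ≤ ENNReal.ofReal p)] [Fact (1 ≤ ENNReal.ofReal q)]

/-- The functional `v ↦ (1/p) ‖G v‖_p^p - (1/q) ‖J v‖_q^q`. -/
def powEnergy (G : V →L[ℝ] Lp F (ENNReal.ofReal p) μ) (J : V →L[ℝ] Lp ℝ (ENNReal.ofReal q) μ)
    (v : V) : ℝ :=
  1 / p * lpPow (G v) - 1 / q * lpPow (J v)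

variable {G : V →L[ℝ] Lp F (ENNReal.ofReal p) μ} {J : V →L[ℝ] Lp ℝ (ENNReal.ofReal q) μ}

lemma hasFDerivAt_powEnergy (hp : 2 ≤ p) (hq : 2 ≤ q) (v : V) :
    HasFDerivAt (powEnergy G J) ((1 / p) • (lpPowD1 hp (G v)).comp G -
      (1 / q) • (lpPowD1 hq (J v)).comp J) v :=
  (((hasFDerivAt_lpPow hp (G v)).comp v G.hasFDerivAt).const_mul (1 / p)).sub
    (((hasFDerivAt_lpPow hq (J v)).comp v J.hasFDerivAt).const_mul (1 / q))

lemma fderiv_powEnergy_apply (hp : 2 ≤ p) (hq : 2 ≤ q) (v h : V) :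
    fderiv ℝ (powEnergy G J) v h = 1 / p * lpPowD1 hp (G v) (G h) -
      1 / q * lpPowD1 hq (J v) (J h) := by
  rw [(hasFDerivAt_powEnergy hp hq v).fderiv]
  rfl

lemma fderiv_powEnergy_self (hp : 2 ≤ p) (hq : 2 ≤ q) (v : V) :
    fderiv ℝ (powEnergy G J) v v = lpPow (G v) - lpPow (J v) := by
  have hp0 : p ≠ 0 := by linarith
  have hq0 : q ≠ 0 := by linarith
  rw [fderiv_powEnergy_apply hp hq, lpPowD1_self, lpPowD1_self]
  field_simp

variable [FiniteDimensional ℝ F]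

lemma contDiff_powEnergy (hp : 2 ≤ p) (hq : 2 ≤ q) : ContDiff ℝ 2 (powEnergy G J) :=
  (contDiff_const.mul ((contDiff_lpPow hp).comp G.contDiff)).sub
    (contDiff_const.mul ((contDiff_lpPow hq).comp J.contDiff))

lemma hasFDerivAt_lpPowD1_comp_apply {E : Type*} [NormedAddCommGroup E] [InnerProductSpace ℝ E]
    [FiniteDimensional ℝ E] {r : ℝ} [Fact (1 ≤ ENNReal.ofReal r)] (hr : 2 ≤ r)
    (T : V →L[ℝ] Lp E (ENNReal.ofReal r) μ) (u h : V) :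
    HasFDerivAt (fun v => lpPowD1 hr (T v) (T h)) (((lpPowD2 hr (T u)).flip (T h)).comp T) u :=
  HasFDerivAt.comp (g := ContinuousLinearMap.apply ℝ ℝ (T h)) u
    (ContinuousLinearMap.hasFDerivAt _)
    (HasFDerivAt.comp (g := lpPowD1 hr) (f := T) u (hasFDerivAt_lpPowD1 hr (T u)) T.hasFDerivAt)

lemma fderiv_fderiv_powEnergy (hp : 2 ≤ p) (hq : 2 ≤ q) (u g h : V) :
    fderiv ℝ (fderiv ℝ (powEnergy G J)) u g h = 1 / p * lpPowD2 hp (G u) (G g) (G h) -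
      1 / q * lpPowD2 hq (J u) (J g) (J h) := by
  have hC : ContDiff ℝ 2 (powEnergy G J) := contDiff_powEnergy hp hq
  have hd : DifferentiableAt ℝ (fderiv ℝ (powEnergy G J)) u :=
    (hC.fderiv_right (m := 1) le_rfl).differentiable one_ne_zero u
  have h1 : HasFDerivAt (fun v => fderiv ℝ (powEnergy G J) v h)
      ((ContinuousLinearMap.apply ℝ ℝ h).comp (fderiv ℝ (fderiv ℝ (powEnergy G J)) u)) u :=
    ((ContinuousLinearMap.apply ℝ ℝ h).hasFDerivAt).comp u hd.hasFDerivAt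
  have h2 : HasFDerivAt (fun v => fderiv ℝ (powEnergy G J) v h)
      ((1 / p) • (((lpPowD2 hp (G u)).flip (G h)).comp G) -
        (1 / q) • (((lpPowD2 hq (J u)).flip (J h)).comp J)) u := by
    simp_rw [fderiv_powEnergy_apply hp hq]
    exact ((hasFDerivAt_lpPowD1_comp_apply hp G u h).const_mul _).sub
      ((hasFDerivAt_lpPowD1_comp_apply hq J u h).const_mul _)
  exact congrArg (fun T : V →L[ℝ] ℝ => T g) (h1.unique h2)

end PowEnergy

/-! ### Ground states -/

section Minimization

variable {V X F : Type*} [NormedAddCommGroup V] [NormedSpace ℝ V] [CompleteSpace V]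
  [MeasurableSpace X] {μ : Measure X} [NormedAddCommGroup F] [InnerProductSpace ℝ F]
  {p q : ℝ} [Fact (1 ≤ ENNReal.ofReal p)] [Fact (1 ≤ ENNReal.ofReal q)]
  {G : V →L[ℝ] Lp F (ENNReal.ofReal p) μ} {J : V →L[ℝ] Lp ℝ (ENNReal.ofReal q) μ}

/-- The best constant in `λ ‖J v‖ ≤ ‖G v‖` is attained. By Clarkson's inequality a minimizing
sequence is Cauchy as soon as its image under `J` is. -/
lemma exists_minimizer_norm (hp : 2 ≤ p) {C : ℝ} (hC : ∀ v, ‖v‖ ≤ C * ‖G v‖)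
    (hJ : ∀ v, J v = 0 → v = 0) (hne : ∃ v : V, v ≠ 0)
    (hcpt : ∀ (v : ℕ → V) (M : ℝ), (∀ n, ‖v n‖ ≤ M) →
      ∃ k : ℕ → ℕ, StrictMono k ∧ CauchySeq fun n => J (v (k n))) :
    ∃ w : V, ‖J w‖ = 1 ∧ ∀ v, ‖G w‖ * ‖J v‖ ≤ ‖G v‖ := by
  set S : Set ℝ := (fun v => ‖G v‖) '' {v | ‖J v‖ = 1} with hS
  have hnorm : ∀ v, J v ≠ 0 → ‖J (‖J v‖⁻¹ • v)‖ = 1 := fun v hv => by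
    rw [map_smul, norm_smul, norm_inv, norm_norm, inv_mul_cancel₀ (norm_ne_zero_iff.2 hv)]
  have hSne : S.Nonempty := by
    obtain ⟨v, hv⟩ := hne
    exact ⟨_, ‖J v‖⁻¹ • v, hnorm v fun h => hv (hJ v h), rfl⟩
  have hSb : BddBelow S := ⟨0, by rintro _ ⟨v, -, rfl⟩; exact norm_nonneg _⟩
  have hinf : ∀ v, sInf S * ‖J v‖ ≤ ‖G v‖ := fun v => by
    by_cases hv : J v = 0
    · rw [hv, norm_zero, mul_zero]
      exact norm_nonneg _
    have h1 : sInf S ≤ ‖G (‖J v‖⁻¹ • v)‖ := csInf_le hSb ⟨_, hnorm v hv, rfl⟩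
    rw [map_smul, norm_smul, norm_inv, norm_norm] at h1
    have h2 : 0 < ‖J v‖ := norm_pos_iff.2 hv
    calc sInf S * ‖J v‖ ≤ ‖J v‖⁻¹ * ‖G v‖ * ‖J v‖ := by gcongr
      _ = ‖G v‖ := by field_simp
  have hinf0 : 0 ≤ sInf S := Real.sInf_nonneg (by rintro _ ⟨v, -, rfl⟩; exact norm_nonneg _)
  obtain ⟨s, -, hslim, hsS⟩ := exists_seq_tendsto_sInf hSne hSb
  choose v hv1 hvs using hsS
  simp only at hvs
  replace hv1 : ∀ n, ‖J (v n)‖ = 1 := hv1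
  have hlim : Tendsto (fun n => ‖G (v n)‖) atTop (𝓝 (sInf S)) := by simpa only [hvs] using hslim
  obtain ⟨B, hB⟩ := hlim.bddAbove_range
  have hC' : ∀ v, ‖v‖ ≤ |C| * ‖G v‖ := fun v =>
    (hC v).trans (mul_le_mul_of_nonneg_right (le_abs_self C) (norm_nonneg _))
  obtain ⟨k, hk, hcau⟩ := hcpt v (|C| * B) fun n => (hC' _).trans
    (mul_le_mul_of_nonneg_left (hB ⟨n, rfl⟩) (abs_nonneg _))
  have hcauchy : CauchySeq fun n => v (k n) := by
    refine Metric.cauchySeq_iff.2 fun ε hε => ?_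
    -- with `λ = sInf S`, `‖G (v n)‖ ≤ λ + η` and `‖J (v m + v n) / 2‖ ≥ 1 - η` bound the defect
    have hη : Tendsto (fun η : ℝ => (sInf S + η) ^ p - (sInf S * (1 - η)) ^ p) (𝓝 0)
        (𝓝 0) := by
      have hc : Continuous fun η : ℝ => (sInf S + η) ^ p - (sInf S * (1 - η)) ^ p :=
        ((continuous_const.add continuous_id).rpow_const fun _ => Or.inr (by linarith)).sub
          ((continuous_const.mul (continuous_const.sub continuous_id)).rpow_const
            fun _ => Or.inr (by linarith))
      simpa using hc.tendsto 0
    have hε' : 0 < (ε / (2 * (|C| + 1))) ^ p := by positivity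
    obtain ⟨η, ⟨hη1, hη2⟩, hη3⟩ : ∃ η : ℝ,
        ((sInf S + η) ^ p - (sInf S * (1 - η)) ^ p < (ε / (2 * (|C| + 1))) ^ p ∧ η < 1) ∧
          0 < η := by
      have h1 : ∀ᶠ η : ℝ in 𝓝[>] 0, ((sInf S + η) ^ p - (sInf S * (1 - η)) ^ p <
          (ε / (2 * (|C| + 1))) ^ p ∧ η < 1) :=
        nhdsWithin_le_nhds ((hη.eventually (gt_mem_nhds hε')).and (gt_mem_nhds one_pos))
      exact (h1.and self_mem_nhdsWithin).exists
    obtain ⟨n₁, hn₁⟩ := Metric.cauchySeq_iff.1 hcau (2 * η) (by positivity)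
    obtain ⟨n₂, hn₂⟩ := eventually_atTop.1
      ((hlim.comp hk.tendsto_atTop).eventually (ge_mem_nhds (lt_add_of_pos_right (sInf S) hη3)))
    refine ⟨max n₁ n₂, fun m hm n hn => ?_⟩
    have h1 : dist (J (v (k m))) (J (v (k n))) < 2 * η :=
      hn₁ m (le_of_max_le_left hm) n (le_of_max_le_left hn)
    have h2 : ‖G (v (k m))‖ ≤ sInf S + η := hn₂ m (le_of_max_le_right hm)
    have h3 : ‖G (v (k n))‖ ≤ sInf S + η := hn₂ n (le_of_max_le_right hn)
    have h4 : 1 - η ≤ ‖J ((1 / 2 : ℝ) • (v (k m) + v (k n)))‖ := by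
      have e1 : J (v (k m)) = J ((1 / 2 : ℝ) • (v (k m) + v (k n))) +
          (1 / 2 : ℝ) • (J (v (k m)) - J (v (k n))) := by
        rw [map_smul, map_add]
        module
      have e2 := norm_add_le (J ((1 / 2 : ℝ) • (v (k m) + v (k n))))
        ((1 / 2 : ℝ) • (J (v (k m)) - J (v (k n))))
      rw [← e1, hv1, norm_smul, ← dist_eq_norm, Real.norm_of_nonneg (by norm_num)] at e2
      linarith
    have h5 : (sInf S * (1 - η)) ^ p ≤ ‖(1 / 2 : ℝ) • (G (v (k m)) + G (v (k n)))‖ ^ p := by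
      refine Real.rpow_le_rpow (mul_nonneg hinf0 (by linarith)) ?_ (by linarith)
      rw [← map_add, ← map_smul]
      exact (mul_le_mul_of_nonneg_left h4 hinf0).trans (hinf _)
    have h6 := norm_half_add_rpow_add_norm_half_sub_rpow_le_lp hp (G (v (k m))) (G (v (k n)))
    have h7 : ‖G (v (k m))‖ ^ p ≤ (sInf S + η) ^ p :=
      Real.rpow_le_rpow (norm_nonneg _) h2 (by linarith)
    have h8 : ‖G (v (k n))‖ ^ p ≤ (sInf S + η) ^ p :=
      Real.rpow_le_rpow (norm_nonneg _) h3 (by linarith)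
    have h9 : ‖(1 / 2 : ℝ) • (G (v (k m)) - G (v (k n)))‖ ^ p < (ε / (2 * (|C| + 1))) ^ p := by
      linarith
    have h10 := (Real.rpow_lt_rpow_iff (norm_nonneg _) (by positivity) (by linarith)).1 h9
    rw [← map_sub, norm_smul, Real.norm_of_nonneg (by norm_num),
      lt_div_iff₀ (by positivity)] at h10
    rw [dist_eq_norm]
    refine (hC' _).trans_lt ?_
    nlinarith [norm_nonneg (G (v (k m) - v (k n)))]
  obtain ⟨w, hw⟩ := cauchySeq_tendsto_of_complete hcauchy
  refine ⟨w, ?_, fun z => ?_⟩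
  · have h1 := ((J.continuous.norm).tendsto w).comp hw
    refine tendsto_nhds_unique h1 ?_
    simp only [Function.comp_def, hv1]
    exact tendsto_const_nhds
  · have h1 := ((G.continuous.norm).tendsto w).comp hw
    rw [tendsto_nhds_unique h1 (hlim.comp hk.tendsto_atTop)]
    exact hinf z

omit [CompleteSpace V] in
lemma lpPow_pos {E : Type*} [NormedAddCommGroup E] [InnerProductSpace ℝ E] {r : ℝ}
    [Fact (1 ≤ ENNReal.ofReal r)] (hr : 2 ≤ r) {g : Lp E (ENNReal.ofReal r) μ} (hg : g ≠ 0) :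
    0 < lpPow g := by
  rw [lpPow_eq_norm_rpow hr]
  exact Real.rpow_pos_of_pos (norm_pos_iff.2 hg) _

omit [Fact (1 ≤ ENNReal.ofReal p)] [Fact (1 ≤ ENNReal.ofReal q)] in
/-- The factor that scales `v` to the Nehari manifold: the solution `a` of
`a ^ p * A = a ^ q * B`. -/
lemma rpow_mul_eq_rpow_mul {A B : ℝ} (hA : 0 < A) (hB : 0 < B) (hqp : q ≠ p) :
    ((A / B) ^ (1 / (q - p))) ^ p * A = ((A / B) ^ (1 / (q - p))) ^ q * B := by
  have h0 : q - p ≠ 0 := sub_ne_zero.2 hqp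
  have hAB : 0 < A / B := div_pos hA hB
  have h1 : ((A / B) ^ (1 / (q - p))) ^ q = ((A / B) ^ (1 / (q - p))) ^ p * (A / B) := by
    rw [← Real.rpow_mul hAB.le, ← Real.rpow_mul hAB.le, ← Real.rpow_add_one hAB.ne']
    congr 1
    field_simp
    ring
  rw [h1]
  field_simp

/-- The ground state: a nonzero critical point minimizing the energy among all `v ≠ 0` with
`‖G v‖_p^p = ‖J v‖_q^q`. -/
lemma exists_ground_state (hp : 2 ≤ p) (hq : 2 ≤ q) (hqp : q ≠ p) {C : ℝ}
    (hC : ∀ v, ‖v‖ ≤ C * ‖G v‖) (hJ : ∀ v, J v = 0 → v = 0) (hne : ∃ v : V, v ≠ 0)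
    (hcpt : ∀ (v : ℕ → V) (M : ℝ), (∀ n, ‖v n‖ ≤ M) →
      ∃ k : ℕ → ℕ, StrictMono k ∧ CauchySeq fun n => J (v (k n))) :
    ∃ w : V, w ≠ 0 ∧ HasFDerivAt (powEnergy G J) (0 : V →L[ℝ] ℝ) w ∧
      ∀ v, v ≠ 0 → lpPow (G v) = lpPow (J v) → powEnergy G J w ≤ powEnergy G J v := by
  -- The minimizer of `‖G v‖ / ‖J v‖` is scaled to satisfy `‖G w‖_p^p = ‖J w‖_q^q`; the
  -- scaling leaves `l * lpPow (J v) ^ (p / q) ≤ lpPow (G v)`, with equality at `w`, unchanged.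
  obtain ⟨w₀, hw₀, hmin₀⟩ := exists_minimizer_norm hp hC hJ hne hcpt
  have hp0 : 0 < p := by linarith
  have hq0 : 0 < q := by linarith
  have hG : ∀ v, G v = 0 → v = 0 := fun v hv => by
    have := hC v
    rw [hv, norm_zero, mul_zero] at this
    exact norm_le_zero_iff.1 this
  have hw₀' : w₀ ≠ 0 := fun h => by simp [h] at hw₀
  have hA₀ : 0 < lpPow (G w₀) := lpPow_pos hp fun h => hw₀' (hG _ h)
  have hB₀ : 0 < lpPow (J w₀) := lpPow_pos hq fun h => hw₀' (hJ _ h)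
  set a : ℝ := (lpPow (G w₀) / lpPow (J w₀)) ^ (1 / (q - p)) with ha
  have ha0 : 0 < a := Real.rpow_pos_of_pos (div_pos hA₀ hB₀) _
  set w : V := a • w₀ with hw
  set l : ℝ := ‖G w₀‖ ^ p with hl
  have hl0 : 0 < l := by rw [hl, ← lpPow_eq_norm_rpow hp]; exact hA₀
  have hwne : w ≠ 0 := smul_ne_zero ha0.ne' hw₀'
  have hA : 0 < lpPow (G w) := lpPow_pos hp fun h => hwne (hG _ h)
  have hnehari : lpPow (G w) = lpPow (J w) := by
    rw [hw, map_smul, map_smul, lpPow_smul hp, lpPow_smul hq, abs_of_pos ha0]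
    exact rpow_mul_eq_rpow_mul hA₀ hB₀ hqp
  have hBrpow : ∀ v, lpPow (J v) ^ (p / q) = ‖J v‖ ^ p := fun v => by
    rw [lpPow_eq_norm_rpow hq, ← Real.rpow_mul (norm_nonneg _)]
    congr 1
    field_simp
  have hmin : ∀ v, l * lpPow (J v) ^ (p / q) ≤ lpPow (G v) := fun v => by
    rw [hBrpow, hl, ← Real.mul_rpow (norm_nonneg _) (norm_nonneg _), lpPow_eq_norm_rpow hp]
    exact Real.rpow_le_rpow (by positivity) (hmin₀ v) hp0.le
  have heq : l * lpPow (J w) ^ (p / q) = lpPow (G w) := by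
    rw [hBrpow, hw, map_smul, map_smul, lpPow_eq_norm_rpow hp, norm_smul, norm_smul, hw₀,
      mul_one, hl, Real.mul_rpow (norm_nonneg _) (norm_nonneg _), mul_comm]
  have hone : l * lpPow (J w) ^ (p / q - 1) = 1 := by
    rw [Real.rpow_sub_one (hnehari ▸ hA).ne', ← mul_div_assoc, heq, hnehari,
      div_self (hnehari ▸ hA).ne']
  have hlA : ∀ v, v ≠ 0 → lpPow (G v) = lpPow (J v) → l ≤ lpPow (G v) ^ (1 - p / q) := by
    intro v hv h
    have h1 : 0 < lpPow (G v) := lpPow_pos hp fun h => hv (hG _ h)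
    have h2 := hmin v
    rw [← h] at h2
    rw [Real.rpow_sub h1, Real.rpow_one, le_div_iff₀ (Real.rpow_pos_of_pos h1 _)]
    exact h2
  have hlw : lpPow (G w) ^ (1 - p / q) = l := by
    rw [Real.rpow_sub hA, Real.rpow_one, div_eq_iff (Real.rpow_pos_of_pos hA _).ne', ← heq]
    nth_rewrite 2 [heq]
    rw [hnehari]
  have hEn : ∀ v, lpPow (G v) = lpPow (J v) →
      powEnergy G J v = (1 / p - 1 / q) * lpPow (G v) := fun v h => by
    rw [powEnergy, ← h]
    ring
  refine ⟨w, hwne, ?_, fun v hv h => ?_⟩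
  · -- `v ↦ A v - l * B v ^ (p / q)` has a minimum at `w`, and its derivative is `p E'(w)`
    have hd := hasFDerivAt_powEnergy (G := G) (J := J) hp hq w
    have h1 : HasFDerivAt (fun v => lpPow (G v)) ((lpPowD1 hp (G w)).comp G) w :=
      (hasFDerivAt_lpPow hp (G w)).comp w G.hasFDerivAt
    have h2 : HasFDerivAt (fun v => lpPow (J v)) ((lpPowD1 hq (J w)).comp J) w :=
      (hasFDerivAt_lpPow hq (J w)).comp w J.hasFDerivAt
    have h3 := (h1.sub ((h2.rpow_const (p := p / q) (Or.inl (hnehari ▸ hA).ne')).const_mul l))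
    have h4 : IsLocalMin (fun v => lpPow (G v) - l * lpPow (J v) ^ (p / q)) w :=
      Eventually.of_forall fun v => by
        simp only [heq, sub_self]
        exact sub_nonneg.2 (hmin v)
    have h5 := h4.hasFDerivAt_eq_zero h3
    convert hd using 1
    ext h
    have h6 := congrArg (fun T : V →L[ℝ] ℝ => T h) h5
    have h7 : lpPowD1 hp (G w) (G h) - l * (p / q * lpPow (J w) ^ (p / q - 1) *
        lpPowD1 hq (J w) (J h)) = 0 := h6
    have h8 : (1 / p) * lpPowD1 hp (G w) (G h) - (1 / q) * lpPowD1 hq (J w) (J h) = 0 := by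
      have h9 : lpPowD1 hp (G w) (G h) = p / q * lpPowD1 hq (J w) (J h) := by
        linear_combination h7 + p / q * lpPowD1 hq (J w) (J h) * hone
      rw [h9]
      field_simp
      ring
    exact h8.symm
  · rw [hEn w hnehari, hEn v h]
    have h1 : 0 < lpPow (G v) := lpPow_pos hp fun h => hv (hG _ h)
    have h2 := hlA v hv h
    rw [← hlw] at h2
    -- The exponent `1 - p / q` and the factor `1 / p - 1 / q` have the same sign.
    rcases lt_or_gt_of_ne hqp with hlt | hlt
    · have h3 : lpPow (G v) ≤ lpPow (G w) := by
        by_contra h4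
        have : lpPow (G v) ^ (1 - p / q) < lpPow (G w) ^ (1 - p / q) :=
          Real.rpow_lt_rpow_of_neg hA (not_le.1 h4) (by
            rw [sub_neg, lt_div_iff₀ hq0]
            linarith)
        linarith
      have h4 : 1 / p - 1 / q ≤ 0 := sub_nonpos.2 (one_div_le_one_div_of_le hq0 hlt.le)
      exact mul_le_mul_of_nonpos_left h3 h4
    · have h3 : lpPow (G w) ≤ lpPow (G v) :=
        (Real.rpow_le_rpow_iff hA.le h1.le (by
          rw [sub_pos, div_lt_iff₀ hq0]
          linarith)).1 h2
      have h4 : 0 ≤ 1 / p - 1 / q := sub_nonneg.2 (one_div_le_one_div_of_le hp0 hlt.le)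
      exact mul_le_mul_of_nonneg_left h3 h4

end Minimization

/-! ### Curves in the Nehari manifold -/

section NehariPath

/-- Normalization along a path: if `A` and `B` are the `p`- and `q`-integrals along the path, then
`α = (A / B) ^ (1 / (q - p))` scales the path into the Nehari manifold. -/
lemma exists_nehari_scaling {p q δ : ℝ} (hqp : q ≠ p) (hδ : 0 < δ) {A B : ℝ → ℝ}
    (hA : ContDiffOn ℝ 2 A (Set.Ioo (-δ) δ)) (hB : ContDiffOn ℝ 2 B (Set.Ioo (-δ) δ))
    (hA0 : 0 < A 0) (hAB : A 0 = B 0) :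
    ∃ ε : ℝ, 0 < ε ∧ ε ≤ δ ∧ ∃ α : ℝ → ℝ, ContDiffOn ℝ 1 α (Set.Ioo (-ε) ε) ∧ α 0 = 1 ∧
      ∀ t ∈ Set.Ioo (-ε) ε, 0 < A t ∧ 0 < B t ∧ 0 < α t ∧ α t ^ p * A t = α t ^ q * B t := by
  have h0 : Set.Ioo (-δ) δ ∈ 𝓝 (0 : ℝ) := Ioo_mem_nhds (by linarith) hδ
  have hAc : ContinuousAt A 0 := (hA.continuousOn).continuousAt h0
  have hBc : ContinuousAt B 0 := (hB.continuousOn).continuousAt h0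
  have hev : ∀ᶠ t in 𝓝 (0 : ℝ), 0 < A t ∧ 0 < B t :=
    (hAc.eventually (lt_mem_nhds hA0)).and (hBc.eventually (lt_mem_nhds (hAB ▸ hA0)))
  obtain ⟨ε, hε, hball⟩ := Metric.eventually_nhds_iff_ball.1 hev
  have hsub : ∀ t ∈ Set.Ioo (-(min ε δ)) (min ε δ), 0 < A t ∧ 0 < B t := fun t ht => by
    refine hball t ?_
    rw [mem_ball_zero_iff, Real.norm_eq_abs, abs_lt]
    exact ⟨by linarith [ht.1, min_le_left ε δ], ht.2.trans_le (min_le_left _ _)⟩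
  have hmono : Set.Ioo (-(min ε δ)) (min ε δ) ⊆ Set.Ioo (-δ) δ :=
    Set.Ioo_subset_Ioo (by linarith [min_le_right ε δ]) (min_le_right _ _)
  refine ⟨min ε δ, lt_min hε hδ, min_le_right _ _, fun t => (A t / B t) ^ (1 / (q - p)),
    ?_, ?_, fun t ht => ?_⟩
  · refine ContDiffOn.rpow_const_of_ne ?_ fun t ht =>
      (div_pos (hsub t ht).1 (hsub t ht).2).ne'
    exact ((hA.mono hmono).div (hB.mono hmono) fun t ht => (hsub t ht).2.ne').of_le
      one_le_two
  · simp only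
    rw [← hAB, div_self hA0.ne', Real.one_rpow]
  · obtain ⟨h1, h2⟩ := hsub t ht
    exact ⟨h1, h2, Real.rpow_pos_of_pos (div_pos h1 h2) _, rpow_mul_eq_rpow_mul h1 h2 hqp⟩

variable {V X F : Type*} [NormedAddCommGroup V] [NormedSpace ℝ V] [MeasurableSpace X]
  {μ : Measure X} [NormedAddCommGroup F] [InnerProductSpace ℝ F]
  {p q : ℝ} [Fact (1 ≤ ENNReal.ofReal p)] [Fact (1 ≤ ENNReal.ofReal q)]

/-- What the Poincaré inequality and the compact embedding say about the gradient `G` and the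
embedding `J`. -/
structure IsSubcriticalPair (G : V →L[ℝ] Lp F (ENNReal.ofReal p) μ)
    (J : V →L[ℝ] Lp ℝ (ENNReal.ofReal q) μ) : Prop where
  exists_norm_le : ∃ C : ℝ, ∀ v, ‖v‖ ≤ C * ‖G v‖
  eq_zero : ∀ v, J v = 0 → v = 0
  exists_subseq : ∀ (v : ℕ → V) (M : ℝ), (∀ n, ‖v n‖ ≤ M) →
    ∃ k : ℕ → ℕ, StrictMono k ∧ CauchySeq fun n => J (v (k n))

variable {G : V →L[ℝ] Lp F (ENNReal.ofReal p) μ} {J : V →L[ℝ] Lp ℝ (ENNReal.ofReal q) μ}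

lemma IsSubcriticalPair.lpPow_left_pos (h : IsSubcriticalPair G J) (hp : 2 ≤ p) {v : V}
    (hv : v ≠ 0) : 0 < lpPow (G v) := by
  refine lpPow_pos hp fun h0 => hv ?_
  obtain ⟨C, hC⟩ := h.exists_norm_le
  have := hC v
  rw [h0, norm_zero, mul_zero] at this
  exact norm_le_zero_iff.1 this

lemma IsSubcriticalPair.lpPow_right_pos (h : IsSubcriticalPair G J) (hq : 2 ≤ q) {v : V}
    (hv : v ≠ 0) : 0 < lpPow (J v) :=
  lpPow_pos hq fun h0 => hv (h.eq_zero v h0)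

lemma IsSubcriticalPair.exists_smul (h : IsSubcriticalPair G J) (hp : 2 ≤ p) (hq : 2 ≤ q)
    (hqp : q ≠ p) {v : V} (hv : v ≠ 0) :
    ∃ a : ℝ, 0 < a ∧ a • v ≠ 0 ∧ fderiv ℝ (powEnergy G J) (a • v) (a • v) = 0 := by
  have hA := h.lpPow_left_pos hp hv
  have hB := h.lpPow_right_pos hq hv
  have ha := Real.rpow_pos_of_pos (div_pos hA hB) (1 / (q - p))
  refine ⟨_, ha, smul_ne_zero ha.ne' hv, ?_⟩
  rw [fderiv_powEnergy_self hp hq, map_smul, map_smul, lpPow_smul hp, lpPow_smul hq,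
    abs_of_pos ha, rpow_mul_eq_rpow_mul hA hB hqp, sub_self]

lemma IsSubcriticalPair.exists_path [FiniteDimensional ℝ F] (h : IsSubcriticalPair G J)
    (hp : 2 ≤ p) (hq : 2 ≤ q) (hqp : q ≠ p) {δ : ℝ} (hδ : 0 < δ) {w : V} (v : V) (hw : w ≠ 0)
    (hwN : fderiv ℝ (powEnergy G J) w w = 0) :
    ∃ ε : ℝ, 0 < ε ∧ ε ≤ δ ∧ ∃ β : ℝ → ℝ, ContDiffOn ℝ 1 β (Set.Ioo (-ε) ε) ∧ β 0 = 1 ∧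
      ∀ s ∈ Set.Ioo (-ε) ε, 0 < β s ∧ β s • (w + s • v) ≠ 0 ∧
        fderiv ℝ (powEnergy G J) (β s • (w + s • v)) (β s • (w + s • v)) = 0 := by
  have hpath : ContDiff ℝ 2 fun s : ℝ => w + s • v := by fun_prop
  have h1 : ContDiff ℝ 2 fun s : ℝ => lpPow (G (w + s • v)) :=
    (contDiff_lpPow hp).comp (G.contDiff.comp hpath)
  have h2 : ContDiff ℝ 2 fun s : ℝ => lpPow (J (w + s • v)) :=
    (contDiff_lpPow hq).comp (J.contDiff.comp hpath)
  rw [fderiv_powEnergy_self hp hq, sub_eq_zero] at hwN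
  obtain ⟨ε, hε, hεδ, β, hβ, hβ0, hβ'⟩ := exists_nehari_scaling hqp hδ h1.contDiffOn
    h2.contDiffOn (by simpa using h.lpPow_left_pos hp hw) (by simpa using hwN)
  refine ⟨ε, hε, hεδ, β, hβ, hβ0, fun s hs => ?_⟩
  obtain ⟨h3, h4, h5, h6⟩ := hβ' s hs
  refine ⟨h5, smul_ne_zero h5.ne' fun h0 => ?_, ?_⟩
  · rw [h0, map_zero, lpPow_eq_norm_rpow hp, norm_zero, Real.zero_rpow (by linarith)] at h3
    exact lt_irrefl _ h3
  · rw [fderiv_powEnergy_self hp hq, map_smul, map_smul, lpPow_smul hp, lpPow_smul hq,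
      abs_of_pos h5, h6, sub_self]

lemma IsSubcriticalPair.exists_ground_state [CompleteSpace V] (h : IsSubcriticalPair G J)
    (hp : 2 ≤ p) (hq : 2 ≤ q) (hqp : q ≠ p) (hne : ∃ v : V, v ≠ 0) :
    ∃ w : V, w ≠ 0 ∧ HasFDerivAt (powEnergy G J) (0 : V →L[ℝ] ℝ) w ∧
      ∀ v, v ≠ 0 → fderiv ℝ (powEnergy G J) v v = 0 → powEnergy G J w ≤ powEnergy G J v := by
  obtain ⟨C, hC⟩ := h.exists_norm_le
  obtain ⟨w, h1, h2, h3⟩ := NehariShape.exists_ground_state hp hq hqp hC h.eq_zero hne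
    h.exists_subseq
  refine ⟨w, h1, h2, fun v hv hv' => h3 v hv ?_⟩
  rwa [fderiv_powEnergy_self hp hq, sub_eq_zero] at hv'

end NehariPath

/-! ### The Lane–Emden functional -/

section LaneEmden

variable {N : ℕ} {Ω : Set (Eucl N)} {p q : ℝ} [Fact (1 ≤ ENNReal.ofReal p)]
  [Fact (1 ≤ ENNReal.ofReal q)]

lemma exists_ne_zero (hΩo : IsOpen Ω) (hΩ : Ω.Nonempty) : ∃ w : W0 Ω p, w ≠ 0 := by
  obtain ⟨x, hx⟩ := hΩ
  obtain ⟨φ, h1, h2, h3, -, h4⟩ := exists_contDiff_tsupport_subset (n := ⊤) (hΩo.mem_nhds hx)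
  obtain ⟨w, hw, -⟩ := exists_of_testFun (p := p) (φ := φ) ⟨h3, h2, h1⟩
  refine ⟨w, fun h => ?_⟩
  have h5 : val (0 : W0 Ω p) =ᵐ[volume.restrict Ω] 0 := Lp.coeFn_zero _ _ _
  rw [h] at hw
  have h6 := Measure.eqOn_open_of_ae_eq (hw.symm.trans h5) hΩo h3.continuous.continuousOn
    continuousOn_const hx
  simp [h4] at h6

omit [Fact (1 ≤ ENNReal.ofReal q)] in
lemma energy_laneEmden (hp : 2 ≤ p) (hq : 2 ≤ q)
    {J : W0 Ω p → Lp ℝ (ENNReal.ofReal q) (volume.restrict Ω)}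
    (hJ : ∀ w, J w =ᵐ[volume.restrict Ω] val w) (w : W0 Ω p) :
    energy (laneEmden p q) w = 1 / p * lpPow (gradL w) - 1 / q * lpPow (J w) := by
  have h1 := (integrable_norm_rpow hp (gradL w)).const_mul (1 / p)
  have h2 := (integrable_norm_rpow hq (J w)).const_mul (1 / q)
  rw [energy, lpPow, lpPow, ← integral_const_mul, ← integral_const_mul, ← integral_sub h1 h2]
  refine integral_congr_ae ((hJ w).mono fun x hx => ?_)
  simp only [laneEmden, hx]
  rfl

omit [Fact (1 ≤ ENNReal.ofReal q)] in
lemma lpPow_eq_integral_val {J : W0 Ω p → Lp ℝ (ENNReal.ofReal q) (volume.restrict Ω)}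
    (hJ : ∀ w, J w =ᵐ[volume.restrict Ω] val w) (w : W0 Ω p) :
    lpPow (J w) = ∫ x in Ω, |val w x| ^ q :=
  integral_congr_ae ((hJ w).mono fun x hx => by simp only [hx, Real.norm_eq_abs])

omit [Fact (1 ≤ ENNReal.ofReal q)] in
lemma exists_norm_le_gradL (hN : 2 ≤ N) (hp : 2 ≤ p) (hΩ : Bornology.IsBounded Ω) :
    ∃ C : ℝ, ∀ v : W0 Ω p, ‖v‖ ≤ C * ‖gradL v‖ := by
  obtain ⟨D, hD⟩ := exists_norm_valL_le (Ω := Ω) (p := p) hN hp hΩ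
  refine ⟨max D 1, fun v => ?_⟩
  rw [norm_eq_max]
  refine max_le ((hD v).trans ?_) ?_
  · exact mul_le_mul_of_nonneg_right (le_max_left _ _) (norm_nonneg _)
  · exact le_mul_of_one_le_left (norm_nonneg _) (le_max_right _ _)

omit [Fact (1 ≤ ENNReal.ofReal q)] in
lemma eq_zero_of_embedding_eq_zero (hp : 2 ≤ p) (hΩo : IsOpen Ω) (hΩ : Bornology.IsBounded Ω)
    {v : W0 Ω p} {g : Lp ℝ (ENNReal.ofReal q) (volume.restrict Ω)}
    (hg : g =ᵐ[volume.restrict Ω] val v) (h0 : g = 0) : v = 0 := by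
  have h1 : val v =ᵐ[volume.restrict Ω] val (0 : W0 Ω p) := by
    have h2 : val (0 : W0 Ω p) =ᵐ[volume.restrict Ω] 0 := Lp.coeFn_zero _ _ _
    rw [h0] at hg
    exact hg.symm.trans ((Lp.coeFn_zero _ _ _).trans h2.symm)
  exact eq_of_val_ae_eq hp hΩo hΩ h1

lemma isSubcriticalPair_gradCLM (hN : 2 ≤ N) (hp : 2 ≤ p) (hq : 2 ≤ q)
    (hcrit : (q : EReal) < sobolevConj N p) (hΩo : IsOpen Ω) (hΩ : Bornology.IsBounded Ω)
    {J : W0 Ω p →L[ℝ] Lp ℝ (ENNReal.ofReal q) (volume.restrict Ω)}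
    (hJ : ∀ w, J w =ᵐ[volume.restrict Ω] val w) : IsSubcriticalPair gradCLM J :=
  IsSubcriticalPair.mk (exists_norm_le_gradL hN hp hΩ)
    (fun v hv => eq_zero_of_embedding_eq_zero hp hΩo hΩ (hJ v) hv)
    (fun _ _ hv => exists_subseq_cauchySeq hN hp hq hcrit hΩo hΩ hJ hv)

/-- The Lane–Emden energy on `W_0^{1,p}(Ω)` is the abstract functional `powEnergy` of the gradient
and the embedding into `L^q`. -/
lemma exists_isSubcriticalPair (hN : 2 ≤ N) (hp : 2 ≤ p) (hq : 2 ≤ q)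
    (hcrit : (q : EReal) < sobolevConj N p) (hΩo : IsOpen Ω) (hΩ : Bornology.IsBounded Ω) :
    ∃ J : W0 Ω p →L[ℝ] Lp ℝ (ENNReal.ofReal q) (volume.restrict Ω),
      (∀ w, J w =ᵐ[volume.restrict Ω] val w) ∧ IsSubcriticalPair gradCLM J ∧
      energy (laneEmden p q) = powEnergy gradCLM J := by
  obtain ⟨C, hC⟩ := sobolev_inequality (Ω := Ω) hN hp hq hcrit hΩ
  obtain ⟨J, hJ, -⟩ := exists_embedding (r := q) hC
  exact ⟨J, hJ, isSubcriticalPair_gradCLM hN hp hq hcrit hΩo hΩ hJ,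
    funext fun w => energy_laneEmden hp hq hJ w⟩

end LaneEmden

/-! ### Least energy critical points of the Lane–Emden functional -/

section GroundState

variable {N : ℕ} {Ω : Set (Eucl N)} {p q : ℝ} [Fact (1 ≤ ENNReal.ofReal p)]
  [Fact (1 ≤ ENNReal.ofReal q)]

lemma mem_nehari_iff_of_embedding {J : W0 Ω p →L[ℝ] Lp ℝ (ENNReal.ofReal q) (volume.restrict Ω)}
    (hp : 2 ≤ p) (hq : 2 ≤ q) (w : W0 Ω p) :
    w ∈ nehari (powEnergy gradCLM J) ↔ w ≠ 0 ∧ lpPow (gradL w) = lpPow (J w) := by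
  have h : fderiv ℝ (powEnergy gradCLM J) w w = lpPow (gradL w) - lpPow (J w) :=
    fderiv_powEnergy_self hp hq w
  exact and_congr_right fun _ => ⟨fun hw => sub_eq_zero.1 (h.symm.trans hw),
    fun hw => h.trans (sub_eq_zero.2 hw)⟩

/-- The Nehari constraint `E'(w) w = 0` is the equality of the two power integrals. -/
lemma mem_nehari_iff (hN : 2 ≤ N) (hp : 2 ≤ p) (hq : 2 ≤ q)
    (hcrit : (q : EReal) < sobolevConj N p) (hΩo : IsOpen Ω) (hΩ : Bornology.IsBounded Ω)
    (w : W0 Ω p) : w ∈ nehari (energy (laneEmden p q)) ↔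
      w ≠ 0 ∧ ∫ x in Ω, ‖grad w x‖ ^ p = ∫ x in Ω, |val w x| ^ q := by
  obtain ⟨J, hJ, -, hE⟩ := exists_isSubcriticalPair hN hp hq hcrit hΩo hΩ
  rw [hE, mem_nehari_iff_of_embedding hp hq, lpPow_eq_integral_val hJ]
  rfl

lemma contDiff_energy (hN : 2 ≤ N) (hp : 2 ≤ p) (hq : 2 ≤ q)
    (hcrit : (q : EReal) < sobolevConj N p) (hΩo : IsOpen Ω) (hΩ : Bornology.IsBounded Ω) :
    ContDiff ℝ 2 (energy (laneEmden p q) : W0 Ω p → ℝ) := by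
  obtain ⟨J, -, -, hE⟩ := exists_isSubcriticalPair hN hp hq hcrit hΩo hΩ
  rw [hE]
  exact contDiff_powEnergy hp hq

lemma exists_smul_mem_nehari (hN : 2 ≤ N) (hp : 2 ≤ p) (hq : 2 ≤ q) (hqp : q ≠ p)
    (hcrit : (q : EReal) < sobolevConj N p) (hΩo : IsOpen Ω) (hΩ : Bornology.IsBounded Ω)
    {w : W0 Ω p} (hw : w ≠ 0) : ∃ a : ℝ, 0 < a ∧ a • w ∈ nehari (energy (laneEmden p q)) := by
  obtain ⟨J, -, hJ, hE⟩ := exists_isSubcriticalPair hN hp hq hcrit hΩo hΩ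
  obtain ⟨a, h1, h2, h3⟩ := hJ.exists_smul hp hq hqp hw
  rw [hE]
  exact ⟨a, h1, h2, h3⟩

lemma exists_path_mem_nehari (hN : 2 ≤ N) (hp : 2 ≤ p) (hq : 2 ≤ q) (hqp : q ≠ p)
    (hcrit : (q : EReal) < sobolevConj N p) (hΩo : IsOpen Ω) (hΩ : Bornology.IsBounded Ω)
    {δ : ℝ} (hδ : 0 < δ) {w : W0 Ω p} (v : W0 Ω p) (hw : w ∈ nehari (energy (laneEmden p q))) :
    ∃ ε : ℝ, 0 < ε ∧ ε ≤ δ ∧ ∃ β : ℝ → ℝ, ContDiffOn ℝ 1 β (Set.Ioo (-ε) ε) ∧ β 0 = 1 ∧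
      ∀ s ∈ Set.Ioo (-ε) ε, 0 < β s ∧ β s • (w + s • v) ∈ nehari (energy (laneEmden p q)) := by
  obtain ⟨J, -, hJ, hE⟩ := exists_isSubcriticalPair hN hp hq hcrit hΩo hΩ
  rw [hE] at hw ⊢
  obtain ⟨ε, h1, h2, β, h3, h4, h5⟩ := hJ.exists_path hp hq hqp hδ v hw.1 hw.2
  exact ⟨ε, h1, h2, β, h3, h4, fun s hs => ⟨(h5 s hs).1, (h5 s hs).2.1, (h5 s hs).2.2⟩⟩

/-- A critical point that minimizes the energy over the whole Nehari manifold. It decides both the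
existence of least energy critical points and their minimality. -/
lemma exists_critical_le_nehari (hN : 2 ≤ N) (hp : 2 ≤ p) (hq : 2 ≤ q) (hqp : q ≠ p)
    (hcrit : (q : EReal) < sobolevConj N p) (hΩo : IsOpen Ω) (hΩne : Ω.Nonempty)
    (hΩ : Bornology.IsBounded Ω) :
    ∃ w : W0 Ω p, w ≠ 0 ∧
      HasFDerivAt (energy (laneEmden p q)) (0 : W0 Ω p →L[ℝ] ℝ) w ∧
      ∀ v ∈ nehari (energy (laneEmden p q) : W0 Ω p → ℝ),
        energy (laneEmden p q) w ≤ energy (laneEmden p q) v := by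
  obtain ⟨J, -, hJ, hE⟩ := exists_isSubcriticalPair (q := q) hN hp hq hcrit hΩo hΩ
  rw [hE]
  obtain ⟨w, h1, h2, h3⟩ := hJ.exists_ground_state hp hq hqp (exists_ne_zero hΩo hΩne)
  exact ⟨w, h1, h2, fun v hv => h3 v hv.1 hv.2⟩

omit [Fact (1 ≤ ENNReal.ofReal q)] in
lemma mem_nehari_of_hasFDerivAt {E : W0 Ω p → ℝ} {w : W0 Ω p} (hw : w ≠ 0)
    (h : HasFDerivAt E (0 : W0 Ω p →L[ℝ] ℝ) w) : w ∈ nehari E := by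
  refine ⟨hw, ?_⟩
  rw [h.fderiv]
  rfl

lemma exists_isLeastEnergyCritical (hN : 2 ≤ N) (hp : 2 ≤ p) (hq : 2 ≤ q) (hqp : q ≠ p)
    (hcrit : (q : EReal) < sobolevConj N p) (hΩo : IsOpen Ω) (hΩne : Ω.Nonempty)
    (hΩ : Bornology.IsBounded Ω) :
    ∃ w : W0 Ω p, IsLeastEnergyCritical (energy (laneEmden p q)) w := by
  obtain ⟨w, h1, h2, h3⟩ := exists_critical_le_nehari hN hp hq hqp hcrit hΩo hΩne hΩ
  exact ⟨w, h1, h2, fun v hv hv' => h3 v (mem_nehari_of_hasFDerivAt hv hv')⟩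

lemma IsLeastEnergyCritical.isMinOn (hN : 2 ≤ N) (hp : 2 ≤ p) (hq : 2 ≤ q) (hqp : q ≠ p)
    (hcrit : (q : EReal) < sobolevConj N p) (hΩo : IsOpen Ω) (hΩne : Ω.Nonempty)
    (hΩ : Bornology.IsBounded Ω) {u : W0 Ω p}
    (hu : IsLeastEnergyCritical (energy (laneEmden p q)) u) :
    u ∈ nehari (energy (laneEmden p q)) ∧
      IsMinOn (energy (laneEmden p q)) (nehari (energy (laneEmden p q))) u := by
  obtain ⟨w, h1, h2, h3⟩ := exists_critical_le_nehari (q := q) hN hp hq hqp hcrit hΩo hΩne hΩ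
  exact ⟨mem_nehari_of_hasFDerivAt hu.1 hu.2.1, fun v hv => (hu.2.2 w h1 h2).trans (h3 v hv)⟩

lemma integral_rpow_val_pos (hN : 2 ≤ N) (hp : 2 ≤ p) (hq : 2 ≤ q)
    (hcrit : (q : EReal) < sobolevConj N p) (hΩo : IsOpen Ω)
    (hΩ : Bornology.IsBounded Ω) {u : W0 Ω p} (hu : u ≠ 0) : 0 < ∫ x in Ω, |val u x| ^ q := by
  obtain ⟨J, hJ, hJ', hE⟩ := exists_isSubcriticalPair (q := q) hN hp hq hcrit hΩo hΩ
  rw [← lpPow_eq_integral_val hJ]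
  exact hJ'.lpPow_right_pos hq hu

/-- The function underlying an element of `W_0^{1,p}` as an element of `L^q`. -/
lemma exists_lp_val (hN : 2 ≤ N) (hp : 2 ≤ p) (hq : 2 ≤ q)
    (hcrit : (q : EReal) < sobolevConj N p) (hΩo : IsOpen Ω) (hΩ : Bornology.IsBounded Ω)
    (w : W0 Ω p) : ∃ f : Lp ℝ (ENNReal.ofReal q) (volume.restrict Ω),
      f =ᵐ[volume.restrict Ω] val w := by
  obtain ⟨J, hJ, -, -⟩ := exists_isSubcriticalPair (p := p) hN hp hq hcrit hΩo hΩ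
  have h := hJ w
  exact ⟨_, h⟩

omit [Fact (1 ≤ ENNReal.ofReal q)] in
lemma bracket_eq_fderiv {L : ℝ → Eucl N → ℝ} {E : W0 Ω p → ℝ} (hE : energy L = E)
    (u g h : W0 Ω p) : bracket L u g h = fderiv ℝ (fderiv ℝ E) u g h := by
  subst hE
  rfl

lemma bracket_powEnergy {J : W0 Ω p →L[ℝ] Lp ℝ (ENNReal.ofReal q) (volume.restrict Ω)}
    (hp : 2 ≤ p) (hq : 2 ≤ q) (hE : energy (laneEmden p q) = powEnergy gradCLM J)
    (u g h : W0 Ω p) : bracket (laneEmden p q) u g h =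
      1 / p * lpPowD2 hp (gradL u) (gradL g) (gradL h) - 1 / q * lpPowD2 hq (J u) (J g) (J h) := by
  rw [bracket_eq_fderiv hE]
  exact fderiv_fderiv_powEnergy hp hq u g h

lemma bracket_eq (hN : 2 ≤ N) (hp : 2 ≤ p) (hq : 2 ≤ q)
    (hcrit : (q : EReal) < sobolevConj N p) (hΩo : IsOpen Ω) (hΩ : Bornology.IsBounded Ω)
    (u g h : W0 Ω p) : bracket (laneEmden p q) u g h =
      1 / p * (∫ x in Ω, normPowD2 p (grad u x) (grad g x) (grad h x)) -
        1 / q * ∫ x in Ω, normPowD2 q (val u x) (val g x) (val h x) := by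
  obtain ⟨J, hJ, -, hE⟩ := exists_isSubcriticalPair hN hp hq hcrit hΩo hΩ
  rw [bracket_powEnergy hp hq hE, lpPowD2_apply, lpPowD2_apply]
  congr 2
  refine integral_congr_ae ?_
  filter_upwards [hJ u, hJ g, hJ h] with x h1 h2 h3
  rw [h1, h2, h3]

/-- On the Nehari manifold `E''(w)(w, w) = (p - 1) A - (q - 1) B` with `A = B`. -/
lemma bracket_self (hN : 2 ≤ N) (hp : 2 ≤ p) (hq : 2 ≤ q)
    (hcrit : (q : EReal) < sobolevConj N p) (hΩo : IsOpen Ω) (hΩ : Bornology.IsBounded Ω)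
    {u : W0 Ω p} (hu : u ∈ nehari (energy (laneEmden p q))) :
    bracket (laneEmden p q) u u u = (p - q) * ∫ x in Ω, |val u x| ^ q := by
  have h1 := (mem_nehari_iff hN hp hq hcrit hΩo hΩ u).1 hu
  obtain ⟨J, hJ, -, hE⟩ := exists_isSubcriticalPair hN hp hq hcrit hΩo hΩ
  have h2 : lpPow (gradL u) = lpPow (J u) := by
    rw [lpPow_eq_integral_val hJ, ← h1.2]
    rfl
  rw [bracket_powEnergy hp hq hE, lpPowD2_self, lpPowD2_self, h2, ← lpPow_eq_integral_val hJ]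
  have hp0 : p ≠ 0 := by linarith
  have hq0 : q ≠ 0 := by linarith
  field_simp
  ring

end GroundState

/-! ### Approximation of `C¹` functions by test functions -/

section Mollification

variable {N : ℕ} {Ω : Set (Eucl N)} {p : ℝ} [Fact (1 ≤ ENNReal.ofReal p)]

omit [Fact (1 ≤ ENNReal.ofReal p)] in
/-- Mollification: a `C¹` function with compact support in `Ω` is a `C¹` limit of test
functions. -/
lemma exists_testFun_near (hΩo : IsOpen Ω) {ψ : Eucl N → ℝ} (hψ : ContDiff ℝ 1 ψ)
    (hc : HasCompactSupport ψ) (hs : tsupport ψ ⊆ Ω) {τ : ℝ} (hτ : 0 < τ) :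
    ∃ φ : Eucl N → ℝ, IsTestFun Ω φ ∧ ∀ x, ‖φ x - ψ x‖ ≤ τ ∧
      ‖gradient φ x - gradient ψ x‖ ≤ τ := by
  have hcd : HasCompactSupport (fderiv ℝ ψ) := hc.fderiv ℝ
  have hcont : Continuous (fderiv ℝ ψ) := hψ.continuous_fderiv one_ne_zero
  -- The radius `ρ` of the mollifier is small for the uniform continuity of `ψ` and of its
  -- derivative, and keeps the support inside `Ω`.
  obtain ⟨ρ₁, hρ₁, h₁⟩ := Metric.uniformContinuous_iff.1
    (hc.uniformContinuous_of_continuous hψ.continuous) τ hτ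
  obtain ⟨ρ₂, hρ₂, h₂⟩ := Metric.uniformContinuous_iff.1
    (hcd.uniformContinuous_of_continuous hcont) τ hτ
  obtain ⟨ρ₃, hρ₃, h₃⟩ := hc.isCompact.exists_cthickening_subset_open hΩo hs
  set ρ := min ρ₁ (min ρ₂ ρ₃) with hρ
  have hρ0 : 0 < ρ := lt_min hρ₁ (lt_min hρ₂ hρ₃)
  let b : ContDiffBump (0 : Eucl N) := ⟨ρ / 2, ρ, half_pos hρ0, half_lt_self hρ0⟩
  let L : ℝ →L[ℝ] ℝ →L[ℝ] ℝ := ContinuousLinearMap.lsmul ℝ ℝ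
  let φ : Eucl N → ℝ := convolution (b.normed volume) ψ L volume
  have hbl : LocallyIntegrable (b.normed (volume : Measure (Eucl N))) volume :=
    b.continuous_normed.locallyIntegrable
  have hder : ∀ x e, fderiv ℝ φ x e =
      convolution (b.normed volume) (fun a => fderiv ℝ ψ a e) L volume x := fun x e => by
    rw [(hc.hasFDerivAt_convolution_right L hbl hψ x).fderiv]
    exact convolution_precompR_apply L hbl hcd hcont x e
  refine ⟨φ, ⟨?_, ?_, ?_⟩, fun x => ⟨?_, ?_⟩⟩
  · exact b.hasCompactSupport_normed.contDiff_convolution_left L b.contDiff_normed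
      hψ.continuous.locallyIntegrable
  · exact b.hasCompactSupport_normed.convolution L hc
  · have h4 : tsupport φ ⊆ Metric.cthickening ρ (tsupport ψ) := by
      refine closure_minimal ?_ Metric.isClosed_cthickening
      refine (support_convolution_subset L).trans ?_
      rintro _ ⟨y, hy, z, hz, rfl⟩
      rw [b.support_normed_eq, mem_ball_zero_iff] at hy
      refine Metric.mem_cthickening_of_dist_le _ z _ _ (subset_tsupport _ hz) ?_
      simpa using hy.le
    refine h4.trans ((Metric.cthickening_mono ?_ _).trans h₃)
    exact (min_le_right _ _).trans (min_le_right _ _)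
  · rw [← dist_eq_norm]
    refine b.dist_normed_convolution_le hψ.continuous.aestronglyMeasurable fun y hy => ?_
    exact (h₁ (lt_of_lt_of_le hy (min_le_left _ _))).le
  · rw [gradient, gradient, ← map_sub, LinearIsometryEquiv.norm_map]
    refine ContinuousLinearMap.opNorm_le_bound _ hτ.le fun e => ?_
    rw [sub_apply, hder, ← dist_eq_norm]
    refine b.dist_normed_convolution_le
      (hcont.clm_apply continuous_const).aestronglyMeasurable fun y hy => ?_
    have h4 := (h₂ (lt_of_lt_of_le hy ((min_le_right _ _).trans (min_le_left _ _)))).le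
    rw [dist_eq_norm] at h4 ⊢
    exact ContinuousLinearMap.le_of_opNorm_le _ h4 e

/-- `C¹` functions with compact support in `Ω` belong to `W_0^{1,p}(Ω)`. -/
lemma exists_of_contDiff_one (hΩo : IsOpen Ω) (hΩ : Bornology.IsBounded Ω) {ψ : Eucl N → ℝ}
    (hψ : ContDiff ℝ 1 ψ) (hc : HasCompactSupport ψ) (hs : tsupport ψ ⊆ Ω) :
    ∃ w : W0 Ω p, val w =ᵐ[volume.restrict Ω] ψ ∧
      grad w =ᵐ[volume.restrict Ω] gradient ψ := by
  have hfin : IsFiniteMeasure (volume.restrict Ω) := ⟨by simpa using hΩ.measure_lt_top⟩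
  have m1 := memLp_restrict_of_hasCompactSupport (Ω := Ω) hψ.continuous hc (ENNReal.ofReal p)
  have m2 := memLp_restrict_of_hasCompactSupport (Ω := Ω) (continuous_gradient hψ)
    (hasCompactSupport_gradient hc) (ENNReal.ofReal p)
  have hmem : (m1.toLp ψ, m2.toLp (gradient ψ)) ∈ W0 Ω p := by
    refine Metric.mem_closure_iff.2 fun ε hε => ?_
    set D := (measureUnivNNReal (volume.restrict Ω) : ℝ) ^ (ENNReal.ofReal p).toReal⁻¹ with hD
    have hD0 : 0 ≤ D := by positivity
    obtain ⟨φ, hφ, hnear⟩ := exists_testFun_near hΩo hψ hc hs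
      (show 0 < ε / (2 * (D + 1)) by positivity)
    have k1 := memLp_restrict_of_hasCompactSupport (Ω := Ω) hφ.1.continuous hφ.2.1
      (ENNReal.ofReal p)
    have k2 := memLp_restrict_of_hasCompactSupport (Ω := Ω)
      (continuous_gradient (hφ.1.of_le (by simp))) (hasCompactSupport_gradient hφ.2.1)
      (ENNReal.ofReal p)
    have hlt : D * (ε / (2 * (D + 1))) < ε := by
      rw [← mul_div_assoc, div_lt_iff₀ (by positivity)]
      nlinarith
    refine ⟨(k1.toLp φ, k2.toLp (gradient φ)), ⟨φ, hφ.1, hφ.2.1, hφ.2.2, k1.coeFn_toLp,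
      k2.coeFn_toLp⟩, ?_⟩
    rw [Prod.dist_eq]
    refine max_lt ?_ ?_
    · rw [dist_eq_norm, ← MemLp.toLp_sub]
      refine lt_of_le_of_lt (Lp.norm_le_of_ae_bound (C := ε / (2 * (D + 1))) (by positivity) ?_) hlt
      filter_upwards [(m1.sub k1).coeFn_toLp] with x hx
      rw [hx, Pi.sub_apply, norm_sub_rev]
      exact (hnear x).1
    · rw [dist_eq_norm, ← MemLp.toLp_sub]
      refine lt_of_le_of_lt (Lp.norm_le_of_ae_bound (C := ε / (2 * (D + 1))) (by positivity) ?_) hlt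
      filter_upwards [(m2.sub k2).coeFn_toLp] with x hx
      rw [hx, Pi.sub_apply, norm_sub_rev]
      exact (hnear x).2
  exact ⟨⟨_, hmem⟩, m1.coeFn_toLp, m2.coeFn_toLp⟩

end Mollification

/-! ### Operators near the identity -/

section NearIdentity

variable {E : Type*} [NormedAddCommGroup E] [InnerProductSpace ℝ E] [FiniteDimensional ℝ E]

omit [FiniteDimensional ℝ E] in
lemma norm_sub_self_le {A : E →L[ℝ] E} (hA : ‖A - 1‖ ≤ 1 / 2) (z : E) :
    ‖A z - z‖ ≤ 1 / 2 * ‖z‖ := by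
  have := ContinuousLinearMap.le_of_opNorm_le _ hA z
  simpa using this

omit [FiniteDimensional ℝ E] in
lemma norm_le_two_mul {A : E →L[ℝ] E} (hA : ‖A - 1‖ ≤ 1 / 2) (z : E) : ‖z‖ ≤ 2 * ‖A z‖ := by
  have h1 := norm_sub_self_le hA z
  have h2 := norm_sub_norm_le z (A z)
  rw [norm_sub_rev] at h1
  linarith

omit [FiniteDimensional ℝ E] in
lemma norm_apply_le_two_mul {A : E →L[ℝ] E} (hA : ‖A - 1‖ ≤ 1 / 2) (z : E) :
    ‖A z‖ ≤ 2 * ‖z‖ := by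
  have h1 := norm_sub_self_le hA z
  have h2 := norm_sub_norm_le (A z) z
  linarith [norm_nonneg z]

lemma norm_adjoint_sub_one {A : E →L[ℝ] E} (hA : ‖A - 1‖ ≤ 1 / 2) :
    ‖ContinuousLinearMap.adjoint A - 1‖ ≤ 1 / 2 := by
  have h1 : ContinuousLinearMap.adjoint A - 1 = ContinuousLinearMap.adjoint (A - 1) := by
    rw [map_sub]
    congr 1
    exact (star_one (E →L[ℝ] E)).symm
  rw [h1, LinearIsometryEquiv.norm_map]
  exact hA

lemma isUnit_of_norm_sub_one_le {A : E →L[ℝ] E} (hA : ‖A - 1‖ ≤ 1 / 2) : IsUnit A := by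
  have h : IsUnit (1 - (1 - A)) := isUnit_one_sub_of_norm_lt_one (by
    rw [norm_sub_rev]
    linarith)
  rwa [sub_sub_cancel] at h

lemma det_ne_zero_of_norm_sub_one_le {A : E →L[ℝ] E} (hA : ‖A - 1‖ ≤ 1 / 2) : A.det ≠ 0 := by
  obtain ⟨u, rfl⟩ := isUnit_of_norm_sub_one_le hA
  intro h
  have h1 : ((u : E →L[ℝ] E) * ((u⁻¹ : (E →L[ℝ] E)ˣ) : E →L[ℝ] E)).det = 1 := by
    rw [u.mul_inv]
    exact LinearMap.det_id
  have h2 : ((u : E →L[ℝ] E) * ((u⁻¹ : (E →L[ℝ] E)ˣ) : E →L[ℝ] E)).det =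
      (u : E →L[ℝ] E).det * ((u⁻¹ : (E →L[ℝ] E)ˣ) : E →L[ℝ] E).det :=
    LinearMap.det_comp _ _
  rw [h2, h, zero_mul] at h1
  exact zero_ne_one h1

/-- The determinant does not vanish on the ball of radius `1/2` about the identity, which is
connected, and it is `1` at the centre. -/
lemma det_pos_of_norm_sub_one_le {A : E →L[ℝ] E} (hA : ‖A - 1‖ ≤ 1 / 2) : 0 < A.det := by
  have hconv : IsPreconnected (Metric.closedBall (1 : E →L[ℝ] E) (1 / 2)) :=
    (convex_closedBall _ _).isPreconnected
  have hcont : ContinuousOn (fun B : E →L[ℝ] E => B.det) (Metric.closedBall 1 (1 / 2)) :=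
    ContinuousLinearMap.continuous_det.continuousOn
  by_contra hneg
  have h1 : (1 : E →L[ℝ] E) ∈ Metric.closedBall (1 : E →L[ℝ] E) (1 / 2) :=
    Metric.mem_closedBall_self (by norm_num)
  have hd1 : (1 : E →L[ℝ] E).det = 1 := LinearMap.det_id
  have hA' : A ∈ Metric.closedBall (1 : E →L[ℝ] E) (1 / 2) := by
    rw [mem_closedBall_iff_norm]
    exact hA
  have h2 := hconv.intermediate_value hA' h1 hcont
  obtain ⟨B, hB, hB'⟩ := h2 ⟨not_lt.1 hneg, by rw [hd1]; exact zero_le_one⟩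
  rw [mem_closedBall_iff_norm] at hB
  exact det_ne_zero_of_norm_sub_one_le hB hB'

/-- Two-sided bounds, by compactness of the ball. -/
lemma exists_det_bounds : ∃ c C : ℝ, 0 < c ∧ 0 < C ∧ ∀ A : E →L[ℝ] E, ‖A - 1‖ ≤ 1 / 2 →
    c ≤ A.det ∧ A.det ≤ C := by
  have hK : IsCompact (Metric.closedBall (1 : E →L[ℝ] E) (1 / 2)) := isCompact_closedBall _ _
  have hne : (Metric.closedBall (1 : E →L[ℝ] E) (1 / 2)).Nonempty :=
    ⟨1, Metric.mem_closedBall_self (by norm_num)⟩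
  have hcont : ContinuousOn (fun B : E →L[ℝ] E => B.det) (Metric.closedBall 1 (1 / 2)) :=
    ContinuousLinearMap.continuous_det.continuousOn
  obtain ⟨A, hA, hmin⟩ := hK.exists_isMinOn hne hcont
  obtain ⟨B, hB, hmax⟩ := hK.exists_isMaxOn hne hcont
  rw [mem_closedBall_iff_norm] at hA hB
  refine ⟨A.det, B.det, det_pos_of_norm_sub_one_le hA, det_pos_of_norm_sub_one_le hB,
    fun T hT => ?_⟩
  have hT' : T ∈ Metric.closedBall (1 : E →L[ℝ] E) (1 / 2) := by
    rw [mem_closedBall_iff_norm]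
    exact hT
  exact ⟨hmin hT', hmax hT'⟩

end NearIdentity

/-! ### Small deformations of a domain -/

section Deformation

variable {N : ℕ} {Ω : Set (Eucl N)} {Φ : Eucl N → Eucl N}

/-- A `C¹` map of `Ω` at Lipschitz distance at most `1/2` from the identity. -/
structure IsSmallDeformation (Φ : Eucl N → Eucl N) (Ω : Set (Eucl N)) : Prop where
  contDiffOn : ContDiffOn ℝ 1 Φ Ω
  lipschitz : LipschitzOnWith 2⁻¹ (fun x => Φ x - x) Ω

lemma IsSmallDeformation.hasFDerivAt (h : IsSmallDeformation Φ Ω) (hΩo : IsOpen Ω) {x : Eucl N}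
    (hx : x ∈ Ω) : HasFDerivAt Φ (fderiv ℝ Φ x) x :=
  ((h.contDiffOn.contDiffAt (hΩo.mem_nhds hx)).differentiableAt one_ne_zero).hasFDerivAt

lemma IsSmallDeformation.norm_fderiv_sub_one_le (h : IsSmallDeformation Φ Ω) (hΩo : IsOpen Ω)
    {x : Eucl N} (hx : x ∈ Ω) : ‖fderiv ℝ Φ x - 1‖ ≤ 1 / 2 := by
  have h1 : HasFDerivAt (fun x => Φ x - x) (fderiv ℝ Φ x - 1) x :=
    (h.hasFDerivAt hΩo hx).sub (hasFDerivAt_id x)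
  have h2 := h1.le_of_lipschitzOn (hΩo.mem_nhds hx) h.lipschitz
  simpa using h2

lemma IsSmallDeformation.injOn (h : IsSmallDeformation Φ Ω) : Set.InjOn Φ Ω := by
  intro x hx y hy hxy
  have h1 := h.lipschitz.norm_sub_le hx hy
  rw [hxy, sub_sub_sub_cancel_left, norm_sub_rev] at h1
  have h2 : ‖x - y‖ ≤ 2⁻¹ * ‖x - y‖ := by simpa using h1
  have h3 : ‖x - y‖ = 0 := by linarith [norm_nonneg (x - y)]
  exact sub_eq_zero.1 (norm_eq_zero.1 h3)

/-- A small deformation is a homeomorphism onto an open set, by the Lipschitz form of the inverse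
function theorem. -/
lemma IsSmallDeformation.exists_homeomorph (h : IsSmallDeformation Φ Ω) (hΩo : IsOpen Ω) :
    ∃ e : OpenPartialHomeomorph (Eucl N) (Eucl N), (e : Eucl N → Eucl N) = Φ ∧ e.source = Ω ∧
      e.target = Φ '' Ω := by
  have h1 : ApproximatesLinearOn Φ
      ((ContinuousLinearEquiv.refl ℝ (Eucl N) : Eucl N ≃L[ℝ] Eucl N) : Eucl N →L[ℝ] Eucl N)
      Ω 2⁻¹ := by
    refine ApproximatesLinearOn.approximatesLinearOn_iff_lipschitzOnWith.2 ?_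
    exact h.lipschitz
  have h2 : Subsingleton (Eucl N) ∨ (2⁻¹ : NNReal) <
      ‖((ContinuousLinearEquiv.refl ℝ (Eucl N)).symm : Eucl N →L[ℝ] Eucl N)‖₊⁻¹ := by
    rcases subsingleton_or_nontrivial (Eucl N) with h0 | h0
    · exact Or.inl h0
    · right
      have h3 : ‖((ContinuousLinearEquiv.refl ℝ (Eucl N)).symm : Eucl N →L[ℝ] Eucl N)‖₊ = 1 := by
        have : ((ContinuousLinearEquiv.refl ℝ (Eucl N)).symm : Eucl N →L[ℝ] Eucl N) =
          ContinuousLinearMap.id ℝ (Eucl N) := rfl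
        rw [this]
        exact ContinuousLinearMap.nnnorm_id
      rw [h3, inv_one]
      exact inv_lt_one_of_one_lt₀ (by norm_num)
  exact ⟨h1.toOpenPartialHomeomorph Φ Ω h2 hΩo, rfl, rfl, rfl⟩

lemma IsSmallDeformation.isOpen_image (h : IsSmallDeformation Φ Ω) (hΩo : IsOpen Ω) :
    IsOpen (Φ '' Ω) := by
  obtain ⟨e, -, -, he⟩ := h.exists_homeomorph hΩo
  rw [← he]
  exact e.open_target

lemma IsSmallDeformation.isBounded_image (h : IsSmallDeformation Φ Ω)
    (hΩ : Bornology.IsBounded Ω) : Bornology.IsBounded (Φ '' Ω) := by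
  obtain ⟨M, hM⟩ := Metric.isBounded_iff.1 hΩ
  refine Metric.isBounded_iff.2 ⟨2 * M, ?_⟩
  rintro _ ⟨x, hx, rfl⟩ _ ⟨y, hy, rfl⟩
  have h1 := h.lipschitz.norm_sub_le hx hy
  have h2 : ‖(Φ x - x) - (Φ y - y)‖ ≤ 2⁻¹ * ‖x - y‖ := by simpa using h1
  have h3 := hM hx hy
  have h4 := norm_add_le ((Φ x - x) - (Φ y - y)) (x - y)
  rw [show (Φ x - x) - (Φ y - y) + (x - y) = Φ x - Φ y by abel] at h4
  rw [dist_eq_norm] at h3 ⊢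
  linarith [norm_nonneg (x - y)]

/-- Null sets of `Φ(Ω)` are pulled back to null sets. -/
lemma IsSmallDeformation.ae_comp (h : IsSmallDeformation Φ Ω) (hΩo : IsOpen Ω)
    {P : Eucl N → Prop} (hP : ∀ᵐ y ∂(volume.restrict (Φ '' Ω)), P y) :
    ∀ᵐ x ∂(volume.restrict Ω), P (Φ x) := by
  have hm : MeasurableSet (Φ '' Ω) := (h.isOpen_image hΩo).measurableSet
  rw [ae_restrict_iff' hm] at hP
  rw [ae_restrict_iff' hΩo.measurableSet]
  obtain ⟨e, he, hs, ht⟩ := h.exists_homeomorph hΩo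
  have hnull : volume (Φ '' Ω ∩ {y | ¬ P y}) = 0 := by
    refine measure_mono_null ?_ hP
    rintro y ⟨h1, h2⟩ h3
    exact h2 (h3 h1)
  have hdiff : DifferentiableOn ℝ e.symm (Φ '' Ω ∩ {y | ¬ P y}) := by
    rintro y ⟨hy, -⟩
    have hx : e.symm y ∈ Ω := hs ▸ e.map_target (ht ▸ hy)
    obtain ⟨u, hu⟩ := isUnit_of_norm_sub_one_le (h.norm_fderiv_sub_one_le hΩo hx)
    have h1 : HasFDerivAt e ((ContinuousLinearEquiv.unitsEquiv ℝ (Eucl N) u :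
        Eucl N ≃L[ℝ] Eucl N) : Eucl N →L[ℝ] Eucl N) (e.symm y) := by
      have h2 := h.hasFDerivAt hΩo hx
      rw [← hu] at h2
      rw [he]
      exact h2
    exact (e.hasFDerivAt_symm (ht ▸ hy) h1).differentiableAt.differentiableWithinAt
  have h2 := addHaar_image_eq_zero_of_differentiableOn_of_addHaar_eq_zero volume hdiff hnull
  refine measure_mono_null ?_ h2
  intro x hx
  simp only [Set.mem_compl_iff, Set.mem_ofPred_eq, Classical.not_imp] at hx
  refine ⟨Φ x, ⟨⟨x, hx.1, rfl⟩, hx.2⟩, ?_⟩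
  rw [← he]
  exact e.left_inv (hs ▸ hx.1)

lemma IsSmallDeformation.lintegral_image (h : IsSmallDeformation Φ Ω) (hΩo : IsOpen Ω)
    (g : Eucl N → ENNReal) : ∫⁻ y in Φ '' Ω, g y =
      ∫⁻ x in Ω, ENNReal.ofReal (fderiv ℝ Φ x).det * g (Φ x) := by
  rw [lintegral_image_eq_lintegral_abs_det_fderiv_mul volume hΩo.measurableSet
    (fun x hx => (h.hasFDerivAt hΩo hx).hasFDerivWithinAt) h.injOn]
  refine setLIntegral_congr_fun hΩo.measurableSet fun x hx => ?_
  rw [abs_of_pos (det_pos_of_norm_sub_one_le (h.norm_fderiv_sub_one_le hΩo hx))]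

lemma IsSmallDeformation.integral_image (h : IsSmallDeformation Φ Ω) (hΩo : IsOpen Ω)
    (g : Eucl N → ℝ) : ∫ y in Φ '' Ω, g y = ∫ x in Ω, (fderiv ℝ Φ x).det * g (Φ x) := by
  rw [integral_image_eq_integral_abs_det_fderiv_smul volume hΩo.measurableSet
    (fun x hx => (h.hasFDerivAt hΩo hx).hasFDerivWithinAt) h.injOn]
  refine setIntegral_congr_fun hΩo.measurableSet fun x hx => ?_
  simp only [smul_eq_mul]
  rw [abs_of_pos (det_pos_of_norm_sub_one_le (h.norm_fderiv_sub_one_le hΩo hx))]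

/-- Composition with `Φ` is bounded below and above on `L^p`. -/
lemma exists_eLpNorm_comp_bounds (N : ℕ) {p : ℝ} (hp : 0 < p) : ∃ C : NNReal,
    ∀ {Ω : Set (Eucl N)} {Φ : Eucl N → Eucl N}, IsSmallDeformation Φ Ω → IsOpen Ω →
    ∀ {F : Type} [NormedAddCommGroup F] (f : Eucl N → F),
      eLpNorm f (ENNReal.ofReal p) (volume.restrict (Φ '' Ω)) ≤
        C * eLpNorm (fun x => f (Φ x)) (ENNReal.ofReal p) (volume.restrict Ω) ∧
      eLpNorm (fun x => f (Φ x)) (ENNReal.ofReal p) (volume.restrict Ω) ≤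
        C * eLpNorm f (ENNReal.ofReal p) (volume.restrict (Φ '' Ω)) := by
  -- The constant depends only on bounds for the Jacobian determinant of the change of variables.
  obtain ⟨c, C, hc, hC, hb⟩ := exists_det_bounds (E := Eucl N)
  have hpow : ∀ {a b : ENNReal} {D : ℝ}, 0 < D → a ≤ ENNReal.ofReal D * b →
      a ^ (1 / p) ≤ (Real.toNNReal (D ^ (1 / p)) : ENNReal) * b ^ (1 / p) := by
    intro a b D hD hab
    have h1 := ENNReal.rpow_le_rpow hab (show 0 ≤ 1 / p by positivity)
    rwa [ENNReal.mul_rpow_of_nonneg _ _ (by positivity),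
      ENNReal.ofReal_rpow_of_pos hD] at h1
  refine ⟨Real.toNNReal (C ^ (1 / p)) + Real.toNNReal (c⁻¹ ^ (1 / p)),
    fun {Ω Φ} h hΩo {F} _ f => ?_⟩
  have hp0 : ENNReal.ofReal p ≠ 0 := by simpa using hp
  rw [eLpNorm_eq_lintegral_rpow_enorm_toReal hp0 ENNReal.ofReal_ne_top,
    eLpNorm_eq_lintegral_rpow_enorm_toReal hp0 ENNReal.ofReal_ne_top,
    ENNReal.toReal_ofReal hp.le, h.lintegral_image hΩo]
  constructor
  · refine (hpow hC ?_).trans (mul_le_mul_left (by push_cast; exact le_self_add) _)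
    rw [← lintegral_const_mul' _ _ ENNReal.ofReal_ne_top]
    refine setLIntegral_mono' hΩo.measurableSet fun x hx => ?_
    gcongr
    exact (hb _ (h.norm_fderiv_sub_one_le hΩo hx)).2
  · refine (hpow (inv_pos.2 hc) ?_).trans (mul_le_mul_left (by push_cast; exact le_add_self) _)
    rw [← lintegral_const_mul' _ _ ENNReal.ofReal_ne_top]
    refine setLIntegral_mono' hΩo.measurableSet fun x hx => ?_
    rw [← mul_assoc, ← ENNReal.ofReal_mul (inv_nonneg.2 hc.le)]
    refine le_mul_of_one_le_left zero_le ?_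
    rw [ENNReal.one_le_ofReal, inv_mul_eq_div, one_le_div hc]
    exact (hb _ (h.norm_fderiv_sub_one_le hΩo hx)).1

end Deformation

/-! ### Transport of `W_0^{1,p}` under a small deformation -/

section Transport

variable {N : ℕ} {Ω : Set (Eucl N)} {Φ : Eucl N → Eucl N} {p : ℝ} [Fact (1 ≤ ENNReal.ofReal p)]

omit [Fact (1 ≤ ENNReal.ofReal p)] in
/-- Null sets of `Ω` are mapped to null sets. -/
lemma IsSmallDeformation.ae_of_ae_comp (h : IsSmallDeformation Φ Ω) (hΩo : IsOpen Ω)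
    {P : Eucl N → Prop} (hP : ∀ᵐ x ∂(volume.restrict Ω), P (Φ x)) :
    ∀ᵐ y ∂(volume.restrict (Φ '' Ω)), P y := by
  have hm : MeasurableSet (Φ '' Ω) := (h.isOpen_image hΩo).measurableSet
  rw [ae_restrict_iff' hm]
  rw [ae_restrict_iff' hΩo.measurableSet] at hP
  have hnull : volume (Ω ∩ {x | ¬ P (Φ x)}) = 0 := by
    refine measure_mono_null ?_ hP
    rintro y ⟨h1, h2⟩ h3
    exact h2 (h3 h1)
  have hdiff : DifferentiableOn ℝ Φ (Ω ∩ {x | ¬ P (Φ x)}) := fun x hx =>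
    (h.hasFDerivAt hΩo hx.1).differentiableAt.differentiableWithinAt
  have h2 := addHaar_image_eq_zero_of_differentiableOn_of_addHaar_eq_zero volume hdiff hnull
  refine measure_mono_null ?_ h2
  intro y hy
  simp only [Set.mem_compl_iff, Set.mem_ofPred_eq, Classical.not_imp] at hy
  obtain ⟨⟨x, hx, rfl⟩, hy⟩ := hy
  exact ⟨x, ⟨hx, hy⟩, rfl⟩

omit [Fact (1 ≤ ENNReal.ofReal p)] in
lemma IsSmallDeformation.aestronglyMeasurable_comp (h : IsSmallDeformation Φ Ω) (hΩo : IsOpen Ω)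
    {F : Type*} [TopologicalSpace F] {f : Eucl N → F}
    (hf : AEStronglyMeasurable f (volume.restrict (Φ '' Ω))) :
    AEStronglyMeasurable (fun x => f (Φ x)) (volume.restrict Ω) :=
  AEStronglyMeasurable.congr
    (hf.stronglyMeasurable_mk.aestronglyMeasurable.comp_aemeasurable
      (h.contDiffOn.continuousOn.aemeasurable hΩo.measurableSet))
    ((h.ae_comp hΩo hf.ae_eq_mk).mono fun _ hx => hx.symm)

omit [Fact (1 ≤ ENNReal.ofReal p)] in
/-- The function `φ ∘ Φ⁻¹`, extended by zero, for a test function `φ`. -/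
lemma IsSmallDeformation.exists_pushforward (h : IsSmallDeformation Φ Ω) (hΩo : IsOpen Ω)
    {φ : Eucl N → ℝ} (hφ : IsTestFun Ω φ) :
    ∃ ψ : Eucl N → ℝ, ContDiff ℝ 1 ψ ∧ HasCompactSupport ψ ∧ tsupport ψ ⊆ Φ '' Ω ∧
      ∀ x ∈ Ω, ψ (Φ x) = φ x ∧
        ContinuousLinearMap.adjoint (fderiv ℝ Φ x) (gradient ψ (Φ x)) = gradient φ x := by
  classical
  obtain ⟨e, he, hs, ht⟩ := h.exists_homeomorph hΩo
  let ψ : Eucl N → ℝ := fun y => if y ∈ Φ '' Ω then φ (e.symm y) else 0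
  have hψΦ : ∀ x ∈ Ω, ψ (Φ x) = φ x := fun x hx => by
    have h1 : e.symm (Φ x) = x := by
      rw [← he]
      exact e.left_inv (hs ▸ hx)
    simp only [ψ, if_pos (Set.mem_image_of_mem Φ hx), h1]
  have hK : IsCompact (Φ '' tsupport φ) :=
    hφ.2.1.isCompact.image_of_continuousOn (h.contDiffOn.continuousOn.mono hφ.2.2)
  have hzero : ∀ y, y ∉ Φ '' tsupport φ → ψ y = 0 := fun y hy => by
    by_cases hyΩ : y ∈ Φ '' Ω
    · obtain ⟨x, hx, rfl⟩ := hyΩ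
      rw [hψΦ x hx]
      exact image_eq_zero_of_notMem_tsupport fun h' => hy ⟨x, h', rfl⟩
    · simp only [ψ, if_neg hyΩ]
  have hsupp : tsupport ψ ⊆ Φ '' tsupport φ :=
    closure_minimal (fun y hy => by_contra fun hy' => hy (hzero y hy')) hK.isClosed
  -- Near points of `Φ(Ω)` the function `ψ` is `φ ∘ Φ⁻¹`, of class `C¹` by the inverse
  -- function theorem; near all other points it vanishes, as `Φ (tsupport φ)` is closed.
  have hψ : ContDiff ℝ 1 ψ := by
    refine contDiff_iff_contDiffAt.2 fun y => ?_
    by_cases hyΩ : y ∈ Φ '' Ω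
    · have hx : e.symm y ∈ Ω := hs ▸ e.map_target (ht ▸ hyΩ)
      obtain ⟨u, hu⟩ := isUnit_of_norm_sub_one_le (h.norm_fderiv_sub_one_le hΩo hx)
      have h1 : HasFDerivAt e ((ContinuousLinearEquiv.unitsEquiv ℝ (Eucl N) u :
          Eucl N ≃L[ℝ] Eucl N) : Eucl N →L[ℝ] Eucl N) (e.symm y) := by
        have h2 := h.hasFDerivAt hΩo hx
        rw [← hu] at h2
        rw [he]
        exact h2
      have h2 : ContDiffAt ℝ 1 e (e.symm y) := by
        rw [he]
        exact h.contDiffOn.contDiffAt (hΩo.mem_nhds hx)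
      have h3 : ContDiffAt ℝ 1 (fun y => φ (e.symm y)) y :=
        (hφ.1.of_le (by simp)).contDiffAt.comp y (e.contDiffAt_symm (ht ▸ hyΩ) h1 h2)
      refine h3.congr_of_eventuallyEq ?_
      filter_upwards [(h.isOpen_image hΩo).mem_nhds hyΩ] with z hz
      simp only [ψ, if_pos hz]
    · have h1 : y ∉ Φ '' tsupport φ := fun h' => hyΩ (Set.image_mono hφ.2.2 h')
      refine (contDiffAt_const (c := (0 : ℝ))).congr_of_eventuallyEq ?_
      filter_upwards [hK.isClosed.isOpen_compl.mem_nhds h1] with z hz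
      exact hzero z hz
  refine ⟨ψ, hψ, HasCompactSupport.intro hK hzero, hsupp.trans (Set.image_mono hφ.2.2),
    fun x hx => ⟨hψΦ x hx, ?_⟩⟩
  have h1 : HasFDerivAt φ ((fderiv ℝ ψ (Φ x)).comp (fderiv ℝ Φ x)) x := by
    refine (((hψ.differentiable one_ne_zero (Φ x)).hasFDerivAt).comp x
      (h.hasFDerivAt hΩo hx)).congr_of_eventuallyEq ?_
    filter_upwards [hΩo.mem_nhds hx] with z hz
    exact (hψΦ z hz).symm
  refine ext_inner_right ℝ fun v => ?_
  rw [ContinuousLinearMap.adjoint_inner_left, inner_gradient, inner_gradient, h1.fderiv]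
  rfl

/-- `W = w ∘ Φ⁻¹`, together with the chain rule for the weak gradients. -/
def IsPushforward (Φ : Eucl N → Eucl N) (w : W0 Ω p) (W : W0 (Φ '' Ω) p) : Prop :=
  IsTransport Φ w W ∧ ∀ᵐ x ∂(volume.restrict Ω),
    ContinuousLinearMap.adjoint (fderiv ℝ Φ x) (grad W (Φ x)) = grad w x

lemma IsPushforward.sub (h : IsSmallDeformation Φ Ω) (hΩo : IsOpen Ω) {w v : W0 Ω p}
    {W V : W0 (Φ '' Ω) p} (hw : IsPushforward Φ w W) (hv : IsPushforward Φ v V) :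
    IsPushforward Φ (w - v) (W - V) := by
  constructor
  · filter_upwards [hw.1, hv.1, val_sub w v, h.ae_comp hΩo (val_sub W V)] with x h1 h2 h3 h4
    rw [h3, h4, h1, h2]
  · filter_upwards [hw.2, hv.2, grad_sub w v, h.ae_comp hΩo (grad_sub W V)] with x h1 h2 h3 h4
    rw [h3, h4, map_sub, h1, h2]

lemma eLpNorm_val_le (w : W0 Ω p) :
    eLpNorm (val w) (ENNReal.ofReal p) (volume.restrict Ω) ≤ ENNReal.ofReal ‖w‖ := by
  have h1 : ‖valL w‖ ≤ ‖w‖ := by rw [norm_eq_max]; exact le_max_left _ _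
  have h2 : eLpNorm (val w) (ENNReal.ofReal p) (volume.restrict Ω) = ENNReal.ofReal ‖valL w‖ := by
    rw [ofReal_norm, Lp.enorm_def]
    rfl
  rw [h2]
  exact ENNReal.ofReal_le_ofReal h1

lemma eLpNorm_grad_le (w : W0 Ω p) :
    eLpNorm (grad w) (ENNReal.ofReal p) (volume.restrict Ω) ≤ ENNReal.ofReal ‖w‖ := by
  have h1 : ‖gradL w‖ ≤ ‖w‖ := by rw [norm_eq_max]; exact le_max_right _ _
  have h2 : eLpNorm (grad w) (ENNReal.ofReal p) (volume.restrict Ω) = ENNReal.ofReal ‖gradL w‖ := by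
    rw [ofReal_norm, Lp.enorm_def]
    rfl
  rw [h2]
  exact ENNReal.ofReal_le_ofReal h1

lemma norm_le_of_eLpNorm_le {w : W0 Ω p} {C : ℝ} (hC : 0 ≤ C)
    (h1 : eLpNorm (val w) (ENNReal.ofReal p) (volume.restrict Ω) ≤ ENNReal.ofReal C)
    (h2 : eLpNorm (grad w) (ENNReal.ofReal p) (volume.restrict Ω) ≤ ENNReal.ofReal C) :
    ‖w‖ ≤ C := by
  rw [norm_eq_max]
  refine max_le ?_ ?_
  · rw [Lp.norm_def]
    exact ENNReal.toReal_le_of_le_ofReal hC h1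
  · rw [Lp.norm_def]
    exact ENNReal.toReal_le_of_le_ofReal hC h2

lemma exists_norm_pushforward_le (hp : 2 ≤ p) (h : IsSmallDeformation Φ Ω) (hΩo : IsOpen Ω) :
    ∃ C : ℝ, 0 ≤ C ∧ ∀ (w : W0 Ω p) (W : W0 (Φ '' Ω) p), IsPushforward Φ w W →
      ‖W‖ ≤ C * ‖w‖ := by
  obtain ⟨C, hC⟩ := exists_eLpNorm_comp_bounds N (show 0 < p by linarith)
  refine ⟨2 * C, by positivity, fun w W hW => ?_⟩
  refine norm_le_of_eLpNorm_le (by positivity) ?_ ?_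
  · refine ((hC h hΩo (val W)).1).trans ?_
    rw [eLpNorm_congr_ae (show (fun x => val W (Φ x)) =ᵐ[volume.restrict Ω] val w from hW.1)]
    refine (mul_le_mul_right (eLpNorm_val_le w) _).trans ?_
    rw [mul_assoc, ← ENNReal.ofReal_coe_nnreal, ← ENNReal.ofReal_mul (by positivity)]
    refine ENNReal.ofReal_le_ofReal ?_
    nlinarith [norm_nonneg w, C.coe_nonneg, mul_nonneg C.coe_nonneg (norm_nonneg w)]
  · refine ((hC h hΩo (grad W)).1).trans ?_
    have h1 : eLpNorm (fun x => grad W (Φ x)) (ENNReal.ofReal p) (volume.restrict Ω) ≤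
        ENNReal.ofReal 2 * eLpNorm (grad w) (ENNReal.ofReal p) (volume.restrict Ω) := by
      refine eLpNorm_le_mul_eLpNorm_of_ae_le_mul ?_ _
      filter_upwards [hW.2, ae_restrict_mem hΩo.measurableSet] with x hx hxΩ
      rw [← hx]
      exact norm_le_two_mul (norm_adjoint_sub_one (h.norm_fderiv_sub_one_le hΩo hxΩ)) _
    refine (mul_le_mul_right (h1.trans (mul_le_mul_right (eLpNorm_grad_le w) _)) _).trans ?_
    rw [← ENNReal.ofReal_coe_nnreal, ← ENNReal.ofReal_mul (by positivity),
      ← ENNReal.ofReal_mul (by positivity)]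
    refine ENNReal.ofReal_le_ofReal (le_of_eq ?_)
    ring

omit [Fact (1 ≤ ENNReal.ofReal p)] in
lemma ae_eq_zero_of_norm_le_add {X F : Type*} [MeasurableSpace X] {μ : Measure X}
    [NormedAddCommGroup F] (hp : 1 ≤ p) {D : X → F} (hD : AEStronglyMeasurable D μ)
    {a b : ℕ → X → ℝ} (ha : ∀ n, AEStronglyMeasurable (a n) μ)
    (hb : ∀ n, AEStronglyMeasurable (b n) μ) (hle : ∀ n, ∀ᵐ x ∂μ, ‖D x‖ ≤ a n x + b n x)
    (ha0 : Tendsto (fun n => eLpNorm (a n) (ENNReal.ofReal p) μ) atTop (𝓝 0))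
    (hb0 : Tendsto (fun n => eLpNorm (b n) (ENNReal.ofReal p) μ) atTop (𝓝 0)) :
    D =ᵐ[μ] 0 := by
  have h1 : ∀ n, eLpNorm D (ENNReal.ofReal p) μ ≤
      eLpNorm (a n) (ENNReal.ofReal p) μ + eLpNorm (b n) (ENNReal.ofReal p) μ := fun n =>
    (eLpNorm_mono_ae_real (hle n)).trans
      (eLpNorm_add_le (ha n) (hb n) (ENNReal.one_le_ofReal.2 hp))
  have h2 := ha0.add hb0
  rw [add_zero] at h2
  have h3 : eLpNorm D (ENNReal.ofReal p) μ = 0 :=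
    le_antisymm (ge_of_tendsto' h2 h1) zero_le
  rwa [eLpNorm_eq_zero_iff hD (by simpa using lt_of_lt_of_le one_pos hp)] at h3

lemma IsSmallDeformation.aestronglyMeasurable_adjoint (h : IsSmallDeformation Φ Ω)
    (hΩo : IsOpen Ω) {g : Eucl N → Eucl N} (hg : AEStronglyMeasurable g (volume.restrict Ω)) :
    AEStronglyMeasurable (fun x => ContinuousLinearMap.adjoint (fderiv ℝ Φ x) (g x))
      (volume.restrict Ω) := by
  have h1 : ContinuousOn (fun x => ContinuousLinearMap.adjoint (fderiv ℝ Φ x)) Ω :=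
    (LinearIsometryEquiv.continuous _).comp_continuousOn
      (h.contDiffOn.continuousOn_fderiv_of_isOpen hΩo le_rfl)
  exact (ContinuousLinearMap.id ℝ (Eucl N →L[ℝ] Eucl N)).aestronglyMeasurable_comp₂
    (h1.aestronglyMeasurable hΩo.measurableSet) hg

omit [Fact (1 ≤ ENNReal.ofReal p)] in
lemma tendsto_eLpNorm_of_tendsto {X : Type*} [MeasurableSpace X] {μ : Measure X}
    {f : ℕ → X → ℝ} {C : NNReal} {s : ℕ → ℝ} (hs : Tendsto s atTop (𝓝 0))
    (h : ∀ n, eLpNorm (f n) (ENNReal.ofReal p) μ ≤ C * ENNReal.ofReal (s n)) :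
    Tendsto (fun n => eLpNorm (f n) (ENNReal.ofReal p) μ) atTop (𝓝 0) := by
  have h1 : Tendsto (fun n => (C : ENNReal) * ENNReal.ofReal (s n)) atTop
      (𝓝 (C * ENNReal.ofReal 0)) :=
    ENNReal.Tendsto.const_mul ((ENNReal.continuous_ofReal.tendsto 0).comp hs)
      (Or.inr ENNReal.coe_ne_top)
  rw [ENNReal.ofReal_zero, mul_zero] at h1
  exact tendsto_of_tendsto_of_tendsto_of_le_of_le tendsto_const_nhds h1 (fun _ => zero_le) h

/-- The relation `W ∘ Φ = w` passes to limits, since composition with `Φ` is bounded on `L^p`. -/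
lemma IsPushforward.isTransport_of_tendsto (hp : 2 ≤ p) (h : IsSmallDeformation Φ Ω)
    (hΩo : IsOpen Ω) {w : W0 Ω p} {W : W0 (Φ '' Ω) p} {v : ℕ → W0 Ω p} {V : ℕ → W0 (Φ '' Ω) p}
    (hv : Tendsto (fun n => ‖v n - w‖) atTop (𝓝 0))
    (hV : Tendsto (fun n => ‖W - V n‖) atTop (𝓝 0))
    (hvV : ∀ n, IsPushforward Φ (v n) (V n)) : IsTransport Φ w W := by
  obtain ⟨C, hC⟩ := exists_eLpNorm_comp_bounds N (show 0 < p by linarith)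
  have hp1 : 1 ≤ p := by linarith
  have h1 := ae_eq_zero_of_norm_le_add (μ := volume.restrict Ω) hp1
    (D := fun x => val W (Φ x) - val w x) (a := fun n x => ‖val (W - V n) (Φ x)‖)
    (b := fun n x => ‖val (v n - w) x‖)
    ((h.aestronglyMeasurable_comp hΩo (memLp_val W).1).sub (memLp_val w).1)
    (fun n => (h.aestronglyMeasurable_comp hΩo (memLp_val _).1).norm)
    (fun n => (memLp_val _).1.norm) (fun n => ?_)
    (tendsto_eLpNorm_of_tendsto (C := C) hV fun n => ?_)
    (tendsto_eLpNorm_of_tendsto (C := 1) hv fun n => ?_)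
  · filter_upwards [h1] with x hx
    exact sub_eq_zero.1 hx
  · filter_upwards [(hvV n).1, h.ae_comp hΩo (val_sub W (V n)), val_sub (v n) w]
      with x h1 h2 h3
    rw [h2, h3, h1]
    refine le_trans (le_of_eq ?_) (norm_add_le _ _)
    congr 1
    ring
  · rw [eLpNorm_norm]
    exact ((hC h hΩo _).2).trans (mul_le_mul_right (eLpNorm_val_le _) _)
  · rw [eLpNorm_norm, ENNReal.coe_one, one_mul]
    exact eLpNorm_val_le _

/-- The chain rule for weak gradients passes to limits, since the adjoints of `DΦ` are uniformly
bounded. -/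
lemma IsPushforward.adjoint_grad_of_tendsto (hp : 2 ≤ p) (h : IsSmallDeformation Φ Ω)
    (hΩo : IsOpen Ω) {w : W0 Ω p} {W : W0 (Φ '' Ω) p} {v : ℕ → W0 Ω p} {V : ℕ → W0 (Φ '' Ω) p}
    (hv : Tendsto (fun n => ‖v n - w‖) atTop (𝓝 0))
    (hV : Tendsto (fun n => ‖W - V n‖) atTop (𝓝 0))
    (hvV : ∀ n, IsPushforward Φ (v n) (V n)) :
    ∀ᵐ x ∂(volume.restrict Ω),
      ContinuousLinearMap.adjoint (fderiv ℝ Φ x) (grad W (Φ x)) = grad w x := by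
  obtain ⟨C, hC⟩ := exists_eLpNorm_comp_bounds N (show 0 < p by linarith)
  have hp1 : 1 ≤ p := by linarith
  have h1 := ae_eq_zero_of_norm_le_add (μ := volume.restrict Ω) hp1
    (D := fun x => ContinuousLinearMap.adjoint (fderiv ℝ Φ x) (grad W (Φ x)) - grad w x)
    (a := fun n x => 2 * ‖grad (W - V n) (Φ x)‖) (b := fun n x => ‖grad (v n - w) x‖)
    ((h.aestronglyMeasurable_adjoint hΩo
      (h.aestronglyMeasurable_comp hΩo (memLp_grad W).1)).sub (memLp_grad w).1)
    (fun n => ((h.aestronglyMeasurable_comp hΩo (memLp_grad _).1).norm).const_mul 2)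
    (fun n => (memLp_grad _).1.norm) (fun n => ?_)
    (tendsto_eLpNorm_of_tendsto (C := 2 * C) hV fun n => ?_)
    (tendsto_eLpNorm_of_tendsto (C := 1) hv fun n => ?_)
  · filter_upwards [h1] with x hx
    exact sub_eq_zero.1 hx
  · filter_upwards [(hvV n).2, h.ae_comp hΩo (grad_sub W (V n)), grad_sub (v n) w,
      ae_restrict_mem hΩo.measurableSet] with x h1 h2 h3 h4
    have h5 := norm_apply_le_two_mul
      (norm_adjoint_sub_one (h.norm_fderiv_sub_one_le hΩo h4)) (grad W (Φ x) - grad (V n) (Φ x))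
    rw [h2, h3, ← h1]
    rw [map_sub] at h5
    refine le_trans (le_trans (le_of_eq ?_) (norm_add_le _ _)) (add_le_add_left h5 _)
    congr 1
    abel
  · have h2 : eLpNorm (fun x => 2 * ‖grad (W - V n) (Φ x)‖) (ENNReal.ofReal p)
        (volume.restrict Ω) ≤ ENNReal.ofReal 2 *
          eLpNorm (fun x => grad (W - V n) (Φ x)) (ENNReal.ofReal p) (volume.restrict Ω) :=
      eLpNorm_le_mul_eLpNorm_of_ae_le_mul (Eventually.of_forall fun x => by
        rw [norm_mul, norm_norm, Real.norm_of_nonneg zero_le_two]) _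
    refine h2.trans ?_
    refine (mul_le_mul_right ((hC h hΩo _).2.trans
      (mul_le_mul_right (eLpNorm_grad_le _) _)) _).trans (le_of_eq ?_)
    rw [← mul_assoc]
    congr 1
    simp
  · rw [eLpNorm_norm, ENNReal.coe_one, one_mul]
    exact eLpNorm_grad_le _

/-- Pushforwards are closed under limits. -/
lemma IsPushforward.of_tendsto (hp : 2 ≤ p) (h : IsSmallDeformation Φ Ω) (hΩo : IsOpen Ω)
    {w : W0 Ω p} {W : W0 (Φ '' Ω) p} {v : ℕ → W0 Ω p} {V : ℕ → W0 (Φ '' Ω) p}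
    (hv : Tendsto (fun n => ‖v n - w‖) atTop (𝓝 0))
    (hV : Tendsto (fun n => ‖W - V n‖) atTop (𝓝 0))
    (hvV : ∀ n, IsPushforward Φ (v n) (V n)) : IsPushforward Φ w W :=
  ⟨IsPushforward.isTransport_of_tendsto hp h hΩo hv hV hvV,
    IsPushforward.adjoint_grad_of_tendsto hp h hΩo hv hV hvV⟩

lemma exists_isPushforward_of_testFun (h : IsSmallDeformation Φ Ω) (hΩo : IsOpen Ω)
    (hΩ : Bornology.IsBounded Ω) {φ : Eucl N → ℝ} (hφ : IsTestFun Ω φ) {v : W0 Ω p}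
    (h1 : val v =ᵐ[volume.restrict Ω] φ) (h2 : grad v =ᵐ[volume.restrict Ω] gradient φ) :
    ∃ V : W0 (Φ '' Ω) p, IsPushforward Φ v V := by
  obtain ⟨ψ, k1, k2, k3, k4⟩ := h.exists_pushforward hΩo hφ
  obtain ⟨V, k5, k6⟩ := exists_of_contDiff_one (p := p) (h.isOpen_image hΩo)
    (h.isBounded_image hΩ) k1 k2 k3
  refine ⟨V, ?_, ?_⟩
  · filter_upwards [h1, h.ae_comp hΩo k5, ae_restrict_mem hΩo.measurableSet] with x e1 e2 e3
    rw [e1, e2, (k4 x e3).1]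
  · filter_upwards [h2, h.ae_comp hΩo k6, ae_restrict_mem hΩo.measurableSet] with x e1 e2 e3
    rw [e1, e2, (k4 x e3).2]

omit [Fact (1 ≤ ENNReal.ofReal p)] in
lemma exists_limit_of_norm_sub_le {E E' : Type*} [NormedAddCommGroup E] [NormedAddCommGroup E']
    [CompleteSpace E'] {C : ℝ} (hC0 : 0 ≤ C) {v : ℕ → E} {w : E} (hv : Tendsto v atTop (𝓝 w))
    {V : ℕ → E'} (hC : ∀ m n, ‖V m - V n‖ ≤ C * ‖v m - v n‖) :
    Tendsto (fun n => ‖v n - w‖) atTop (𝓝 0) ∧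
      ∃ W : E', Tendsto (fun n => ‖W - V n‖) atTop (𝓝 0) := by
  have hcau : CauchySeq V := by
    refine Metric.cauchySeq_iff.2 fun ε hε => ?_
    obtain ⟨n₀, hn₀⟩ := Metric.cauchySeq_iff.1 hv.cauchySeq (ε / (C + 1)) (by positivity)
    refine ⟨n₀, fun m hm n hn => ?_⟩
    have e1 := hn₀ m hm n hn
    have e2 := hC m n
    rw [dist_eq_norm, lt_div_iff₀ (by positivity)] at e1
    rw [dist_eq_norm]
    nlinarith [norm_nonneg (v m - v n)]
  obtain ⟨W, hW⟩ := cauchySeq_tendsto_of_complete hcau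
  refine ⟨tendsto_iff_norm_sub_tendsto_zero.1 hv, W, ?_⟩
  simpa only [norm_sub_rev] using tendsto_iff_norm_sub_tendsto_zero.1 hW

/-- `w ∘ Φ⁻¹` belongs to `W_0^{1,p}(Φ(Ω))`. -/
lemma exists_isPushforward (hp : 2 ≤ p) (h : IsSmallDeformation Φ Ω) (hΩo : IsOpen Ω)
    (hΩ : Bornology.IsBounded Ω) (w : W0 Ω p) : ∃ W : W0 (Φ '' Ω) p, IsPushforward Φ w W := by
  obtain ⟨φ, v, h1, h2, h3, h4⟩ := exists_seq_testFun w
  choose V hV using fun n =>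
    exists_isPushforward_of_testFun h hΩo hΩ (h1 n) (h2 n) (h3 n)
  obtain ⟨C, hC0, hC⟩ := exists_norm_pushforward_le (p := p) hp h hΩo
  obtain ⟨hv0, W, hW⟩ := exists_limit_of_norm_sub_le hC0 h4 (V := V)
    fun m n => hC _ _ ((hV m).sub h hΩo (hV n))
  exact ⟨W, IsPushforward.of_tendsto hp h hΩo hv0 hW hV⟩

/-- `w ∘ Φ⁻¹` determines the element of `W_0^{1,p}(Φ(Ω))`. -/
lemma IsTransport.unique (hp : 2 ≤ p) (h : IsSmallDeformation Φ Ω) (hΩo : IsOpen Ω)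
    (hΩ : Bornology.IsBounded Ω) {w : W0 Ω p} {W V : W0 (Φ '' Ω) p} (hW : IsTransport Φ w W)
    (hV : IsTransport Φ w V) : W = V := by
  refine eq_of_val_ae_eq hp (h.isOpen_image hΩo) (h.isBounded_image hΩ) ?_
  refine h.ae_of_ae_comp hΩo ?_
  filter_upwards [hW, hV] with x h1 h2
  rw [h1, h2]

/-- The chain rule for weak gradients holds for every transported function, because transport
determines `W`. -/
lemma IsTransport.isPushforward (hp : 2 ≤ p) (h : IsSmallDeformation Φ Ω) (hΩo : IsOpen Ω)
    (hΩ : Bornology.IsBounded Ω) {w : W0 Ω p} {W : W0 (Φ '' Ω) p} (hW : IsTransport Φ w W) :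
    IsPushforward Φ w W := by
  obtain ⟨V, hV⟩ := exists_isPushforward hp h hΩo hΩ w
  rwa [hW.unique hp h hΩo hΩ hV.1]

lemma IsTransport.integral_val_rpow (h : IsSmallDeformation Φ Ω) (hΩo : IsOpen Ω) {w : W0 Ω p}
    {W : W0 (Φ '' Ω) p} (hW : IsTransport Φ w W) (q : ℝ) :
    ∫ y in Φ '' Ω, |val W y| ^ q = ∫ x in Ω, (fderiv ℝ Φ x).det * |val w x| ^ q := by
  rw [h.integral_image hΩo]
  refine integral_congr_ae (hW.mono fun x hx => ?_)
  simp only [hx]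

lemma IsTransport.integral_norm_grad_rpow (hp : 2 ≤ p) (h : IsSmallDeformation Φ Ω)
    (hΩo : IsOpen Ω) (hΩ : Bornology.IsBounded Ω) {w : W0 Ω p} {W : W0 (Φ '' Ω) p}
    (hW : IsTransport Φ w W) :
    ∫ y in Φ '' Ω, ‖grad W y‖ ^ p = ∫ x in Ω, (fderiv ℝ Φ x).det *
      ‖Ring.inverse (ContinuousLinearMap.adjoint (fderiv ℝ Φ x)) (grad w x)‖ ^ p := by
  rw [h.integral_image hΩo]
  refine integral_congr_ae ?_
  filter_upwards [(hW.isPushforward hp h hΩo hΩ).2, ae_restrict_mem hΩo.measurableSet] with x hx hxΩ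
  have h1 := Ring.inverse_mul_cancel _ (isUnit_of_norm_sub_one_le
    (norm_adjoint_sub_one (h.norm_fderiv_sub_one_le hΩo hxΩ)))
  have h2 : Ring.inverse (ContinuousLinearMap.adjoint (fderiv ℝ Φ x)) (grad w x) =
      grad W (Φ x) := by
    rw [← hx]
    exact congrArg (fun T : Eucl N →L[ℝ] Eucl N => T (grad W (Φ x))) h1
  rw [h2]

end Transport

/-! ### The maps `Φ_t` for small `t` -/

section Flow

variable {N : ℕ} {Ω : Set (Eucl N)} {F R R' : Eucl N → Eucl N}

lemma IsC1Over.contDiffOn (hF : IsC1Over F Ω) : ContDiffOn ℝ 1 F Ω := by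
  obtain ⟨U, -, hU, h⟩ := hF
  exact h.mono (subset_closure.trans hU)

lemma IsC1Over.differentiableAt (hF : IsC1Over F Ω) {x : Eucl N} (hx : x ∈ Ω) :
    DifferentiableAt ℝ F x := by
  obtain ⟨U, hUo, hU, h⟩ := hF
  exact (h.contDiffAt (hUo.mem_nhds (hU (subset_closure hx)))).differentiableAt one_ne_zero

lemma IsC1Over.exists_lipschitzOnWith (hF : IsC1Over F Ω) (hΩ : Bornology.IsBounded Ω) :
    ∃ L : NNReal, LipschitzOnWith L F Ω := by
  obtain ⟨U, hUo, hU, h⟩ := hF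
  have h1 : LocallyLipschitzOn (closure Ω) F := fun x hx => by
    obtain ⟨K, t, ht, hK⟩ := (h.contDiffAt (hUo.mem_nhds (hU hx))).exists_lipschitzOnWith
    exact ⟨K, t, mem_nhdsWithin_of_mem_nhds ht, hK⟩
  obtain ⟨L, hL⟩ := h1.exists_lipschitzOnWith_of_compact hΩ.isCompact_closure
  exact ⟨L, hL.mono subset_closure⟩

lemma IsC1Over.exists_norm_fderiv_le (hF : IsC1Over F Ω) (hΩo : IsOpen Ω)
    (hΩ : Bornology.IsBounded Ω) : ∃ L : ℝ, 0 ≤ L ∧ ∀ x ∈ Ω, ‖fderiv ℝ F x‖ ≤ L := by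
  obtain ⟨L, hL⟩ := hF.exists_lipschitzOnWith hΩ
  exact ⟨L, L.coe_nonneg, fun x hx =>
    (hF.differentiableAt hx).hasFDerivAt.le_of_lipschitzOn (hΩo.mem_nhds hx) hL⟩

lemma IsC1Over.continuousOn_fderiv (hF : IsC1Over F Ω) (hΩo : IsOpen Ω) :
    ContinuousOn (fderiv ℝ F) Ω :=
  hF.contDiffOn.continuousOn_fderiv_of_isOpen hΩo le_rfl

/-- For small `|t|`, the flow map is a small deformation of `Ω`. -/
lemma exists_isSmallDeformation_flow (hR : IsC1Over R Ω) (hR' : IsC1Over R' Ω)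
    (hΩ : Bornology.IsBounded Ω) : ∃ δ : ℝ, 0 < δ ∧ δ ≤ 1 ∧
      ∀ t ∈ Set.Ioo (-δ) δ, IsSmallDeformation (flow R R' t) Ω := by
  obtain ⟨L, hL⟩ := hR.exists_lipschitzOnWith hΩ
  obtain ⟨L', hL'⟩ := hR'.exists_lipschitzOnWith hΩ
  have hpos : (0 : ℝ) < 2 * (L + L' + 1) := by positivity
  refine ⟨1 / (2 * (L + L' + 1)), by positivity, ?_, fun t ht => ⟨?_, ?_⟩⟩
  · rw [div_le_one hpos]
    linarith [L.coe_nonneg, L'.coe_nonneg]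
  · exact (contDiffOn_id.add (hR.contDiffOn.const_smul t)).add
      (hR'.contDiffOn.const_smul (t ^ 2 / 2))
  · have ht' : |t| * (2 * (L + L' + 1)) ≤ 1 := by
      rw [← le_div_iff₀ hpos]
      exact (abs_lt.2 ht).le
    have h1 : |t| ≤ 1 := by nlinarith [L.coe_nonneg, L'.coe_nonneg, abs_nonneg t]
    refine LipschitzOnWith.of_dist_le_mul fun x hx y hy => ?_
    have e1 := hL.norm_sub_le hx hy
    have e2 := hL'.norm_sub_le hx hy
    have e3 : (flow R R' t x - x) - (flow R R' t y - y) =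
        t • (R x - R y) + (t ^ 2 / 2) • (R' x - R' y) := by
      simp only [flow]
      module
    have e4 := norm_add_le (t • (R x - R y)) ((t ^ 2 / 2) • (R' x - R' y))
    rw [norm_smul, norm_smul, Real.norm_eq_abs, Real.norm_of_nonneg (by positivity)] at e4
    rw [dist_eq_norm, dist_eq_norm, e3]
    have e5 : t ^ 2 / 2 ≤ |t| := by
      rw [← sq_abs]
      nlinarith [abs_nonneg t]
    calc _ ≤ |t| * ‖R x - R y‖ + t ^ 2 / 2 * ‖R' x - R' y‖ := e4
      _ ≤ |t| * (L * ‖x - y‖) + |t| * (L' * ‖x - y‖) := by gcongr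
      _ = |t| * (L + L') * ‖x - y‖ := by ring
      _ ≤ ((2⁻¹ : NNReal) : ℝ) * ‖x - y‖ := by
          gcongr
          push_cast
          nlinarith [abs_nonneg t]

lemma fderiv_flow (hR : IsC1Over R Ω) (hR' : IsC1Over R' Ω) (t : ℝ) {x : Eucl N} (hx : x ∈ Ω) :
    fderiv ℝ (flow R R' t) x = 1 + t • fderiv ℝ R x + (t ^ 2 / 2) • fderiv ℝ R' x :=
  (((hasFDerivAt_id x).add ((hR.differentiableAt hx).hasFDerivAt.const_smul t)).add
    ((hR'.differentiableAt hx).hasFDerivAt.const_smul (t ^ 2 / 2))).fderiv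

end Flow

/-! ### Jacobi matrices and derivatives -/

section Jacobi

variable {N : ℕ} (F : Eucl N → Eucl N) (x : Eucl N)

lemma jac_eq_toMatrix : jac F x = LinearMap.toMatrix (EuclideanSpace.basisFun (Fin N) ℝ).toBasis
    (EuclideanSpace.basisFun (Fin N) ℝ).toBasis (fderiv ℝ F x : Eucl N →ₗ[ℝ] Eucl N) := by
  ext i j
  simp [jac, LinearMap.toMatrix_apply]

lemma det_jac : (jac F x).det = (fderiv ℝ F x).det := by
  rw [jac_eq_toMatrix, LinearMap.det_toMatrix]

lemma divg_eq_trace : divg F x = LinearMap.trace ℝ (Eucl N) (fderiv ℝ F x) := by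
  rw [divg, jac_eq_toMatrix, ← LinearMap.trace_eq_matrix_trace]

lemma trace_jac_mul_self : (jac F x * jac F x).trace =
    LinearMap.trace ℝ (Eucl N) ((fderiv ℝ F x * fderiv ℝ F x : Eucl N →L[ℝ] Eucl N)) := by
  rw [jac_eq_toMatrix, ← LinearMap.toMatrix_mul, ← LinearMap.trace_eq_matrix_trace]
  rfl

lemma rowMul_jac (z : Eucl N) :
    rowMul z (jac F x) = ContinuousLinearMap.adjoint (fderiv ℝ F x) z := by
  ext j
  have h1 : ContinuousLinearMap.adjoint (fderiv ℝ F x) z j =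
      inner ℝ (ContinuousLinearMap.adjoint (fderiv ℝ F x) z) (EuclideanSpace.single j (1 : ℝ)) := by
    rw [EuclideanSpace.inner_single_right]
    simp
  rw [h1, ContinuousLinearMap.adjoint_inner_left, PiLp.inner_apply]
  simp [rowMul, Matrix.vecMul, dotProduct, jac, mul_comm]

omit F x in
/-- `2 χ₂(M) = (tr M)² - tr (M²)`. -/
lemma two_mul_chi2 (M : Matrix (Fin N) (Fin N) ℝ) :
    2 * chi2 M = M.trace ^ 2 - (M * M).trace := by
  set h : Fin N → Fin N → ℝ := fun i j => M i i * M j j - M i j * M j i with hh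
  have h1 : M.trace ^ 2 - (M * M).trace = ∑ i, ∑ j, h i j := by
    simp only [hh, Finset.sum_sub_distrib, Matrix.trace, Matrix.diag, Matrix.mul_apply, sq,
      Finset.sum_mul_sum]
  have h2 : ∀ i, ∑ j, h i j = ∑ j ∈ Finset.Iio i, h i j + ∑ j ∈ Finset.Ioi i, h i j := by
    intro i
    have e1 : (Finset.univ : Finset (Fin N)) = (Finset.Iio i ∪ Finset.Ioi i) ∪ {i} := by
      ext j
      simp only [Finset.mem_univ, Finset.mem_union, Finset.mem_Iio, Finset.mem_Ioi,
        Finset.mem_singleton, true_iff]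
      rcases lt_trichotomy j i with hj | hj | hj <;> simp [hj]
    rw [e1, Finset.sum_union, Finset.sum_union]
    · have : h i i = 0 := by simp [hh]
      rw [Finset.sum_singleton, this, add_zero]
    · exact Finset.disjoint_left.2 fun j hj hj' =>
        lt_asymm (Finset.mem_Iio.1 hj) (Finset.mem_Ioi.1 hj')
    · refine Finset.disjoint_left.2 fun j hj hj' => ?_
      rw [Finset.mem_singleton] at hj'
      subst hj'
      simp at hj
  have h3 : ∑ i, ∑ j ∈ Finset.Iio i, h i j = ∑ i, ∑ j ∈ Finset.Ioi i, h i j := by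
    rw [Finset.sum_comm' (t' := Finset.univ) (s' := fun j => Finset.Ioi j) (by simp)]
    refine Finset.sum_congr rfl fun j _ => Finset.sum_congr rfl fun i _ => ?_
    simp only [hh]
    ring
  rw [h1, Finset.sum_congr rfl fun i _ => h2 i, Finset.sum_add_distrib, h3, chi2]
  ring

end Jacobi

/-! ### Paths of class `C²` with explicit derivatives -/

section Path

variable {E F G : Type*} [NormedAddCommGroup E] [NormedSpace ℝ E] [NormedAddCommGroup F]
  [NormedSpace ℝ F] [NormedAddCommGroup G] [NormedSpace ℝ G] {s : Set ℝ}

/-- On `s`, the curve `f` has first derivative `f'` and continuous second derivative `f''`. -/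
structure HasC2Path (f f' f'' : ℝ → E) (s : Set ℝ) : Prop where
  hasDerivAt : ∀ t ∈ s, HasDerivAt f (f' t) t
  hasDerivAt' : ∀ t ∈ s, HasDerivAt f' (f'' t) t
  continuousOn : ContinuousOn f'' s

lemma HasC2Path.contDiffOn {f f' f'' : ℝ → E} (hf : HasC2Path f f' f'' s) (hs : IsOpen s) :
    ContDiffOn ℝ 2 f s := by
  have h1 : ContDiffOn ℝ 1 f' s := by
    rw [show (1 : WithTop ℕ∞) = 0 + 1 by norm_num, contDiffOn_succ_iff_deriv_of_isOpen hs]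
    refine ⟨fun t ht => (hf.hasDerivAt' t ht).differentiableAt.differentiableWithinAt,
      by simp, ?_⟩
    rw [contDiffOn_zero]
    exact hf.continuousOn.congr fun t ht => (hf.hasDerivAt' t ht).deriv
  rw [show (2 : WithTop ℕ∞) = 1 + 1 by norm_num, contDiffOn_succ_iff_deriv_of_isOpen hs]
  exact ⟨fun t ht => (hf.hasDerivAt t ht).differentiableAt.differentiableWithinAt, by simp,
    h1.congr fun t ht => (hf.hasDerivAt t ht).deriv⟩

lemma HasC2Path.congr {f f' f'' g' g'' : ℝ → E} (hf : HasC2Path f f' f'' s)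
    (h' : ∀ t, g' t = f' t) (h'' : ∀ t, g'' t = f'' t) : HasC2Path f g' g'' s := by
  rwa [funext h', funext h'']

lemma HasC2Path.bilin (B : E →L[ℝ] F →L[ℝ] G) {a a' a'' : ℝ → E} {b b' b'' : ℝ → F}
    (ha : HasC2Path a a' a'' s) (hb : HasC2Path b b' b'' s) :
    HasC2Path (fun t => B (a t) (b t)) (fun t => B (a t) (b' t) + B (a' t) (b t))
      (fun t => B (a t) (b'' t) + B (a' t) (b' t) + (B (a' t) (b' t) + B (a'' t) (b t))) s where
  hasDerivAt t ht :=
    B.hasDerivAt_of_bilinear (fun _ => ha.hasDerivAt t ht) (fun _ => hb.hasDerivAt t ht)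
  hasDerivAt' t ht :=
    (B.hasDerivAt_of_bilinear (fun _ => ha.hasDerivAt t ht) (fun _ => hb.hasDerivAt' t ht)).add
      (B.hasDerivAt_of_bilinear (fun _ => ha.hasDerivAt' t ht) (fun _ => hb.hasDerivAt t ht))
  continuousOn := by
    have c0 : ContinuousOn a s := fun t ht => (ha.hasDerivAt t ht).continuousAt.continuousWithinAt
    have c1 : ContinuousOn a' s :=
      fun t ht => (ha.hasDerivAt' t ht).continuousAt.continuousWithinAt
    have d0 : ContinuousOn b s := fun t ht => (hb.hasDerivAt t ht).continuousAt.continuousWithinAt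
    have d1 : ContinuousOn b' s :=
      fun t ht => (hb.hasDerivAt' t ht).continuousAt.continuousWithinAt
    have c2 := ha.continuousOn
    have d2 := hb.continuousOn
    fun_prop

lemma HasC2Path.mul {a a' a'' b b' b'' : ℝ → ℝ} (ha : HasC2Path a a' a'' s)
    (hb : HasC2Path b b' b'' s) : HasC2Path (fun t => a t * b t)
      (fun t => a' t * b t + a t * b' t)
      (fun t => a'' t * b t + 2 * (a' t * b' t) + a t * b'' t) s := by
  refine (ha.bilin (ContinuousLinearMap.mul ℝ ℝ) hb).congr (fun t => ?_) (fun t => ?_) <;>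
  · simp only [ContinuousLinearMap.mul_apply']
    ring

lemma HasC2Path.clm_comp (B : E →L[ℝ] F) {a a' a'' : ℝ → E} (ha : HasC2Path a a' a'' s) :
    HasC2Path (fun t => B (a t)) (fun t => B (a' t)) (fun t => B (a'' t)) s where
  hasDerivAt t ht := B.hasFDerivAt.comp_hasDerivAt t (ha.hasDerivAt t ht)
  hasDerivAt' t ht := B.hasFDerivAt.comp_hasDerivAt t (ha.hasDerivAt' t ht)
  continuousOn := B.continuous.comp_continuousOn ha.continuousOn

lemma hasC2Path_line (a b : E) : HasC2Path (fun t => a + t • b) (fun _ => b) (fun _ => 0) s where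
  hasDerivAt t _ := by simpa using ((hasDerivAt_id t).smul_const b).const_add a
  hasDerivAt' t _ := hasDerivAt_const t b
  continuousOn := continuousOn_const

lemma hasC2Path_quadratic (a b c : E) : HasC2Path (fun t => a + t • b + (t ^ 2 / 2) • c)
    (fun t => b + t • c) (fun _ => c) s where
  hasDerivAt t _ := by
    have h1 : HasDerivAt (fun t : ℝ => t ^ 2 / 2) t t := by
      simpa using ((hasDerivAt_id t).pow 2).div_const 2
    simpa using (((hasDerivAt_id t).smul_const b).const_add a).fun_add (h1.smul_const c)
  hasDerivAt' t _ := by simpa using ((hasDerivAt_id t).smul_const c).const_add b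
  continuousOn := continuousOn_const

lemma HasC2Path.norm_rpow {H : Type*} [NormedAddCommGroup H] [InnerProductSpace ℝ H] {p : ℝ}
    (hp : 2 ≤ p) {a a' a'' : ℝ → H} (ha : HasC2Path a a' a'' s) :
    HasC2Path (fun t => ‖a t‖ ^ p) (fun t => normPowD1 p (a t) (a' t))
      (fun t => normPowD2 p (a t) (a' t) (a' t) + normPowD1 p (a t) (a'' t)) s where
  hasDerivAt t ht :=
    (hasFDerivAt_norm_rpow_normPowD1 hp (a t)).comp_hasDerivAt t (ha.hasDerivAt t ht)
  hasDerivAt' t ht :=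
    HasDerivAt.clm_apply (c := fun t => normPowD1 p (a t))
      ((hasFDerivAt_normPowD1 hp (a t)).comp_hasDerivAt t (ha.hasDerivAt t ht))
      (ha.hasDerivAt' t ht)
  continuousOn := by
    have c0 : ContinuousOn a s := fun t ht => (ha.hasDerivAt t ht).continuousAt.continuousWithinAt
    have c1 : ContinuousOn a' s :=
      fun t ht => (ha.hasDerivAt' t ht).continuousAt.continuousWithinAt
    have c2 := ha.continuousOn
    have h2 : ContinuousOn (fun t => normPowD2 p (a t)) s :=
      (continuous_normPowD2 hp).comp_continuousOn c0
    have h1 : ContinuousOn (fun t => normPowD1 p (a t)) s :=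
      (continuous_iff_continuousAt.2 fun z =>
        (hasFDerivAt_normPowD1 (F := H) hp z).continuousAt).comp_continuousOn c0
    fun_prop

end Path

/-! ### Differentiation under the integral sign, twice -/

section Integral

variable {X : Type*} [MeasurableSpace X] {μ : Measure X} {s : Set ℝ}

/-- The derivative is an almost everywhere limit of difference quotients. -/
lemma aestronglyMeasurable_deriv {f f' : ℝ → X → ℝ} (hs : IsOpen s)
    (hm : ∀ t ∈ s, AEStronglyMeasurable (f t) μ) {t : ℝ} (ht : t ∈ s)
    (hd : ∀ᵐ x ∂μ, HasDerivAt (fun t => f t x) (f' t x) t) :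
    AEStronglyMeasurable (f' t) μ := by
  have hu : Tendsto (fun n : ℕ => 1 / ((n : ℝ) + 1)) atTop (𝓝 0) :=
    tendsto_one_div_add_atTop_nhds_zero_nat
  have hmem : ∀ᶠ n : ℕ in atTop, t + 1 / ((n : ℝ) + 1) ∈ s := by
    have h1 : Tendsto (fun n : ℕ => t + 1 / ((n : ℝ) + 1)) atTop (𝓝 t) := by
      simpa using hu.const_add t
    exact h1.eventually (hs.mem_nhds ht)
  obtain ⟨n₀, hn₀⟩ := eventually_atTop.1 hmem
  refine aestronglyMeasurable_of_tendsto_ae atTop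
    (f := fun (n : ℕ) x => (1 / (((n + n₀ : ℕ) : ℝ) + 1))⁻¹ •
      (f (t + 1 / (((n + n₀ : ℕ) : ℝ) + 1)) x - f t x))
    (fun n => ((hm _ (hn₀ (n + n₀) (Nat.le_add_left _ _))).sub (hm t ht)).const_smul
      ((1 / (((n + n₀ : ℕ) : ℝ) + 1))⁻¹)) ?_
  filter_upwards [hd] with x hx
  have h2 : Tendsto (fun n : ℕ => 1 / (((n + n₀ : ℕ) : ℝ) + 1)) atTop (𝓝[≠] 0) := by
    refine tendsto_nhdsWithin_iff.2 ⟨hu.comp (tendsto_add_atTop_nat n₀), .of_forall fun n => ?_⟩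
    simp only [Set.mem_compl_iff, Set.mem_singleton_iff]
    positivity
  exact (hasDerivAt_iff_tendsto_slope_zero.1 hx).comp h2

/-- Differentiation twice under the integral sign. Measurability of the derivatives is a consequence
of that of `f`. -/
lemma HasC2Path.integral {f f' f'' : ℝ → X → ℝ} {bound : X → ℝ} (hs : IsOpen s)
    (hm : ∀ t ∈ s, AEStronglyMeasurable (f t) μ)
    (hf : ∀ᵐ x ∂μ, HasC2Path (fun t => f t x) (fun t => f' t x) (fun t => f'' t x) s)
    (hb : Integrable bound μ)
    (hle : ∀ᵐ x ∂μ, ∀ t ∈ s, |f t x| ≤ bound x ∧ |f' t x| ≤ bound x ∧ |f'' t x| ≤ bound x) :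
    HasC2Path (fun t => ∫ x, f t x ∂μ) (fun t => ∫ x, f' t x ∂μ) (fun t => ∫ x, f'' t x ∂μ) s := by
  have hm' : ∀ t ∈ s, AEStronglyMeasurable (f' t) μ := fun t ht =>
    aestronglyMeasurable_deriv hs hm ht (hf.mono fun x hx => hx.hasDerivAt t ht)
  have hm'' : ∀ t ∈ s, AEStronglyMeasurable (f'' t) μ := fun t ht =>
    aestronglyMeasurable_deriv hs hm' ht (hf.mono fun x hx => hx.hasDerivAt' t ht)
  refine ⟨fun t ht => ?_, fun t ht => ?_, ?_⟩
  · exact (hasDerivAt_integral_of_dominated_loc_of_deriv_le (hs.mem_nhds ht)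
      (eventually_of_mem (hs.mem_nhds ht) hm)
      (hb.mono' (hm t ht) (hle.mono fun x hx => (hx t ht).1)) (hm' t ht)
      (hle.mono fun x hx t ht => (hx t ht).2.1) hb (hf.mono fun x hx => hx.hasDerivAt)).2
  · exact (hasDerivAt_integral_of_dominated_loc_of_deriv_le (hs.mem_nhds ht)
      (eventually_of_mem (hs.mem_nhds ht) hm')
      (hb.mono' (hm' t ht) (hle.mono fun x hx => (hx t ht).2.1)) (hm'' t ht)
      (hle.mono fun x hx t ht => (hx t ht).2.2) hb (hf.mono fun x hx => hx.hasDerivAt')).2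
  · exact continuousOn_of_dominated hm''
      (fun t ht => hle.mono fun x hx => (hx t ht).2.2) hb (hf.mono fun x hx => hx.continuousOn)

lemma abs_normPowD1_le_of_le {H : Type*} [NormedAddCommGroup H] [InnerProductSpace ℝ H] {p : ℝ}
    (hp : 2 ≤ p) {z a : H} {b : ℝ} (hz : ‖z‖ ≤ b) (ha : ‖a‖ ≤ b) :
    |normPowD1 p z a| ≤ p * b ^ p := by
  have hb : 0 ≤ b := (norm_nonneg _).trans hz
  refine (abs_normPowD1_le hp z a).trans ?_
  have h1 : b ^ p = b ^ (p - 1) * b := by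
    rw [← Real.rpow_add_one' hb (by linarith)]
    ring_nf
  rw [h1]
  have h2 : 0 ≤ p - 1 := by linarith
  gcongr

lemma abs_normPowD2_le_of_le {H : Type*} [NormedAddCommGroup H] [InnerProductSpace ℝ H] {p : ℝ}
    (hp : 2 ≤ p) {z a : H} {b : ℝ} (hz : ‖z‖ ≤ b) (ha : ‖a‖ ≤ b) :
    |normPowD2 p z a a| ≤ p * (p - 1) * b ^ p := by
  have hb : 0 ≤ b := (norm_nonneg _).trans hz
  refine (abs_normPowD2_le hp z a a).trans ?_
  rw [← rpow_sub_two_mul_self (p := p) hp hb]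
  have h2 : 0 ≤ p - 2 := by linarith
  have h3 : 0 ≤ p - 1 := by linarith
  calc _ = p * (p - 1) * (‖z‖ ^ (p - 2) * (‖a‖ * ‖a‖)) := by ring
    _ ≤ p * (p - 1) * (b ^ (p - 2) * (b * b)) := by gcongr
    _ = _ := by ring

/-- Differentiation twice under the integral sign in `t ↦ ∫ D_t |ζ_t|^p`. -/
lemma hasC2Path_integral_mul_norm_rpow {H : Type*} [NormedAddCommGroup H] [InnerProductSpace ℝ H]
    {p : ℝ} (hp : 2 ≤ p) (hs : IsOpen s) {D D' D'' : ℝ → X → ℝ} {ζ ζ' ζ'' : ℝ → X → H} {M : ℝ}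
    {b : X → ℝ} (hM : 0 ≤ M) (hb : Integrable (fun x => b x ^ p) μ)
    (hDm : ∀ t ∈ s, AEStronglyMeasurable (D t) μ) (hζm : ∀ t ∈ s, AEStronglyMeasurable (ζ t) μ)
    (hD : ∀ᵐ x ∂μ, HasC2Path (fun t => D t x) (fun t => D' t x) (fun t => D'' t x) s)
    (hζ : ∀ᵐ x ∂μ, HasC2Path (fun t => ζ t x) (fun t => ζ' t x) (fun t => ζ'' t x) s)
    (hDle : ∀ᵐ x ∂μ, ∀ t ∈ s, |D t x| ≤ M ∧ |D' t x| ≤ M ∧ |D'' t x| ≤ M)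
    (hζle : ∀ᵐ x ∂μ, ∀ t ∈ s, ‖ζ t x‖ ≤ b x ∧ ‖ζ' t x‖ ≤ b x ∧ ‖ζ'' t x‖ ≤ b x) :
    HasC2Path (fun t => ∫ x, D t x * ‖ζ t x‖ ^ p ∂μ)
      (fun t => ∫ x, (D' t x * ‖ζ t x‖ ^ p + D t x * normPowD1 p (ζ t x) (ζ' t x)) ∂μ)
      (fun t => ∫ x, (D'' t x * ‖ζ t x‖ ^ p + 2 * (D' t x * normPowD1 p (ζ t x) (ζ' t x)) +
        D t x * (normPowD2 p (ζ t x) (ζ' t x) (ζ' t x) + normPowD1 p (ζ t x) (ζ'' t x))) ∂μ) s := by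
  -- With `|D|, |D'|, |D''| ≤ M` and all vectors bounded by `b`, the second derivative is at most
  -- `M (b ^ p + 2 p b ^ p + p (p - 1) b ^ p + p b ^ p)`.
  refine HasC2Path.integral (bound := fun x => (M * (1 + 2 * p + p * p)) * b x ^ p) hs
    (fun t ht => (hDm t ht).mul ?_) ?_ (hb.const_mul _) ?_
  · exact ((hζm t ht).norm.aemeasurable.pow_const p).aestronglyMeasurable
  · filter_upwards [hD, hζ] with x h1 h2
    exact h1.mul (h2.norm_rpow hp)
  · filter_upwards [hDle, hζle] with x h1 h2 t ht
    obtain ⟨d0, d1, d2⟩ := h1 t ht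
    obtain ⟨z0, z1, z2⟩ := h2 t ht
    have hbx : 0 ≤ b x ^ p := Real.rpow_nonneg ((norm_nonneg _).trans z0) p
    have e0 : |‖ζ t x‖ ^ p| ≤ b x ^ p := by
      rw [abs_of_nonneg (by positivity)]
      exact Real.rpow_le_rpow (norm_nonneg _) z0 (by linarith)
    have e1 := abs_normPowD1_le_of_le hp z0 z1
    have e2 := abs_normPowD1_le_of_le hp z0 z2
    have e3 := abs_normPowD2_le_of_le hp z0 z1
    have hmul : ∀ {c y K : ℝ}, |c| ≤ M → |y| ≤ K → |c * y| ≤ M * K := fun {c y K} hc hy => by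
      rw [abs_mul]
      exact mul_le_mul hc hy (abs_nonneg _) hM
    have hMb : 0 ≤ M * b x ^ p := mul_nonneg hM hbx
    have hp0 : 0 ≤ p * (M * b x ^ p) := mul_nonneg (by linarith) hMb
    have hpp : 0 ≤ p * p * (M * b x ^ p) := mul_nonneg (by nlinarith) hMb
    have hsum := (abs_add_le (normPowD2 p (ζ t x) (ζ' t x) (ζ' t x))
      (normPowD1 p (ζ t x) (ζ'' t x))).trans (add_le_add e3 e2)
    refine ⟨?_, ?_, ?_⟩
    · linarith [hmul d0 e0]
    · linarith [abs_add_le (D' t x * ‖ζ t x‖ ^ p) (D t x * normPowD1 p (ζ t x) (ζ' t x)),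
        hmul d1 e0, hmul d0 e1]
    · have k1 : |2 * (D' t x * normPowD1 p (ζ t x) (ζ' t x))| ≤ 2 * (M * (p * b x ^ p)) := by
        rw [abs_mul, abs_two]
        exact mul_le_mul_of_nonneg_left (hmul d1 e1) zero_le_two
      refine (abs_add_three _ _ _).trans ?_
      linarith [hmul d2 e0, hmul d0 hsum]

end Integral

/-! ### Derivatives of the determinant and of the inverse along a path of operators -/

section InversePath

variable {A : Type*} [NormedRing A] [NormedAlgebra ℝ A] [HasSummableGeomSeries A] {s : Set ℝ}

/-- First derivative of `C⁻¹` in terms of `C` and its derivative `C'`. -/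
def invD1 (C C' : A) : A := -(Ring.inverse C * C' * Ring.inverse C)

/-- Second derivative of `C⁻¹` in terms of `C` and its derivatives `C'`, `C''`. -/
def invD2 (C C' C'' : A) : A :=
  -((invD1 C C' * C' + Ring.inverse C * C'') * Ring.inverse C +
    Ring.inverse C * C' * invD1 C C')

lemma hasDerivAt_ringInverse {C : ℝ → A} {C' : A} {t : ℝ} (hC : HasDerivAt C C' t)
    (hu : IsUnit (C t)) : HasDerivAt (fun t => Ring.inverse (C t)) (invD1 (C t) C') t := by
  obtain ⟨u, hu⟩ := hu
  have h1 := hasFDerivAt_ringInverse (𝕜 := ℝ) u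
  rw [hu] at h1
  have h2 := h1.comp_hasDerivAt t hC
  have h3 : invD1 (C t) C' =
      (-((ContinuousLinearMap.mulLeftRight ℝ A) ↑u⁻¹) ↑u⁻¹) C' := by
    simp [invD1, ← hu]
  rw [h3]
  exact h2

lemma HasC2Path.ringInverse {C C' C'' : ℝ → A} (hC : HasC2Path C C' C'' s)
    (hu : ∀ t ∈ s, IsUnit (C t)) :
    HasC2Path (fun t => Ring.inverse (C t)) (fun t => invD1 (C t) (C' t))
      (fun t => invD2 (C t) (C' t) (C'' t)) s := by
  have h0 : ∀ t ∈ s, HasDerivAt (fun t => Ring.inverse (C t)) (invD1 (C t) (C' t)) t :=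
    fun t ht => hasDerivAt_ringInverse (hC.hasDerivAt t ht) (hu t ht)
  have h1 : ∀ t ∈ s, HasDerivAt (fun t => invD1 (C t) (C' t)) (invD2 (C t) (C' t) (C'' t)) t :=
    fun t ht => (((h0 t ht).mul (hC.hasDerivAt' t ht)).mul (h0 t ht)).neg
  refine ⟨h0, h1, ?_⟩
  have c1 : ContinuousOn C' s :=
    fun t ht => (hC.hasDerivAt' t ht).continuousAt.continuousWithinAt
  have c2 := hC.continuousOn
  have d0 : ContinuousOn (fun t => Ring.inverse (C t)) s :=
    fun t ht => (h0 t ht).continuousAt.continuousWithinAt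
  have d1 : ContinuousOn (fun t => invD1 (C t) (C' t)) s :=
    fun t ht => (h1 t ht).continuousAt.continuousWithinAt
  unfold invD2
  fun_prop

end InversePath

section DetPath

variable {E : Type*} [NormedAddCommGroup E] [InnerProductSpace ℝ E] [FiniteDimensional ℝ E]
  {s : Set ℝ}

variable (E) in
/-- The trace of an endomorphism, as a continuous linear form. -/
def traceL : (E →L[ℝ] E) →L[ℝ] ℝ :=
  LinearMap.toContinuousLinearMap
    ((LinearMap.trace ℝ E).comp (ContinuousLinearMap.coeLM ℝ : (E →L[ℝ] E) →ₗ[ℝ] E →ₗ[ℝ] E))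

lemma traceL_apply (A : E →L[ℝ] E) : traceL E A = LinearMap.trace ℝ E A := rfl

lemma det_eq_det_toMatrix (A : E →L[ℝ] E) : A.det = (LinearMap.toMatrix
    (stdOrthonormalBasis ℝ E).toBasis (stdOrthonormalBasis ℝ E).toBasis (A : E →ₗ[ℝ] E)).det :=
  (LinearMap.det_toMatrix _ _).symm

lemma contDiff_det : ContDiff ℝ 1 fun A : E →L[ℝ] E => A.det := by
  have h1 : (fun A : E →L[ℝ] E => A.det) = fun A => _ := funext det_eq_det_toMatrix
  rw [h1]
  simp only [Matrix.det_apply]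
  refine ContDiff.sum fun σ _ => ContDiff.const_smul _ (contDiff_prod fun i _ => ?_)
  let l : (E →L[ℝ] E) →ₗ[ℝ] ℝ :=
    { toFun := fun A => LinearMap.toMatrix (stdOrthonormalBasis ℝ E).toBasis
        (stdOrthonormalBasis ℝ E).toBasis (A : E →ₗ[ℝ] E) (σ i) i
      map_add' := fun A B => by simp
      map_smul' := fun c A => by simp }
  exact (LinearMap.toContinuousLinearMap l).contDiff

omit [FiniteDimensional ℝ E] in
lemma det_one : (1 : E →L[ℝ] E).det = 1 := LinearMap.det_id

omit [FiniteDimensional ℝ E] in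
lemma det_mul (A B : E →L[ℝ] E) : (A * B).det = A.det * B.det := LinearMap.det_comp _ _

/-- The derivative of the determinant at the identity is the trace. -/
lemma hasFDerivAt_det_one : HasFDerivAt (fun A : E →L[ℝ] E => A.det) (traceL E) 1 := by
  have h1 : HasFDerivAt (fun A : E →L[ℝ] E => A.det) _ 1 :=
    ((contDiff_det (E := E)).differentiable one_ne_zero 1).hasFDerivAt
  have h2 : fderiv ℝ (fun A : E →L[ℝ] E => A.det) 1 = traceL E := by
    ext B
    have h3 : HasDerivAt (fun r : ℝ => (1 : E →L[ℝ] E) + r • B) B 0 := by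
      simpa using ((hasDerivAt_id (0 : ℝ)).smul_const B).const_add 1
    have h4 : HasDerivAt (fun r : ℝ => ((1 : E →L[ℝ] E) + r • B).det)
        (fderiv ℝ (fun A : E →L[ℝ] E => A.det) 1 B) 0 := by
      refine HasFDerivAt.comp_hasDerivAt (0 : ℝ) (l := fun A : E →L[ℝ] E => A.det) ?_ h3
      simpa using h1
    let b := (stdOrthonormalBasis ℝ E).toBasis
    let P := LinearMap.toMatrix b b (B : E →ₗ[ℝ] E)
    -- `det (1 + r B)` is a polynomial in `r` whose linear coefficient is the trace of `B`.
    have h5 : (fun r : ℝ => ((1 : E →L[ℝ] E) + r • B).det) = fun r => 1 + P.trace * r +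
        Polynomial.eval r
          (1 + (Polynomial.X : Polynomial ℝ) • P.map Polynomial.C).det.divX.divX * r ^ 2 := by
      funext r
      rw [det_eq_det_toMatrix, ← Matrix.det_one_add_smul]
      congr 1
      have : ((1 + r • B : E →L[ℝ] E) : E →ₗ[ℝ] E) = LinearMap.id + r • (B : E →ₗ[ℝ] E) := rfl
      rw [this, map_add, map_smul, LinearMap.toMatrix_id]
    have h6 : HasDerivAt (fun r : ℝ => 1 + P.trace * r +
        Polynomial.eval r
          (1 + (Polynomial.X : Polynomial ℝ) • P.map Polynomial.C).det.divX.divX * r ^ 2)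
        P.trace 0 := by
      have e1 := ((hasDerivAt_id (0 : ℝ)).const_mul P.trace).const_add 1
      have e2 := (Polynomial.hasDerivAt
        (1 + (Polynomial.X : Polynomial ℝ) • P.map Polynomial.C).det.divX.divX (0 : ℝ)).mul
        ((hasDerivAt_id (0 : ℝ)).pow 2)
      simpa using e1.fun_add e2
    rw [h5] at h4
    rw [h4.unique h6, traceL_apply, LinearMap.trace_eq_matrix_trace ℝ b]
  rwa [h2] at h1

/-- First derivative of `det C` (Jacobi's formula). -/
def detD1 (C C' : E →L[ℝ] E) : ℝ := C.det * traceL E (Ring.inverse C * C')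

/-- Second derivative of `det C`. -/
def detD2 (C C' C'' : E →L[ℝ] E) : ℝ :=
  detD1 C C' * traceL E (Ring.inverse C * C') +
    C.det * traceL E (invD1 C C' * C' + Ring.inverse C * C'')

lemma hasDerivAt_det {C : ℝ → E →L[ℝ] E} {C' : E →L[ℝ] E} {t : ℝ} (hC : HasDerivAt C C' t)
    (hu : IsUnit (C t)) : HasDerivAt (fun t => (C t).det) (detD1 (C t) C') t := by
  have h1 : HasDerivAt (fun r => Ring.inverse (C t) * C r) (Ring.inverse (C t) * C') t :=
    hC.const_mul _
  have h2 : HasDerivAt (fun r => (Ring.inverse (C t) * C r).det)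
      (traceL E (Ring.inverse (C t) * C')) t := by
    refine HasFDerivAt.comp_hasDerivAt t (l := fun A : E →L[ℝ] E => A.det) ?_ h1
    rw [Ring.inverse_mul_cancel _ hu]
    exact hasFDerivAt_det_one
  -- Factoring out `C t` reduces to the derivative of the determinant at the identity.
  have h3 : (fun r => (C t).det * (Ring.inverse (C t) * C r).det) = fun r => (C r).det := by
    funext r
    rw [← det_mul, ← mul_assoc, Ring.mul_inverse_cancel _ hu, one_mul]
  rw [← h3]
  exact h2.const_mul _

lemma HasC2Path.det {C C' C'' : ℝ → E →L[ℝ] E} (hC : HasC2Path C C' C'' s)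
    (hu : ∀ t ∈ s, IsUnit (C t)) :
    HasC2Path (fun t => (C t).det) (fun t => detD1 (C t) (C' t))
      (fun t => detD2 (C t) (C' t) (C'' t)) s := by
  have hS := hC.ringInverse hu
  have h0 : ∀ t ∈ s, HasDerivAt (fun t => (C t).det) (detD1 (C t) (C' t)) t :=
    fun t ht => hasDerivAt_det (hC.hasDerivAt t ht) (hu t ht)
  have h1 : ∀ t ∈ s, HasDerivAt (fun t => detD1 (C t) (C' t)) (detD2 (C t) (C' t) (C'' t)) t :=
    fun t ht => (h0 t ht).mul ((traceL E).hasFDerivAt.comp_hasDerivAt t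
      ((hS.hasDerivAt t ht).mul (hC.hasDerivAt' t ht)))
  refine ⟨h0, h1, ?_⟩
  have c1 : ContinuousOn C' s :=
    fun t ht => (hC.hasDerivAt' t ht).continuousAt.continuousWithinAt
  have c2 := hC.continuousOn
  have d0 : ContinuousOn (fun t => Ring.inverse (C t)) s :=
    fun t ht => (hS.hasDerivAt t ht).continuousAt.continuousWithinAt
  have d1 : ContinuousOn (fun t => invD1 (C t) (C' t)) s :=
    fun t ht => (hS.hasDerivAt' t ht).continuousAt.continuousWithinAt
  have e0 : ContinuousOn (fun t => (C t).det) s :=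
    fun t ht => (h0 t ht).continuousAt.continuousWithinAt
  have e1 : ContinuousOn (fun t => detD1 (C t) (C' t)) s :=
    fun t ht => (h1 t ht).continuousAt.continuousWithinAt
  unfold detD2
  fun_prop

omit [FiniteDimensional ℝ E] in
lemma invD1_one (C' : E →L[ℝ] E) : invD1 1 C' = -C' := by simp [invD1]

omit [FiniteDimensional ℝ E] in
lemma invD2_one (C' C'' : E →L[ℝ] E) : invD2 1 C' C'' = 2 • (C' * C') - C'' := by
  simp only [invD2, invD1, Ring.inverse_one, one_mul, mul_one]
  noncomm_ring

lemma detD1_one (C' : E →L[ℝ] E) : detD1 1 C' = traceL E C' := by simp [detD1, det_one]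

lemma detD2_one (C' C'' : E →L[ℝ] E) :
    detD2 1 C' C'' = (traceL E C') ^ 2 - traceL E (C' * C') + traceL E C'' := by
  simp only [detD2, detD1_one, invD1_one, Ring.inverse_one, one_mul, det_one, map_add, neg_mul,
    map_neg]
  ring

lemma norm_inverse_le {A : E →L[ℝ] E} (hA : ‖A - 1‖ ≤ 1 / 2) : ‖Ring.inverse A‖ ≤ 2 := by
  refine ContinuousLinearMap.opNorm_le_bound _ zero_le_two fun z => ?_
  have h1 := norm_le_two_mul hA (Ring.inverse A z)
  have h2 : A (Ring.inverse A z) = z := by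
    have := Ring.mul_inverse_cancel _ (isUnit_of_norm_sub_one_le hA)
    exact congrArg (fun T : E →L[ℝ] E => T z) this
  rwa [h2] at h1

lemma norm_invD1_le {A A' : E →L[ℝ] E} {K : ℝ} (hA : ‖A - 1‖ ≤ 1 / 2) (hA' : ‖A'‖ ≤ K) :
    ‖invD1 A A'‖ ≤ 4 * K := by
  have h := norm_inverse_le hA
  rw [invD1, norm_neg]
  calc _ ≤ ‖Ring.inverse A‖ * ‖A'‖ * ‖Ring.inverse A‖ :=
        (norm_mul_le _ _).trans (mul_le_mul_of_nonneg_right (norm_mul_le _ _) (norm_nonneg _))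
    _ ≤ 2 * K * 2 := by
        have := (norm_nonneg _).trans hA'
        gcongr
    _ = 4 * K := by ring

lemma norm_invD1_mul_add_le {A A' A'' : E →L[ℝ] E} {K : ℝ} (hA : ‖A - 1‖ ≤ 1 / 2)
    (hA' : ‖A'‖ ≤ K) (hA'' : ‖A''‖ ≤ K) :
    ‖invD1 A A' * A' + Ring.inverse A * A''‖ ≤ 4 * K * K + 2 * K := by
  have h := norm_inverse_le hA
  have h1 := norm_invD1_le hA hA'
  have hK := (norm_nonneg _).trans hA'
  calc _ ≤ ‖invD1 A A'‖ * ‖A'‖ + ‖Ring.inverse A‖ * ‖A''‖ :=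
        (norm_add_le _ _).trans (add_le_add (norm_mul_le _ _) (norm_mul_le _ _))
    _ ≤ 4 * K * K + 2 * K := by gcongr

lemma norm_invD2_le {A A' A'' : E →L[ℝ] E} {K : ℝ} (hA : ‖A - 1‖ ≤ 1 / 2)
    (hA' : ‖A'‖ ≤ K) (hA'' : ‖A''‖ ≤ K) :
    ‖invD2 A A' A''‖ ≤ (4 * K * K + 2 * K) * 2 + 2 * K * (4 * K) := by
  have h := norm_inverse_le hA
  have h1 := norm_invD1_le hA hA'
  have h2 := norm_invD1_mul_add_le hA hA' hA''
  have hK := (norm_nonneg _).trans hA'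
  rw [invD2, norm_neg]
  calc _ ≤ ‖invD1 A A' * A' + Ring.inverse A * A''‖ * ‖Ring.inverse A‖ +
        ‖Ring.inverse A‖ * ‖A'‖ * ‖invD1 A A'‖ :=
        (norm_add_le _ _).trans (add_le_add (norm_mul_le _ _)
          ((norm_mul_le _ _).trans (mul_le_mul_of_nonneg_right (norm_mul_le _ _)
            (norm_nonneg _))))
    _ ≤ _ := by gcongr

/-- The determinant and its two derivatives along a path are bounded near the identity in terms of
bounds on the derivatives of the path. -/
lemma exists_detD_bounds (K : ℝ) : ∃ M : ℝ, ∀ A A' A'' : E →L[ℝ] E, ‖A - 1‖ ≤ 1 / 2 →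
    ‖A'‖ ≤ K → ‖A''‖ ≤ K → |A.det| ≤ M ∧ |detD1 A A'| ≤ M ∧ |detD2 A A' A''| ≤ M := by
  obtain ⟨c, C, hc, hC, hb⟩ := exists_det_bounds (E := E)
  rcases lt_or_ge K 0 with hK | hK
  · exact ⟨0, fun A A' _ _ hA' => absurd hA' (not_le.2 (hK.trans_le (norm_nonneg _)))⟩
  let τ := ‖traceL E‖
  let M₁ := C * (τ * (2 * K))
  let M₂ := M₁ * (τ * (2 * K)) + C * (τ * (4 * K * K + 2 * K))
  have hτ : 0 ≤ τ := norm_nonneg (traceL E)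
  have hM₁ : 0 ≤ M₁ := by positivity
  have hM₂ : 0 ≤ M₂ := by positivity
  refine ⟨C + M₁ + M₂, fun A A' A'' hA hA' hA'' => ?_⟩
  have hd : |A.det| ≤ C := by
    rw [abs_of_pos (hc.trans_le (hb A hA).1)]
    exact (hb A hA).2
  have ht : |traceL E (Ring.inverse A * A')| ≤ τ * (2 * K) := by
    refine ((traceL E).le_opNorm _).trans (mul_le_mul_of_nonneg_left ?_ hτ)
    exact (norm_mul_le _ _).trans (mul_le_mul (norm_inverse_le hA) hA' (norm_nonneg _) zero_le_two)
  have ht' : |traceL E (invD1 A A' * A' + Ring.inverse A * A'')| ≤ τ * (4 * K * K + 2 * K) :=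
    ((traceL E).le_opNorm _).trans
      (mul_le_mul_of_nonneg_left (norm_invD1_mul_add_le hA hA' hA'') hτ)
  have h1 : |detD1 A A'| ≤ M₁ := by
    rw [detD1, abs_mul]
    exact mul_le_mul hd ht (abs_nonneg _) hC.le
  have h2 : |detD2 A A' A''| ≤ M₂ := by
    refine (abs_add_le _ _).trans (add_le_add ?_ ?_)
    · rw [abs_mul]
      exact mul_le_mul h1 ht (abs_nonneg _) hM₁
    · rw [abs_mul]
      exact mul_le_mul hd ht' (abs_nonneg _) hC.le
  exact ⟨by linarith, by linarith, by linarith⟩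

lemma exists_invD_bounds (E : Type*) [NormedAddCommGroup E] [InnerProductSpace ℝ E]
    [FiniteDimensional ℝ E] (K : ℝ) : ∃ M : ℝ, 0 ≤ M ∧ ∀ A A' A'' : E →L[ℝ] E, ‖A - 1‖ ≤ 1 / 2 →
    ‖A'‖ ≤ K → ‖A''‖ ≤ K → ‖Ring.inverse A‖ ≤ M ∧ ‖invD1 A A'‖ ≤ M ∧ ‖invD2 A A' A''‖ ≤ M := by
  rcases lt_or_ge K 0 with hK | hK
  · exact ⟨0, le_rfl, fun A A' _ _ hA' => absurd hA' (not_le.2 (hK.trans_le (norm_nonneg _)))⟩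
  refine ⟨2 + 4 * K + ((4 * K * K + 2 * K) * 2 + 2 * K * (4 * K)), by positivity,
    fun A A' A'' hA hA' hA'' => ?_⟩
  have h0 := norm_inverse_le hA
  have h1 := norm_invD1_le hA hA'
  have h2 := norm_invD2_le hA hA' hA''
  have hKK := mul_nonneg hK hK
  exact ⟨by linarith, by linarith, by linarith⟩

end DetPath

/-! ### Integrals along the deformation -/

section FlowIntegral

variable {N : ℕ} {Ω : Set (Eucl N)} {R R' : Eucl N → Eucl N} {δ : ℝ}

/-- The Jacobi matrix of the flow at `x`, as an operator. -/
def flowD (R R' : Eucl N → Eucl N) (x : Eucl N) (t : ℝ) : Eucl N →L[ℝ] Eucl N :=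
  1 + t • fderiv ℝ R x + (t ^ 2 / 2) • fderiv ℝ R' x

/-- The time derivative of `flowD`. -/
def flowD' (R R' : Eucl N → Eucl N) (x : Eucl N) (t : ℝ) : Eucl N →L[ℝ] Eucl N :=
  fderiv ℝ R x + t • fderiv ℝ R' x

lemma hasC2Path_flowD (x : Eucl N) {s : Set ℝ} :
    HasC2Path (flowD R R' x) (flowD' R R' x) (fun _ => fderiv ℝ R' x) s :=
  hasC2Path_quadratic _ _ _

lemma flowD_zero (x : Eucl N) : flowD R R' x 0 = 1 := by
  ext z
  simp [flowD]

lemma flowD'_zero (x : Eucl N) : flowD' R R' x 0 = fderiv ℝ R x := by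
  ext z
  simp [flowD']

/-- The adjoint, as a real continuous linear map. -/
def adjointL (N : ℕ) : (Eucl N →L[ℝ] Eucl N) →L[ℝ] (Eucl N →L[ℝ] Eucl N) :=
  LinearMap.toContinuousLinearMap
    { toFun := ContinuousLinearMap.adjoint
      map_add' := map_add _
      map_smul' := fun c A => by simp }

lemma adjointL_apply (A : Eucl N →L[ℝ] Eucl N) : adjointL N A = ContinuousLinearMap.adjoint A :=
  rfl

lemma rowMul_jac_eq_adjointL (F : Eucl N → Eucl N) (x z : Eucl N) :
    rowMul z (jac F x) = adjointL N (fderiv ℝ F x) z := rowMul_jac F x z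

lemma norm_adjointL (A : Eucl N →L[ℝ] Eucl N) : ‖adjointL N A‖ = ‖A‖ :=
  LinearIsometryEquiv.norm_map _ _

lemma adjointL_one : adjointL N 1 = 1 := star_one (Eucl N →L[ℝ] Eucl N)

/-- The hypotheses under which the flow deforms `Ω` for `|t| < δ`. -/
structure IsFlowData (R R' : Eucl N → Eucl N) (Ω : Set (Eucl N)) (δ : ℝ) : Prop where
  isOpen : IsOpen Ω
  isBounded : Bornology.IsBounded Ω
  left : IsC1Over R Ω
  right : IsC1Over R' Ω
  pos : 0 < δ
  le_one : δ ≤ 1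
  deformation : ∀ t ∈ Set.Ioo (-δ) δ, IsSmallDeformation (flow R R' t) Ω

namespace IsFlowData

lemma fderiv_eq (h : IsFlowData R R' Ω δ) (t : ℝ) {x : Eucl N} (hx : x ∈ Ω) :
    fderiv ℝ (flow R R' t) x = flowD R R' x t :=
  fderiv_flow h.left h.right t hx

lemma norm_flowD_sub_one_le (h : IsFlowData R R' Ω δ) {t : ℝ} (ht : t ∈ Set.Ioo (-δ) δ)
    {x : Eucl N} (hx : x ∈ Ω) : ‖flowD R R' x t - 1‖ ≤ 1 / 2 := by
  rw [← h.fderiv_eq t hx]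
  exact (h.deformation t ht).norm_fderiv_sub_one_le h.isOpen hx

lemma abs_lt_one (h : IsFlowData R R' Ω δ) {t : ℝ} (ht : t ∈ Set.Ioo (-δ) δ) : |t| ≤ 1 :=
  (abs_lt.2 ht).le.trans h.le_one

lemma exists_norm_flowD_le (h : IsFlowData R R' Ω δ) : ∃ K : ℝ, ∀ t ∈ Set.Ioo (-δ) δ, ∀ x ∈ Ω,
    ‖flowD' R R' x t‖ ≤ K ∧ ‖fderiv ℝ R' x‖ ≤ K := by
  obtain ⟨L, hL0, hL⟩ := h.left.exists_norm_fderiv_le h.isOpen h.isBounded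
  obtain ⟨L', hL0', hL'⟩ := h.right.exists_norm_fderiv_le h.isOpen h.isBounded
  refine ⟨L + L', fun t ht x hx => ⟨?_, by linarith [hL' x hx]⟩⟩
  refine (norm_add_le _ _).trans (add_le_add (hL x hx) ?_)
  rw [norm_smul, Real.norm_eq_abs]
  exact (mul_le_mul (h.abs_lt_one ht) (hL' x hx) (norm_nonneg _) zero_le_one).trans_eq (one_mul _)

lemma continuousOn_flowD (h : IsFlowData R R' Ω δ) (t : ℝ) :
    ContinuousOn (fun x => flowD R R' x t) Ω := by
  have h1 := h.left.continuousOn_fderiv h.isOpen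
  have h2 := h.right.continuousOn_fderiv h.isOpen
  unfold flowD
  fun_prop

lemma aestronglyMeasurable_det (h : IsFlowData R R' Ω δ) (t : ℝ) :
    AEStronglyMeasurable (fun x => (flowD R R' x t).det) (volume.restrict Ω) :=
  (ContinuousLinearMap.continuous_det.comp_continuousOn
    (h.continuousOn_flowD t)).aestronglyMeasurable h.isOpen.measurableSet

lemma aestronglyMeasurable_inverse (h : IsFlowData R R' Ω δ) {t : ℝ} (ht : t ∈ Set.Ioo (-δ) δ)
    {g : Eucl N → Eucl N} (hg : AEStronglyMeasurable g (volume.restrict Ω)) :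
    AEStronglyMeasurable (fun x => Ring.inverse (adjointL N (flowD R R' x t)) (g x))
      (volume.restrict Ω) := by
  have h1 : ContinuousOn (fun x => Ring.inverse (adjointL N (flowD R R' x t))) Ω := by
    intro x hx
    obtain ⟨u, hu⟩ := isUnit_of_norm_sub_one_le
      (norm_adjoint_sub_one (h.norm_flowD_sub_one_le ht hx))
    have e1 : ContinuousAt Ring.inverse (adjointL N (flowD R R' x t)) := by
      rw [adjointL_apply, ← hu]
      exact NormedRing.inverse_continuousAt u
    exact ContinuousAt.comp_continuousWithinAt
      (f := fun x => adjointL N (flowD R R' x t)) e1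
      (((adjointL N).continuous.comp_continuousOn (h.continuousOn_flowD t)) x hx)
  exact (ContinuousLinearMap.id ℝ (Eucl N →L[ℝ] Eucl N)).aestronglyMeasurable_comp₂
    (h1.aestronglyMeasurable h.isOpen.measurableSet) hg

/-- The weighted integral of a power along the deformation, for a fixed function on `Ω`
translated linearly in time. -/
lemma hasC2Path_val (h : IsFlowData R R' Ω δ) {q : ℝ} (hq : 2 ≤ q) {f k : Eucl N → ℝ}
    (hf : MemLp f (ENNReal.ofReal q) (volume.restrict Ω))
    (hk : MemLp k (ENNReal.ofReal q) (volume.restrict Ω)) :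
    ∃ B' B'' : ℝ → ℝ,
      HasC2Path (fun t => ∫ x in Ω, (flowD R R' x t).det * ‖f x + t • k x‖ ^ q) B' B''
        (Set.Ioo (-δ) δ) ∧
      B' 0 = ∫ x in Ω, (traceL _ (fderiv ℝ R x) * ‖f x‖ ^ q + normPowD1 q (f x) (k x)) ∧
      B'' 0 = ∫ x in Ω, (((traceL _ (fderiv ℝ R x)) ^ 2 -
        traceL _ (fderiv ℝ R x * fderiv ℝ R x) + traceL _ (fderiv ℝ R' x)) * ‖f x‖ ^ q +
        2 * (traceL _ (fderiv ℝ R x) * normPowD1 q (f x) (k x)) +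
        normPowD2 q (f x) (k x) (k x)) := by
  obtain ⟨K, hK⟩ := h.exists_norm_flowD_le
  obtain ⟨M, hM⟩ := exists_detD_bounds (E := Eucl N) K
  have hb : Integrable (fun x => (‖f x‖ + ‖k x‖) ^ q) (volume.restrict Ω) := by
    have := (hf.norm.add hk.norm).integrable_norm_rpow (by simp; linarith) ENNReal.ofReal_ne_top
    rw [ENNReal.toReal_ofReal (by linarith)] at this
    refine this.congr (.of_forall fun x => ?_)
    simp only [Pi.add_apply]
    rw [Real.norm_of_nonneg (by positivity)]
  have hmem : ∀ᵐ x ∂(volume.restrict Ω), x ∈ Ω := ae_restrict_mem h.isOpen.measurableSet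
  have key := hasC2Path_integral_mul_norm_rpow (μ := volume.restrict Ω) hq
    (isOpen_Ioo : IsOpen (Set.Ioo (-δ) δ))
    (D := fun t x => (flowD R R' x t).det)
    (D' := fun t x => detD1 (flowD R R' x t) (flowD' R R' x t))
    (D'' := fun t x => detD2 (flowD R R' x t) (flowD' R R' x t) (fderiv ℝ R' x))
    (ζ := fun t x => f x + t • k x) (ζ' := fun _ x => k x) (ζ'' := fun _ _ => (0 : ℝ))
    (le_max_right M 0) hb (fun t _ => h.aestronglyMeasurable_det t)
    (fun t _ => hf.aestronglyMeasurable.add (hk.aestronglyMeasurable.const_smul t))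
    (hmem.mono fun x hx => (hasC2Path_flowD x).det fun t ht =>
      isUnit_of_norm_sub_one_le (h.norm_flowD_sub_one_le ht hx))
    (.of_forall fun x => hasC2Path_line _ _)
    (hmem.mono fun x hx t ht => by
      obtain ⟨h1, h2, h3⟩ :=
        hM _ _ _ (h.norm_flowD_sub_one_le ht hx) (hK t ht x hx).1 (hK t ht x hx).2
      exact ⟨le_max_of_le_left h1, le_max_of_le_left h2, le_max_of_le_left h3⟩)
    (.of_forall fun x t ht => by
      refine ⟨(norm_add_le _ _).trans (add_le_add le_rfl ?_), by
        linarith [norm_nonneg (f x)], by rw [norm_zero]; positivity⟩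
      rw [norm_smul, Real.norm_eq_abs]
      exact mul_le_of_le_one_left (norm_nonneg _) (h.abs_lt_one ht))
  refine ⟨_, _, key, ?_, ?_⟩
  · simp only [flowD_zero, flowD'_zero, detD1_one, det_one, zero_smul, add_zero, one_mul]
  · simp only [flowD_zero, flowD'_zero, detD1_one, detD2_one, det_one, zero_smul, add_zero,
      one_mul, map_zero]

/-- The weighted integral of a power of the transported gradient along the deformation. -/
lemma hasC2Path_grad (h : IsFlowData R R' Ω δ) {p : ℝ} (hp : 2 ≤ p) {g k : Eucl N → Eucl N}
    (hg : MemLp g (ENNReal.ofReal p) (volume.restrict Ω))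
    (hk : MemLp k (ENNReal.ofReal p) (volume.restrict Ω)) :
    ∃ A' A'' : ℝ → ℝ,
      HasC2Path (fun t => ∫ x in Ω, (flowD R R' x t).det *
          ‖Ring.inverse (adjointL N (flowD R R' x t)) (g x + t • k x)‖ ^ p) A' A''
        (Set.Ioo (-δ) δ) ∧
      A' 0 = ∫ x in Ω, (traceL _ (fderiv ℝ R x) * ‖g x‖ ^ p +
        normPowD1 p (g x) (k x - rowMul (g x) (jac R x))) ∧
      A'' 0 = ∫ x in Ω, (((traceL _ (fderiv ℝ R x)) ^ 2 -
        traceL _ (fderiv ℝ R x * fderiv ℝ R x) + traceL _ (fderiv ℝ R' x)) * ‖g x‖ ^ p +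
        2 * (traceL _ (fderiv ℝ R x) *
          normPowD1 p (g x) (k x - rowMul (g x) (jac R x))) +
        (normPowD2 p (g x) (k x - rowMul (g x) (jac R x)) (k x - rowMul (g x) (jac R x)) +
          normPowD1 p (g x) ((2 : ℝ) • rowMul (rowMul (g x) (jac R x)) (jac R x) -
            rowMul (g x) (jac R' x) - (2 : ℝ) • rowMul (k x) (jac R x)))) := by
  obtain ⟨K, hK⟩ := h.exists_norm_flowD_le
  obtain ⟨M, hM⟩ := exists_detD_bounds (E := Eucl N) K
  obtain ⟨M₁, hM₁0, hM₁⟩ := exists_invD_bounds (Eucl N) K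
  have hb : Integrable (fun x => (3 * M₁ * (‖g x‖ + ‖k x‖)) ^ p) (volume.restrict Ω) := by
    have := ((hg.norm.add hk.norm).const_mul (3 * M₁)).integrable_norm_rpow
      (by simp; linarith) ENNReal.ofReal_ne_top
    rw [ENNReal.toReal_ofReal (by linarith)] at this
    refine this.congr (.of_forall fun x => ?_)
    simp only [Pi.add_apply]
    rw [Real.norm_of_nonneg (by positivity)]
  have hmem : ∀ᵐ x ∂(volume.restrict Ω), x ∈ Ω := ae_restrict_mem h.isOpen.measurableSet
  have hadj : ∀ {t : ℝ}, t ∈ Set.Ioo (-δ) δ → ∀ {x}, x ∈ Ω →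
      ‖adjointL N (flowD R R' x t) - 1‖ ≤ 1 / 2 := fun ht x hx =>
    norm_adjoint_sub_one (h.norm_flowD_sub_one_le ht hx)
  have key := hasC2Path_integral_mul_norm_rpow (μ := volume.restrict Ω) hp
    (isOpen_Ioo : IsOpen (Set.Ioo (-δ) δ))
    (D := fun t x => (flowD R R' x t).det)
    (D' := fun t x => detD1 (flowD R R' x t) (flowD' R R' x t))
    (D'' := fun t x => detD2 (flowD R R' x t) (flowD' R R' x t) (fderiv ℝ R' x))
    (ζ := fun t x => Ring.inverse (adjointL N (flowD R R' x t)) (g x + t • k x))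
    -- product rule for `T_t (g + t k)` with `T_t = (DΦ_t)^{-T}`; the `0` is the second
    -- derivative of `g + t k`
    (ζ' := fun t x => Ring.inverse (adjointL N (flowD R R' x t)) (k x) +
      invD1 (adjointL N (flowD R R' x t)) (adjointL N (flowD' R R' x t)) (g x + t • k x))
    (ζ'' := fun t x => Ring.inverse (adjointL N (flowD R R' x t)) 0 +
      invD1 (adjointL N (flowD R R' x t)) (adjointL N (flowD' R R' x t)) (k x) +
      (invD1 (adjointL N (flowD R R' x t)) (adjointL N (flowD' R R' x t)) (k x) +
      invD2 (adjointL N (flowD R R' x t)) (adjointL N (flowD' R R' x t))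
        (adjointL N (fderiv ℝ R' x)) (g x + t • k x)))
    (le_max_right M 0) hb (fun t _ => h.aestronglyMeasurable_det t)
    (fun t ht => h.aestronglyMeasurable_inverse ht
      (hg.aestronglyMeasurable.add (hk.aestronglyMeasurable.const_smul t)))
    (hmem.mono fun x hx => (hasC2Path_flowD x).det fun t ht =>
      isUnit_of_norm_sub_one_le (h.norm_flowD_sub_one_le ht hx))
    (hmem.mono fun x hx => HasC2Path.bilin (ContinuousLinearMap.id ℝ (Eucl N →L[ℝ] Eucl N))
      (((hasC2Path_flowD x).clm_comp (adjointL N)).ringInverse fun t ht =>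
        isUnit_of_norm_sub_one_le (hadj ht hx)) (hasC2Path_line _ _))
    (hmem.mono fun x hx t ht => by
      obtain ⟨h1, h2, h3⟩ :=
        hM _ _ _ (h.norm_flowD_sub_one_le ht hx) (hK t ht x hx).1 (hK t ht x hx).2
      exact ⟨le_max_of_le_left h1, le_max_of_le_left h2, le_max_of_le_left h3⟩)
    (hmem.mono fun x hx t ht => by
      obtain ⟨h1, h2, h3⟩ := hM₁ _ _ _ (hadj ht hx)
        ((norm_adjointL _).trans_le (hK t ht x hx).1) ((norm_adjointL _).trans_le (hK t ht x hx).2)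
      have e0 : ‖g x + t • k x‖ ≤ ‖g x‖ + ‖k x‖ := by
        refine (norm_add_le _ _).trans (add_le_add le_rfl ?_)
        rw [norm_smul, Real.norm_eq_abs]
        exact mul_le_of_le_one_left (norm_nonneg _) (h.abs_lt_one ht)
      have e1 : ‖k x‖ ≤ ‖g x‖ + ‖k x‖ := by linarith [norm_nonneg (g x)]
      have hop : ∀ {T : Eucl N →L[ℝ] Eucl N} {z : Eucl N}, ‖T‖ ≤ M₁ → ‖z‖ ≤ ‖g x‖ + ‖k x‖ →
          ‖T z‖ ≤ M₁ * (‖g x‖ + ‖k x‖) := fun {T z} hT hz =>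
        (T.le_opNorm z).trans (mul_le_mul hT hz (norm_nonneg _) hM₁0)
      have hpos : 0 ≤ M₁ * (‖g x‖ + ‖k x‖) := by positivity
      refine ⟨?_, ?_, ?_⟩
      · linarith [hop h1 e0]
      · linarith [norm_add_le (Ring.inverse (adjointL N (flowD R R' x t)) (k x))
          (invD1 (adjointL N (flowD R R' x t)) (adjointL N (flowD' R R' x t)) (g x + t • k x)),
          hop h1 e1, hop h2 e0]
      · rw [map_zero, zero_add]
        refine (norm_add_le _ _).trans ?_
        linarith [norm_add_le
          (invD1 (adjointL N (flowD R R' x t)) (adjointL N (flowD' R R' x t)) (k x))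
          (invD2 (adjointL N (flowD R R' x t)) (adjointL N (flowD' R R' x t))
            (adjointL N (fderiv ℝ R' x)) (g x + t • k x)), hop h2 e1, hop h3 e0])
  refine ⟨_, _, key, ?_, ?_⟩
  · refine integral_congr_ae (.of_forall fun x => ?_)
    simp only [flowD_zero, flowD'_zero, detD1_one, det_one, zero_smul, add_zero, one_mul,
      adjointL_one, Ring.inverse_one, invD1_one, rowMul_jac_eq_adjointL,
      one_apply_eq_self, neg_apply, ← sub_eq_add_neg]
  · refine integral_congr_ae (.of_forall fun x => ?_)
    have e : -adjointL N (fderiv ℝ R x) (k x) +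
        (-adjointL N (fderiv ℝ R x) (k x) +
          (2 • (adjointL N (fderiv ℝ R x) *
            adjointL N (fderiv ℝ R x)) -
              adjointL N (fderiv ℝ R' x)) (g x)) =
        (2 : ℝ) • adjointL N (fderiv ℝ R x)
          (adjointL N (fderiv ℝ R x) (g x)) -
          adjointL N (fderiv ℝ R' x) (g x) -
          (2 : ℝ) • adjointL N (fderiv ℝ R x) (k x) := by
      simp only [sub_apply, two_smul, add_apply, mul_apply_eq_comp]
      abel
    simp only [flowD_zero, flowD'_zero, detD1_one, detD2_one, det_one, zero_smul, add_zero,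
      one_mul, adjointL_one, Ring.inverse_one, invD1_one, invD2_one, rowMul_jac_eq_adjointL,
      one_apply_eq_self, neg_apply, map_zero, zero_add, e]
    simp only [← sub_eq_add_neg]

end IsFlowData

end FlowIntegral

/-! ### The energy along the deformation and the abstract assumptions -/

section ShapePath

variable {N : ℕ} {Ω : Set (Eucl N)} {p q : ℝ} [Fact (1 ≤ ENNReal.ofReal p)]
  {R R' : Eucl N → Eucl N} {δ : ℝ}

/-- `∫ |DW|^p` for `W = (u + t v) ∘ Φ_t⁻¹`, pulled back to `Ω`. -/
def gradInt (R R' : Eucl N → Eucl N) (u v : W0 Ω p) (t : ℝ) : ℝ :=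
  ∫ x in Ω, (flowD R R' x t).det *
    ‖Ring.inverse (adjointL N (flowD R R' x t)) (grad u x + t • grad v x)‖ ^ p

/-- `∫ |W|^q` for `W = (u + t v) ∘ Φ_t⁻¹`, pulled back to `Ω`. -/
def valInt (R R' : Eucl N → Eucl N) (q : ℝ) (u v : W0 Ω p) (t : ℝ) : ℝ :=
  ∫ x in Ω, (flowD R R' x t).det * ‖val u x + t • val v x‖ ^ q

lemma gradInt_zero (u v : W0 Ω p) : gradInt R R' u v 0 = ∫ x in Ω, ‖grad u x‖ ^ p := by
  simp only [gradInt, flowD_zero, det_one, adjointL_one, Ring.inverse_one, zero_smul, add_zero,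
    one_mul, one_apply_eq_self]

lemma valInt_zero (u v : W0 Ω p) : valInt R R' q u v 0 = ∫ x in Ω, |val u x| ^ q := by
  simp only [valInt, flowD_zero, det_one, zero_smul, add_zero, one_mul, Real.norm_eq_abs]

lemma val_path (c t : ℝ) (u v : W0 Ω p) : val (c • (u + t • v)) =ᵐ[volume.restrict Ω]
    fun x => c * (val u x + t • val v x) := by
  filter_upwards [val_smul c (u + t • v), val_add u (t • v), val_smul t v] with x h1 h2 h3
  rw [h1, h2, h3, smul_eq_mul]

lemma grad_path (c t : ℝ) (u v : W0 Ω p) : grad (c • (u + t • v)) =ᵐ[volume.restrict Ω]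
    fun x => c • (grad u x + t • grad v x) := by
  filter_upwards [grad_smul c (u + t • v), grad_add u (t • v), grad_smul t v] with x h1 h2 h3
  rw [h1, h2, h3]

lemma IsTransport.integral_val_path (h : IsFlowData R R' Ω δ) {t : ℝ} (ht : t ∈ Set.Ioo (-δ) δ)
    {c : ℝ} (hc : 0 ≤ c) {u v : W0 Ω p} {W : W0 (flow R R' t '' Ω) p}
    (hW : IsTransport (flow R R' t) (c • (u + t • v)) W) :
    ∫ y in flow R R' t '' Ω, |val W y| ^ q = c ^ q * valInt R R' q u v t := by
  rw [hW.integral_val_rpow (h.deformation t ht) h.isOpen, valInt, ← integral_const_mul]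
  refine integral_congr_ae ?_
  filter_upwards [val_path c t u v, ae_restrict_mem h.isOpen.measurableSet] with x h1 h2
  rw [h1, h.fderiv_eq t h2, abs_mul, abs_of_nonneg hc, Real.mul_rpow hc (abs_nonneg _),
    Real.norm_eq_abs]
  ring

lemma IsTransport.integral_grad_path (hp : 2 ≤ p) (h : IsFlowData R R' Ω δ) {t : ℝ}
    (ht : t ∈ Set.Ioo (-δ) δ) {c : ℝ} (hc : 0 ≤ c) {u v : W0 Ω p}
    {W : W0 (flow R R' t '' Ω) p} (hW : IsTransport (flow R R' t) (c • (u + t • v)) W) :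
    ∫ y in flow R R' t '' Ω, ‖grad W y‖ ^ p = c ^ p * gradInt R R' u v t := by
  rw [hW.integral_norm_grad_rpow hp (h.deformation t ht) h.isOpen h.isBounded, gradInt,
    ← integral_const_mul]
  refine integral_congr_ae ?_
  filter_upwards [grad_path c t u v, ae_restrict_mem h.isOpen.measurableSet] with x h1 h2
  rw [h1, h.fderiv_eq t h2, map_smul, norm_smul, Real.norm_of_nonneg hc,
    Real.mul_rpow hc (norm_nonneg _), adjointL_apply]
  ring

variable [Fact (1 ≤ ENNReal.ofReal q)]

lemma energy_eq (hN : 2 ≤ N) (hp : 2 ≤ p) (hq : 2 ≤ q)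
    (hcrit : (q : EReal) < sobolevConj N p) (hΩo : IsOpen Ω) (hΩ : Bornology.IsBounded Ω)
    (w : W0 Ω p) : energy (laneEmden p q) w =
      1 / p * (∫ x in Ω, ‖grad w x‖ ^ p) - 1 / q * ∫ x in Ω, |val w x| ^ q := by
  obtain ⟨J, hJ, -, -⟩ := exists_isSubcriticalPair (q := q) hN hp hq hcrit hΩo hΩ
  rw [energy_laneEmden hp hq hJ, lpPow_eq_integral_val hJ]
  rfl

/-- The positivity of `∫ |w|^q` replaces the condition `w ≠ 0`. -/
lemma mem_nehari_of_integral_eq (hN : 2 ≤ N) (hp : 2 ≤ p) (hq : 2 ≤ q)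
    (hcrit : (q : EReal) < sobolevConj N p) (hΩo : IsOpen Ω) (hΩ : Bornology.IsBounded Ω)
    {w : W0 Ω p} (hpos : 0 < ∫ x in Ω, |val w x| ^ q)
    (heq : ∫ x in Ω, ‖grad w x‖ ^ p = ∫ x in Ω, |val w x| ^ q) :
    w ∈ nehari (energy (laneEmden p q)) := by
  refine (mem_nehari_iff hN hp hq hcrit hΩo hΩ w).2 ⟨fun h0 => ?_, heq⟩
  subst h0
  have h2 : val (0 : W0 Ω p) =ᵐ[volume.restrict Ω] 0 := Lp.coeFn_zero _ _ _
  have h3 : ∫ x in Ω, |val (0 : W0 Ω p) x| ^ q = 0 := by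
    rw [← integral_zero (Eucl N) ℝ (μ := volume.restrict Ω)]
    refine integral_congr_ae (h2.mono fun x hx => ?_)
    simp only [hx, Pi.zero_apply, abs_zero]
    exact Real.zero_rpow (by linarith)
  exact hpos.ne' h3

lemma memLp_val_q (hN : 2 ≤ N) (hp : 2 ≤ p) (hq : 2 ≤ q)
    (hcrit : (q : EReal) < sobolevConj N p) (hΩo : IsOpen Ω) (hΩ : Bornology.IsBounded Ω)
    (w : W0 Ω p) : MemLp (val w) (ENNReal.ofReal q) (volume.restrict Ω) := by
  obtain ⟨f, hf⟩ := exists_lp_val hN hp hq hcrit hΩo hΩ w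
  exact (memLp_congr_ae hf).1 (Lp.memLp f)

lemma IsFlowData.contDiffOn_gradInt (h : IsFlowData R R' Ω δ) (hp : 2 ≤ p) (u v : W0 Ω p) :
    ContDiffOn ℝ 2 (gradInt R R' u v) (Set.Ioo (-δ) δ) := by
  obtain ⟨_, _, h1, -⟩ := h.hasC2Path_grad hp (memLp_grad u) (memLp_grad v)
  exact h1.contDiffOn isOpen_Ioo

lemma IsFlowData.contDiffOn_valInt (h : IsFlowData R R' Ω δ) (hN : 2 ≤ N) (hp : 2 ≤ p)
    (hq : 2 ≤ q) (hcrit : (q : EReal) < sobolevConj N p) (u v : W0 Ω p) :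
    ContDiffOn ℝ 2 (valInt R R' q u v) (Set.Ioo (-δ) δ) := by
  obtain ⟨_, _, h1, -⟩ := h.hasC2Path_val hq
    (memLp_val_q hN hp hq hcrit h.isOpen h.isBounded u)
    (memLp_val_q hN hp hq hcrit h.isOpen h.isBounded v)
  exact h1.contDiffOn isOpen_Ioo

/-- The energy of the transported function, pulled back to `Ω`. -/
lemma IsTransport.energy_path (h : IsFlowData R R' Ω δ) (hN : 2 ≤ N) (hp : 2 ≤ p)
    (hq : 2 ≤ q) (hcrit : (q : EReal) < sobolevConj N p) {t : ℝ} (ht : t ∈ Set.Ioo (-δ) δ)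
    {c : ℝ} (hc : 0 ≤ c) {u v : W0 Ω p} {W : W0 (flow R R' t '' Ω) p}
    (hW : IsTransport (flow R R' t) (c • (u + t • v)) W) :
    energy (laneEmden p q) W = 1 / p * (c ^ p * gradInt R R' u v t) -
      1 / q * (c ^ q * valInt R R' q u v t) := by
  have hd := h.deformation t ht
  rw [energy_eq hN hp hq hcrit (hd.isOpen_image h.isOpen) (hd.isBounded_image h.isBounded),
    hW.integral_val_path h ht hc, hW.integral_grad_path hp h ht hc]

/-- The Nehari constraint on `Ω_t`, pulled back to `Ω`. -/
lemma IsTransport.nehari_path (h : IsFlowData R R' Ω δ) (hN : 2 ≤ N) (hp : 2 ≤ p)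
    (hq : 2 ≤ q) (hcrit : (q : EReal) < sobolevConj N p) {t : ℝ} (ht : t ∈ Set.Ioo (-δ) δ)
    {c : ℝ} (hc : 0 ≤ c) {u v : W0 Ω p} {W : W0 (flow R R' t '' Ω) p}
    (hW : IsTransport (flow R R' t) (c • (u + t • v)) W)
    (hWN : W ∈ nehari (energy (laneEmden p q))) :
    c ^ p * gradInt R R' u v t = c ^ q * valInt R R' q u v t := by
  have hd := h.deformation t ht
  have h1 := ((mem_nehari_iff hN hp hq hcrit (hd.isOpen_image h.isOpen)
    (hd.isBounded_image h.isBounded) W).1 hWN).2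
  rwa [hW.integral_val_path h ht hc, hW.integral_grad_path hp h ht hc] at h1

lemma IsTransport.mem_nehari (h : IsFlowData R R' Ω δ) (hN : 2 ≤ N) (hp : 2 ≤ p)
    (hq : 2 ≤ q) (hcrit : (q : EReal) < sobolevConj N p) {t : ℝ} (ht : t ∈ Set.Ioo (-δ) δ)
    {c : ℝ} (hc : 0 < c) {u v : W0 Ω p} {W : W0 (flow R R' t '' Ω) p}
    (hW : IsTransport (flow R R' t) (c • (u + t • v)) W) (hpos : 0 < valInt R R' q u v t)
    (heq : c ^ p * gradInt R R' u v t = c ^ q * valInt R R' q u v t) :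
    W ∈ nehari (energy (laneEmden p q)) := by
  have hd := h.deformation t ht
  refine mem_nehari_of_integral_eq hN hp hq hcrit (hd.isOpen_image h.isOpen)
    (hd.isBounded_image h.isBounded) ?_ ?_
  · rw [hW.integral_val_path h ht hc.le]
    exact mul_pos (Real.rpow_pos_of_pos hc q) hpos
  · rwa [hW.integral_val_path h ht hc.le, hW.integral_grad_path hp h ht hc.le]

omit [Fact (1 ≤ ENNReal.ofReal q)] in
lemma IsFlowData.exists_transport (h : IsFlowData R R' Ω δ) (hp : 2 ≤ p) (w : ℝ → W0 Ω p) :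
    ∃ W : (t : ℝ) → W0 (flow R R' t '' Ω) p,
      ∀ t ∈ Set.Ioo (-δ) δ, IsTransport (flow R R' t) (w t) (W t) := by
  have h1 : ∀ t, ∃ W : W0 (flow R R' t '' Ω) p,
      t ∈ Set.Ioo (-δ) δ → IsTransport (flow R R' t) (w t) W := fun t => by
    by_cases ht : t ∈ Set.Ioo (-δ) δ
    · obtain ⟨W, hW⟩ := exists_isPushforward hp (h.deformation t ht) h.isOpen h.isBounded (w t)
      exact ⟨W, fun _ => hW.1⟩
    · exact ⟨0, fun ht' => absurd ht' ht⟩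
  exact ⟨fun t => (h1 t).choose, fun t => (h1 t).choose_spec⟩

omit [Fact (1 ≤ ENNReal.ofReal q)] [Fact (1 ≤ ENNReal.ofReal p)] in
lemma IsFlowData.diffeo (h : IsFlowData R R' Ω δ) {t : ℝ} (ht : t ∈ Set.Ioo (-δ) δ) :
    ContDiffOn ℝ 1 (flow R R' t) Ω ∧ Set.InjOn (flow R R' t) Ω ∧
      IsOpen (flow R R' t '' Ω) ∧ ∀ x ∈ Ω, 0 < (jac (flow R R' t) x).det := by
  have hd := h.deformation t ht
  refine ⟨hd.contDiffOn, hd.injOn, hd.isOpen_image h.isOpen, fun x hx => ?_⟩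
  rw [det_jac]
  exact det_pos_of_norm_sub_one_le (hd.norm_fderiv_sub_one_le h.isOpen hx)

lemma IsFlowData.contDiff_energy (h : IsFlowData R R' Ω δ) (hN : 2 ≤ N) (hp : 2 ≤ p)
    (hq : 2 ≤ q) (hcrit : (q : EReal) < sobolevConj N p) {t : ℝ} (ht : t ∈ Set.Ioo (-δ) δ) :
    ContDiff ℝ 2 (energy (laneEmden p q) : W0 (flow R R' t '' Ω) p → ℝ) :=
  NehariShape.contDiff_energy hN hp hq hcrit ((h.deformation t ht).isOpen_image h.isOpen)
    ((h.deformation t ht).isBounded_image h.isBounded)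

lemma IsFlowData.exists_energy_path (h : IsFlowData R R' Ω δ) (hN : 2 ≤ N) (hp : 2 ≤ p)
    (hq : 2 ≤ q) (hcrit : (q : EReal) < sobolevConj N p) (w : W0 Ω p) :
    ∃ W : (t : ℝ) → W0 (flow R R' t '' Ω) p,
      (∀ t ∈ Set.Ioo (-δ) δ, IsTransport (flow R R' t) w (W t)) ∧
      ContDiffOn ℝ 2 (fun t => energy (laneEmden p q) (W t)) (Set.Ioo (-δ) δ) := by
  obtain ⟨W, hW⟩ := h.exists_transport hp fun _ => w
  refine ⟨W, hW, ?_⟩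
  have h1 : ∀ t ∈ Set.Ioo (-δ) δ, energy (laneEmden p q) (W t) =
      1 / p * gradInt R R' w 0 t - 1 / q * valInt R R' q w 0 t := fun t ht => by
    have h2 : IsTransport (flow R R' t) ((1 : ℝ) • (w + t • (0 : W0 Ω p))) (W t) := by
      rw [smul_zero, add_zero, one_smul]
      exact hW t ht
    rw [h2.energy_path h hN hp hq hcrit ht zero_le_one, Real.one_rpow, Real.one_rpow, one_mul,
      one_mul]
  exact ((contDiffOn_const.mul (h.contDiffOn_gradInt hp w 0)).sub
    (contDiffOn_const.mul (h.contDiffOn_valInt hN hp hq hcrit w 0))).congr h1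

lemma IsFlowData.exists_nehari_path (h : IsFlowData R R' Ω δ) (hN : 2 ≤ N) (hp : 2 ≤ p)
    (hq : 2 ≤ q) (hqp : q ≠ p) (hcrit : (q : EReal) < sobolevConj N p) {w : W0 Ω p} (v : W0 Ω p)
    (hw : w ∈ nehari (energy (laneEmden p q))) : ∃ ε : ℝ, 0 < ε ∧ ε ≤ δ ∧
      ∃ (α : ℝ → ℝ) (U : (t : ℝ) → W0 (flow R R' t '' Ω) p),
        ContDiffOn ℝ 1 α (Set.Ioo (-ε) ε) ∧ α 0 = 1 ∧ ∀ t ∈ Set.Ioo (-ε) ε, 0 < α t ∧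
          IsTransport (flow R R' t) (α t • (w + t • v)) (U t) ∧
          U t ∈ nehari (energy (laneEmden p q)) := by
  have hw' := (mem_nehari_iff hN hp hq hcrit h.isOpen h.isBounded w).1 hw
  have hpos := integral_rpow_val_pos hN hp hq hcrit h.isOpen h.isBounded hw'.1
  obtain ⟨ε, hε, hεδ, α, hα, hα0, hα'⟩ := exists_nehari_scaling hqp h.pos
    (h.contDiffOn_gradInt hp w v) (h.contDiffOn_valInt hN hp hq hcrit w v)
    (by rwa [gradInt_zero, hw'.2]) (by rw [gradInt_zero, valInt_zero, hw'.2])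
  obtain ⟨U, hU⟩ := h.exists_transport hp fun t => α t • (w + t • v)
  refine ⟨ε, hε, hεδ, α, U, hα, hα0, fun t ht => ?_⟩
  obtain ⟨h1, h2, h3, h4⟩ := hα' t ht
  have ht' : t ∈ Set.Ioo (-δ) δ := ⟨by linarith [ht.1], by linarith [ht.2]⟩
  exact ⟨h3, hU t ht', (hU t ht').mem_nehari h hN hp hq hcrit ht' h3 h2 h4⟩

lemma exists_isFlowData (hΩo : IsOpen Ω) (hΩ : Bornology.IsBounded Ω) (hR : IsC1Over R Ω)
    (hR' : IsC1Over R' Ω) : ∃ δ : ℝ, IsFlowData R R' Ω δ := by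
  obtain ⟨δ, h1, h2, h3⟩ := exists_isSmallDeformation_flow hR hR' hΩ
  exact ⟨δ, hΩo, hΩ, hR, hR', h1, h2, h3⟩

lemma bracket_self_ne_zero (hN : 2 ≤ N) (hp : 2 ≤ p) (hq : 2 ≤ q) (hqp : q ≠ p)
    (hcrit : (q : EReal) < sobolevConj N p) (hΩo : IsOpen Ω) (hΩ : Bornology.IsBounded Ω)
    {u : W0 Ω p} (hu : u ∈ nehari (energy (laneEmden p q))) :
    bracket (laneEmden p q) u u u ≠ 0 := by
  rw [bracket_self hN hp hq hcrit hΩo hΩ hu]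
  exact mul_ne_zero (sub_ne_zero.2 hqp.symm)
    (integral_rpow_val_pos hN hp hq hcrit hΩo hΩ hu.1).ne'

lemma exists_nondegenerate_critical (hN : 2 ≤ N) (hp : 2 ≤ p) (hq : 2 ≤ q) (hqp : q ≠ p)
    (hcrit : (q : EReal) < sobolevConj N p) (hΩo : IsOpen Ω) (hΩne : Ω.Nonempty)
    (hΩ : Bornology.IsBounded Ω) : ∃ u : W0 Ω p,
      IsLeastEnergyCritical (energy (laneEmden p q)) u ∧ bracket (laneEmden p q) u u u ≠ 0 := by
  obtain ⟨u, hu⟩ := exists_isLeastEnergyCritical (q := q) (p := p) hN hp hq hqp hcrit hΩo hΩne hΩ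
  have h1 := (hu.isMinOn hN hp hq hqp hcrit hΩo hΩne hΩ).1
  have h2 := bracket_self_ne_zero hN hp hq hqp hcrit hΩo hΩ h1
  exact ⟨u, hu, h2⟩

lemma IsFlowData.assumptions (h : IsFlowData R R' Ω δ) (hN : 2 ≤ N) (hp : 2 ≤ p)
    (hq : 2 ≤ q) (hqp : q ≠ p) (hcrit : (q : EReal) < sobolevConj N p) (hΩne : Ω.Nonempty) :
    Assumptions (laneEmden p q) p Ω R R' δ where
  diffeo _ ht := h.diffeo ht
  i_energy _ ht := h.contDiff_energy hN hp hq hcrit ht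
  i_path w := h.exists_energy_path hN hp hq hcrit w
  ii_exists t ht := exists_isLeastEnergyCritical hN hp hq hqp hcrit
    ((h.deformation t ht).isOpen_image h.isOpen) (hΩne.image _)
    ((h.deformation t ht).isBounded_image h.isBounded)
  ii_min t ht _ hw := hw.isMinOn hN hp hq hqp hcrit
    ((h.deformation t ht).isOpen_image h.isOpen) (hΩne.image _)
    ((h.deformation t ht).isBounded_image h.isBounded)
  iii_ray _ hw := exists_smul_mem_nehari hN hp hq hqp hcrit h.isOpen h.isBounded hw
  iii_path w v hw := by
    obtain ⟨ε₁, h1, h2, α, U, h3, h4, h5⟩ := h.exists_nehari_path hN hp hq hqp hcrit v hw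
    obtain ⟨ε₂, k1, k2, β, k3, k4, k5⟩ := exists_path_mem_nehari hN hp hq hqp hcrit h.isOpen
      h.isBounded h1 v hw
    have hsub : Set.Ioo (-ε₂) ε₂ ⊆ Set.Ioo (-ε₁) ε₁ := Set.Ioo_subset_Ioo (by linarith) k2
    exact ⟨ε₂, k1, k2.trans h2, ⟨α, U, h3.mono hsub, h4, fun t ht => h5 t (hsub ht)⟩,
      β, k3, k4, k5⟩
  iv := exists_nondegenerate_critical hN hp hq hqp hcrit h.isOpen hΩne h.isBounded

end ShapePath

/-! ### The value along the Nehari manifold as a function of two power integrals -/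

section NehariValue

variable {p q : ℝ}

/-- The value of `α ^ p * A` once `α` solves the scaling equation, which is linear in logarithms. -/
lemma nehari_value {α A B : ℝ} (hqp : q ≠ p) (hα : 0 < α) (hA : 0 < A) (hB : 0 < B)
    (h : α ^ p * A = α ^ q * B) :
    α ^ p * A = A ^ (q / (q - p)) * B ^ (-(p / (q - p))) := by
  have hd : q - p ≠ 0 := sub_ne_zero.2 hqp
  obtain ⟨a, rfl⟩ : ∃ a, Real.exp a = α := ⟨_, Real.exp_log hα⟩
  obtain ⟨b, rfl⟩ : ∃ b, Real.exp b = A := ⟨_, Real.exp_log hA⟩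
  obtain ⟨c, rfl⟩ : ∃ c, Real.exp c = B := ⟨_, Real.exp_log hB⟩
  simp only [← Real.exp_mul, ← Real.exp_add] at h ⊢
  have h1 := Real.exp_injective h
  congr 1
  have h2 : a = (b - c) / (q - p) := by
    rw [eq_div_iff hd]
    linarith
  rw [h2]
  field_simp
  ring

lemma hasDerivAt_nehari_value {A B : ℝ → ℝ} {A' B' t : ℝ} (hA : HasDerivAt A A' t)
    (hB : HasDerivAt B B' t) (hA0 : 0 < A t) (hB0 : 0 < B t) (c r s : ℝ) :
    HasDerivAt (fun t => c * (A t ^ r * B t ^ (-s)))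
      (c * (A t ^ r * B t ^ (-s)) * (r * A' / A t - s * B' / B t)) t := by
  have h := ((hA.rpow_const (p := r) (Or.inl hA0.ne')).mul
    (hB.rpow_const (p := -s) (Or.inl hB0.ne'))).const_mul c
  rw [Real.rpow_sub_one hA0.ne', Real.rpow_sub_one hB0.ne'] at h
  refine h.congr_deriv ?_
  ring

/-- The value `(1/p - 1/q) A^{q/(q-p)} B^{-p/(q-p)}` along the Nehari manifold is of class `C²`,
and at a critical parameter with `A = B` its second derivative is explicit. -/
lemma deriv_deriv_nehari_value (hp : 0 < p) (hq : 0 < q) (hqp : q ≠ p)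
    {A A' A'' B B' B'' m : ℝ → ℝ} {s : Set ℝ} (hs : s ∈ 𝓝 (0 : ℝ)) (hso : IsOpen s)
    (hA : HasC2Path A A' A'' s) (hB : HasC2Path B B' B'' s) (hB0 : 0 < B 0) (hAB : A 0 = B 0)
    (hm : ∀ᶠ t in 𝓝 (0 : ℝ), 0 < A t → 0 < B t →
      m t = (1 / p - 1 / q) * (A t ^ (q / (q - p)) * B t ^ (-(p / (q - p)))))
    (hm0 : deriv m 0 = 0) :
    ContDiffAt ℝ 2 m 0 ∧ deriv (deriv m) 0 =
      1 / p * A'' 0 - 1 / q * B'' 0 + (q - p) / q ^ 2 * (B' 0 ^ 2 / B 0) := by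
  have h0 : (0 : ℝ) ∈ s := mem_of_mem_nhds hs
  have hA0 : 0 < A 0 := hAB ▸ hB0
  have hpos : ∀ᶠ t in 𝓝 (0 : ℝ), 0 < A t ∧ 0 < B t :=
    ((hA.hasDerivAt 0 h0).continuousAt.eventually (lt_mem_nhds hA0)).and
      ((hB.hasDerivAt 0 h0).continuousAt.eventually (lt_mem_nhds hB0))
  let f : ℝ → ℝ := fun t => (1 / p - 1 / q) * (A t ^ (q / (q - p)) * B t ^ (-(p / (q - p))))
  have hmf : m =ᶠ[𝓝 0] f := by
    filter_upwards [hm, hpos] with t h1 h2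
    exact h1 h2.1 h2.2
  have hf' : deriv f =ᶠ[𝓝 0] fun t =>
      f t * (q / (q - p) * A' t / A t - p / (q - p) * B' t / B t) := by
    filter_upwards [hpos, hs] with t h1 h2
    exact (hasDerivAt_nehari_value (hA.hasDerivAt t h2) (hB.hasDerivAt t h2) h1.1 h1.2 _ _ _).deriv
  have hd : q - p ≠ 0 := sub_ne_zero.2 hqp
  have hf0 : f 0 = (q - p) / (p * q) * B 0 := by
    have e1 : B 0 ^ (q / (q - p)) * B 0 ^ (-(p / (q - p))) = B 0 := by
      rw [← Real.rpow_add hB0, ← sub_eq_add_neg, ← sub_div, div_self hd, Real.rpow_one]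
    simp only [f]
    rw [hAB, e1]
    field_simp
  -- The logarithmic derivative vanishes at a critical parameter.
  have hlog : q * A' 0 = p * B' 0 := by
    rw [hmf.deriv_eq, hf'.eq_of_nhds, hf0, hAB] at hm0
    have hne : (q - p) / (p * q) * B 0 ≠ 0 :=
      mul_ne_zero (div_ne_zero hd (mul_ne_zero hp.ne' hq.ne')) hB0.ne'
    have h1 := (mul_eq_zero.1 hm0).resolve_left hne
    field_simp at h1
    linarith
  refine ⟨?_, ?_⟩
  · have hAc := (hA.contDiffOn hso).contDiffAt hs
    have hBc := (hB.contDiffOn hso).contDiffAt hs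
    exact ContDiffAt.congr_of_eventuallyEq
      (contDiffAt_const.mul ((hAc.rpow_const_of_ne hA0.ne').mul (hBc.rpow_const_of_ne hB0.ne')))
      hmf
  · rw [(hmf.deriv.trans hf').deriv_eq]
    have k1 : HasDerivAt f (f 0 * (q / (q - p) * A' 0 / A 0 - p / (q - p) * B' 0 / B 0)) 0 :=
      hasDerivAt_nehari_value (hA.hasDerivAt 0 h0) (hB.hasDerivAt 0 h0) hA0 hB0 _ _ _
    have k2 := ((hA.hasDerivAt' 0 h0).const_mul (q / (q - p))).div (hA.hasDerivAt 0 h0) hA0.ne'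
    have k3 := ((hB.hasDerivAt' 0 h0).const_mul (p / (q - p))).div (hB.hasDerivAt 0 h0) hB0.ne'
    refine ((k1.mul (k2.sub k3)).deriv).trans ?_
    have hA' : A' 0 = p * B' 0 / q := by
      field_simp
      linarith
    simp only [Pi.sub_apply, Pi.div_apply]
    rw [hf0, hAB, hA']
    field_simp
    ring

end NehariValue

/-! ### Integrable integrands with a known integral -/

section HasIntegral

variable {X : Type*} [MeasurableSpace X] {μ : Measure X} {f g : X → ℝ} {a b : ℝ}

/-- `f` is integrable with integral `a`. -/
def HasInt (μ : Measure X) (f : X → ℝ) (a : ℝ) : Prop := Integrable f μ ∧ ∫ x, f x ∂μ = a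

lemma hasInt_of_integrable (hf : Integrable f μ) : HasInt μ f (∫ x, f x ∂μ) := ⟨hf, rfl⟩

lemma HasInt.add (hf : HasInt μ f a) (hg : HasInt μ g b) :
    HasInt μ (fun x => f x + g x) (a + b) :=
  ⟨hf.1.add hg.1, by rw [integral_add hf.1 hg.1, hf.2, hg.2]⟩

lemma HasInt.sub (hf : HasInt μ f a) (hg : HasInt μ g b) :
    HasInt μ (fun x => f x - g x) (a - b) :=
  ⟨hf.1.sub hg.1, by rw [integral_sub hf.1 hg.1, hf.2, hg.2]⟩

lemma HasInt.const_mul (c : ℝ) (hf : HasInt μ f a) : HasInt μ (fun x => c * f x) (c * a) :=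
  ⟨hf.1.const_mul c, by rw [integral_const_mul, hf.2]⟩

lemma HasInt.integral_eq (hf : HasInt μ f a) {f' : X → ℝ} (h : ∀ᵐ x ∂μ, f' x = f x) :
    ∫ x, f' x ∂μ = a := (integral_congr_ae h).trans hf.2

variable {H : Type*} [NormedAddCommGroup H] [InnerProductSpace ℝ H] {p : ℝ} {z y w : X → H}

lemma integrable_rpow_mul_inner (hp : 2 ≤ p) (hz : MemLp z (ENNReal.ofReal p) μ)
    (hy : MemLp y (ENNReal.ofReal p) μ) (hw : MemLp w (ENNReal.ofReal p) μ) :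
    Integrable (fun x => ‖z x‖ ^ (p - 2) * inner ℝ (y x) (w x)) μ := by
  refine (integrable_and_abs_integral_le
    (φ := fun x => ‖z x‖ ^ (p - 2) * inner ℝ (y x) (w x)) hp zero_le_one
    (fun x => norm_nonneg (z x))
    (fun x => norm_nonneg (y x)) (fun x => norm_nonneg (w x)) hz.norm hy.norm hw.norm
    ((aestronglyMeasurable_norm_rpow hz.1 _).mul (hy.1.inner hw.1))
    (.of_forall fun x => ?_)).1
  rw [one_mul, abs_mul, abs_of_nonneg (by positivity), mul_assoc]
  exact mul_le_mul_of_nonneg_left (abs_real_inner_le_norm _ _) (by positivity)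

/-- Where `z = 0` and `p < 4`, the factor `‖z‖ ^ (p - 4)` is harmless, being multiplied by `0`. -/
lemma integrable_rpow_mul_inner_mul_inner (hp : 2 ≤ p) (hz : MemLp z (ENNReal.ofReal p) μ)
    (hy : MemLp y (ENNReal.ofReal p) μ) (hw : MemLp w (ENNReal.ofReal p) μ) :
    Integrable (fun x => ‖z x‖ ^ (p - 4) * inner ℝ (z x) (y x) * inner ℝ (z x) (w x)) μ := by
  refine (integrable_and_abs_integral_le
    (φ := fun x => ‖z x‖ ^ (p - 4) * inner ℝ (z x) (y x) * inner ℝ (z x) (w x)) hp zero_le_one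
    (fun x => norm_nonneg (z x))
    (fun x => norm_nonneg (y x)) (fun x => norm_nonneg (w x)) hz.norm hy.norm hw.norm
    (((aestronglyMeasurable_norm_rpow hz.1 _).mul (hz.1.inner hy.1)).mul (hz.1.inner hw.1))
    (.of_forall fun x => ?_)).1
  have h0 : ‖z x‖ ^ (p - 4) * ‖z x‖ ^ 2 ≤ ‖z x‖ ^ (p - 2) := by
    have := rpow_sub_two_mul_sq_le (r := p - 2) (norm_nonneg (z x))
    rwa [show p - 2 - 2 = p - 4 by ring] at this
  rw [one_mul, abs_mul, abs_mul, abs_of_nonneg (by positivity)]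
  calc _ ≤ ‖z x‖ ^ (p - 4) * (‖z x‖ * ‖y x‖) * (‖z x‖ * ‖w x‖) := by
        gcongr
        · exact abs_real_inner_le_norm _ _
        · exact abs_real_inner_le_norm _ _
    _ = ‖z x‖ ^ (p - 4) * ‖z x‖ ^ 2 * ‖y x‖ * ‖w x‖ := by ring
    _ ≤ _ := by gcongr

omit [InnerProductSpace ℝ H] in
lemma integrable_rpow_of_memLp (hp : 2 ≤ p) (hz : MemLp z (ENNReal.ofReal p) μ) :
    Integrable (fun x => ‖z x‖ ^ p) μ := by
  have := hz.integrable_norm_rpow (by simp; linarith) ENNReal.ofReal_ne_top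
  rwa [ENNReal.toReal_ofReal (by linarith)] at this

lemma normPowD1_real (q s a : ℝ) : normPowD1 q s a = q * (|s| ^ (q - 2) * s * a) := by
  rw [normPowD1_apply, Real.norm_eq_abs]
  simp only [RCLike.inner_apply, Real.ringHom_apply]
  ring

/-- In one dimension the two terms of `normPowD2` merge, also at `s = 0`. -/
lemma normPowD2_real {q : ℝ} (hq : 2 ≤ q) (s a b : ℝ) :
    normPowD2 q s a b = q * (q - 1) * (|s| ^ (q - 2) * (a * b)) := by
  rw [normPowD2_apply, Real.norm_eq_abs]
  simp only [RCLike.inner_apply, Real.ringHom_apply]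
  have h : (q - 2) * (|s| ^ (q - 4) * s ^ 2) = (q - 2) * |s| ^ (q - 2) := by
    rcases eq_or_ne s 0 with rfl | hs
    · rcases hq.eq_or_lt with rfl | hq'
      · simp
      · rw [abs_zero, Real.zero_rpow (show q - 2 ≠ 0 by linarith)]
        simp
    · congr 1
      rw [← sq_abs, ← Real.rpow_natCast |s| 2, ← Real.rpow_add (abs_pos.2 hs)]
      congr 1
      push_cast
      ring
  linear_combination q * a * b * h

end HasIntegral

/-! ### The coefficients of the deformation fields -/

section Coefficients

variable {N : ℕ} {Ω : Set (Eucl N)} {F : Eucl N → Eucl N}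

lemma divg_eq_traceL (x : Eucl N) : divg F x = traceL (Eucl N) (fderiv ℝ F x) :=
  divg_eq_trace F x

lemma two_mul_chi2_jac (x : Eucl N) : 2 * chi2 (jac F x) =
    traceL (Eucl N) (fderiv ℝ F x) ^ 2 - traceL (Eucl N) (fderiv ℝ F x * fderiv ℝ F x) := by
  rw [two_mul_chi2, trace_jac_mul_self]
  exact congrArg (fun a : ℝ => a ^ 2 - _) (divg_eq_trace F x)

lemma IsC1Over.integrable_mul_divg (hF : IsC1Over F Ω) (hΩo : IsOpen Ω)
    (hΩ : Bornology.IsBounded Ω) {f : Eucl N → ℝ} (hf : Integrable f (volume.restrict Ω)) :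
    Integrable (fun x => f x * divg F x) (volume.restrict Ω) := by
  obtain ⟨L, hL0, hL⟩ := hF.exists_norm_fderiv_le hΩo hΩ
  have hc : ContinuousOn (divg F) Ω := by
    rw [show divg F = fun x => traceL (Eucl N) (fderiv ℝ F x) from funext divg_eq_traceL]
    exact (traceL (Eucl N)).continuous.comp_continuousOn (hF.continuousOn_fderiv hΩo)
  refine hf.mul_bdd (c := ‖traceL (Eucl N)‖ * L)
    (hc.aestronglyMeasurable hΩo.measurableSet) ?_
  filter_upwards [ae_restrict_mem hΩo.measurableSet] with x hx
  rw [divg_eq_traceL]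
  exact ((traceL (Eucl N)).le_opNorm _).trans
    (mul_le_mul_of_nonneg_left (hL x hx) (norm_nonneg _))

lemma IsC1Over.integrable_mul_chi2 (hF : IsC1Over F Ω) (hΩo : IsOpen Ω)
    (hΩ : Bornology.IsBounded Ω) {f : Eucl N → ℝ} (hf : Integrable f (volume.restrict Ω)) :
    Integrable (fun x => f x * chi2 (jac F x)) (volume.restrict Ω) := by
  obtain ⟨L, hL0, hL⟩ := hF.exists_norm_fderiv_le hΩo hΩ
  have h1 := hF.continuousOn_fderiv hΩo
  have h2 : Integrable (fun x => f x * traceL (Eucl N) (fderiv ℝ F x * fderiv ℝ F x))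
      (volume.restrict Ω) := by
    refine hf.mul_bdd (c := ‖traceL (Eucl N)‖ * (L * L)) (ContinuousOn.aestronglyMeasurable
      ((traceL (Eucl N)).continuous.comp_continuousOn (h1.mul h1)) hΩo.measurableSet) ?_
    filter_upwards [ae_restrict_mem hΩo.measurableSet] with x hx
    refine ((traceL (Eucl N)).le_opNorm _).trans (mul_le_mul_of_nonneg_left ?_ (norm_nonneg _))
    exact (norm_mul_le _ _).trans (mul_le_mul (hL x hx) (hL x hx) (norm_nonneg _) hL0)
  have h3 := hF.integrable_mul_divg hΩo hΩ (hF.integrable_mul_divg hΩo hΩ hf)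
  refine ((h3.sub h2).const_mul (1 / 2)).congr (.of_forall fun x => ?_)
  have := two_mul_chi2_jac (F := F) x
  rw [← divg_eq_traceL] at this
  simp only [Pi.sub_apply]
  linear_combination -(1 / 2) * f x * this

lemma IsC1Over.memLp_rowMul (hF : IsC1Over F Ω) (hΩo : IsOpen Ω)
    (hΩ : Bornology.IsBounded Ω) {g : Eucl N → Eucl N} {r : ENNReal}
    (hg : MemLp g r (volume.restrict Ω)) :
    MemLp (fun x => rowMul (g x) (jac F x)) r (volume.restrict Ω) := by
  obtain ⟨L, hL0, hL⟩ := hF.exists_norm_fderiv_le hΩo hΩ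
  simp only [rowMul_jac_eq_adjointL]
  refine hg.of_le_mul (c := L) ?_ ?_
  · exact (ContinuousLinearMap.id ℝ (Eucl N →L[ℝ] Eucl N)).aestronglyMeasurable_comp₂
      (((adjointL N).continuous.comp_continuousOn
        (hF.continuousOn_fderiv hΩo)).aestronglyMeasurable hΩo.measurableSet) hg.1
  · filter_upwards [ae_restrict_mem hΩo.measurableSet] with x hx
    refine (ContinuousLinearMap.le_opNorm _ _).trans (mul_le_mul_of_nonneg_right ?_ (norm_nonneg _))
    rw [norm_adjointL]
    exact hL x hx

end Coefficients

/-! ### The derivatives of the Lane–Emden integrand -/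

section LaneEmdenDeriv

variable {N : ℕ} {p q : ℝ}

lemma hasFDerivAt_laneEmden (hp : 2 ≤ p) (s : ℝ) (z : Eucl N) :
    HasFDerivAt (laneEmden p q s) ((1 / p) • normPowD1 p z) z :=
  ((hasFDerivAt_norm_rpow_normPowD1 hp z).const_mul (1 / p)).sub_const _

lemma DzzL_laneEmden (hp : 2 ≤ p) (s : ℝ) (z a b : Eucl N) :
    DzzL (laneEmden p q) s z a b = ‖z‖ ^ (p - 2) * inner ℝ a b +
      (p - 2) * (‖z‖ ^ (p - 4) * inner ℝ z a * inner ℝ z b) := by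
  have h1 : (fun y : Eucl N => fderiv ℝ (laneEmden p q s) y) =
      fun y => (1 / p) • normPowD1 p y :=
    funext fun y => (hasFDerivAt_laneEmden hp s y).fderiv
  have h2 : HasFDerivAt (fun y : Eucl N => (1 / p) • normPowD1 p y) ((1 / p) • normPowD2 p z) z :=
    (hasFDerivAt_normPowD1 hp z).const_smul (1 / p)
  rw [DzzL, h1, h2.fderiv]
  simp only [smul_apply, normPowD2_apply, smul_eq_mul]
  have : p ≠ 0 := by linarith
  field_simp

lemma inner_DzL_laneEmden (hp : 2 ≤ p) (s : ℝ) (z a : Eucl N) :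
    inner ℝ (DzL (laneEmden p q) s z) a = ‖z‖ ^ (p - 2) * inner ℝ z a := by
  rw [DzL, gradient, InnerProductSpace.toDual_symm_apply, (hasFDerivAt_laneEmden hp s z).fderiv]
  simp only [smul_apply, normPowD1_apply, smul_eq_mul]
  have : p ≠ 0 := by linarith
  field_simp

lemma Lu_laneEmden (hq : 2 ≤ q) (s : ℝ) (z : Eucl N) :
    Lu (laneEmden p q) s z = -(|s| ^ (q - 2) * s) := by
  have h1 : HasDerivAt (fun r : ℝ => |r| ^ q) (normPowD1 q s 1) s :=
    (hasFDerivAt_norm_rpow_normPowD1 hq s).hasDerivAt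
  have h2 : HasDerivAt (fun r : ℝ => laneEmden p q r z) (-(1 / q * normPowD1 q s 1)) s :=
    (h1.const_mul (1 / q)).const_sub _
  rw [Lu, h2.deriv, normPowD1_real]
  have : q ≠ 0 := by linarith
  field_simp

lemma DzLu_laneEmden (hq : 2 ≤ q) (s : ℝ) (z : Eucl N) : DzLu (laneEmden p q) s z = 0 := by
  have h1 : Lu (laneEmden p q) s = fun _ : Eucl N => -(|s| ^ (q - 2) * s) :=
    funext fun z => Lu_laneEmden hq s z
  rw [DzLu, h1]
  simp [gradient]

end LaneEmdenDeriv

/-! ### The explicit formulas -/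

section Formulas

variable {N : ℕ} {Ω : Set (Eucl N)} {p q : ℝ} [Fact (1 ≤ ENNReal.ofReal p)]
  {R R' : Eucl N → Eucl N} {δ : ℝ}

lemma integrable_rpow_mul_self_mul (hq : 2 ≤ q) {f k : Eucl N → ℝ}
    (hf : MemLp f (ENNReal.ofReal q) (volume.restrict Ω))
    (hk : MemLp k (ENNReal.ofReal q) (volume.restrict Ω)) :
    Integrable (fun x => |f x| ^ (q - 2) * f x * k x) (volume.restrict Ω) := by
  refine (integrable_rpow_mul_inner hq hf hf hk).congr (.of_forall fun x => ?_)
  simp only [RCLike.inner_apply, Real.ringHom_apply, Real.norm_eq_abs]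
  ring

lemma integrable_rpow_mul_sq (hq : 2 ≤ q) {f k : Eucl N → ℝ}
    (hf : MemLp f (ENNReal.ofReal q) (volume.restrict Ω))
    (hk : MemLp k (ENNReal.ofReal q) (volume.restrict Ω)) :
    Integrable (fun x => |f x| ^ (q - 2) * k x ^ 2) (volume.restrict Ω) := by
  refine (integrable_rpow_mul_inner hq hf hk hk).congr (.of_forall fun x => ?_)
  simp only [RCLike.inner_apply, Real.ringHom_apply, Real.norm_eq_abs]
  ring

lemma integral_normPowD2_grad (hp : 2 ≤ p) (u h : W0 Ω p) :
    1 / p * (∫ x in Ω, normPowD2 p (grad u x) (grad h x) (grad h x)) =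
      (∫ x in Ω, ‖grad u x‖ ^ (p - 2) * ‖grad h x‖ ^ 2)
        + (p - 2) * ∫ x in Ω, ‖grad u x‖ ^ (p - 4) * (inner ℝ (grad u x) (grad h x)) ^ 2 := by
  have h1 := hasInt_of_integrable
    (integrable_rpow_mul_inner hp (memLp_grad u) (memLp_grad h) (memLp_grad h))
  have h2 := hasInt_of_integrable
    (integrable_rpow_mul_inner_mul_inner hp (memLp_grad u) (memLp_grad h) (memLp_grad h))
  have hp0 : p ≠ 0 := by linarith
  have h3 := (h1.add (h2.const_mul (p - 2))).integral_eq
    (f' := fun x => 1 / p * normPowD2 p (grad u x) (grad h x) (grad h x))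
    (.of_forall fun x => by
      rw [normPowD2_apply]
      field_simp)
  rw [integral_const_mul] at h3
  rw [h3]
  simp only [real_inner_self_eq_norm_sq, mul_assoc, sq]

variable [Fact (1 ≤ ENNReal.ofReal q)]

lemma bracket_formula (hN : 2 ≤ N) (hp : 2 ≤ p) (hq : 2 ≤ q)
    (hcrit : (q : EReal) < sobolevConj N p) (hΩo : IsOpen Ω) (hΩ : Bornology.IsBounded Ω)
    (u h : W0 Ω p) : bracket (laneEmden p q) u h h =
        (∫ x in Ω, ‖grad u x‖ ^ (p - 2) * ‖grad h x‖ ^ 2)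
        + (p - 2) * (∫ x in Ω, ‖grad u x‖ ^ (p - 4) * (inner ℝ (grad u x) (grad h x)) ^ 2)
        - (q - 1) * (∫ x in Ω, |val u x| ^ (q - 2) * (val h x) ^ 2) := by
  have h1 : 1 / q * (∫ x in Ω, normPowD2 q (val u x) (val h x) (val h x)) =
      (q - 1) * (∫ x in Ω, |val u x| ^ (q - 2) * (val h x) ^ 2) := by
    rw [← integral_const_mul, ← integral_const_mul]
    congr 1
    funext x
    rw [normPowD2_real hq]
    have hq0 : q ≠ 0 := by linarith
    field_simp
  refine (bracket_eq hN hp hq hcrit hΩo hΩ u h h).trans ?_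
  rw [h1, integral_normPowD2_grad hp]

omit [Fact (1 ≤ ENNReal.ofReal q)] in
lemma Q_formula (hp : 2 ≤ p) (hq : 2 ≤ q) (hΩo : IsOpen Ω) (hΩ : Bornology.IsBounded Ω)
    (hR : IsC1Over R Ω) (u h : W0 Ω p) : Q (laneEmden p q) R u h =
        - (∫ x in Ω, ‖grad u x‖ ^ (p - 2) * inner ℝ (grad h x) (rowMul (grad u x) (jac R x)))
        - (p - 2) * (∫ x in Ω, ‖grad u x‖ ^ (p - 4) * inner ℝ (grad u x) (grad h x)
            * inner ℝ (grad u x) (rowMul (grad u x) (jac R x)))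
        - (∫ x in Ω, ‖grad u x‖ ^ (p - 2) * inner ℝ (grad u x) (rowMul (grad h x) (jac R x)))
        + (∫ x in Ω, ‖grad u x‖ ^ (p - 2) * inner ℝ (grad u x) (grad h x) * divg R x)
        - (∫ x in Ω, |val u x| ^ (q - 2) * val u x * val h x * divg R x) := by
  have hJ := hR.memLp_rowMul hΩo hΩ (memLp_grad u)
  have h1 := hasInt_of_integrable (integrable_rpow_mul_inner hp (memLp_grad u) (memLp_grad h) hJ)
  have h2 := hasInt_of_integrable
    (integrable_rpow_mul_inner_mul_inner hp (memLp_grad u) (memLp_grad h) hJ)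
  simp only [Q, DzzL_laneEmden hp, inner_DzL_laneEmden hp, Lu_laneEmden hq, DzLu_laneEmden hq,
    inner_zero_left, zero_mul, integral_zero, neg_mul, integral_neg]
  rw [(h1.add (h2.const_mul (p - 2))).2]
  ring

/-- The second derivative of `∫ |DW|^p / p` along `W = (u + t v) ∘ Φ_t⁻¹`. -/
lemma IsFlowData.exists_gradInt_path (h : IsFlowData R R' Ω δ) (hp : 2 ≤ p) (u v : W0 Ω p) :
    ∃ A' A'' : ℝ → ℝ, HasC2Path (gradInt R R' u v) A' A'' (Set.Ioo (-δ) δ) ∧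
      1 / p * A'' 0 =
        1 / p * (∫ x in Ω, ‖grad u x‖ ^ p * divg R' x)
        + 2 / p * (∫ x in Ω, ‖grad u x‖ ^ p * chi2 (jac R x))
        + 2 * (∫ x in Ω, ‖grad u x‖ ^ (p - 2) * inner ℝ (grad u x) (grad v x) * divg R x)
        - 2 * (∫ x in Ω, ‖grad u x‖ ^ (p - 2)
            * inner ℝ (grad u x) (rowMul (grad u x) (jac R x)) * divg R x)
        + 1 / p * (∫ x in Ω, normPowD2 p (grad u x) (grad v x) (grad v x))
        - 2 * (∫ x in Ω, ‖grad u x‖ ^ (p - 2)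
            * inner ℝ (grad v x) (rowMul (grad u x) (jac R x)))
        + (∫ x in Ω, ‖grad u x‖ ^ (p - 2)
            * inner ℝ (rowMul (grad u x) (jac R x)) (rowMul (grad u x) (jac R x)))
        - 2 * (p - 2) * (∫ x in Ω, ‖grad u x‖ ^ (p - 4) * inner ℝ (grad u x) (grad v x)
            * inner ℝ (grad u x) (rowMul (grad u x) (jac R x)))
        + (p - 2) * (∫ x in Ω, ‖grad u x‖ ^ (p - 4)
            * (inner ℝ (grad u x) (rowMul (grad u x) (jac R x))) ^ 2)
        + 2 * (∫ x in Ω, ‖grad u x‖ ^ (p - 2)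
            * inner ℝ (grad u x) (rowMul (rowMul (grad u x) (jac R x)) (jac R x)))
        - (∫ x in Ω, ‖grad u x‖ ^ (p - 2)
            * inner ℝ (grad u x) (rowMul (grad u x) (jac R' x)))
        - 2 * (∫ x in Ω, ‖grad u x‖ ^ (p - 2)
            * inner ℝ (grad u x) (rowMul (grad v x) (jac R x))) := by
  obtain ⟨A', A'', hA, -, hA''⟩ := h.hasC2Path_grad hp (memLp_grad u) (memLp_grad v)
  refine ⟨A', A'', hA, ?_⟩
  have hg := memLp_grad u
  have hk := memLp_grad v
  have hJ := h.left.memLp_rowMul h.isOpen h.isBounded hg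
  have hJJ := h.left.memLp_rowMul h.isOpen h.isBounded hJ
  have hJ' := h.right.memLp_rowMul h.isOpen h.isBounded hg
  have hJk := h.left.memLp_rowMul h.isOpen h.isBounded hk
  have i0 := integrable_rpow_of_memLp hp hg
  have i1 := hasInt_of_integrable (h.right.integrable_mul_divg h.isOpen h.isBounded i0)
  have i2 := hasInt_of_integrable (h.left.integrable_mul_chi2 h.isOpen h.isBounded i0)
  have i3 := hasInt_of_integrable (h.left.integrable_mul_divg h.isOpen h.isBounded
    (integrable_rpow_mul_inner hp hg hg hk))
  have i4 := hasInt_of_integrable (h.left.integrable_mul_divg h.isOpen h.isBounded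
    (integrable_rpow_mul_inner hp hg hg hJ))
  have i5 := hasInt_of_integrable (μ := volume.restrict Ω)
    (integrable_normPowD2 hp (gradL u) (gradL v) (gradL v)).1
  have i6 := hasInt_of_integrable (integrable_rpow_mul_inner hp hg hk hJ)
  have i7 := hasInt_of_integrable (integrable_rpow_mul_inner hp hg hJ hJ)
  have i8 := hasInt_of_integrable (integrable_rpow_mul_inner_mul_inner hp hg hk hJ)
  have i9 := hasInt_of_integrable (integrable_rpow_mul_inner_mul_inner hp hg hJ hJ)
  have i10 := hasInt_of_integrable (integrable_rpow_mul_inner hp hg hg hJJ)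
  have i11 := hasInt_of_integrable (integrable_rpow_mul_inner hp hg hg hJ')
  have i12 := hasInt_of_integrable (integrable_rpow_mul_inner hp hg hg hJk)
  have key := (((((((((((i1.const_mul (1 / p)).add (i2.const_mul (2 / p))).add
    (i3.const_mul 2)).sub (i4.const_mul 2)).add (i5.const_mul (1 / p))).sub
    (i6.const_mul 2)).add i7).sub (i8.const_mul (2 * (p - 2)))).add (i9.const_mul (p - 2))).add
    (i10.const_mul 2)).sub i11).sub (i12.const_mul 2)
  have hp0 : p ≠ 0 := by linarith
  rw [hA'', ← integral_const_mul]
  refine (key.integral_eq (.of_forall fun x => ?_)).trans ?_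
  · rw [← two_mul_chi2_jac, ← divg_eq_traceL, ← divg_eq_traceL]
    change _ = _ + 1 / p * normPowD2 p (grad u x) (grad v x) (grad v x) - _ + _ - _ + _ + _ - _ - _
    simp only [normPowD1_apply, normPowD2_apply, inner_sub_left, inner_sub_right,
      real_inner_smul_right]
    rw [real_inner_comm (grad v x) (rowMul (grad u x) (jac R x))]
    field_simp
    ring
  · simp only [sq, mul_assoc]
    rfl

/-- The derivatives of `∫ |W|^q / q` along `W = (u + t v) ∘ Φ_t⁻¹`. -/
lemma IsFlowData.exists_valInt_path (h : IsFlowData R R' Ω δ) (hN : 2 ≤ N) (hp : 2 ≤ p)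
    (hq : 2 ≤ q) (hcrit : (q : EReal) < sobolevConj N p) (u v : W0 Ω p) :
    ∃ B' B'' : ℝ → ℝ, HasC2Path (valInt R R' q u v) B' B'' (Set.Ioo (-δ) δ) ∧
      B' 0 = (∫ x in Ω, |val u x| ^ q * divg R x)
        + q * (∫ x in Ω, |val u x| ^ (q - 2) * val u x * val v x) ∧
      1 / q * B'' 0 =
        1 / q * (∫ x in Ω, |val u x| ^ q * divg R' x)
        + 2 / q * (∫ x in Ω, |val u x| ^ q * chi2 (jac R x))
        + 2 * (∫ x in Ω, |val u x| ^ (q - 2) * val u x * val v x * divg R x)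
        + (q - 1) * (∫ x in Ω, |val u x| ^ (q - 2) * (val v x) ^ 2) := by
  have hu := memLp_val_q hN hp hq hcrit h.isOpen h.isBounded u
  have hv := memLp_val_q hN hp hq hcrit h.isOpen h.isBounded v
  obtain ⟨B', B'', hB, hB', hB''⟩ := h.hasC2Path_val hq hu hv
  have i0 : Integrable (fun x => |val u x| ^ q) (volume.restrict Ω) :=
    integrable_rpow_of_memLp hq hu
  have i1 := integrable_rpow_mul_self_mul hq hu hv
  have j0 := hasInt_of_integrable (h.left.integrable_mul_divg h.isOpen h.isBounded i0)
  have j1 := hasInt_of_integrable (h.right.integrable_mul_divg h.isOpen h.isBounded i0)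
  have j2 := hasInt_of_integrable (h.left.integrable_mul_chi2 h.isOpen h.isBounded i0)
  have j3 := hasInt_of_integrable (h.left.integrable_mul_divg h.isOpen h.isBounded i1)
  have j4 := hasInt_of_integrable (integrable_rpow_mul_sq hq hu hv)
  refine ⟨B', B'', hB, ?_, ?_⟩
  · rw [hB']
    refine (j0.add ((hasInt_of_integrable i1).const_mul q)).integral_eq (.of_forall fun x => ?_)
    rw [← divg_eq_traceL, normPowD1_real, Real.norm_eq_abs]
    ring
  · have hq0 : q ≠ 0 := by linarith
    rw [hB'', ← integral_const_mul]
    refine ((((j1.const_mul (1 / q)).add (j2.const_mul (2 / q))).add (j3.const_mul 2)).add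
      (j4.const_mul (q - 1))).integral_eq (.of_forall fun x => ?_)
    rw [← two_mul_chi2_jac, ← divg_eq_traceL, ← divg_eq_traceL, normPowD1_real,
      normPowD2_real hq, Real.norm_eq_abs]
    field_simp
    ring

/-- The value along a Nehari trajectory, as a function of the two power integrals. -/
lemma IsFlowData.energy_nehari_path (h : IsFlowData R R' Ω δ) (hN : 2 ≤ N) (hp : 2 ≤ p)
    (hq : 2 ≤ q) (hqp : q ≠ p) (hcrit : (q : EReal) < sobolevConj N p) {t : ℝ}
    (ht : t ∈ Set.Ioo (-δ) δ) {c : ℝ} (hc : 0 < c) {u v : W0 Ω p}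
    {W : W0 (flow R R' t '' Ω) p} (hW : IsTransport (flow R R' t) (c • (u + t • v)) W)
    (hWN : W ∈ nehari (energy (laneEmden p q))) (hA : 0 < gradInt R R' u v t)
    (hB : 0 < valInt R R' q u v t) : energy (laneEmden p q) W =
      (1 / p - 1 / q) * (gradInt R R' u v t ^ (q / (q - p)) *
        valInt R R' q u v t ^ (-(p / (q - p)))) := by
  have h1 := hW.nehari_path h hN hp hq hcrit ht hc.le hWN
  rw [hW.energy_path h hN hp hq hcrit ht hc.le, ← nehari_value hqp hc hA hB h1, ← h1]
  ring

/-- The second variation of the value along a Nehari trajectory. The condition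
`⟨v, v⟩ = -Q[v]` turns the contribution `⟨v, v⟩ + 2 Q[v]` of the corrector `v` into
`-Q[v]² / ⟨v, v⟩`. -/
lemma IsFlowData.second_variation (h : IsFlowData R R' Ω δ) (hN : 2 ≤ N) (hp : 2 ≤ p)
    (hq : 2 ≤ q) (hqp : q ≠ p) (hcrit : (q : EReal) < sobolevConj N p) {u : W0 Ω p}
    (hu : u ∈ nehari (energy (laneEmden p q))) (v : W0 Ω p)
    (hv0 : (∫ x in Ω, |val u x| ^ (q - 2) * val u x * val v x) = 0)
    (hvQ : bracket (laneEmden p q) u v v = - Q (laneEmden p q) R u v)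
    (hvpos : 0 < bracket (laneEmden p q) u v v)
    {α : ℝ → ℝ} {U : (t : ℝ) → W0 (flow R R' t '' Ω) p} {m : ℝ → ℝ}
    (hU : ∀ᶠ t in 𝓝 (0 : ℝ), 0 < α t ∧ IsTransport (flow R R' t) (α t • (u + t • v)) (U t) ∧
      U t ∈ nehari (energy (laneEmden p q)))
    (hm : ∀ t, m t = energy (laneEmden p q) (U t)) (hm0 : deriv m 0 = 0) :
    ContDiffAt ℝ 2 m 0 ∧ deriv (deriv m) 0 =
      1 / p * (∫ x in Ω, ‖grad u x‖ ^ p * divg R' x)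
      - 1 / q * (∫ x in Ω, |val u x| ^ q * divg R' x)
      - (∫ x in Ω, ‖grad u x‖ ^ (p - 2)
          * inner ℝ (grad u x) (rowMul (grad u x) (jac R' x)))
      + 2 / p * (∫ x in Ω, ‖grad u x‖ ^ p * chi2 (jac R x))
      - 2 / q * (∫ x in Ω, |val u x| ^ q * chi2 (jac R x))
      - 2 * (∫ x in Ω, ‖grad u x‖ ^ (p - 2)
          * inner ℝ (grad u x) (rowMul (grad u x) (jac R x)) * divg R x)
      + 2 * (∫ x in Ω, ‖grad u x‖ ^ (p - 2)
          * inner ℝ (grad u x) (rowMul (rowMul (grad u x) (jac R x)) (jac R x)))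
      + (∫ x in Ω, ‖grad u x‖ ^ (p - 2)
          * inner ℝ (rowMul (grad u x) (jac R x)) (rowMul (grad u x) (jac R x)))
      + (p - 2) * (∫ x in Ω, ‖grad u x‖ ^ (p - 4)
          * (inner ℝ (grad u x) (rowMul (grad u x) (jac R x))) ^ 2)
      + (q - p) / q ^ 2 * ((∫ x in Ω, |val u x| ^ q * divg R x) ^ 2
          / ∫ x in Ω, |val u x| ^ q)
      - (Q (laneEmden p q) R u v) ^ 2 / bracket (laneEmden p q) u v v := by
  obtain ⟨A', A'', hA, hA''⟩ := h.exists_gradInt_path hp u v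
  obtain ⟨B', B'', hB, hB', hB''⟩ := h.exists_valInt_path hN hp hq hcrit u v
  have hu' := (mem_nehari_iff hN hp hq hcrit h.isOpen h.isBounded u).1 hu
  have hB0 : 0 < valInt R R' q u v 0 := by
    rw [valInt_zero]
    exact integral_rpow_val_pos hN hp hq hcrit h.isOpen h.isBounded hu'.1
  have hAB : gradInt R R' u v 0 = valInt R R' q u v 0 := by
    rw [gradInt_zero, valInt_zero]
    exact hu'.2
  have hs : Set.Ioo (-δ) δ ∈ 𝓝 (0 : ℝ) := Ioo_mem_nhds (by linarith [h.pos]) h.pos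
  have hmf : ∀ᶠ t in 𝓝 (0 : ℝ), 0 < gradInt R R' u v t → 0 < valInt R R' q u v t →
      m t = (1 / p - 1 / q) * (gradInt R R' u v t ^ (q / (q - p)) *
        valInt R R' q u v t ^ (-(p / (q - p)))) := by
    filter_upwards [hU, hs] with t h1 h2 h3 h4
    exact (hm t).trans
      (h.energy_nehari_path hN hp hq hqp hcrit h2 h1.1 h1.2.1 h1.2.2 h3 h4)
  obtain ⟨k1, k2⟩ := deriv_deriv_nehari_value (by linarith) (by linarith) hqp hs isOpen_Ioo hA hB
    hB0 hAB hmf hm0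
  refine ⟨k1, k2.trans ?_⟩
  have hbr := bracket_formula hN hp hq hcrit h.isOpen h.isBounded u v
  have hQ := Q_formula (q := q) hp hq h.isOpen h.isBounded h.left u v
  -- Both sides equal `⟨v, v⟩`, because `Q[v] = -⟨v, v⟩`.
  have hQ2 : (Q (laneEmden p q) R u v) ^ 2 / bracket (laneEmden p q) u v v =
      - (bracket (laneEmden p q) u v v + 2 * Q (laneEmden p q) R u v) := by
    rw [div_eq_iff hvpos.ne']
    generalize bracket (laneEmden p q) u v v = b at *
    generalize Q (laneEmden p q) R u v = c at *
    subst hvQ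
    ring
  rw [hQ2, hbr, hQ, hA'', hB'', hB', hv0, valInt_zero, integral_normPowD2_grad hp]
  ring

end Formulas

end NehariShape

end

theorem mainTheorem5 {N : ℕ} (hN : 2 ≤ N) {p q : ℝ} [Fact (1 ≤ ENNReal.ofReal p)]
    (hp : 2 ≤ p) (hq : 2 ≤ q) (hqp : q ≠ p) (hcrit : (q : EReal) < sobolevConj N p)
    (Ω : Set (Eucl N)) (hΩo : IsOpen Ω) (hΩc : IsConnected Ω) (hΩb : Bornology.IsBounded Ω)
    (R R' : Eucl N → Eucl N) (hR : IsC1Over R Ω) (hR' : IsC1Over R' Ω) :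
    -- the abstract assumptions hold for the Lane–Emden functional
    (∃ δ : ℝ, 0 < δ ∧ Assumptions (laneEmden p q) p Ω R R' δ) ∧
    ∀ u : W0 Ω p, IsLeastEnergyCritical (energy (laneEmden p q)) u →
      -- every least energy critical point is nondegenerate in its own direction
      (bracket (laneEmden p q) u u u = (p - q) * ∫ x in Ω, |val u x| ^ q) ∧
      (bracket (laneEmden p q) u u u ≠ 0) ∧
      -- the second variation and `Q` in explicit form
      (∀ h : W0 Ω p, bracket (laneEmden p q) u h h =
        (∫ x in Ω, ‖grad u x‖ ^ (p - 2) * ‖grad h x‖ ^ 2)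
        + (p - 2) * (∫ x in Ω, ‖grad u x‖ ^ (p - 4) * (inner ℝ (grad u x) (grad h x)) ^ 2)
        - (q - 1) * (∫ x in Ω, |val u x| ^ (q - 2) * (val h x) ^ 2)) ∧
      (∀ h : W0 Ω p, Q (laneEmden p q) R u h =
        - (∫ x in Ω, ‖grad u x‖ ^ (p - 2) * inner ℝ (grad h x) (rowMul (grad u x) (jac R x)))
        - (p - 2) * (∫ x in Ω, ‖grad u x‖ ^ (p - 4) * inner ℝ (grad u x) (grad h x)
            * inner ℝ (grad u x) (rowMul (grad u x) (jac R x)))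
        - (∫ x in Ω, ‖grad u x‖ ^ (p - 2) * inner ℝ (grad u x) (rowMul (grad h x) (jac R x)))
        + (∫ x in Ω, ‖grad u x‖ ^ (p - 2) * inner ℝ (grad u x) (grad h x) * divg R x)
        - (∫ x in Ω, |val u x| ^ (q - 2) * val u x * val h x * divg R x)) ∧
      -- the second derivative along the Nehari trajectory with corrector `v`
      ∀ v : W0 Ω p,
        (∫ x in Ω, |val u x| ^ (q - 2) * val u x * val v x) = 0 →
        bracket (laneEmden p q) u v v = - Q (laneEmden p q) R u v →
        0 < bracket (laneEmden p q) u v v →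
        ∀ (α : ℝ → ℝ) (U : (t : ℝ) → W0 (flow R R' t '' Ω) p) (m : ℝ → ℝ),
          (∀ᶠ t in 𝓝 (0 : ℝ), 0 < α t ∧
            IsTransport (flow R R' t) (α t • (u + t • v)) (U t) ∧
            U t ∈ nehari (energy (laneEmden p q))) →
          (∀ t, m t = energy (laneEmden p q) (U t)) →
          deriv m 0 = 0 →
          ContDiffAt ℝ 2 m 0 ∧
          deriv (deriv m) 0 =
            1 / p * (∫ x in Ω, ‖grad u x‖ ^ p * divg R' x)
            - 1 / q * (∫ x in Ω, |val u x| ^ q * divg R' x)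
            - (∫ x in Ω, ‖grad u x‖ ^ (p - 2)
                * inner ℝ (grad u x) (rowMul (grad u x) (jac R' x)))
            + 2 / p * (∫ x in Ω, ‖grad u x‖ ^ p * chi2 (jac R x))
            - 2 / q * (∫ x in Ω, |val u x| ^ q * chi2 (jac R x))
            - 2 * (∫ x in Ω, ‖grad u x‖ ^ (p - 2)
                * inner ℝ (grad u x) (rowMul (grad u x) (jac R x)) * divg R x)
            + 2 * (∫ x in Ω, ‖grad u x‖ ^ (p - 2)
                * inner ℝ (grad u x) (rowMul (rowMul (grad u x) (jac R x)) (jac R x)))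
            + (∫ x in Ω, ‖grad u x‖ ^ (p - 2)
                * inner ℝ (rowMul (grad u x) (jac R x)) (rowMul (grad u x) (jac R x)))
            + (p - 2) * (∫ x in Ω, ‖grad u x‖ ^ (p - 4)
                * (inner ℝ (grad u x) (rowMul (grad u x) (jac R x))) ^ 2)
            + (q - p) / q ^ 2 * ((∫ x in Ω, |val u x| ^ q * divg R x) ^ 2
                / ∫ x in Ω, |val u x| ^ q)
            - (Q (laneEmden p q) R u v) ^ 2 / bracket (laneEmden p q) u v v := by
  have : Fact (1 ≤ ENNReal.ofReal q) := ⟨by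
    rw [← ENNReal.ofReal_one]
    exact ENNReal.ofReal_le_ofReal (by linarith)⟩
  obtain ⟨δ, h⟩ := exists_isFlowData hΩo hΩb hR hR'
  refine ⟨⟨δ, h.pos, h.assumptions hN hp hq hqp hcrit hΩc.nonempty⟩, fun u hu => ?_⟩
  have huN := (hu.isMinOn hN hp hq hqp hcrit hΩo hΩc.nonempty hΩb).1
  exact ⟨bracket_self hN hp hq hcrit hΩo hΩb huN,
    bracket_self_ne_zero hN hp hq hqp hcrit hΩo hΩb huN,
    bracket_formula hN hp hq hcrit hΩo hΩb u, Q_formula hp hq hΩo hΩb hR u,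
    fun v hv0 hvQ hvpos α U m hU hm hm0 =>
      h.second_variation hN hp hq hqp hcrit huN v hv0 hvQ hvpos hU hm hm0⟩
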